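/- Let $\nu>0$. Let $h:\mathbf R^3\to(0,\infty]$ and $\tilde h:\mathbf R^3\to[0,\infty]$ be measurable, with $h$ locally square integrable and, for all $x\in\mathbf R^3$, $$\int_{\mathbf R^3}h^2(x-y)|y|^{-2}\,dy\le h(x)\quad\text{and}\quad\int_{\mathbf R^3}\tilde h(x-y)|y|^{-1}\,dy\le h(x).$$ Let $u_0:\mathbf R^3\to\mathbf R^3$ be a vector field with $\nabla\cdot u_0=0$ in the sense of distributions, such that $y\mapsto u_0(x-y)e^{-|y|^2/4\nu t}$ is integrable for all $x\in\mathbf R^3$, $t>0$, and let $g:\mathbf R^3\times(0,\infty)\to\mathbf R^3$ be measurable. Suppose that for all $x\in\mathbf R^3$ and $t>0$ $$(4\pi\nu t)^{-3/2}\Big|\int_{\mathbf R^3}u_0(x-y)e^{-|y|^2/4\nu t}\,dy\Big|<\frac{\pi\nu\,h(x)}{11}\quad\text{and}\quad|g(x,t)|<\frac{(\pi\nu)^2\,\tilde h(x)}{11}.$$ A weak solution of the Navier–Stokes equations (with viscosity $\nu$, forcing $g$ and initial velocity $u_0$) is a vector field $u\in(\mathcal S'(\mathbf R^3\times(0,\infty)))^3$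 that is locally square integrable on $\mathbf R^3\times(0,\infty)$, satisfies $\nabla\cdot u=0$ and, for some $p\in\mathcal S'(\mathbf R^3\times(0,\infty))$, $$\frac{\partial u}{\partial t}+\nabla\cdot(u\otimes u)=\nu\Delta u-\nabla p+g,$$ both in the sense of distributions on $\mathbf R^3\times(0,\infty)$, and satisfies $u(\cdot,t)\to u_0$ in the sense of distributions on $\mathbf R^3$ as $t\downarrow0$ (outside a null set of times $t$). Then there exist a measurable space $(\Omega,\mathcal F)$, probability measures $\{P_x:x\in\mathbf R^3\}$ on it, a measurable function $\Xi:(0,\infty)\times\Omega\to\mathbf R^3$ and a weak solution $u$ of the Navier–Stokes equations such that for every $x\in\mathbf R^3$ $$|\Xi(t,\omega)|<\frac{2\pi\nu}{11}\ \text{ for all }t>0,\quad\text{for }P_x\text{-almost every }\omega,$$ and $$u(x,t)=h(x)\int_\Omega\Xi(t,\omega)\,dP_x(\omega)\quad\text{for all }t>0\text{ and all }x\in\mathbf R^3\text{ with }h(x)<\infty .$$ Moreover $|u(x,t)|<2\pi\nu h(x)/11$ for all $x\in\mathbf R^3$, $t>0$, and $u$ is the unique such weak solution: every weak solution $v$ (with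 the same $\nu,u_0,g$) with $|v(x,t)|<2\pi\nu h(x)/11$ for all $x\in\mathbf R^3$, $t>0$ equals $u$ almost everywhere on $\mathbf R^3\times(0,\infty)$. -/

import Mathlib

open MeasureTheory Filter Topology Set
open scoped ENNReal SchwartzMap LineDeriv

/-- The space `ℝ³` with its Euclidean norm. -/
abbrev R3 : Type := EuclideanSpace ℝ (Fin 3)

/-- The open half space `ℝ³ × (0, ∞)` of space-time. -/
def spaceTime : Set (R3 × ℝ) := univ ×ˢ Ioi 0

/-- The `j`-th spatial direction of space-time. -/
noncomputable def spatialDir (j : Fin 3) : R3 × ℝ := (EuclideanSpace.single j 1, 0)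

/-- The time direction of space-time. -/
def timeDir : R3 × ℝ := (0, 1)

/-- `φ` belongs to `C_c^∞(ℝ³ × (0, ∞))`: a smooth function on `ℝ³ × ℝ` whose (closed) support is
compact and contained in `ℝ³ × (0, ∞)`. -/
def IsTestFunction (φ : 𝓢(R3 × ℝ, ℝ)) : Prop :=
  HasCompactSupport φ ∧ tsupport φ ⊆ spaceTime

/-- The measurable vector field `u` is square integrable on every compact subset of
`ℝ³ × (0, ∞)`. -/
def LocallySquareIntegrable (u : R3 → ℝ → R3) : Prop :=
  ∀ K : Set (R3 × ℝ), IsCompact K → K ⊆ spaceTime →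
    MemLp (fun z : R3 × ℝ => u z.1 z.2) 2 (volume.restrict K)

/-- The vector field `u` on `ℝ³ × (0, ∞)` is a (vector valued) tempered distribution on
`ℝ³ × (0, ∞)`. Tempered distributions on this open set are the restrictions to it of continuous
functionals on the Schwartz space of `ℝ³ × ℝ`. -/
def IsTempered (u : R3 → ℝ → R3) : Prop :=
  ∃ T : 𝓢(R3 × ℝ, ℝ) →L[ℝ] R3, ∀ φ : 𝓢(R3 × ℝ, ℝ), IsTestFunction φ →
    T φ = ∫ z : R3 × ℝ, φ z • u z.1 z.2

/-- `∇ · u₀ = 0` in the sense of distributions on `ℝ³`. -/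
def DivFree (u₀ : R3 → R3) : Prop :=
  ∀ φ : 𝓢(R3, ℝ), HasCompactSupport φ →
    ∫ x, ∑ j, u₀ x j * (∂_{(EuclideanSpace.single j 1 : R3)} φ) x = 0

/-- `∇ · u = 0` (divergence in the space variable) in the sense of distributions on
`ℝ³ × (0, ∞)`. -/
def SpaceTimeDivFree (u : R3 → ℝ → R3) : Prop :=
  ∀ φ : 𝓢(R3 × ℝ, ℝ), IsTestFunction φ →
    ∫ z : R3 × ℝ, ∑ j, u z.1 z.2 j * (∂_{spatialDir j} φ) z = 0

/-- The momentum equation `∂u/∂t + u · ∇u = ν Δu - ∇p + g` in the sense of distributions on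
`ℝ³ × (0, ∞)`, with pressure the tempered distribution `p` and with `(u · ∇u)ᵢ = ∑ⱼ ∂ⱼ(uᵢ uⱼ)`:
both sides of `∂ₜuᵢ + ∑ⱼ ∂ⱼ(uᵢ uⱼ) - ν Δuᵢ - gᵢ = -∂ᵢp` are paired with `φ`. -/
def MomentumEquation (ν : ℝ) (g u : R3 → ℝ → R3) (p : 𝓢(R3 × ℝ, ℝ) →L[ℝ] ℝ) : Prop :=
  ∀ φ : 𝓢(R3 × ℝ, ℝ), IsTestFunction φ → ∀ i : Fin 3,
    ∫ z : R3 × ℝ,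
        (-(u z.1 z.2 i * (∂_{timeDir} φ) z)
          - ∑ j, u z.1 z.2 i * u z.1 z.2 j * (∂_{spatialDir j} φ) z
          - ν * (u z.1 z.2 i * ∑ j, (∂_{spatialDir j} (∂_{spatialDir j} φ)) z)
          - g z.1 z.2 i * φ z)
      = p (∂_{spatialDir i} φ)

/-- `u(·, t) → u₀` in the sense of distributions on `ℝ³` as `t ↓ 0`. The limit is taken along
almost every `t`, so that it does not change when `u` is modified on a null set. -/
def HasInitialVelocity (u₀ : R3 → R3) (u : R3 → ℝ → R3) : Prop :=
  ∀ φ : 𝓢(R3, ℝ), HasCompactSupport φ →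
    Tendsto (fun t : ℝ => ∫ x, φ x • u x t) (𝓝[>] (0 : ℝ) ⊓ ae volume)
      (𝓝 (∫ x, φ x • u₀ x))

/-- `u` is a weak solution of the incompressible Navier–Stokes equations on `ℝ³ × (0, ∞)` with
viscosity `ν`, forcing `g` and initial velocity `u₀`. Only the values `u x t` with `0 < t` matter. -/
structure IsWeakSolution (ν : ℝ) (u₀ : R3 → R3) (g u : R3 → ℝ → R3) : Prop where
  tempered : IsTempered u
  locallySquareIntegrable : LocallySquareIntegrable u
  divFree : SpaceTimeDivFree u
  momentum : ∃ p : 𝓢(R3 × ℝ, ℝ) →L[ℝ] ℝ, MomentumEquation ν g u p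
  initial : HasInitialVelocity u₀ u

/-! The equations are replaced by their mild form `u = U + D(u)`. Here `U` is the heat flow of the
initial velocity, and `D(u)` integrates, over all space-time displacements, the Oseen kernel `K`
applied to `g` minus the gradient of `K` applied bilinearly to `(u, u)`. The Oseen kernel is the
heat kernel plus an integral of its Hessian over later times. It therefore has an explicit majorant,
and so does its gradient, whose integrals over time can be computed: at most `1/(2πν|y|)` for the
kernel (`lintegral_oseenMaj_le`) and at most `1/(πν|y|²)` for the gradient
(`lintegral_oseenGradMaj_le`). These are the two kernels in the hypotheses on the weights. Hence
`|u| ≤ (2πν/11) h` and the bound on `g` give `|D(u)| ≤ (19/22)(πν/11) h`, and `D` is Lipschitz with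
constant `4/11` in the norm weighted by `h` (`SmallData.enorm_mildMap_lt`,
`SmallData.enorm_mildMap_sub_le`).

Existence comes from a probabilistic reading of the mild equation. After division by `h(x)`, the
majorants times `h²` or `h'` become densities of displacements of total mass at most one. A vertex
returns the heat flow with probability `1/2`, branches into two with probability at most `1/5`,
returns a forcing term with probability at most `3/10`, and dies otherwise. Dividing by these
probabilities and densities, each vertex value stays below `2πν/11`. The mean number of children is
at most `2/5`, so the tree is almost surely finite (`Branching.ae_extinct`) and the root value is
defined by recursion. Conditioning on the mark of the root (`Branching.mean_eq_integral_markMean`),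
together with the independence of the two subtrees and the bilinearity of the quadratic term, shows
that `h` times the expected root value solves the mild equation wherever `h` is finite
(`Branching.IsNavierStokes.meanField_eq_mildMap`).

A mild solution is a weak solution because the adjoint of the Oseen kernel sends `(∂ₜ + νΔ)φ` to
minus the Leray projection of `φ`. The part of the projection that is not `φ` itself is a pairing
with `∂ᵢφ`, that is, a pressure (`IsSmoothCompact.integral_oseen_mul_heatAdj`,
`exists_clm_pressure`, `SmallData.isWeakSolution_of_mild`). The kernel inequalities make
`h²(1+|x|)⁻²`, `h(1+|x|)⁻³` and `h'(1+|x|)⁻¹` integrable, which is what all pairings need.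

For uniqueness, let `v` be a weak solution below the bound. The difference of `v` and its own mild
image solves the Stokes equations with zero data. Testing with Laplacians eliminates the pressure,
and averaging against heat kernels shows that the pairing of the difference with the heat flow of a
test function does not depend on the heat time. It tends to zero for large times, so the difference
vanishes (`IsNullStokes.ae_eq_zero`). Thus `v` is mild, and the contraction leaves only one mild
solution (`SmallData.ae_eq_of_mild`). -/

/-! ### The heat kernel of `ℝ³` -/

/-- The heat kernel `(4πτ)^{-3/2} exp (-|y|² / 4τ)` of `ℝ³`. -/
noncomputable def heatKernel (τ : ℝ) (y : R3) : ℝ :=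
  (4 * Real.pi * τ) ^ (-(3 / 2) : ℝ) * Real.exp (-‖y‖ ^ 2 / (4 * τ))

lemma heatKernel_nonneg {τ : ℝ} (hτ : 0 ≤ τ) (y : R3) : 0 ≤ heatKernel τ y := by
  unfold heatKernel; positivity

@[fun_prop]
lemma Measurable.heatKernel {α : Type*} [MeasurableSpace α] {f : α → ℝ} {g : α → R3}
    (hf : Measurable f) (hg : Measurable g) : Measurable fun x => heatKernel (f x) (g x) := by
  unfold _root_.heatKernel; fun_prop

lemma ContinuousAt.heatKernel {α : Type*} [TopologicalSpace α] {f : α → ℝ} {g : α → R3} {x : α}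
    (hf : ContinuousAt f x) (hg : ContinuousAt g x) (h0 : 0 < f x) :
    ContinuousAt (fun x => heatKernel (f x) (g x)) x := by
  unfold _root_.heatKernel
  refine ContinuousAt.mul (ContinuousAt.rpow_const (by fun_prop) (Or.inl (by positivity))) ?_
  refine Real.continuous_exp.continuousAt.comp ?_
  exact ContinuousAt.div (by fun_prop) (by fun_prop) (by positivity)

lemma continuous_heatKernel {τ : ℝ} (hτ : 0 < τ) : Continuous (heatKernel τ) :=
  continuous_iff_continuousAt.2 fun _ => ContinuousAt.heatKernel continuousAt_const continuousAt_id hτ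

lemma integral_heatKernel {τ : ℝ} (hτ : 0 < τ) : ∫ y, heatKernel τ y = 1 := by
  unfold heatKernel
  rw [integral_const_mul]
  have h1 : ∀ y : R3, Real.exp (-‖y‖ ^ 2 / (4 * τ)) = Real.exp (-(1 / (4 * τ)) * ‖y‖ ^ 2) := by
    intro y; congr 1; ring
  simp_rw [h1]
  rw [GaussianFourier.integral_rexp_neg_mul_sq_norm (by positivity)]
  have h2 : Real.pi / (1 / (4 * τ)) = 4 * Real.pi * τ := by field_simp
  rw [h2, ← Real.rpow_add (by positivity)]
  simp

lemma integrable_heatKernel {τ : ℝ} (hτ : 0 < τ) : Integrable (heatKernel τ) := by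
  refine Integrable.of_integral_ne_zero ?_
  rw [integral_heatKernel hτ]; exact one_ne_zero

lemma lintegral_heatKernel {τ : ℝ} (hτ : 0 < τ) :
    ∫⁻ y, ENNReal.ofReal (heatKernel τ y) = 1 := by
  rw [← ofReal_integral_eq_lintegral_ofReal (integrable_heatKernel hτ)
    (Eventually.of_forall fun y => heatKernel_nonneg hτ.le y), integral_heatKernel hτ]
  simp

lemma hasDerivAt_heatKernel_time {τ : ℝ} (hτ : 0 < τ) (y : R3) :
    HasDerivAt (fun s => heatKernel s y)
      ((‖y‖ ^ 2 / (4 * τ ^ 2) - 3 / (2 * τ)) * heatKernel τ y) τ := by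
  unfold heatKernel
  have h1 : HasDerivAt (fun s : ℝ => (4 * Real.pi * s) ^ (-(3 / 2) : ℝ))
      ((4 * Real.pi * 1) * (-(3 / 2)) * (4 * Real.pi * τ) ^ (-(3 / 2) - 1 : ℝ)) τ :=
    ((hasDerivAt_id τ).const_mul (4 * Real.pi)).rpow_const (Or.inl (by simp; positivity))
  have h2 : HasDerivAt (fun s : ℝ => -‖y‖ ^ 2 / (4 * s)) (‖y‖ ^ 2 / (4 * τ ^ 2)) τ := by
    have := (hasDerivAt_const τ (-‖y‖ ^ 2)).div ((hasDerivAt_id τ).const_mul 4) (by simp; positivity)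
    refine this.congr_deriv ?_
    simp; field_simp
  refine (h1.mul h2.exp).congr_deriv ?_
  rw [Real.rpow_sub_one (by positivity)]
  field_simp
  ring

/-! ### Directional derivatives of the heat kernel -/

/-- The directional derivative of the heat kernel. -/
noncomputable def heatKernelD1 (τ : ℝ) (a : R3) (y : R3) : ℝ :=
  -(inner ℝ y a / (2 * τ)) * heatKernel τ y

/-- The second directional derivatives of the heat kernel. -/
noncomputable def heatKernelD2 (τ : ℝ) (a b : R3) (y : R3) : ℝ :=
  (inner ℝ y a * inner ℝ y b / (4 * τ ^ 2) - inner ℝ a b / (2 * τ)) * heatKernel τ y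

lemma hasDerivAt_inner_line (y v a : R3) :
    HasDerivAt (fun t : ℝ => inner ℝ (y + t • v) a) (inner ℝ v a) 0 := by
  have : (fun t : ℝ => (inner ℝ (y + t • v) a : ℝ)) = fun t => inner ℝ y a + t * inner ℝ v a := by
    funext t; simp [inner_add_left, inner_smul_left]
  rw [this]
  simpa using ((hasDerivAt_id (0 : ℝ)).mul_const (inner ℝ v a)).const_add (inner ℝ y a)

lemma hasLineDerivAt_heatKernel {τ : ℝ} (hτ : 0 < τ) (v y : R3) :
    HasLineDerivAt ℝ (heatKernel τ) (heatKernelD1 τ v y) y v := by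
  unfold HasLineDerivAt heatKernel heatKernelD1
  have h0 : HasDerivAt (fun t : ℝ => -‖y + t • v‖ ^ 2 / (4 * τ)) (-(inner ℝ y v / (2 * τ))) 0 := by
    have : (fun t : ℝ => -‖y + t • v‖ ^ 2 / (4 * τ))
        = fun t => -(‖y‖ ^ 2 + t * (2 * inner ℝ y v) + t ^ 2 * ‖v‖ ^ 2) / (4 * τ) := by
      funext t
      rw [norm_add_sq_real, inner_smul_right, norm_smul, mul_pow, Real.norm_eq_abs, sq_abs]
      ring
    rw [this]
    have h := ((((hasDerivAt_id (0 : ℝ)).mul_const (2 * inner ℝ y v)).const_add (‖y‖ ^ 2)).add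
      (((hasDerivAt_id (0 : ℝ)).pow 2).mul_const (‖v‖ ^ 2))).neg.div_const (4 * τ)
    refine h.congr_deriv ?_
    simp; field_simp; ring
  refine (h0.exp.const_mul _).congr_deriv ?_
  simp [heatKernel]; ring

lemma hasLineDerivAt_heatKernelD1 {τ : ℝ} (hτ : 0 < τ) (a v y : R3) :
    HasLineDerivAt ℝ (heatKernelD1 τ a) (heatKernelD2 τ a v y) y v := by
  have h1 := ((hasDerivAt_inner_line y v a).div_const (2 * τ)).neg.mul
    (hasLineDerivAt_heatKernel hτ v y)
  refine HasDerivAt.congr_deriv h1 ?_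
  simp only [heatKernelD1, heatKernelD2, zero_smul, add_zero, real_inner_comm v a, Pi.neg_apply]
  field_simp; ring

@[fun_prop]
lemma Measurable.heatKernelD1 {α : Type*} [MeasurableSpace α] {f : α → ℝ} {g : α → R3} (a : R3)
    (hf : Measurable f) (hg : Measurable g) : Measurable fun x => heatKernelD1 (f x) a (g x) := by
  unfold _root_.heatKernelD1; fun_prop

@[fun_prop]
lemma Measurable.heatKernelD2 {α : Type*} [MeasurableSpace α] {f : α → ℝ} {g : α → R3} (a b : R3)
    (hf : Measurable f) (hg : Measurable g) : Measurable fun x => heatKernelD2 (f x) a b (g x) := by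
  unfold _root_.heatKernelD2; fun_prop

lemma continuous_heatKernelD1 {τ : ℝ} (hτ : 0 < τ) (a : R3) : Continuous (heatKernelD1 τ a) := by
  have := continuous_heatKernel hτ
  unfold heatKernelD1; fun_prop

lemma continuous_heatKernelD2 {τ : ℝ} (hτ : 0 < τ) (a b : R3) :
    Continuous (heatKernelD2 τ a b) := by
  have := continuous_heatKernel hτ
  unfold heatKernelD2; fun_prop

/-- This is the heat equation for the kernel: the time derivative equals the trace of the Hessian,
and the `3` is the dimension. -/
lemma heatKernel_time_deriv_eq_sum {τ : ℝ} (hτ : 0 < τ) (y : R3) :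
    (‖y‖ ^ 2 / (4 * τ ^ 2) - 3 / (2 * τ)) * heatKernel τ y
      = ∑ j : Fin 3, heatKernelD2 τ (EuclideanSpace.single j 1) (EuclideanSpace.single j 1) y := by
  simp only [heatKernelD2, ← Finset.sum_mul]
  congr 1
  rw [Finset.sum_sub_distrib, ← Finset.sum_div, EuclideanSpace.real_norm_sq_eq]
  simp [EuclideanSpace.inner_single_right]
  field_simp

/-! ### Bounds and moments of the heat kernel -/

lemma heatKernel_le_of_le {τ₀ τ : ℝ} (h0 : 0 < τ₀) (h : τ₀ ≤ τ) (y : R3) :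
    heatKernel τ y ≤ (4 * Real.pi * τ₀) ^ (-(3 / 2) : ℝ) := by
  have hτ : 0 < τ := h0.trans_le h
  unfold heatKernel
  have h1 : (4 * Real.pi * τ) ^ (-(3 / 2) : ℝ) ≤ (4 * Real.pi * τ₀) ^ (-(3 / 2) : ℝ) :=
    Real.rpow_le_rpow_of_nonpos (by positivity) (by gcongr) (by norm_num)
  have h2 : Real.exp (-‖y‖ ^ 2 / (4 * τ)) ≤ 1 := by
    rw [Real.exp_le_one_iff, neg_div]
    exact neg_nonpos.2 (by positivity)
  calc _ ≤ (4 * Real.pi * τ) ^ (-(3 / 2) : ℝ) * 1 := by gcongr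
    _ ≤ _ := by rw [mul_one]; exact h1

/-- In the variable `w = |y|²/4τ` the product is `(w/π)^{3/2} e^{-w}`, from which the time has
disappeared. This is the source of spatial decay uniform in time. -/
lemma norm_pow_three_mul_heatKernel_le {τ : ℝ} (hτ : 0 < τ) (y : R3) :
    ‖y‖ ^ 3 * heatKernel τ y ≤ 3 := by
  unfold heatKernel
  set w := ‖y‖ ^ 2 / (4 * τ) with hw
  have hw0 : 0 ≤ w := by positivity
  have h1 : ‖y‖ ^ 3 * (4 * Real.pi * τ) ^ (-(3 / 2) : ℝ) = (w / Real.pi) ^ (3 / 2 : ℝ) := by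
    have : ‖y‖ ^ 3 = (‖y‖ ^ 2) ^ (3 / 2 : ℝ) := by
      rw [← Real.rpow_natCast ‖y‖ 2, ← Real.rpow_mul (norm_nonneg y), ← Real.rpow_natCast ‖y‖ 3]
      norm_num
    rw [this, Real.rpow_neg (by positivity), ← div_eq_mul_inv, ← Real.div_rpow (by positivity)
      (by positivity), hw]
    congr 1; field_simp
  have h2 : (w / Real.pi) ^ (3 / 2 : ℝ) ≤ 1 + w ^ 2 := by
    have : w / Real.pi ≤ w := div_le_self hw0 (by linarith [Real.pi_gt_three])
    calc (w / Real.pi) ^ (3 / 2 : ℝ) ≤ w ^ (3 / 2 : ℝ) := by gcongr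
      _ ≤ 1 + w ^ 2 := by
        rcases le_total w 1 with h | h
        · exact (Real.rpow_le_one hw0 h (by norm_num)).trans (by nlinarith)
        · calc w ^ (3 / 2 : ℝ) ≤ w ^ (2 : ℝ) := Real.rpow_le_rpow_of_exponent_le h (by norm_num)
            _ ≤ 1 + w ^ 2 := by rw [Real.rpow_two]; linarith
  have h3 : 1 + w ^ 2 ≤ 3 * Real.exp w := by
    have := Real.quadratic_le_exp_of_nonneg hw0
    nlinarith [sq_nonneg w]
  have h4 : -‖y‖ ^ 2 / (4 * τ) = -w := by rw [hw]; ring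
  rw [← mul_assoc, h1, h4]
  calc (w / Real.pi) ^ (3 / 2 : ℝ) * Real.exp (-w) ≤ (3 * Real.exp w) * Real.exp (-w) := by
        gcongr; exact h2.trans h3
    _ = 3 := by rw [mul_assoc, ← Real.exp_add]; simp

/-- The substitution `τ ↦ 1/τ` turns the left side into Euler's integral for `Γ(k + 1/2)`. The case
`k = 0` is the Newtonian potential; `k = 1, 2` are needed for the derivatives that enter the Oseen
kernel and its gradient. -/
lemma lintegral_heatKernel_div_pow {y : R3} (hy : y ≠ 0) (k : ℕ) :
    ∫⁻ τ in Ioi (0 : ℝ), ENNReal.ofReal (heatKernel τ y / τ ^ k)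
      = ENNReal.ofReal ((4 * Real.pi) ^ (-(3 / 2) : ℝ) *
        ((4 / ‖y‖ ^ 2) ^ (k + 1 / 2 : ℝ) * Real.Gamma (k + 1 / 2))) := by
  have hr : 0 < ‖y‖ := norm_pos_iff.2 hy
  set b := ‖y‖ ^ 2 / 4 with hb
  have hb0 : 0 < b := by positivity
  set f : ℝ → ℝ := fun τ => heatKernel τ y / τ ^ k with hf
  have hsub : ∀ x ∈ Ioi (0 : ℝ), (|(-1 : ℝ)| * x ^ ((-1 : ℝ) - 1)) • f (x ^ (-1 : ℝ))
      = (4 * Real.pi) ^ (-(3 / 2) : ℝ) * (x ^ ((k + 1 / 2 : ℝ) - 1) * Real.exp (-(b * x))) := by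
    intro x (hx : 0 < x)
    simp only [hf, heatKernel, smul_eq_mul, abs_neg, abs_one, one_mul]
    rw [Real.rpow_neg_one, Real.mul_rpow (by positivity) (by positivity), Real.inv_rpow hx.le,
      ← Real.rpow_neg hx.le, inv_pow, div_inv_eq_mul, ← Real.rpow_natCast x k]
    have h1 : -‖y‖ ^ 2 / (4 * x⁻¹) = -(b * x) := by rw [hb]; field_simp
    have h2 : x ^ ((k + 1 / 2 : ℝ) - 1) = x ^ ((-1 : ℝ) - 1) * x ^ (-(-(3 / 2)) : ℝ) * x ^ (k : ℝ) := by
      rw [← Real.rpow_add hx, ← Real.rpow_add hx]; congr 1; ring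
    rw [h1, h2]; ring
  have hint : IntegrableOn f (Ioi 0) := by
    rw [← integrableOn_Ioi_comp_rpow_iff f (p := -1) (by norm_num)]
    refine IntegrableOn.congr_fun ?_ (fun x hx => (hsub x hx).symm) measurableSet_Ioi
    refine Integrable.const_mul ?_ _
    refine Integrable.of_integral_ne_zero ?_
    rw [Real.integral_rpow_mul_exp_neg_mul_Ioi (by positivity) hb0]
    have := Real.Gamma_pos_of_pos (s := (k + 1 / 2 : ℝ)) (by positivity)
    positivity
  have hval : ∫ τ in Ioi (0 : ℝ), f τ = (4 * Real.pi) ^ (-(3 / 2) : ℝ) *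
        ((4 / ‖y‖ ^ 2) ^ (k + 1 / 2 : ℝ) * Real.Gamma (k + 1 / 2)) := by
    rw [← integral_comp_rpow_Ioi f (p := -1) (by norm_num),
      setIntegral_congr_fun measurableSet_Ioi hsub, integral_const_mul,
      Real.integral_rpow_mul_exp_neg_mul_Ioi (by positivity) hb0, hb, one_div_div]
  rw [← hval, ofReal_integral_eq_lintegral_ofReal hint]
  refine (ae_restrict_iff' measurableSet_Ioi).2 (Eventually.of_forall fun τ (hτ : 0 < τ) => ?_)
  have := heatKernel_nonneg hτ.le y
  simp only [hf, Pi.zero_apply]; positivity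

lemma four_pi_rpow : (4 * Real.pi) ^ (-(3 / 2) : ℝ) = (8 * Real.pi * √Real.pi)⁻¹ := by
  have hp := Real.pi_pos
  rw [Real.rpow_neg (by positivity)]
  congr 1
  rw [show (3 / 2 : ℝ) = 1 + 1 / 2 by norm_num, Real.rpow_add (by positivity), Real.rpow_one,
    ← Real.sqrt_eq_rpow, Real.sqrt_mul (by norm_num), show (4 : ℝ) = 2 ^ 2 by norm_num,
    Real.sqrt_sq (by norm_num)]
  ring

lemma four_div_sq_rpow {r : ℝ} (hr : 0 < r) (k : ℕ) :
    (4 / r ^ 2) ^ (k + 1 / 2 : ℝ) = (4 / r ^ 2) ^ k * (2 / r) := by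
  rw [Real.rpow_add (by positivity), Real.rpow_natCast, ← Real.sqrt_eq_rpow,
    show 4 / r ^ 2 = (2 / r) ^ 2 by rw [div_pow]; norm_num, Real.sqrt_sq (by positivity)]

lemma lintegral_heatKernel_time {y : R3} (hy : y ≠ 0) :
    ∫⁻ τ in Ioi (0 : ℝ), ENNReal.ofReal (heatKernel τ y)
      = ENNReal.ofReal (1 / (4 * Real.pi * ‖y‖)) := by
  have hr : 0 < ‖y‖ := norm_pos_iff.2 hy
  have h := lintegral_heatKernel_div_pow hy 0
  have hs : √Real.pi ≠ 0 := by positivity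
  simp only [pow_zero, div_one] at h
  rw [h, four_div_sq_rpow hr, four_pi_rpow]
  congr 1
  rw [show ((0 : ℕ) : ℝ) + 1 / 2 = 1 / 2 by norm_num, Real.Gamma_one_half_eq]
  field_simp; norm_num

lemma lintegral_heatKernel_div_time {y : R3} (hy : y ≠ 0) :
    ∫⁻ τ in Ioi (0 : ℝ), ENNReal.ofReal (heatKernel τ y / τ)
      = ENNReal.ofReal (1 / (2 * Real.pi * ‖y‖ ^ 3)) := by
  have hr : 0 < ‖y‖ := norm_pos_iff.2 hy
  have h := lintegral_heatKernel_div_pow hy 1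
  have hs : √Real.pi ≠ 0 := by positivity
  simp only [pow_one] at h
  rw [h, four_div_sq_rpow hr, four_pi_rpow]
  congr 1
  rw [show ((1 : ℕ) : ℝ) + 1 / 2 = 1 / 2 + 1 by norm_num, Real.Gamma_add_one (by norm_num),
    Real.Gamma_one_half_eq]
  field_simp; norm_num

lemma lintegral_heatKernel_div_time_sq {y : R3} (hy : y ≠ 0) :
    ∫⁻ τ in Ioi (0 : ℝ), ENNReal.ofReal (heatKernel τ y / τ ^ 2)
      = ENNReal.ofReal (3 / (Real.pi * ‖y‖ ^ 5)) := by
  have hr : 0 < ‖y‖ := norm_pos_iff.2 hy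
  have h := lintegral_heatKernel_div_pow hy 2
  have hs : √Real.pi ≠ 0 := by positivity
  rw [h, four_div_sq_rpow hr, four_pi_rpow]
  congr 1
  rw [show ((2 : ℕ) : ℝ) + 1 / 2 = 1 / 2 + 1 + 1 by norm_num, Real.Gamma_add_one (by norm_num),
    Real.Gamma_add_one (by norm_num), Real.Gamma_one_half_eq]
  field_simp; norm_num

/-! ### Smooth compactly supported functions on space-time -/

/-- Smooth compactly supported real functions on `ℝ³ × ℝ`. -/
structure IsSmoothCompact (φ : R3 × ℝ → ℝ) : Prop where
  contDiff : ContDiff ℝ (⊤ : ℕ∞) φ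
  hasCompactSupport : HasCompactSupport φ

/-- The directional derivative of a function on space-time. -/
noncomputable def dirDeriv (v : R3 × ℝ) (φ : R3 × ℝ → ℝ) : R3 × ℝ → ℝ := fun z => fderiv ℝ φ z v

/-- The Laplacian in the space variable. -/
noncomputable def spaceLap (φ : R3 × ℝ → ℝ) : R3 × ℝ → ℝ :=
  fun z => ∑ j, dirDeriv (spatialDir j) (dirDeriv (spatialDir j) φ) z

/-- The adjoint heat operator `∂ₜ + νΔ`. -/
noncomputable def heatAdj (ν : ℝ) (φ : R3 × ℝ → ℝ) : R3 × ℝ → ℝ :=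
  fun z => dirDeriv timeDir φ z + ν * spaceLap φ z

namespace IsSmoothCompact

variable {φ ψ : R3 × ℝ → ℝ}

lemma continuous (hφ : IsSmoothCompact φ) : Continuous φ := hφ.contDiff.continuous

lemma differentiable (hφ : IsSmoothCompact φ) : Differentiable ℝ φ :=
  hφ.contDiff.differentiable (by simp)

protected lemma dirDeriv (hφ : IsSmoothCompact φ) (v : R3 × ℝ) : IsSmoothCompact (dirDeriv v φ) where
  contDiff := (hφ.contDiff.fderiv_right (m := (⊤ : ℕ∞)) (by simp)).clm_apply contDiff_const
  hasCompactSupport := hφ.hasCompactSupport.fderiv_apply (𝕜 := ℝ) v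

lemma add (hφ : IsSmoothCompact φ) (hψ : IsSmoothCompact ψ) :
    IsSmoothCompact fun z => φ z + ψ z :=
  ⟨hφ.contDiff.add hψ.contDiff, hφ.hasCompactSupport.add hψ.hasCompactSupport⟩

lemma mul_left {f : R3 × ℝ → ℝ} (hf : ContDiff ℝ (⊤ : ℕ∞) f) (hφ : IsSmoothCompact φ) :
    IsSmoothCompact fun z => f z * φ z :=
  ⟨hf.mul hφ.contDiff, hφ.hasCompactSupport.mul_left⟩

lemma const_mul (hφ : IsSmoothCompact φ) (c : ℝ) : IsSmoothCompact fun z => c * φ z :=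
  mul_left contDiff_const hφ

lemma sum {ι : Type*} (s : Finset ι) {f : ι → R3 × ℝ → ℝ} (hf : ∀ i, IsSmoothCompact (f i)) :
    IsSmoothCompact fun z => ∑ i ∈ s, f i z := by
  classical
  induction s using Finset.induction_on with
  | empty =>
    refine ⟨by simpa using contDiff_const, ?_⟩
    simp only [Finset.sum_empty]
    exact HasCompactSupport.zero
  | insert a s ha ih => simpa [Finset.sum_insert ha] using (hf a).add ih

protected lemma spaceLap (hφ : IsSmoothCompact φ) : IsSmoothCompact (spaceLap φ) :=
  sum _ fun _ => (hφ.dirDeriv _).dirDeriv _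

protected lemma heatAdj (hφ : IsSmoothCompact φ) (ν : ℝ) : IsSmoothCompact (heatAdj ν φ) :=
  (hφ.dirDeriv _).add (hφ.spaceLap.const_mul ν)

lemma comp_add (hφ : IsSmoothCompact φ) (w : R3 × ℝ) : IsSmoothCompact fun z => φ (z + w) :=
  ⟨hφ.contDiff.comp (contDiff_id.add contDiff_const),
    hφ.hasCompactSupport.comp_homeomorph (Homeomorph.addRight w)⟩

lemma exists_bound (hφ : IsSmoothCompact φ) :
    ∃ C R : ℝ, 0 < C ∧ 0 < R ∧ (∀ z, |φ z| ≤ C) ∧ ∀ z, φ z ≠ 0 → ‖z.1‖ ≤ R ∧ |z.2| ≤ R := by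
  obtain ⟨C, hC⟩ := hφ.hasCompactSupport.exists_bound_of_continuous hφ.continuous
  obtain ⟨R, hR⟩ := hφ.hasCompactSupport.isBounded.subset_closedBall 0
  refine ⟨|C| + 1, |R| + 1, by positivity, by positivity,
    fun z => (hC z).trans (by linarith [le_abs_self C]), fun z hz => ?_⟩
  have h := hR (subset_tsupport φ hz)
  rw [mem_closedBall_zero_iff, Prod.norm_def, max_le_iff] at h
  exact ⟨h.1.trans (by linarith [le_abs_self R]), h.2.trans (by linarith [le_abs_self R])⟩

lemma dirDeriv_comm (hφ : IsSmoothCompact φ) (v w : R3 × ℝ) :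
    dirDeriv v (dirDeriv w φ) = dirDeriv w (dirDeriv v φ) := by
  funext z
  have hd : DifferentiableAt ℝ (fderiv ℝ φ) z :=
    (hφ.contDiff.fderiv_right (m := (⊤ : ℕ∞)) (by simp)).differentiable (by simp) z
  have h1 : ∀ u u' : R3 × ℝ, fderiv ℝ (fun x => fderiv ℝ φ x u) z u' = fderiv ℝ (fderiv ℝ φ) z u' u := by
    intro u u'
    rw [fderiv_clm_apply hd (differentiableAt_const u)]
    simp
  have hs := (hφ.contDiff.contDiffAt (x := z)).isSymmSndFDerivAt (by
    simpa using (WithTop.coe_le_coe.2 (le_top : (2 : ℕ∞) ≤ ⊤)))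
  exact (h1 w v).trans ((hs v w).trans (h1 v w).symm)

end IsSmoothCompact

lemma dirDeriv_add {φ ψ : R3 × ℝ → ℝ} (hφ : Differentiable ℝ φ) (hψ : Differentiable ℝ ψ)
    (v : R3 × ℝ) : dirDeriv v (fun z => φ z + ψ z) = fun z => dirDeriv v φ z + dirDeriv v ψ z := by
  funext z
  simp [dirDeriv, fderiv_fun_add (hφ z) (hψ z)]

lemma dirDeriv_const_mul {φ : R3 × ℝ → ℝ} (hφ : Differentiable ℝ φ) (c : ℝ)
    (v : R3 × ℝ) : dirDeriv v (fun z => c * φ z) = fun z => c * dirDeriv v φ z := by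
  funext z
  simp [dirDeriv, fderiv_const_mul (hφ z) c]

lemma dirDeriv_sum {ι : Type*} (s : Finset ι) {f : ι → R3 × ℝ → ℝ}
    (hf : ∀ i, Differentiable ℝ (f i)) (v : R3 × ℝ) :
    dirDeriv v (fun z => ∑ i ∈ s, f i z) = fun z => ∑ i ∈ s, dirDeriv v (f i) z := by
  funext z
  simp [dirDeriv, fderiv_fun_sum (fun i _ => hf i z)]

lemma dirDeriv_comp_add (φ : R3 × ℝ → ℝ) (v w : R3 × ℝ) :
    dirDeriv v (fun z => φ (z + w)) = fun z => dirDeriv v φ (z + w) := by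
  funext z
  simp [dirDeriv, fderiv_comp_add_right]

lemma IsSmoothCompact.spaceLap_dirDeriv {φ : R3 × ℝ → ℝ} (hφ : IsSmoothCompact φ) (v : R3 × ℝ) :
    spaceLap (dirDeriv v φ) = dirDeriv v (spaceLap φ) := by
  unfold spaceLap
  rw [dirDeriv_sum _ fun j => ((hφ.dirDeriv _).dirDeriv _).differentiable]
  funext z
  refine Finset.sum_congr rfl fun j _ => ?_
  rw [hφ.dirDeriv_comm _ v, (hφ.dirDeriv _).dirDeriv_comm _ v]

lemma IsSmoothCompact.heatAdj_dirDeriv {φ : R3 × ℝ → ℝ} (hφ : IsSmoothCompact φ) (ν : ℝ)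
    (v : R3 × ℝ) : heatAdj ν (dirDeriv v φ) = dirDeriv v (heatAdj ν φ) := by
  unfold heatAdj
  rw [dirDeriv_add (hφ.dirDeriv _).differentiable (hφ.spaceLap.const_mul ν).differentiable,
    dirDeriv_const_mul hφ.spaceLap.differentiable, hφ.spaceLap_dirDeriv, hφ.dirDeriv_comm]

/-! ### Integration by parts on space slices -/

lemma IsSmoothCompact.slice_hasCompactSupport {φ : R3 × ℝ → ℝ} (hφ : IsSmoothCompact φ)
    (z : R3 × ℝ) : HasCompactSupport fun y : R3 => φ (z + (y, 0)) := by
  obtain ⟨-, R, -, -, -, hR⟩ := hφ.exists_bound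
  refine HasCompactSupport.of_support_subset_isCompact
    (isCompact_closedBall (0 : R3) (R + ‖z.1‖)) fun y hy => ?_
  have h := (hR _ hy).1
  rw [mem_closedBall_zero_iff]
  calc ‖y‖ = ‖(z.1 + y) - z.1‖ := by simp
    _ ≤ ‖z.1 + y‖ + ‖z.1‖ := norm_sub_le _ _
    _ ≤ _ := by gcongr; exact h

lemma IsSmoothCompact.integrable_slice_mul {φ : R3 × ℝ → ℝ} (hφ : IsSmoothCompact φ)
    {f : R3 → ℝ} (hf : Continuous f) (z : R3 × ℝ) :
    Integrable fun y : R3 => f y * φ (z + (y, 0)) := by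
  refine Continuous.integrable_of_hasCompactSupport ?_ (hφ.slice_hasCompactSupport z).mul_left
  have := hφ.continuous
  fun_prop

/-- Only a line derivative of `f` in one direction is required, so the same statement serves the
heat kernel, its first derivatives and the components of the Oseen kernel. -/
lemma IsSmoothCompact.integral_lineDeriv_mul {φ : R3 × ℝ → ℝ} (hφ : IsSmoothCompact φ)
    {f f' : R3 → ℝ} (hf : Continuous f) (hf' : Continuous f') {v : R3}
    (hd : ∀ y, HasLineDerivAt ℝ f (f' y) y v) (z : R3 × ℝ) :
    ∫ y, f' y * φ (z + (y, 0)) = -∫ y, f y * dirDeriv (v, 0) φ (z + (y, 0)) := by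
  have h := integral_bilinear_hasLineDerivAt_right_eq_neg_left_of_integrable
    (μ := (volume : Measure R3)) (B := ContinuousLinearMap.mul ℝ ℝ) (f := f) (f' := f')
    (g := fun y => φ (z + (y, 0))) (g' := fun y => dirDeriv (v, 0) φ (z + (y, 0))) (v := v)
    (by simpa using hφ.integrable_slice_mul hf' z)
    (by simpa using (hφ.dirDeriv (v, 0)).integrable_slice_mul hf z)
    (by simpa using hφ.integrable_slice_mul hf z) (fun y _ => hd y) (fun y _ => ?_)
  · simp only [ContinuousLinearMap.mul_apply'] at h
    rw [h, neg_neg]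
  · have h1 : HasFDerivAt φ (fderiv ℝ φ (z + (y, 0))) (z + (y, 0)) :=
      (hφ.differentiable _).hasFDerivAt
    have h2 := h1.hasLineDerivAt (v, 0)
    change HasDerivAt _ (fderiv ℝ φ (z + (y, 0)) (v, 0)) 0
    change HasDerivAt _ (fderiv ℝ φ (z + (y, 0)) (v, 0)) 0 at h2
    convert h2 using 2 with t
    simp [add_assoc]

/-! ### The heat semigroup on test functions -/

/-- The heat semigroup acting in the space variable. -/
noncomputable def heatConv (τ : ℝ) (φ : R3 × ℝ → ℝ) (z : R3 × ℝ) : ℝ :=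
  ∫ y, heatKernel τ y * φ (z + (y, 0))

lemma abs_heatConv_le {φ : R3 × ℝ → ℝ} {C : ℝ} (hC : ∀ z, |φ z| ≤ C) {τ : ℝ} (hτ : 0 < τ)
    (z : R3 × ℝ) : |heatConv τ φ z| ≤ C := by
  have h := norm_integral_le_of_norm_le ((integrable_heatKernel hτ).mul_const C)
    (f := fun y => heatKernel τ y * φ (z + (y, 0))) (Eventually.of_forall fun y => by
      rw [norm_mul, Real.norm_of_nonneg (heatKernel_nonneg hτ.le y)]
      exact mul_le_mul_of_nonneg_left (hC _) (heatKernel_nonneg hτ.le y))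
  rw [integral_mul_const, integral_heatKernel hτ, one_mul] at h
  exact h

lemma heatConv_eq_zero {φ : R3 × ℝ → ℝ} {R : ℝ} (hR : ∀ z, φ z ≠ 0 → ‖z.1‖ ≤ R ∧ |z.2| ≤ R)
    (τ : ℝ) {z : R3 × ℝ} (hz : R < |z.2|) : heatConv τ φ z = 0 := by
  unfold heatConv
  rw [integral_eq_zero_of_ae (Eventually.of_forall fun y => ?_)]
  have : φ (z + (y, 0)) = 0 := by
    by_contra h
    have := (hR _ h).2
    simp at this
    linarith
  simp [this]

lemma heatConv_add {φ ψ : R3 × ℝ → ℝ} (hφ : IsSmoothCompact φ) (hψ : IsSmoothCompact ψ) {τ : ℝ}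
    (hτ : 0 < τ) (z : R3 × ℝ) :
    heatConv τ (fun w => φ w + ψ w) z = heatConv τ φ z + heatConv τ ψ z := by
  unfold heatConv
  rw [← integral_add (hφ.integrable_slice_mul (continuous_heatKernel hτ) z)
    (hψ.integrable_slice_mul (continuous_heatKernel hτ) z)]
  simp_rw [mul_add]

lemma heatConv_const_mul (c : ℝ) (φ : R3 × ℝ → ℝ) (τ : ℝ) (z : R3 × ℝ) :
    heatConv τ (fun w => c * φ w) z = c * heatConv τ φ z := by
  unfold heatConv
  rw [← integral_const_mul]
  congr 1; funext y; ring

lemma integral_heatKernelD1_mul {φ : R3 × ℝ → ℝ} (hφ : IsSmoothCompact φ) {τ : ℝ} (hτ : 0 < τ)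
    (a : R3) (z : R3 × ℝ) :
    ∫ y, heatKernelD1 τ a y * φ (z + (y, 0)) = -heatConv τ (dirDeriv (a, 0) φ) z :=
  hφ.integral_lineDeriv_mul (continuous_heatKernel hτ) (continuous_heatKernelD1 hτ a)
    (hasLineDerivAt_heatKernel hτ a) z

lemma integral_heatKernelD2_mul {φ : R3 × ℝ → ℝ} (hφ : IsSmoothCompact φ) {τ : ℝ} (hτ : 0 < τ)
    (a b : R3) (z : R3 × ℝ) :
    ∫ y, heatKernelD2 τ a b y * φ (z + (y, 0))
      = -∫ y, heatKernelD1 τ a y * dirDeriv (b, 0) φ (z + (y, 0)) :=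
  hφ.integral_lineDeriv_mul (continuous_heatKernelD1 hτ a) (continuous_heatKernelD2 hτ a b)
    (hasLineDerivAt_heatKernelD1 hτ a b) z

/-- Two integrations by parts move the Laplacian onto the kernel, where the heat equation turns it
into a time derivative. -/
lemma heatConv_spaceLap {φ : R3 × ℝ → ℝ} (hφ : IsSmoothCompact φ) {τ : ℝ} (hτ : 0 < τ)
    (z : R3 × ℝ) :
    heatConv τ (spaceLap φ) z
      = ∫ y, ((‖y‖ ^ 2 / (4 * τ ^ 2) - 3 / (2 * τ)) * heatKernel τ y) * φ (z + (y, 0)) := by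
  simp_rw [heatKernel_time_deriv_eq_sum hτ, Finset.sum_mul]
  rw [integral_finsetSum _ fun j _ =>
    hφ.integrable_slice_mul (continuous_heatKernelD2 hτ _ _) z]
  simp_rw [integral_heatKernelD2_mul hφ hτ, integral_heatKernelD1_mul (hφ.dirDeriv _) hτ, neg_neg]
  unfold heatConv spaceLap
  simp_rw [Finset.mul_sum]
  rw [integral_finsetSum _ fun j _ => ((hφ.dirDeriv _).dirDeriv _).integrable_slice_mul
    (continuous_heatKernel hτ) z]
  rfl

/-- The heat time `α + βs` and the physical time shift `γs` move together. With `γ = 1` the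
derivative produces the adjoint heat operator; with `γ = 0` it is the heat semigroup alone. -/
lemma hasDerivAt_heatConv {φ : R3 × ℝ → ℝ} (hφ : IsSmoothCompact φ) (α β γ : ℝ) {s₀ : ℝ}
    (hs₀ : 0 < α + β * s₀) (z : R3 × ℝ) :
    HasDerivAt (fun s => heatConv (α + β * s) φ (z + (0, γ * s)))
      (β * heatConv (α + β * s₀) (spaceLap φ) (z + (0, γ * s₀))
        + γ * heatConv (α + β * s₀) (dirDeriv timeDir φ) (z + (0, γ * s₀))) s₀ := by
  obtain ⟨-, R, -, hR0, -, hR⟩ := hφ.exists_bound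
  set K : ℝ → R3 → ℝ := fun s y =>
    (‖y‖ ^ 2 / (4 * (α + β * s) ^ 2) - 3 / (2 * (α + β * s))) * heatKernel (α + β * s) y with hK
  set F' : ℝ → R3 → ℝ := fun s y => β * (K s y * φ (z + (0, γ * s) + (y, 0)))
    + γ * (heatKernel (α + β * s) y * dirDeriv timeDir φ (z + (0, γ * s) + (y, 0))) with hF'
  have hev : ∀ᶠ s in 𝓝 s₀, 0 < α + β * s :=
    (Continuous.tendsto (by fun_prop : Continuous fun s => α + β * s) s₀).eventually
      (lt_mem_nhds hs₀)
  obtain ⟨ε, hε, hball⟩ := Metric.nhds_basis_closedBall.eventually_iff.1 hev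
  have hφc := hφ.continuous
  have hφt := (hφ.dirDeriv timeDir).continuous
  have hcont : ContinuousOn (fun q : ℝ × R3 => F' q.1 q.2)
      (Metric.closedBall s₀ ε ×ˢ Metric.closedBall 0 (R + ‖z.1‖)) := by
    intro q hq
    have hp : 0 < α + β * q.1 := hball hq.1
    have hG : ContinuousAt (fun q : ℝ × R3 => heatKernel (α + β * q.1) q.2) q :=
      ContinuousAt.heatKernel (by fun_prop) (by fun_prop) hp
    have h1 : ContinuousAt (fun q : ℝ × R3 => ‖q.2‖ ^ 2 / (4 * (α + β * q.1) ^ 2)) q :=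
      ContinuousAt.div (by fun_prop) (by fun_prop) (by positivity)
    have h2 : ContinuousAt (fun q : ℝ × R3 => 3 / (2 * (α + β * q.1))) q :=
      ContinuousAt.div (by fun_prop) (by fun_prop) (by positivity)
    have : ContinuousAt (fun q : ℝ × R3 => F' q.1 q.2) q := by
      simp only [hF', hK]
      have h3 : ContinuousAt (fun q : ℝ × R3 => φ (z + (0, γ * q.1) + (q.2, 0))) q := by fun_prop
      have h4 : ContinuousAt (fun q : ℝ × R3 => dirDeriv timeDir φ (z + (0, γ * q.1) + (q.2, 0))) q :=
        by fun_prop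
      exact (((h1.sub h2).mul hG).mul h3).const_mul β |>.add ((hG.mul h4).const_mul γ)
    exact this.continuousWithinAt
  obtain ⟨M, hM⟩ := ((isCompact_closedBall s₀ ε).prod
    (isCompact_closedBall (0 : R3) (R + ‖z.1‖))).exists_bound_of_continuousOn hcont
  -- For every shift in time, the integrand and its derivative vanish outside one fixed ball. A
  -- constant on this ball is therefore an admissible dominating function.
  have hsupp : ∀ (s : ℝ) (y : R3), R + ‖z.1‖ < ‖y‖ → φ (z + (0, γ * s) + (y, 0)) = 0 := by
    intro s y hy
    by_contra h
    have h1 := (hR _ h).1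
    have h2 : ‖y‖ ≤ ‖z.1 + y‖ + ‖z.1‖ := by
      calc ‖y‖ = ‖(z.1 + y) - z.1‖ := by simp
        _ ≤ _ := norm_sub_le _ _
    simp at h1
    linarith
  have hsupp' : ∀ (s : ℝ) (y : R3), R + ‖z.1‖ < ‖y‖ →
      dirDeriv timeDir φ (z + (0, γ * s) + (y, 0)) = 0 := by
    intro s y hy
    have : (fun w => φ w) =ᶠ[𝓝 (z + (0, γ * s) + (y, 0))] fun _ => 0 := by
      have ho : IsOpen {w : R3 × ℝ | R + ‖z.1‖ < ‖w.1 - z.1‖} :=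
        isOpen_lt continuous_const (by fun_prop)
      filter_upwards [ho.mem_nhds (by simpa using hy)] with w hw
      by_contra h
      have h1 := (hR _ h).1
      have h2 : ‖w.1 - z.1‖ ≤ ‖w.1‖ + ‖z.1‖ := norm_sub_le _ _
      have h3 : R + ‖z.1‖ < ‖w.1 - z.1‖ := hw
      linarith
    change fderiv ℝ (fun w => φ w) _ _ = 0
    rw [this.fderiv_eq]; simp
  have hgoal := (hasDerivAt_integral_of_dominated_loc_of_deriv_le (μ := (volume : Measure R3))
    (F := fun s y => heatKernel (α + β * s) y * φ (z + (0, γ * s) + (y, 0))) (F' := F')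
    (bound := (Metric.closedBall (0 : R3) (R + ‖z.1‖)).indicator fun _ => M)
    (Metric.closedBall_mem_nhds s₀ hε) ?_ ?_ ?_ ?_ ?_ ?_).2
  · refine hgoal.congr_deriv ?_
    simp only [hF']
    rw [integral_add, integral_const_mul, integral_const_mul, heatConv_spaceLap hφ hs₀]
    · rfl
    · refine Integrable.const_mul (hφ.integrable_slice_mul ?_ _) _
      have := continuous_heatKernel hs₀
      simp only [hK]; fun_prop
    · exact Integrable.const_mul ((hφ.dirDeriv _).integrable_slice_mul
        (continuous_heatKernel hs₀) _) _
  · filter_upwards [hev] with s hs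
    exact (hφ.integrable_slice_mul (continuous_heatKernel hs) _).aestronglyMeasurable
  · exact hφ.integrable_slice_mul (continuous_heatKernel hs₀) _
  · have := continuous_heatKernel hs₀
    have hc : Continuous (F' s₀) := by simp only [hF', hK]; fun_prop
    exact hc.aestronglyMeasurable
  · refine Eventually.of_forall fun y s hs => ?_
    by_cases hy : ‖y‖ ≤ R + ‖z.1‖
    · rw [indicator_of_mem (by simpa using hy)]
      exact hM (s, y) ⟨hs, by simpa using hy⟩
    · rw [indicator_of_notMem (by simpa using hy)]
      push Not at hy
      simp [hF', hsupp s y hy, hsupp' s y hy]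
  · exact (integrable_indicator_iff Metric.isClosed_closedBall.measurableSet).2
      (integrableOn_const (measure_closedBall_lt_top (μ := (volume : Measure R3))).ne)
  · refine Eventually.of_forall fun y s hs => ?_
    have hp : 0 < α + β * s := hball hs
    have h1 : HasDerivAt (fun s => heatKernel (α + β * s) y) (K s y * β) s := by
      have h0 : HasDerivAt (fun s => α + β * s) β s := by
        simpa using ((hasDerivAt_id s).const_mul β).const_add α
      exact (hasDerivAt_heatKernel_time hp y).comp s h0
    have h2 : HasDerivAt (fun s => φ (z + (0, γ * s) + (y, 0)))
        (γ * dirDeriv timeDir φ (z + (0, γ * s) + (y, 0))) s := by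
      have h0 : HasDerivAt (fun s : ℝ => z + ((0 : R3), γ * s) + (y, (0 : ℝ))) (γ • timeDir) s := by
        have : HasDerivAt (fun s : ℝ => (((0 : R3), γ * s) : R3 × ℝ)) ((0 : R3), γ * 1) s :=
          (hasDerivAt_const s (0 : R3)).prodMk ((hasDerivAt_id s).const_mul γ)
        refine ((this.const_add z).add_const (y, (0 : ℝ))).congr_deriv ?_
        simp [timeDir]
      have := (hφ.differentiable (z + (0, γ * s) + (y, 0))).hasFDerivAt.comp_hasDerivAt s h0
      refine this.congr_deriv ?_
      simp [dirDeriv]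
    refine (h1.mul h2).congr_deriv ?_
    simp only [hF']; ring

lemma hasDerivAt_heatConv_heatAdj {φ : R3 × ℝ → ℝ} (hφ : IsSmoothCompact φ) {ν m s : ℝ}
    (hν : 0 < ν) (hs : 0 < s + m) (z : R3 × ℝ) :
    HasDerivAt (fun s => heatConv (ν * (s + m)) φ (z + (0, s)))
      (heatConv (ν * (s + m)) (heatAdj ν φ) (z + (0, s))) s := by
  have h := hasDerivAt_heatConv hφ (ν * m) ν 1 (s₀ := s) (by rw [← mul_add, add_comm]; positivity) z
  have e : ∀ s, ν * m + ν * s = ν * (s + m) := fun s => by ring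
  simp only [e, one_mul] at h
  refine h.congr_deriv ?_
  unfold heatAdj
  rw [heatConv_add (hφ.dirDeriv _) (hφ.spaceLap.const_mul ν) (by positivity), heatConv_const_mul,
    add_comm]

/-- The integrand is the derivative in `s` of `heatConv (ν * (s + m)) φ (z + (0, s))`, which is zero
for large `s` because `φ` has bounded support in time. The offset `m > 0` keeps the kernel away from
its singular time. -/
lemma integral_heatConv_heatAdj {φ : R3 × ℝ → ℝ} (hφ : IsSmoothCompact φ) {ν m : ℝ}
    (hν : 0 < ν) (hm : 0 < m) (z : R3 × ℝ) :
    ∫ s in Ioi (0 : ℝ), heatConv (ν * (s + m)) (heatAdj ν φ) (z + (0, s))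
      = -heatConv (ν * m) φ z := by
  obtain ⟨-, R, -, -, -, hR⟩ := hφ.exists_bound
  obtain ⟨C, R', hC0, hR'0, hC, hR'⟩ := (hφ.heatAdj ν).exists_bound
  have hd : ∀ s, 0 ≤ s → HasDerivAt (fun s => heatConv (ν * (s + m)) φ (z + (0, s)))
      (heatConv (ν * (s + m)) (heatAdj ν φ) (z + (0, s))) s := fun s hs =>
    hasDerivAt_heatConv_heatAdj hφ hν (by positivity) z
  have hd' : ∀ s, 0 ≤ s → ContinuousAt
      (fun s => heatConv (ν * (s + m)) (heatAdj ν φ) (z + (0, s))) s := fun s hs =>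
    (hasDerivAt_heatConv_heatAdj (hφ.heatAdj ν) hν (by positivity) z).continuousAt
  rw [integral_Ioi_of_hasDerivAt_of_tendsto (m := 0) (hd 0 le_rfl).continuousAt.continuousWithinAt
    (fun s hs => hd s (le_of_lt hs))]
  · simp [Prod.zero_eq_mk.symm]
  · refine Integrable.mono' (g := (Ioc 0 (R' + |z.2|)).indicator fun _ => C) ?_ ?_ ?_
    · refine Integrable.mono_measure ?_ Measure.restrict_le_self
      exact (integrable_indicator_iff measurableSet_Ioc).2 (integrableOn_const (by simp))
    · exact ContinuousOn.aestronglyMeasurable (fun s hs => (hd' s (le_of_lt hs)).continuousWithinAt)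
        measurableSet_Ioi
    · refine (ae_restrict_iff' measurableSet_Ioi).2 (Eventually.of_forall fun s (hs : 0 < s) => ?_)
      by_cases h : s ≤ R' + |z.2|
      · rw [indicator_of_mem (show s ∈ Ioc 0 (R' + |z.2|) from ⟨hs, h⟩)]
        exact abs_heatConv_le hC (by positivity) _
      · rw [heatConv_eq_zero hR', indicator_of_notMem (fun hh => h hh.2)]
        · simp
        · push Not at h
          simp only [Prod.snd_add]
          calc R' < s - |z.2| := by linarith
            _ ≤ z.2 + s := by linarith [neg_abs_le z.2]
            _ ≤ _ := le_abs_self _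
  · refine tendsto_const_nhds.congr' ?_
    filter_upwards [eventually_gt_atTop (R + |z.2|)] with s hs
    rw [heatConv_eq_zero hR]
    simp only [Prod.snd_add]
    calc R < s - |z.2| := by linarith
      _ ≤ z.2 + s := by linarith [neg_abs_le z.2]
      _ ≤ _ := le_abs_self _

/-! ### Behaviour for short times -/

/-- A rescaled form of `heatConv` which makes sense also for `τ = 0`. -/
noncomputable def scaledHeatConv (τ : ℝ) (φ : R3 × ℝ → ℝ) (z : R3 × ℝ) : ℝ :=
  ∫ w, heatKernel 1 w * φ (z + (√τ • w, 0))

/-- The substitution `y = √τ w` moves the singular scale from the kernel into the argument of `φ`.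
The rescaled form is continuous down to `τ = 0`, which makes the limits at time zero immediate. -/
lemma heatConv_eq_scaled {τ : ℝ} (hτ : 0 < τ) (φ : R3 × ℝ → ℝ) (z : R3 × ℝ) :
    heatConv τ φ z = scaledHeatConv τ φ z := by
  have h := Measure.integral_comp_smul (volume : Measure R3)
    (fun y => heatKernel τ y * φ (z + (y, 0))) (√τ)
  have hs : 0 < √τ := Real.sqrt_pos.2 hτ
  have e : ∀ w : R3, heatKernel τ (√τ • w) = (√τ ^ 3)⁻¹ * heatKernel 1 w := by
    intro w
    unfold heatKernel
    rw [norm_smul, mul_pow, Real.norm_of_nonneg hs.le, Real.sq_sqrt hτ.le,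
      Real.mul_rpow (by positivity) hτ.le]
    have h1 : τ ^ (-(3 / 2) : ℝ) = (√τ ^ 3)⁻¹ := by
      rw [Real.sqrt_eq_rpow, ← Real.rpow_natCast, ← Real.rpow_mul hτ.le, ← Real.rpow_neg hτ.le]
      norm_num
    have h2 : -(τ * ‖w‖ ^ 2) / (4 * τ) = -‖w‖ ^ 2 / (4 * 1) := by field_simp
    rw [h1, h2]; ring_nf
  simp only [e, mul_assoc, integral_const_mul] at h
  rw [finrank_euclideanSpace_fin, abs_of_pos (by positivity), smul_eq_mul] at h
  exact (mul_left_cancel₀ (by positivity) h).symm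

lemma scaledHeatConv_zero (φ : R3 × ℝ → ℝ) (z : R3 × ℝ) : scaledHeatConv 0 φ z = φ z := by
  simp [scaledHeatConv, Prod.zero_eq_mk.symm, integral_mul_const, integral_heatKernel]

lemma continuous_scaledHeatConv {φ : R3 × ℝ → ℝ} (hφ : IsSmoothCompact φ) :
    Continuous fun q : ℝ × (R3 × ℝ) => scaledHeatConv q.1 φ q.2 := by
  obtain ⟨C, -, -, -, hC, -⟩ := hφ.exists_bound
  have h1 := continuous_heatKernel one_pos
  have h2 := hφ.continuous
  refine continuous_of_dominated (bound := fun w => heatKernel 1 w * C) (fun q => ?_) (fun q => ?_)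
    ((integrable_heatKernel one_pos).mul_const C) (Eventually.of_forall fun w => ?_)
  · exact Continuous.aestronglyMeasurable (by fun_prop)
  · refine Eventually.of_forall fun w => ?_
    rw [norm_mul, Real.norm_of_nonneg (heatKernel_nonneg one_pos.le w)]
    exact mul_le_mul_of_nonneg_left (hC _) (heatKernel_nonneg one_pos.le w)
  · fun_prop

lemma abs_scaledHeatConv_le {φ : R3 × ℝ → ℝ} {C : ℝ} (hC : ∀ z, |φ z| ≤ C) (τ : ℝ)
    (z : R3 × ℝ) : |scaledHeatConv τ φ z| ≤ C := by
  have h := norm_integral_le_of_norm_le ((integrable_heatKernel one_pos).mul_const C)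
    (f := fun y => heatKernel 1 y * φ (z + (√τ • y, 0))) (Eventually.of_forall fun y => by
      rw [norm_mul, Real.norm_of_nonneg (heatKernel_nonneg one_pos.le y)]
      exact mul_le_mul_of_nonneg_left (hC _) (heatKernel_nonneg one_pos.le y))
  rw [integral_mul_const, integral_heatKernel one_pos, one_mul] at h
  exact h

lemma tendsto_heatConv_zero {φ : R3 × ℝ → ℝ} (hφ : IsSmoothCompact φ) (z : R3 × ℝ) :
    Tendsto (fun τ => heatConv τ φ z) (𝓝[>] 0) (𝓝 (φ z)) := by
  have h : Tendsto (fun τ => scaledHeatConv τ φ z) (𝓝[>] 0) (𝓝 (scaledHeatConv 0 φ z)) :=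
    ((continuous_scaledHeatConv hφ).comp (by fun_prop : Continuous fun τ : ℝ => (τ, z))).tendsto 0
      |>.mono_left nhdsWithin_le_nhds
  rw [scaledHeatConv_zero] at h
  refine h.congr' ?_
  filter_upwards [self_mem_nhdsWithin] with τ hτ
  rw [heatConv_eq_scaled hτ]

/-- Duhamel's formula for the backward heat equation with final value zero. -/
lemma integral_heatConv_heatAdj_zero {φ : R3 × ℝ → ℝ} (hφ : IsSmoothCompact φ) {ν : ℝ}
    (hν : 0 < ν) (z : R3 × ℝ) :
    ∫ s in Ioi (0 : ℝ), heatConv (ν * s) (heatAdj ν φ) (z + (0, s)) = -φ z := by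
  obtain ⟨C, R, hC0, hR0, hC, hR⟩ := (hφ.heatAdj ν).exists_bound
  have hcs := continuous_scaledHeatConv (hφ.heatAdj ν)
  -- The offset `m` of `integral_heatConv_heatAdj` is sent to zero in the rescaled form. The
  -- integrand is at most `C` and vanishes for `s > R + |z.2|`, independently of `m`.
  have h1 : Tendsto (fun m => ∫ s in Ioi (0 : ℝ),
      scaledHeatConv (ν * (s + m)) (heatAdj ν φ) (z + (0, s))) (𝓝[>] 0)
      (𝓝 (∫ s in Ioi (0 : ℝ), scaledHeatConv (ν * (s + 0)) (heatAdj ν φ) (z + (0, s)))) := by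
    refine tendsto_integral_filter_of_dominated_convergence
      ((Ioc 0 (R + |z.2|)).indicator fun _ => C) ?_ ?_ ?_ ?_
    · exact Eventually.of_forall fun m => Continuous.aestronglyMeasurable
        (hcs.comp (by fun_prop : Continuous fun s : ℝ => (ν * (s + m), z + (0, s))))
    · filter_upwards [self_mem_nhdsWithin] with m (hm : 0 < m)
      refine (ae_restrict_iff' measurableSet_Ioi).2 (Eventually.of_forall fun s (hs : 0 < s) => ?_)
      by_cases h : s ≤ R + |z.2|
      · rw [indicator_of_mem (show s ∈ Ioc 0 (R + |z.2|) from ⟨hs, h⟩)]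
        exact abs_scaledHeatConv_le hC _ _
      · rw [← heatConv_eq_scaled (by positivity), heatConv_eq_zero hR,
          indicator_of_notMem (fun hh => h hh.2)]
        · simp
        · push Not at h
          simp only [Prod.snd_add]
          calc R < s - |z.2| := by linarith
            _ ≤ z.2 + s := by linarith [neg_abs_le z.2]
            _ ≤ _ := le_abs_self _
    · refine Integrable.mono_measure ?_ Measure.restrict_le_self
      exact (integrable_indicator_iff measurableSet_Ioc).2 (integrableOn_const (by simp))
    · refine Eventually.of_forall fun s => ?_
      exact ((hcs.comp (by fun_prop : Continuous fun m : ℝ => (ν * (s + m), z + (0, s)))).tendsto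
        0).mono_left nhdsWithin_le_nhds
  have h2 : Tendsto (fun m => -heatConv (ν * m) φ z) (𝓝[>] 0) (𝓝 (-φ z)) := by
    refine ((tendsto_heatConv_zero hφ z).comp ?_).neg
    refine tendsto_nhdsWithin_iff.2 ⟨?_, ?_⟩
    · exact ((by fun_prop : Continuous fun m : ℝ => ν * m).tendsto' 0 0 (by simp)).mono_left
        nhdsWithin_le_nhds
    · filter_upwards [self_mem_nhdsWithin] with m (hm : 0 < m)
      exact mul_pos hν hm
  have h3 := tendsto_nhds_unique (h1.congr' (f₂ := fun m => -heatConv (ν * m) φ z) ?_) h2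
  · rw [← h3]
    refine setIntegral_congr_fun measurableSet_Ioi fun s (hs : 0 < s) => ?_
    simp only [add_zero]
    rw [heatConv_eq_scaled (by positivity)]
  · filter_upwards [self_mem_nhdsWithin] with m (hm : 0 < m)
    rw [← integral_heatConv_heatAdj hφ hν hm z]
    refine setIntegral_congr_fun measurableSet_Ioi fun s (hs : 0 < s) => ?_
    rw [heatConv_eq_scaled (by positivity)]

/-- The heat semigroup maps bounded functions with bounded support to functions that decay like
`|x|⁻³`, uniformly in time. -/
lemma exists_integral_heatKernel_mul_abs_le {φ : R3 × ℝ → ℝ} (hφ : IsSmoothCompact φ) :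
    ∃ C R : ℝ, 0 < C ∧ ∀ τ, 0 < τ → ∀ z : R3 × ℝ,
      ∫ y, heatKernel τ y * |φ (z + (y, 0))|
        ≤ (Icc (-R) R).indicator (fun _ => C * ((1 + ‖z.1‖) ^ 3)⁻¹) z.2 := by
  obtain ⟨C, R, hC0, hR0, hC, hR⟩ := hφ.exists_bound
  set V := (volume : Measure R3).real (Metric.closedBall 0 R) with hV
  have hV0 : 0 ≤ V := measureReal_nonneg
  -- The first summand covers `|x| ≤ 2R`, where the maximum principle is enough. The second covers
  -- `|x| > 2R`: there `|y| ≥ |x|/2` on the support, so the heat kernel is at most `3 · 8/|x|³`.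
  refine ⟨C * (1 + 2 * R) ^ 3 + 24 * C * V * (1 + 1 / (2 * R)) ^ 3, R, by positivity,
    fun τ hτ z => ?_⟩
  by_cases hz : |z.2| ≤ R
  swap
  · rw [indicator_of_notMem (by rw [mem_Icc, ← abs_le]; exact hz),
      integral_eq_zero_of_ae (Eventually.of_forall fun y => ?_)]
    have : φ (z + (y, 0)) = 0 := by
      by_contra h
      have := (hR _ h).2
      simp at this
      exact hz this
    simp [this]
  rw [indicator_of_mem (by rw [mem_Icc, ← abs_le]; exact hz), add_mul]
  rcases le_or_gt ‖z.1‖ (2 * R) with hx | hx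
  · have h1 : ∫ y, heatKernel τ y * |φ (z + (y, 0))| ≤ ∫ y, heatKernel τ y * C := by
      refine integral_mono_of_nonneg (Eventually.of_forall fun y => ?_)
        ((integrable_heatKernel hτ).mul_const C) (Eventually.of_forall fun y => ?_)
      · exact mul_nonneg (heatKernel_nonneg hτ.le y) (abs_nonneg _)
      · exact mul_le_mul_of_nonneg_left (hC _) (heatKernel_nonneg hτ.le y)
    rw [integral_mul_const, integral_heatKernel hτ, one_mul] at h1
    have h2 : C ≤ C * (1 + 2 * R) ^ 3 * ((1 + ‖z.1‖) ^ 3)⁻¹ := by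
      rw [← div_eq_mul_inv, le_div_iff₀ (by positivity)]
      gcongr
    have h3 : 0 ≤ 24 * C * V * (1 + 1 / (2 * R)) ^ 3 * ((1 + ‖z.1‖) ^ 3)⁻¹ := by positivity
    linarith
  · have hx0 : 0 < ‖z.1‖ := by linarith
    have h1 : ∫ y, heatKernel τ y * |φ (z + (y, 0))|
        ≤ ∫ y, (Metric.closedBall (-z.1) R).indicator (fun _ => 24 * C / ‖z.1‖ ^ 3) y := by
      refine integral_mono_of_nonneg (Eventually.of_forall fun y => ?_) ?_
        (Eventually.of_forall fun y => ?_)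
      · exact mul_nonneg (heatKernel_nonneg hτ.le y) (abs_nonneg _)
      · exact (integrable_indicator_iff Metric.isClosed_closedBall.measurableSet).2
          (integrableOn_const (measure_closedBall_lt_top (μ := (volume : Measure R3))).ne)
      · simp only
        by_cases hy : φ (z + (y, 0)) = 0
        · rw [hy, abs_zero, mul_zero]
          exact indicator_nonneg (fun _ _ => by positivity) _
        · have h1 := (hR _ hy).1
          simp only [Prod.fst_add] at h1
          rw [indicator_of_mem (by
            rw [mem_closedBall_iff_norm, sub_neg_eq_add, add_comm]; exact h1)]
          have h2 : ‖z.1‖ / 2 ≤ ‖y‖ := by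
            have : ‖z.1‖ ≤ ‖z.1 + y‖ + ‖y‖ := by
              calc ‖z.1‖ = ‖(z.1 + y) - y‖ := by simp
                _ ≤ _ := norm_sub_le _ _
            linarith
          have h3 := norm_pow_three_mul_heatKernel_le hτ y
          have h4 : heatKernel τ y ≤ 24 / ‖z.1‖ ^ 3 := by
            rw [le_div_iff₀ (by positivity)]
            have h5 : ‖z.1‖ ^ 3 ≤ 8 * ‖y‖ ^ 3 := by
              calc ‖z.1‖ ^ 3 ≤ (2 * ‖y‖) ^ 3 := by gcongr; linarith
                _ = _ := by ring
            nlinarith [heatKernel_nonneg hτ.le y]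
          calc heatKernel τ y * |φ (z + (y, 0))| ≤ 24 / ‖z.1‖ ^ 3 * C := by
                gcongr; exact hC _
            _ = _ := by ring
    have h2 : ∫ y, (Metric.closedBall (-z.1) R).indicator (fun _ => 24 * C / ‖z.1‖ ^ 3) y
        = V * (24 * C / ‖z.1‖ ^ 3) := by
      rw [integral_indicator Metric.isClosed_closedBall.measurableSet, setIntegral_const, hV,
        smul_eq_mul, measureReal_def, measureReal_def, Measure.addHaar_closedBall_center]
    have h3 : V * (24 * C / ‖z.1‖ ^ 3)
        ≤ 24 * C * V * (1 + 1 / (2 * R)) ^ 3 * ((1 + ‖z.1‖) ^ 3)⁻¹ := by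
      rw [← div_eq_mul_inv, le_div_iff₀ (by positivity), mul_div_assoc', div_mul_eq_mul_div,
        div_le_iff₀ (by positivity)]
      have : 1 + ‖z.1‖ ≤ (1 + 1 / (2 * R)) * ‖z.1‖ := by
        have : 1 ≤ 1 / (2 * R) * ‖z.1‖ := by
          rw [one_div_mul_eq_div, one_le_div (by positivity)]; exact hx.le
        linarith
      calc V * (24 * C) * (1 + ‖z.1‖) ^ 3 ≤ V * (24 * C) * ((1 + 1 / (2 * R)) * ‖z.1‖) ^ 3 := by
            gcongr
        _ = _ := by ring
    have h4 : 0 ≤ C * (1 + 2 * R) ^ 3 * ((1 + ‖z.1‖) ^ 3)⁻¹ := by positivity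
    linarith

/-! ### Auxiliary one-dimensional integrals -/

/-- Tonelli: the sum `x = s + m` is reached from all `s` in `(0, x)`, an interval of length `x`. -/
lemma lintegral_Ioi_lintegral_Ioi_add {f : ℝ → ℝ≥0∞} (hf : Measurable f) :
    ∫⁻ s in Ioi (0 : ℝ), ∫⁻ m in Ioi (0 : ℝ), f (s + m)
      = ∫⁻ x in Ioi (0 : ℝ), ENNReal.ofReal x * f x := by
  have h1 : ∀ s : ℝ, ∫⁻ m in Ioi (0 : ℝ), f (s + m) = ∫⁻ x, (Ioi s).indicator f x := by
    intro s
    rw [← lintegral_indicator measurableSet_Ioi]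
    rw [← lintegral_add_left_eq_self ((Ioi s).indicator f) s]
    refine lintegral_congr fun m => ?_
    simp [indicator]
  simp_rw [h1]
  rw [lintegral_lintegral_swap]
  · rw [← lintegral_indicator measurableSet_Ioi]
    refine lintegral_congr fun x => ?_
    have h2 : ∀ s, (Ioi s).indicator f x = (Iio x).indicator (fun _ => f x) s := by
      intro s; simp [indicator]
    simp_rw [h2]
    rw [lintegral_indicator measurableSet_Iio, setLIntegral_const,
      Measure.restrict_apply measurableSet_Iio, Iio_inter_Ioi, Real.volume_Ioo, sub_zero, mul_comm]
    by_cases hx : 0 < x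
    · rw [indicator_of_mem (show x ∈ Ioi (0 : ℝ) from hx)]
    · rw [indicator_of_notMem (show x ∉ Ioi (0 : ℝ) from hx),
        ENNReal.ofReal_of_nonpos (not_lt.1 hx), zero_mul]
  · refine Measurable.aemeasurable ?_
    have : (Function.uncurry fun s x : ℝ => (Ioi s).indicator f x)
        = {p : ℝ × ℝ | p.1 < p.2}.indicator fun p => f p.2 := by
      funext p; simp [indicator, Function.uncurry]
    rw [this]
    exact (hf.comp measurable_snd).indicator (measurableSet_lt measurable_fst measurable_snd)

lemma lintegral_Ioi_comp_mul_left {ν : ℝ} (hν : 0 < ν) {f : ℝ → ℝ≥0∞} (hf : Measurable f) :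
    ∫⁻ x in Ioi (0 : ℝ), f (ν * x) = ENNReal.ofReal (1 / ν) * ∫⁻ x in Ioi (0 : ℝ), f x := by
  have h1 : ∫⁻ x, (Ioi (0 : ℝ)).indicator f x
      = ENNReal.ofReal ν * ∫⁻ x, (Ioi (0 : ℝ)).indicator f (ν * x) := by
    conv_lhs => rw [← Real.smul_map_volume_mul_left hν.ne', lintegral_smul_measure,
      lintegral_map (hf.indicator measurableSet_Ioi) (by fun_prop), abs_of_pos hν]
    rfl
  rw [lintegral_indicator measurableSet_Ioi] at h1
  rw [h1, ← mul_assoc, ← ENNReal.ofReal_mul (by positivity), one_div_mul_cancel hν.ne',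
    ENNReal.ofReal_one, one_mul, ← lintegral_indicator measurableSet_Ioi]
  refine lintegral_congr fun x => ?_
  simp [indicator, hν]

/-! ### The Oseen kernel -/

/-- Time integrals `∫_s^∞ G(νr, y) (νr)^{-k} ν dr` of the heat kernel. -/
noncomputable def tailMoment (ν : ℝ) (k : ℕ) (s : ℝ) (y : R3) : ℝ :=
  ∫ m in Ioi (0 : ℝ), ν * (heatKernel (ν * (s + m)) y / (ν * (s + m)) ^ k)

/-- The Oseen kernel, the kernel of the semigroup of the Stokes equations. -/
noncomputable def oseen (ν : ℝ) (ζ : R3 × ℝ) (a : R3) : R3 :=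
  if 0 < ζ.2 then
    (heatKernel (ν * ζ.2) ζ.1 - tailMoment ν 1 ζ.2 ζ.1 / 2) • a
      + (tailMoment ν 2 ζ.2 ζ.1 / 4 * inner ℝ ζ.1 a) • ζ.1
  else 0

/-- The derivative of `oseen ν ζ a` in the space direction `b`. -/
noncomputable def oseenGrad (ν : ℝ) (ζ : R3 × ℝ) (a b : R3) : R3 :=
  if 0 < ζ.2 then
    (-(heatKernel (ν * ζ.2) ζ.1 / (2 * (ν * ζ.2))) * inner ℝ ζ.1 b) • a
      - (tailMoment ν 3 ζ.2 ζ.1 / 8 * inner ℝ ζ.1 a * inner ℝ ζ.1 b) • ζ.1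
      + (tailMoment ν 2 ζ.2 ζ.1 / 4) •
        ((inner ℝ a b : ℝ) • ζ.1 + (inner ℝ ζ.1 a : ℝ) • b + (inner ℝ ζ.1 b : ℝ) • a)
  else 0

/-- A bound for the operator norm of `oseen ν ζ`. -/
noncomputable def oseenMaj (ν : ℝ) (ζ : R3 × ℝ) : ℝ :=
  if 0 < ζ.2 then
    heatKernel (ν * ζ.2) ζ.1 + tailMoment ν 1 ζ.2 ζ.1 / 2
      + tailMoment ν 2 ζ.2 ζ.1 / 4 * ‖ζ.1‖ ^ 2
  else 0

/-- A bound for the norm of the bilinear map `oseenGrad ν ζ`. -/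
noncomputable def oseenGradMaj (ν : ℝ) (ζ : R3 × ℝ) : ℝ :=
  if 0 < ζ.2 then
    heatKernel (ν * ζ.2) ζ.1 / (2 * (ν * ζ.2)) * ‖ζ.1‖
      + tailMoment ν 3 ζ.2 ζ.1 / 8 * ‖ζ.1‖ ^ 3 + 3 / 4 * tailMoment ν 2 ζ.2 ζ.1 * ‖ζ.1‖
  else 0

lemma tailMoment_nonneg {ν : ℝ} (hν : 0 < ν) (k : ℕ) {s : ℝ} (hs : 0 ≤ s) (y : R3) :
    0 ≤ tailMoment ν k s y := by
  refine setIntegral_nonneg measurableSet_Ioi fun m (hm : 0 < m) => ?_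
  have := heatKernel_nonneg (τ := ν * (s + m)) (by positivity) y
  positivity

lemma measurable_tailMoment (ν : ℝ) (k : ℕ) :
    Measurable fun q : ℝ × R3 => tailMoment ν k q.1 q.2 := by
  refine (StronglyMeasurable.integral_prod_right' (f := fun p : (ℝ × R3) × ℝ =>
    ν * (heatKernel (ν * (p.1.1 + p.2)) p.1.2 / (ν * (p.1.1 + p.2)) ^ k)) ?_).measurable
  exact Measurable.stronglyMeasurable (by fun_prop)

@[fun_prop]
lemma Measurable.tailMoment {α : Type*} [MeasurableSpace α] {f : α → ℝ} {g : α → R3} (ν : ℝ)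
    (k : ℕ) (hf : Measurable f) (hg : Measurable g) :
    Measurable fun x => tailMoment ν k (f x) (g x) := by
  have h := (measurable_tailMoment ν k).comp (hf.prodMk hg)
  simpa only [Function.comp_def] using h

@[fun_prop]
lemma Measurable.oseen {α : Type*} [MeasurableSpace α] {f : α → R3 × ℝ} {g : α → R3} (ν : ℝ)
    (hf : Measurable f) (hg : Measurable g) : Measurable fun x => oseen ν (f x) (g x) := by
  unfold _root_.oseen
  exact Measurable.ite (measurableSet_lt measurable_const (by fun_prop)) (by fun_prop)
    measurable_const

@[fun_prop]
lemma Measurable.oseenGrad {α : Type*} [MeasurableSpace α] {f : α → R3 × ℝ} {g k : α → R3} (ν : ℝ)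
    (hf : Measurable f) (hg : Measurable g) (hk : Measurable k) :
    Measurable fun x => oseenGrad ν (f x) (g x) (k x) := by
  unfold _root_.oseenGrad
  exact Measurable.ite (measurableSet_lt measurable_const (by fun_prop)) (by fun_prop)
    measurable_const

@[fun_prop]
lemma measurable_oseenMaj (ν : ℝ) : Measurable (oseenMaj ν) := by
  unfold oseenMaj
  exact Measurable.ite (measurableSet_lt measurable_const (by fun_prop)) (by fun_prop)
    measurable_const

@[fun_prop]
lemma measurable_oseenGradMaj (ν : ℝ) : Measurable (oseenGradMaj ν) := by
  unfold oseenGradMaj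
  exact Measurable.ite (measurableSet_lt measurable_const (by fun_prop)) (by fun_prop)
    measurable_const

lemma oseenMaj_nonneg {ν : ℝ} (hν : 0 < ν) (ζ : R3 × ℝ) : 0 ≤ oseenMaj ν ζ := by
  unfold oseenMaj
  split_ifs with h
  · have h1 := heatKernel_nonneg (τ := ν * ζ.2) (by positivity) ζ.1
    have h2 := tailMoment_nonneg hν 1 h.le ζ.1
    have h3 := tailMoment_nonneg hν 2 h.le ζ.1
    positivity
  · exact le_rfl

lemma oseenGradMaj_nonneg {ν : ℝ} (hν : 0 < ν) (ζ : R3 × ℝ) : 0 ≤ oseenGradMaj ν ζ := by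
  unfold oseenGradMaj
  split_ifs with h
  · have h1 := heatKernel_nonneg (τ := ν * ζ.2) (by positivity) ζ.1
    have h2 := tailMoment_nonneg hν 3 h.le ζ.1
    have h3 := tailMoment_nonneg hν 2 h.le ζ.1
    positivity
  · exact le_rfl

lemma norm_oseen_le {ν : ℝ} (hν : 0 < ν) (ζ : R3 × ℝ) (a : R3) :
    ‖oseen ν ζ a‖ ≤ oseenMaj ν ζ * ‖a‖ := by
  unfold oseen oseenMaj
  split_ifs with h
  · have h1 := heatKernel_nonneg (τ := ν * ζ.2) (by positivity) ζ.1
    have h2 := tailMoment_nonneg hν 1 h.le ζ.1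
    have h3 := tailMoment_nonneg hν 2 h.le ζ.1
    have h4 := abs_real_inner_le_norm ζ.1 a
    refine (norm_add_le _ _).trans ?_
    rw [norm_smul, norm_smul, Real.norm_eq_abs, Real.norm_eq_abs, abs_mul,
      abs_of_nonneg (by positivity : 0 ≤ tailMoment ν 2 ζ.2 ζ.1 / 4)]
    have h5 : |heatKernel (ν * ζ.2) ζ.1 - tailMoment ν 1 ζ.2 ζ.1 / 2|
        ≤ heatKernel (ν * ζ.2) ζ.1 + tailMoment ν 1 ζ.2 ζ.1 / 2 :=
      abs_le.2 ⟨by linarith, by linarith⟩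
    calc _ ≤ (heatKernel (ν * ζ.2) ζ.1 + tailMoment ν 1 ζ.2 ζ.1 / 2) * ‖a‖
        + tailMoment ν 2 ζ.2 ζ.1 / 4 * (‖ζ.1‖ * ‖a‖) * ‖ζ.1‖ := by gcongr
      _ = _ := by ring
  · simp

lemma norm_oseenGrad_le {ν : ℝ} (hν : 0 < ν) (ζ : R3 × ℝ) (a b : R3) :
    ‖oseenGrad ν ζ a b‖ ≤ oseenGradMaj ν ζ * ‖a‖ * ‖b‖ := by
  unfold oseenGrad oseenGradMaj
  split_ifs with h
  · have h1 := heatKernel_nonneg (τ := ν * ζ.2) (by positivity) ζ.1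
    have h2 := tailMoment_nonneg hν 3 h.le ζ.1
    have h3 := tailMoment_nonneg hν 2 h.le ζ.1
    have ha := abs_real_inner_le_norm ζ.1 a
    have hb := abs_real_inner_le_norm ζ.1 b
    have hab := abs_real_inner_le_norm a b
    refine (norm_add_le _ _).trans ?_
    refine (add_le_add_left (norm_sub_le _ _) _).trans ?_
    have e1 : ‖(inner ℝ a b : ℝ) • ζ.1 + (inner ℝ ζ.1 a : ℝ) • b + (inner ℝ ζ.1 b : ℝ) • a‖
        ≤ 3 * (‖ζ.1‖ * ‖a‖ * ‖b‖) := by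
      refine (norm_add₃_le).trans ?_
      rw [norm_smul, norm_smul, norm_smul, Real.norm_eq_abs, Real.norm_eq_abs, Real.norm_eq_abs]
      calc _ ≤ ‖a‖ * ‖b‖ * ‖ζ.1‖ + ‖ζ.1‖ * ‖a‖ * ‖b‖ + ‖ζ.1‖ * ‖b‖ * ‖a‖ := by gcongr
        _ = _ := by ring
    rw [norm_smul, norm_smul, norm_smul, Real.norm_eq_abs, Real.norm_eq_abs, Real.norm_eq_abs,
      abs_mul, abs_neg, abs_mul, abs_mul,
      abs_of_nonneg (by positivity : 0 ≤ tailMoment ν 2 ζ.2 ζ.1 / 4),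
      abs_of_nonneg (by positivity : 0 ≤ tailMoment ν 3 ζ.2 ζ.1 / 8),
      abs_of_nonneg (by positivity : 0 ≤ heatKernel (ν * ζ.2) ζ.1 / (2 * (ν * ζ.2)))]
    calc _ ≤ heatKernel (ν * ζ.2) ζ.1 / (2 * (ν * ζ.2)) * (‖ζ.1‖ * ‖b‖) * ‖a‖
        + tailMoment ν 3 ζ.2 ζ.1 / 8 * (‖ζ.1‖ * ‖a‖) * (‖ζ.1‖ * ‖b‖) * ‖ζ.1‖
        + tailMoment ν 2 ζ.2 ζ.1 / 4 * (3 * (‖ζ.1‖ * ‖a‖ * ‖b‖)) := by gcongr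
      _ = _ := by ring
  · simp

/-- The second time integration produces a factor `s + m`, which cancels one inverse power of the
heat time. -/
lemma lintegral_lintegral_heatKernel_div_pow {ν : ℝ} (hν : 0 < ν) (k : ℕ) (y : R3) :
    ∫⁻ s in Ioi (0 : ℝ), ∫⁻ m in Ioi (0 : ℝ),
        ENNReal.ofReal (ν * (heatKernel (ν * (s + m)) y / (ν * (s + m)) ^ (k + 1)))
      = ENNReal.ofReal (1 / ν) * ∫⁻ τ in Ioi (0 : ℝ), ENNReal.ofReal (heatKernel τ y / τ ^ k) := by
  rw [lintegral_Ioi_lintegral_Ioi_add (f := fun x =>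
      ENNReal.ofReal (ν * (heatKernel (ν * x) y / (ν * x) ^ (k + 1)))) (by fun_prop),
    ← lintegral_Ioi_comp_mul_left hν
      (f := fun x => ENNReal.ofReal (heatKernel x y / x ^ k)) (by fun_prop)]
  refine setLIntegral_congr_fun measurableSet_Ioi fun x (hx : 0 < x) => ?_
  rw [← ENNReal.ofReal_mul hx.le]
  congr 1
  rw [pow_succ]
  field_simp

lemma lintegral_tailMoment_le {ν : ℝ} (hν : 0 < ν) (k : ℕ) (y : R3) :
    ∫⁻ s in Ioi (0 : ℝ), ENNReal.ofReal (tailMoment ν (k + 1) s y)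
      ≤ ENNReal.ofReal (1 / ν) * ∫⁻ τ in Ioi (0 : ℝ), ENNReal.ofReal (heatKernel τ y / τ ^ k) := by
  rw [← lintegral_lintegral_heatKernel_div_pow hν]
  refine setLIntegral_mono' measurableSet_Ioi fun s (hs : 0 < s) => ?_
  rw [← Real.enorm_of_nonneg (tailMoment_nonneg hν (k + 1) hs.le y)]
  unfold tailMoment
  refine (enorm_integral_le_lintegral_enorm _).trans ?_
  refine setLIntegral_mono' measurableSet_Ioi fun m (hm : 0 < m) => ?_
  have := heatKernel_nonneg (τ := ν * (s + m)) (by positivity) y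
  rw [Real.enorm_of_nonneg (by positivity)]

/-- The three terms of the majorant contribute `1/4`, `1/8` and `1/8` of `1/(πν|y|)`. The result is
the kernel of the hypothesis on the forcing weight; at `y = 0` the right side is infinite. -/
lemma lintegral_oseenMaj_le {ν : ℝ} (hν : 0 < ν) (y : R3) :
    ∫⁻ s, ENNReal.ofReal (oseenMaj ν (y, s))
      ≤ ENNReal.ofReal (1 / (2 * Real.pi * ν)) * ‖y‖ₑ⁻¹ := by
  have hp := Real.pi_pos
  rcases eq_or_ne y 0 with rfl | hy
  · rw [enorm_zero, ENNReal.inv_zero, ENNReal.mul_top (by simp; positivity)]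
    exact le_top
  have hr : 0 < ‖y‖ := norm_pos_iff.2 hy
  have e : ∀ s, ENNReal.ofReal (oseenMaj ν (y, s)) = (Ioi (0 : ℝ)).indicator (fun s =>
      ENNReal.ofReal (heatKernel (ν * s) y) + ENNReal.ofReal (1 / 2)
        * ENNReal.ofReal (tailMoment ν 1 s y)
      + ENNReal.ofReal (‖y‖ ^ 2 / 4) * ENNReal.ofReal (tailMoment ν 2 s y)) s := by
    intro s
    unfold oseenMaj
    by_cases hs : 0 < s
    · have h1 := heatKernel_nonneg (τ := ν * s) (by positivity) y
      have h2 := tailMoment_nonneg hν 1 hs.le y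
      have h3 := tailMoment_nonneg hν 2 hs.le y
      rw [indicator_of_mem (show s ∈ Ioi (0 : ℝ) from hs), if_pos hs,
        ← ENNReal.ofReal_mul (by positivity), ← ENNReal.ofReal_mul (by positivity),
        ← ENNReal.ofReal_add h1 (by positivity),
        ← ENNReal.ofReal_add (by positivity) (by positivity)]
      congr 1; ring
    · rw [indicator_of_notMem (show s ∉ Ioi (0 : ℝ) from hs), if_neg hs, ENNReal.ofReal_zero]
  simp_rw [e]
  rw [lintegral_indicator measurableSet_Ioi, lintegral_add_right _ (by fun_prop),
    lintegral_add_right _ (by fun_prop), lintegral_const_mul _ (by fun_prop),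
    lintegral_const_mul _ (by fun_prop),
    lintegral_Ioi_comp_mul_left hν (f := fun x => ENNReal.ofReal (heatKernel x y)) (by fun_prop),
    lintegral_heatKernel_time hy]
  have t1 := lintegral_tailMoment_le hν 0 y
  have t2 := lintegral_tailMoment_le hν 1 y
  simp only [pow_zero, div_one, zero_add, pow_one, Nat.reduceAdd, lintegral_heatKernel_time hy,
    lintegral_heatKernel_div_time hy] at t1 t2
  refine (add_le_add (add_le_add le_rfl (mul_le_mul_right t1 _))
    (mul_le_mul_right t2 _)).trans ?_
  rw [← ofReal_norm, ← ENNReal.ofReal_inv_of_pos hr]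
  simp only [← ENNReal.ofReal_mul (show 0 ≤ 1 / ν by positivity),
    ← ENNReal.ofReal_mul (show (0 : ℝ) ≤ 1 / 2 by positivity),
    ← ENNReal.ofReal_mul (show 0 ≤ ‖y‖ ^ 2 / 4 by positivity),
    ← ENNReal.ofReal_mul (show 0 ≤ 1 / (2 * Real.pi * ν) by positivity)]
  rw [← ENNReal.ofReal_add (by positivity) (by positivity),
    ← ENNReal.ofReal_add (by positivity) (by positivity)]
  refine ENNReal.ofReal_le_ofReal (le_of_eq ?_)
  field_simp; norm_num

/-- The three terms contribute `1/4`, `3/8` and `3/8` of `1/(πν|y|²)`, the kernel of the hypothesis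
on `h²`. -/
lemma lintegral_oseenGradMaj_le {ν : ℝ} (hν : 0 < ν) (y : R3) :
    ∫⁻ s, ENNReal.ofReal (oseenGradMaj ν (y, s))
      ≤ ENNReal.ofReal (1 / (Real.pi * ν)) * (‖y‖ₑ ^ 2)⁻¹ := by
  have hp := Real.pi_pos
  rcases eq_or_ne y 0 with rfl | hy
  · rw [enorm_zero, zero_pow two_ne_zero, ENNReal.inv_zero, ENNReal.mul_top (by simp; positivity)]
    exact le_top
  have hr : 0 < ‖y‖ := norm_pos_iff.2 hy
  have e : ∀ s, ENNReal.ofReal (oseenGradMaj ν (y, s)) = (Ioi (0 : ℝ)).indicator (fun s =>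
      ENNReal.ofReal (‖y‖ / 2) * ENNReal.ofReal (heatKernel (ν * s) y / (ν * s))
        + ENNReal.ofReal (‖y‖ ^ 3 / 8) * ENNReal.ofReal (tailMoment ν 3 s y)
      + ENNReal.ofReal (3 / 4 * ‖y‖) * ENNReal.ofReal (tailMoment ν 2 s y)) s := by
    intro s
    unfold oseenGradMaj
    by_cases hs : 0 < s
    · have h1 := heatKernel_nonneg (τ := ν * s) (by positivity) y
      have h2 := tailMoment_nonneg hν 3 hs.le y
      have h3 := tailMoment_nonneg hν 2 hs.le y
      rw [indicator_of_mem (show s ∈ Ioi (0 : ℝ) from hs), if_pos hs,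
        ← ENNReal.ofReal_mul (by positivity), ← ENNReal.ofReal_mul (by positivity),
        ← ENNReal.ofReal_mul (by positivity), ← ENNReal.ofReal_add (by positivity) (by positivity),
        ← ENNReal.ofReal_add (by positivity) (by positivity)]
      congr 1; field_simp
    · rw [indicator_of_notMem (show s ∉ Ioi (0 : ℝ) from hs), if_neg hs, ENNReal.ofReal_zero]
  simp_rw [e]
  rw [lintegral_indicator measurableSet_Ioi, lintegral_add_right _ (by fun_prop),
    lintegral_add_right _ (by fun_prop), lintegral_const_mul _ (by fun_prop),
    lintegral_const_mul _ (by fun_prop), lintegral_const_mul _ (by fun_prop),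
    lintegral_Ioi_comp_mul_left hν (f := fun x => ENNReal.ofReal (heatKernel x y / x))
      (by fun_prop), lintegral_heatKernel_div_time hy]
  have t1 := lintegral_tailMoment_le hν 2 y
  have t2 := lintegral_tailMoment_le hν 1 y
  simp only [pow_one, Nat.reduceAdd, lintegral_heatKernel_div_time_sq hy,
    lintegral_heatKernel_div_time hy] at t1 t2
  refine (add_le_add (add_le_add le_rfl (mul_le_mul_right t1 _))
    (mul_le_mul_right t2 _)).trans ?_
  rw [← ofReal_norm, ← ENNReal.ofReal_pow hr.le, ← ENNReal.ofReal_inv_of_pos (by positivity)]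
  simp only [← ENNReal.ofReal_mul (show 0 ≤ 1 / ν by positivity),
    ← ENNReal.ofReal_mul (show 0 ≤ ‖y‖ / 2 by positivity),
    ← ENNReal.ofReal_mul (show 0 ≤ ‖y‖ ^ 3 / 8 by positivity),
    ← ENNReal.ofReal_mul (show 0 ≤ 3 / 4 * ‖y‖ by positivity),
    ← ENNReal.ofReal_mul (show 0 ≤ 1 / (Real.pi * ν) by positivity)]
  rw [← ENNReal.ofReal_add (by positivity) (by positivity),
    ← ENNReal.ofReal_add (by positivity) (by positivity)]
  refine ENNReal.ofReal_le_ofReal (le_of_eq ?_)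
  field_simp; norm_num

/-- `oseenGrad ν ζ` as a continuous bilinear map. -/
noncomputable def oseenGradCLM {ν : ℝ} (hν : 0 < ν) (ζ : R3 × ℝ) : R3 →L[ℝ] R3 →L[ℝ] R3 :=
  LinearMap.mkContinuous₂
    (LinearMap.mk₂ ℝ (oseenGrad ν ζ)
      (fun a a' b => by
        unfold oseenGrad; split_ifs
        · rw [inner_add_right, inner_add_left]; module
        · simp)
      (fun c a b => by
        unfold oseenGrad; split_ifs
        · rw [inner_smul_right, real_inner_smul_left]; module
        · simp)
      (fun a b b' => by
        unfold oseenGrad; split_ifs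
        · rw [inner_add_right, inner_add_right]; module
        · simp)
      (fun c a b => by
        unfold oseenGrad; split_ifs
        · rw [inner_smul_right, inner_smul_right]; module
        · simp))
    (oseenGradMaj ν ζ) (norm_oseenGrad_le hν ζ)

@[simp] lemma oseenGradCLM_apply {ν : ℝ} (hν : 0 < ν) (ζ : R3 × ℝ) (a b : R3) :
    oseenGradCLM hν ζ a b = oseenGrad ν ζ a b := rfl

/-! ### Regularity of the Oseen kernel in the space variable -/

/-- For fixed `s > 0` the bound does not depend on `y` and is integrable in `m` because of the power
`-3/2`. It dominates all limits and derivatives in `y` taken under the integral. -/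
lemma heatKernel_div_pow_le {ν : ℝ} (hν : 0 < ν) (k : ℕ) {s m : ℝ} (hs : 0 < s) (hm : 0 < m)
    (y : R3) : ν * (heatKernel (ν * (s + m)) y / (ν * (s + m)) ^ k)
      ≤ ν * (4 * Real.pi * ν) ^ (-(3 / 2) : ℝ) / (ν * s) ^ k * (m + s) ^ (-(3 / 2) : ℝ) := by
  have h1 := heatKernel_le_of_le (τ₀ := ν * (s + m)) (by positivity) le_rfl y
  have h2 : (4 * Real.pi * (ν * (s + m))) ^ (-(3 / 2) : ℝ)
      = (4 * Real.pi * ν) ^ (-(3 / 2) : ℝ) * (m + s) ^ (-(3 / 2) : ℝ) := by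
    rw [← mul_assoc, Real.mul_rpow (by positivity) (by positivity), add_comm s m]
  rw [h2] at h1
  calc ν * (heatKernel (ν * (s + m)) y / (ν * (s + m)) ^ k)
      ≤ ν * (((4 * Real.pi * ν) ^ (-(3 / 2) : ℝ) * (m + s) ^ (-(3 / 2) : ℝ)) / (ν * s) ^ k) := by
        gcongr; linarith
    _ = _ := by ring

lemma integrableOn_tail_rpow {s : ℝ} (hs : 0 < s) (C : ℝ) :
    IntegrableOn (fun m : ℝ => C * (m + s) ^ (-(3 / 2) : ℝ)) (Ioi 0) :=
  Integrable.const_mul (integrableOn_add_rpow_Ioi_of_lt (by norm_num) (by linarith)) C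

lemma integrableOn_tail {ν : ℝ} (hν : 0 < ν) (k : ℕ) {s : ℝ} (hs : 0 < s) (y : R3) :
    IntegrableOn (fun m => ν * (heatKernel (ν * (s + m)) y / (ν * (s + m)) ^ k)) (Ioi 0) := by
  refine Integrable.mono' (integrableOn_tail_rpow hs
    (ν * (4 * Real.pi * ν) ^ (-(3 / 2) : ℝ) / (ν * s) ^ k))
    (Measurable.aestronglyMeasurable (by fun_prop)) ((ae_restrict_iff' measurableSet_Ioi).2
      (Eventually.of_forall fun m (hm : 0 < m) => ?_))
  have := heatKernel_nonneg (τ := ν * (s + m)) (by positivity) y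
  rw [Real.norm_of_nonneg (by positivity)]
  exact heatKernel_div_pow_le hν k hs hm y

lemma continuous_tailMoment {ν : ℝ} (hν : 0 < ν) (k : ℕ) {s : ℝ} (hs : 0 < s) :
    Continuous (tailMoment ν k s) := by
  refine continuous_of_dominated (fun y => (integrableOn_tail hν k hs y).aestronglyMeasurable)
    (fun y => (ae_restrict_iff' measurableSet_Ioi).2
      (Eventually.of_forall fun m (hm : 0 < m) => ?_)) (integrableOn_tail_rpow hs
      (ν * (4 * Real.pi * ν) ^ (-(3 / 2) : ℝ) / (ν * s) ^ k))
      ((ae_restrict_iff' measurableSet_Ioi).2 (Eventually.of_forall fun m (hm : 0 < m) => ?_))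
  · have := heatKernel_nonneg (τ := ν * (s + m)) (by positivity) y
    rw [Real.norm_of_nonneg (by positivity)]
    exact heatKernel_div_pow_le hν k hs hm y
  · have := continuous_heatKernel (τ := ν * (s + m)) (by positivity)
    fun_prop

/-- Differentiating the Gaussian at heat time `σ` brings down `-(y·v)/(2σ)`, hence one more inverse
power of `σ` and the index `k + 1`. -/
lemma hasLineDerivAt_tailMoment {ν : ℝ} (hν : 0 < ν) (k : ℕ) {s : ℝ} (hs : 0 < s) (y v : R3) :
    HasLineDerivAt ℝ (tailMoment ν k s) (-(inner ℝ y v / 2) * tailMoment ν (k + 1) s y) y v := by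
  set M : ℝ := (‖y‖ + ‖v‖) * ‖v‖ / 2
  set F' : ℝ → ℝ → ℝ := fun t m => -(inner ℝ (y + t • v) v / 2) *
    (ν * (heatKernel (ν * (s + m)) (y + t • v) / (ν * (s + m)) ^ (k + 1)))
  have h := (hasDerivAt_integral_of_dominated_loc_of_deriv_le
    (μ := (volume : Measure ℝ).restrict (Ioi 0))
    (F := fun t m => ν * (heatKernel (ν * (s + m)) (y + t • v) / (ν * (s + m)) ^ k)) (F' := F')
    (x₀ := (0 : ℝ)) (Metric.ball_mem_nhds 0 one_pos)
    (Eventually.of_forall fun t => (integrableOn_tail hν k hs _).aestronglyMeasurable)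
    (by simpa [IntegrableOn] using integrableOn_tail hν k hs y)
    (by exact Measurable.aestronglyMeasurable (by fun_prop))
    (bound := fun m => M * (ν * (4 * Real.pi * ν) ^ (-(3 / 2) : ℝ) / (ν * s) ^ (k + 1)
      * (m + s) ^ (-(3 / 2) : ℝ))) ?_ ?_ ?_).2
  · refine HasDerivAt.congr_deriv h ?_
    simp only [F', zero_smul, add_zero]
    rw [integral_const_mul]
    rfl
  · refine (ae_restrict_iff' measurableSet_Ioi).2 (Eventually.of_forall fun m (hm : 0 < m) t ht => ?_)
    have h0 := heatKernel_nonneg (τ := ν * (s + m)) (by positivity) (y + t • v)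
    have h1 : |inner ℝ (y + t • v) v / 2| ≤ M := by
      have ht' : ‖t‖ ≤ 1 := by simpa using (mem_ball_zero_iff.1 ht).le
      rw [abs_div, abs_two]
      have h2 : ‖y + t • v‖ ≤ ‖y‖ + ‖v‖ := by
        refine (norm_add_le _ _).trans ?_
        rw [norm_smul]
        gcongr
        exact mul_le_of_le_one_left (norm_nonneg _) ht'
      have h3 := (abs_real_inner_le_norm (y + t • v) v)
      have h4 : ‖y + t • v‖ * ‖v‖ ≤ (‖y‖ + ‖v‖) * ‖v‖ := by gcongr
      simp only [M]
      linarith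
    simp only [F']
    rw [norm_mul, Real.norm_eq_abs, abs_neg, Real.norm_of_nonneg (by positivity)]
    have h5 := heatKernel_div_pow_le hν (k + 1) hs hm (y + t • v)
    gcongr
  · exact Integrable.const_mul (integrableOn_tail_rpow hs _) _
  · refine (ae_restrict_iff' measurableSet_Ioi).2 (Eventually.of_forall fun m (hm : 0 < m) t _ => ?_)
    have hσ : 0 < ν * (s + m) := by positivity
    have h1 : HasDerivAt (fun t : ℝ => heatKernel (ν * (s + m)) (y + t • v))
        (heatKernelD1 (ν * (s + m)) v (y + t • v)) t := by
      have := hasLineDerivAt_heatKernel hσ v (y + t • v)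
      unfold HasLineDerivAt at this
      have h2 := HasDerivAt.comp_sub_const t t (by simpa using this)
      refine h2.congr_of_eventuallyEq (Eventually.of_forall fun r => ?_)
      simp only
      congr 1
      module
    refine ((h1.div_const _).const_mul ν).congr_deriv ?_
    simp only [F', heatKernelD1]
    rw [pow_succ]
    field_simp

lemma continuous_oseen_apply {ν : ℝ} (hν : 0 < ν) {s : ℝ} (hs : 0 < s) (a : R3) (i : Fin 3) :
    Continuous fun y => oseen ν (y, s) a i := by
  have h1 := continuous_tailMoment hν 1 hs
  have h2 := continuous_tailMoment hν 2 hs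
  have h3 := continuous_heatKernel (τ := ν * s) (by positivity)
  simp only [oseen, hs, if_true, PiLp.add_apply, PiLp.smul_apply, smul_eq_mul]
  fun_prop

lemma continuous_oseenGrad_apply {ν : ℝ} (hν : 0 < ν) {s : ℝ} (hs : 0 < s) (a b : R3)
    (i : Fin 3) : Continuous fun y => oseenGrad ν (y, s) a b i := by
  have h1 := continuous_tailMoment hν 3 hs
  have h2 := continuous_tailMoment hν 2 hs
  have h3 := continuous_heatKernel (τ := ν * s) (by positivity)
  simp only [oseenGrad, hs, if_true, PiLp.add_apply, PiLp.sub_apply, PiLp.smul_apply, smul_eq_mul]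
  fun_prop

lemma hasLineDerivAt_oseen_apply {ν : ℝ} (hν : 0 < ν) {s : ℝ} (hs : 0 < s) (a b : R3) (i : Fin 3)
    (y : R3) : HasLineDerivAt ℝ (fun y => oseen ν (y, s) a i) (oseenGrad ν (y, s) a b i) y b := by
  have h1 := hasLineDerivAt_tailMoment hν 1 hs y b
  have h2 := hasLineDerivAt_tailMoment hν 2 hs y b
  have h3 := hasLineDerivAt_heatKernel (τ := ν * s) (by positivity) b y
  have h4 := hasDerivAt_inner_line y b a
  have h5 : HasDerivAt (fun t : ℝ => (y + t • b) i) (b i) 0 := by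
    simpa using ((hasDerivAt_id (0 : ℝ)).mul_const (b i)).const_add (y i)
  unfold HasLineDerivAt at *
  have h := ((h3.sub (h1.div_const 2)).mul_const (a i)).add
    (((h2.div_const 4).mul h4).mul h5)
  simp only [oseen, oseenGrad, hs, if_true, PiLp.add_apply, PiLp.sub_apply, PiLp.smul_apply,
    smul_eq_mul]
  refine (HasDerivAt.congr_deriv h ?_)
  simp only [zero_smul, add_zero, heatKernelD1, Nat.reduceAdd, real_inner_comm b a, Pi.mul_apply]
  field_simp
  ring

/-! ### Integrability against test functions -/

/-- In polar coordinates the Jacobian `r²` of three dimensions cancels the singularity exactly. -/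
lemma lintegral_closedBall_enorm_inv_sq_lt_top (R : ℝ) :
    ∫⁻ y in Metric.closedBall (0 : R3) R, (‖y‖ₑ ^ 2)⁻¹ < ∞ := by
  have h : Integrable (fun y : R3 => (Iic R).indicator (fun r : ℝ => (r ^ 2)⁻¹) ‖y‖) := by
    rw [integrable_fun_norm_addHaar (volume : Measure R3)
      (f := (Iic R).indicator (fun r : ℝ => (r ^ 2)⁻¹)), finrank_euclideanSpace_fin]
    have h1 : IntegrableOn (fun _ : ℝ => (1 : ℝ)) (Ioc 0 R) := integrableOn_const (by simp)
    have h2 := (integrable_indicator_iff measurableSet_Ioc).2 h1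
    refine IntegrableOn.congr_fun h2.integrableOn (fun r (hr : 0 < r) => ?_) measurableSet_Ioi
    by_cases h : r ≤ R
    · rw [indicator_of_mem (show r ∈ Ioc 0 R from ⟨hr, h⟩), indicator_of_mem (show r ∈ Iic R from h),
        smul_eq_mul, Nat.add_one_sub_one, mul_inv_cancel₀ (by positivity)]
    · rw [indicator_of_notMem (fun hh : r ∈ Ioc 0 R => h hh.2),
        indicator_of_notMem (show r ∉ Iic R from h), smul_zero]
  have h2 := h.2
  rw [HasFiniteIntegral] at h2
  refine lt_of_le_of_lt ?_ h2
  rw [← lintegral_indicator Metric.isClosed_closedBall.measurableSet]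
  refine lintegral_mono_ae ?_
  filter_upwards [Measure.ae_ne (volume : Measure R3) 0] with y hy
  have hr : 0 < ‖y‖ := norm_pos_iff.2 hy
  by_cases hyR : ‖y‖ ≤ R
  · rw [indicator_of_mem (by simpa using hyR), indicator_of_mem (show ‖y‖ ∈ Iic R from hyR),
      Real.enorm_of_nonneg (by positivity), ENNReal.ofReal_inv_of_pos (by positivity),
      ENNReal.ofReal_pow hr.le, ofReal_norm]
  · rw [indicator_of_notMem (by simpa using hyR)]
    exact zero_le

lemma lintegral_closedBall_enorm_inv_lt_top (R : ℝ) :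
    ∫⁻ y in Metric.closedBall (0 : R3) R, ‖y‖ₑ⁻¹ < ∞ := by
  have h := lintegral_closedBall_enorm_inv_sq_lt_top R
  calc ∫⁻ y in Metric.closedBall (0 : R3) R, ‖y‖ₑ⁻¹
      ≤ ∫⁻ y in Metric.closedBall (0 : R3) R, (1 + (‖y‖ₑ ^ 2)⁻¹) := by
        refine lintegral_mono fun y => ?_
        rcases le_total ‖y‖ₑ 1 with h1 | h1
        · refine le_add_left (ENNReal.inv_le_inv.2 ?_)
          calc ‖y‖ₑ ^ 2 = ‖y‖ₑ * ‖y‖ₑ := sq _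
            _ ≤ 1 * ‖y‖ₑ := by gcongr
            _ = _ := one_mul _
        · exact le_add_right (ENNReal.inv_le_one.2 h1)
    _ < ∞ := by
        rw [lintegral_add_left measurable_const, setLIntegral_const, one_mul]
        exact ENNReal.add_lt_top.2 ⟨measure_closedBall_lt_top, h⟩

/-- The parameter space `β` collects the time variables: one time for the Oseen kernel, two for its
Hessian representation, none (a point) for the Riesz kernel. It suffices that the integral over `β`
is locally integrable in space, since `φ` confines `y` to a ball. -/
lemma IsSmoothCompact.integrable_kernel_mul {β : Type*} [MeasurableSpace β] {μ : Measure β}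
    [SFinite μ] {φ : R3 × ℝ → ℝ} (hφ : IsSmoothCompact φ) {k : R3 × β → ℝ} (hk : Measurable k)
    {t : β → ℝ} (ht : Measurable t) {w : R3 → ℝ≥0∞}
    (hw : ∀ R, ∫⁻ y in Metric.closedBall (0 : R3) R, w y < ∞)
    (hkw : ∀ y, ∫⁻ b, ‖k (y, b)‖ₑ ∂μ ≤ w y) (z : R3 × ℝ) :
    Integrable (fun p => k p * φ (z + (p.1, t p.2))) ((volume : Measure R3).prod μ) := by
  obtain ⟨C, R, hC0, hR0, hC, hR⟩ := hφ.exists_bound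
  have hφc := hφ.continuous.measurable
  refine ⟨Measurable.aestronglyMeasurable (by fun_prop), ?_⟩
  rw [HasFiniteIntegral]
  refine (lintegral_prod_le _).trans_lt ?_
  refine lt_of_le_of_lt (b := ∫⁻ y, (Metric.closedBall (0 : R3) (R + ‖z.1‖)).indicator
    (fun y => ENNReal.ofReal C * w y) y) (lintegral_mono fun y => ?_) ?_
  · by_cases hy : ‖y‖ ≤ R + ‖z.1‖
    · rw [indicator_of_mem (by simpa using hy)]
      calc ∫⁻ b, ‖k (y, b) * φ (z + (y, t b))‖ₑ ∂μ
          ≤ ∫⁻ b, ENNReal.ofReal C * ‖k (y, b)‖ₑ ∂μ := by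
            refine lintegral_mono fun b => ?_
            rw [enorm_mul, mul_comm]
            gcongr
            rw [← ofReal_norm]
            exact ENNReal.ofReal_le_ofReal (hC _)
        _ = ENNReal.ofReal C * ∫⁻ b, ‖k (y, b)‖ₑ ∂μ :=
            lintegral_const_mul' _ _ ENNReal.ofReal_ne_top
        _ ≤ _ := by gcongr; exact hkw y
    · have : ∀ b, φ (z + (y, t b)) = 0 := by
        intro b
        by_contra h
        have h1 := (hR _ h).1
        have h2 : ‖y‖ ≤ ‖z.1 + y‖ + ‖z.1‖ := by
          calc ‖y‖ = ‖(z.1 + y) - z.1‖ := by simp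
            _ ≤ _ := norm_sub_le _ _
        simp only [Prod.fst_add] at h1
        linarith
      simp [this]
  · rw [lintegral_indicator Metric.isClosed_closedBall.measurableSet,
      lintegral_const_mul' _ _ ENNReal.ofReal_ne_top]
    exact ENNReal.mul_lt_top ENNReal.ofReal_lt_top (hw _)

lemma abs_apply_le_norm (a : R3) (i : Fin 3) : |a i| ≤ ‖a‖ := by
  have := PiLp.norm_apply_le a i
  simpa using this

lemma lintegral_closedBall_const_mul_lt_top {w : R3 → ℝ≥0∞}
    (hw : ∀ R, ∫⁻ y in Metric.closedBall (0 : R3) R, w y < ∞) {c : ℝ≥0∞} (hc : c ≠ ∞) (R : ℝ) :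
    ∫⁻ y in Metric.closedBall (0 : R3) R, c * w y < ∞ := by
  rw [lintegral_const_mul' _ _ hc]
  exact ENNReal.mul_lt_top hc.lt_top (hw R)

lemma lintegral_enorm_oseen_apply_le {ν : ℝ} (hν : 0 < ν) (a : R3) (i : Fin 3) (y : R3) :
    ∫⁻ s, ‖oseen ν (y, s) a i‖ₑ
      ≤ ENNReal.ofReal ‖a‖ * ENNReal.ofReal (1 / (2 * Real.pi * ν)) * ‖y‖ₑ⁻¹ := by
  calc ∫⁻ s, ‖oseen ν (y, s) a i‖ₑ
      ≤ ∫⁻ s, ENNReal.ofReal ‖a‖ * ENNReal.ofReal (oseenMaj ν (y, s)) := by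
        refine lintegral_mono fun s => ?_
        rw [← ENNReal.ofReal_mul (norm_nonneg a), ← ofReal_norm]
        refine ENNReal.ofReal_le_ofReal ?_
        rw [mul_comm]
        exact (abs_apply_le_norm _ i).trans (norm_oseen_le hν _ a)
    _ = ENNReal.ofReal ‖a‖ * ∫⁻ s, ENNReal.ofReal (oseenMaj ν (y, s)) :=
        lintegral_const_mul' _ _ ENNReal.ofReal_ne_top
    _ ≤ _ := by rw [mul_assoc]; gcongr; exact lintegral_oseenMaj_le hν y

lemma lintegral_enorm_oseenGrad_apply_le {ν : ℝ} (hν : 0 < ν) (a b : R3) (i : Fin 3) (y : R3) :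
    ∫⁻ s, ‖oseenGrad ν (y, s) a b i‖ₑ
      ≤ ENNReal.ofReal (‖a‖ * ‖b‖) * ENNReal.ofReal (1 / (Real.pi * ν)) * (‖y‖ₑ ^ 2)⁻¹ := by
  calc ∫⁻ s, ‖oseenGrad ν (y, s) a b i‖ₑ
      ≤ ∫⁻ s, ENNReal.ofReal (‖a‖ * ‖b‖) * ENNReal.ofReal (oseenGradMaj ν (y, s)) := by
        refine lintegral_mono fun s => ?_
        rw [← ENNReal.ofReal_mul (by positivity), ← ofReal_norm]
        refine ENNReal.ofReal_le_ofReal ?_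
        rw [mul_comm, ← mul_assoc]
        exact (abs_apply_le_norm _ i).trans (norm_oseenGrad_le hν _ a b)
    _ = ENNReal.ofReal (‖a‖ * ‖b‖) * ∫⁻ s, ENNReal.ofReal (oseenGradMaj ν (y, s)) :=
        lintegral_const_mul' _ _ ENNReal.ofReal_ne_top
    _ ≤ _ := by rw [mul_assoc]; gcongr; exact lintegral_oseenGradMaj_le hν y

lemma IsSmoothCompact.integrable_oseen_mul {ν : ℝ} (hν : 0 < ν) {φ : R3 × ℝ → ℝ}
    (hφ : IsSmoothCompact φ) (a : R3) (i : Fin 3) (z : R3 × ℝ) :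
    Integrable fun ζ : R3 × ℝ => oseen ν ζ a i * φ (z + ζ) :=
  hφ.integrable_kernel_mul (μ := volume) (t := fun s => s) (k := fun ζ => oseen ν ζ a i)
    (by fun_prop) measurable_id
    (lintegral_closedBall_const_mul_lt_top lintegral_closedBall_enorm_inv_lt_top
      (by finiteness)) (lintegral_enorm_oseen_apply_le hν a i) z

lemma IsSmoothCompact.integrable_oseenGrad_mul {ν : ℝ} (hν : 0 < ν) {φ : R3 × ℝ → ℝ}
    (hφ : IsSmoothCompact φ) (a b : R3) (i : Fin 3) (z : R3 × ℝ) :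
    Integrable fun ζ : R3 × ℝ => oseenGrad ν ζ a b i * φ (z + ζ) :=
  hφ.integrable_kernel_mul (μ := volume) (t := fun s => s) (k := fun ζ => oseenGrad ν ζ a b i)
    (by fun_prop) measurable_id
    (lintegral_closedBall_const_mul_lt_top lintegral_closedBall_enorm_inv_sq_lt_top
      (by finiteness)) (lintegral_enorm_oseenGrad_apply_le hν a b i) z

/-- The kernels are singular only at the space-time origin. At each fixed positive time integration
by parts is harmless, and joint integrability lets Fubini reassemble the slices. -/
lemma IsSmoothCompact.integral_oseenGrad_mul {ν : ℝ} (hν : 0 < ν) {φ : R3 × ℝ → ℝ}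
    (hφ : IsSmoothCompact φ) (a b : R3) (i : Fin 3) (z : R3 × ℝ) :
    ∫ ζ : R3 × ℝ, oseenGrad ν ζ a b i * φ (z + ζ)
      = -∫ ζ : R3 × ℝ, oseen ν ζ a i * dirDeriv (b, 0) φ (z + ζ) := by
  have h1 := hφ.integrable_oseenGrad_mul hν a b i z
  have h2 := (hφ.dirDeriv (b, 0)).integrable_oseen_mul hν a i z
  rw [Measure.volume_eq_prod] at h1 h2 ⊢
  rw [integral_prod_symm _ h1, integral_prod_symm _ h2, ← integral_neg]
  congr 1
  funext s
  by_cases hs : 0 < s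
  · have e : ∀ y : R3, z + (0, s) + (y, 0) = z + (y, s) := fun y => by
      rw [add_assoc]; simp
    have h := hφ.integral_lineDeriv_mul (continuous_oseen_apply hν hs a i)
      (continuous_oseenGrad_apply hν hs a b i) (hasLineDerivAt_oseen_apply hν hs a b i) (z + (0, s))
    simpa only [e] using h
  · simp [oseen, oseenGrad, hs]

/-! ### The adjoint of the Oseen kernel on test functions -/

/-- Lebesgue measure on the half line `(0, ∞)`. -/
noncomputable abbrev halfLine : Measure ℝ := (volume : Measure ℝ).restrict (Ioi 0)

/-- The gradient of the Newtonian potential, written as a time integral of the gradient of the heat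
kernel. -/
noncomputable def rieszKernel (ν : ℝ) (y : R3) : R3 := (-(tailMoment ν 1 0 y / 2)) • y

/-- The convolution of a function with the gradient of the Newtonian potential. -/
noncomputable def rieszConv (ν : ℝ) (i : Fin 3) (φ : R3 × ℝ → ℝ) (z : R3 × ℝ) : ℝ :=
  ∫ y, rieszKernel ν y i * φ (z + (y, 0))

lemma tendsto_heatConv_atTop {φ : R3 × ℝ → ℝ} (hφ : IsSmoothCompact φ) (z : R3 × ℝ) :
    Tendsto (fun τ => heatConv τ φ z) atTop (𝓝 0) := by
  have hi : Integrable fun y : R3 => |φ (z + (y, 0))| := by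
    simpa using (hφ.integrable_slice_mul (f := fun _ => 1) continuous_const z).abs
  have hb : ∀ᶠ τ in atTop, ‖heatConv τ φ z‖
      ≤ (4 * Real.pi * τ) ^ (-(3 / 2) : ℝ) * ∫ y : R3, |φ (z + (y, 0))| := by
    filter_upwards [eventually_gt_atTop 0] with τ hτ
    unfold heatConv
    rw [← integral_const_mul]
    refine norm_integral_le_of_norm_le (hi.const_mul _) (Eventually.of_forall fun y => ?_)
    rw [norm_mul, Real.norm_of_nonneg (heatKernel_nonneg hτ.le y)]
    exact mul_le_mul_of_nonneg_right (heatKernel_le_of_le hτ le_rfl y) (norm_nonneg _)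
  refine squeeze_zero_norm' hb ?_
  have h1 : Tendsto (fun τ : ℝ => 4 * Real.pi * τ) atTop atTop :=
    tendsto_id.const_mul_atTop (by positivity)
  simpa using ((tendsto_rpow_neg_atTop (by norm_num : (0 : ℝ) < 3 / 2)).comp h1).mul_const
    (∫ y : R3, |φ (z + (y, 0))|)

lemma inner_single_one (y : R3) (i : Fin 3) :
    inner ℝ y (EuclideanSpace.single i (1 : ℝ)) = y i := by
  simp [EuclideanSpace.inner_single_right]

/-- This identifies the Oseen kernel as the Leray projection of the heat kernel: `-Δ⁻¹` is the time
integral of the heat semigroup, so `-∂ᵢ∂ⱼΔ⁻¹` applied to the heat kernel is the integral of its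
Hessian over later times. -/
lemma oseen_apply_eq {ν : ℝ} (hν : 0 < ν) {s : ℝ} (hs : 0 < s) (y a : R3) (i : Fin 3) :
    oseen ν (y, s) a i = heatKernel (ν * s) y * a i
      + ∫ m in Ioi (0 : ℝ), ν * heatKernelD2 (ν * (s + m)) a (EuclideanSpace.single i 1) y := by
  have e : ∀ m : ℝ, ν * heatKernelD2 (ν * (s + m)) a (EuclideanSpace.single i 1) y
      = inner ℝ y a * y i / 4 * (ν * (heatKernel (ν * (s + m)) y / (ν * (s + m)) ^ 2))
        - a i / 2 * (ν * (heatKernel (ν * (s + m)) y / (ν * (s + m)) ^ 1)) := by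
    intro m
    simp only [heatKernelD2, inner_single_one, pow_one]
    generalize ν * (s + m) = σ
    ring
  simp_rw [e]
  rw [integral_sub ((integrableOn_tail hν 2 hs y).const_mul _)
    ((integrableOn_tail hν 1 hs y).const_mul _), integral_const_mul (inner ℝ y a * y i / 4),
    integral_const_mul (a i / 2)]
  simp only [oseen, hs, if_true, PiLp.add_apply, PiLp.smul_apply, smul_eq_mul]
  change _ = _ + (_ * tailMoment ν 2 s y - _ * tailMoment ν 1 s y)
  ring

/-- The bound without the summand `1` is `|a||c|/(4πν|y|)`. The summand keeps the constant positive,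
so that the right side is infinite at `y = 0` for all `a` and `c`. -/
lemma lintegral_enorm_heatKernelD2_le {ν : ℝ} (hν : 0 < ν) (a c y : R3) :
    ∫⁻ p : ℝ × ℝ, ‖ν * heatKernelD2 (ν * (p.1 + p.2)) a c y‖ₑ ∂(halfLine.prod halfLine)
      ≤ ENNReal.ofReal ((‖a‖ * ‖c‖ + 1) / (4 * Real.pi * ν)) * ‖y‖ₑ⁻¹ := by
  have hp := Real.pi_pos
  rcases eq_or_ne y 0 with rfl | hy
  · rw [enorm_zero, ENNReal.inv_zero, ENNReal.mul_top (by simp; positivity)]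
    exact le_top
  have hr : 0 < ‖y‖ := norm_pos_iff.2 hy
  set A := ‖a‖ * ‖c‖ with hA
  refine (lintegral_prod_le _).trans ?_
  have hb : ∀ s ∈ Ioi (0 : ℝ), ∀ m ∈ Ioi (0 : ℝ), ‖ν * heatKernelD2 (ν * (s + m)) a c y‖ₑ
      ≤ ENNReal.ofReal (A / 2)
          * ENNReal.ofReal (ν * (heatKernel (ν * (s + m)) y / (ν * (s + m)) ^ (0 + 1)))
        + ENNReal.ofReal (A * ‖y‖ ^ 2 / 4)
          * ENNReal.ofReal (ν * (heatKernel (ν * (s + m)) y / (ν * (s + m)) ^ (1 + 1))) := by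
    intro s (hs : 0 < s) m (hm : 0 < m)
    have h0 := heatKernel_nonneg (τ := ν * (s + m)) (by positivity) y
    rw [← ENNReal.ofReal_mul (by positivity), ← ENNReal.ofReal_mul (by positivity),
      ← ENNReal.ofReal_add (by positivity) (by positivity), ← ofReal_norm]
    refine ENNReal.ofReal_le_ofReal ?_
    have h1 := abs_real_inner_le_norm y a
    have h2 := abs_real_inner_le_norm y c
    have h3 := abs_real_inner_le_norm a c
    simp only [heatKernelD2]
    rw [norm_mul, norm_mul, Real.norm_of_nonneg hν.le, Real.norm_of_nonneg h0, Real.norm_eq_abs]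
    have h4 : |inner ℝ y a * inner ℝ y c / (4 * (ν * (s + m)) ^ 2) - inner ℝ a c / (2 * (ν * (s + m)))|
        ≤ A * ‖y‖ ^ 2 / (4 * (ν * (s + m)) ^ 2) + A / (2 * (ν * (s + m))) := by
      refine (abs_sub _ _).trans (add_le_add ?_ ?_)
      · rw [abs_div, abs_mul, abs_of_pos (show 0 < 4 * (ν * (s + m)) ^ 2 by positivity)]
        refine div_le_div_of_nonneg_right ?_ (by positivity)
        calc |inner ℝ y a| * |inner ℝ y c| ≤ (‖y‖ * ‖a‖) * (‖y‖ * ‖c‖) := by gcongr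
          _ = _ := by rw [hA]; ring
      · rw [abs_div, abs_of_pos (show 0 < 2 * (ν * (s + m)) by positivity)]
        gcongr
    calc _ ≤ ν * ((A * ‖y‖ ^ 2 / (4 * (ν * (s + m)) ^ 2) + A / (2 * (ν * (s + m))))
          * heatKernel (ν * (s + m)) y) := by gcongr
      _ = _ := by simp only [zero_add, pow_one, Nat.reduceAdd]; field_simp; ring
  refine (setLIntegral_mono' measurableSet_Ioi fun s hs =>
    setLIntegral_mono' measurableSet_Ioi fun m hm => hb s hs m hm).trans ?_
  have hm1 : ∀ k : ℕ, Measurable fun q : ℝ × ℝ =>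
      ENNReal.ofReal (ν * (heatKernel (ν * (q.1 + q.2)) y / (ν * (q.1 + q.2)) ^ k)) := by
    intro k; fun_prop
  have hm2 : ∀ k : ℕ, Measurable fun s : ℝ => ∫⁻ m in Ioi (0 : ℝ),
      ENNReal.ofReal (ν * (heatKernel (ν * (s + m)) y / (ν * (s + m)) ^ k)) := fun k =>
    (hm1 k).lintegral_prod_right'
  have e1 : ∀ s : ℝ, ∫⁻ m in Ioi (0 : ℝ), (ENNReal.ofReal (A / 2)
          * ENNReal.ofReal (ν * (heatKernel (ν * (s + m)) y / (ν * (s + m)) ^ (0 + 1)))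
        + ENNReal.ofReal (A * ‖y‖ ^ 2 / 4)
          * ENNReal.ofReal (ν * (heatKernel (ν * (s + m)) y / (ν * (s + m)) ^ (1 + 1))))
      = ENNReal.ofReal (A / 2) * (∫⁻ m in Ioi (0 : ℝ),
          ENNReal.ofReal (ν * (heatKernel (ν * (s + m)) y / (ν * (s + m)) ^ (0 + 1))))
        + ENNReal.ofReal (A * ‖y‖ ^ 2 / 4) * ∫⁻ m in Ioi (0 : ℝ),
          ENNReal.ofReal (ν * (heatKernel (ν * (s + m)) y / (ν * (s + m)) ^ (1 + 1))) := by
    intro s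
    rw [lintegral_add_left (by fun_prop), lintegral_const_mul' _ _ ENNReal.ofReal_ne_top,
      lintegral_const_mul' _ _ ENNReal.ofReal_ne_top]
  simp_rw [e1]
  rw [lintegral_add_left ((hm2 _).const_mul _), lintegral_const_mul' _ _ ENNReal.ofReal_ne_top,
    lintegral_const_mul' _ _ ENNReal.ofReal_ne_top, lintegral_lintegral_heatKernel_div_pow hν,
    lintegral_lintegral_heatKernel_div_pow hν]
  simp only [pow_zero, div_one, pow_one, lintegral_heatKernel_time hy,
    lintegral_heatKernel_div_time hy]
  rw [← ofReal_norm (x := y), ← ENNReal.ofReal_inv_of_pos hr, ← ENNReal.ofReal_mul (by positivity),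
    ← ENNReal.ofReal_mul (by positivity), ← ENNReal.ofReal_mul (by positivity),
    ← ENNReal.ofReal_mul (by positivity), ← ENNReal.ofReal_mul (by positivity),
    ← ENNReal.ofReal_add (by positivity) (by positivity)]
  refine ENNReal.ofReal_le_ofReal ?_
  have : A / 2 * (1 / ν * (1 / (4 * Real.pi * ‖y‖)))
      + A * ‖y‖ ^ 2 / 4 * (1 / ν * (1 / (2 * Real.pi * ‖y‖ ^ 3))) = A / (4 * Real.pi * ν) * ‖y‖⁻¹ := by
    field_simp; norm_num
  rw [this]
  gcongr
  linarith

lemma halfLine_prod_ae : ∀ᵐ p : ℝ × ℝ ∂(halfLine.prod halfLine), 0 < p.1 ∧ 0 < p.2 := by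
  rw [Measure.prod_restrict]
  exact (ae_restrict_iff' (measurableSet_Ioi.prod measurableSet_Ioi)).2
    (Eventually.of_forall fun p hp => hp)

lemma prod_halfLine_eq : (volume : Measure R3).prod halfLine
    = (volume : Measure (R3 × ℝ)).restrict (univ ×ˢ Ioi 0) := by
  rw [Measure.volume_eq_prod, ← Measure.prod_restrict, Measure.restrict_univ]

lemma prod_halfLine_ae : ∀ᵐ p : R3 × ℝ ∂((volume : Measure R3).prod halfLine), 0 < p.2 := by
  rw [prod_halfLine_eq]
  exact (ae_restrict_iff' (MeasurableSet.univ.prod measurableSet_Ioi)).2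
    (Eventually.of_forall fun p hp => hp.2)

lemma add_zero_mk_add_mk (z : R3 × ℝ) (y : R3) (s : ℝ) :
    z + (0, s) + (y, 0) = z + (y, s) := by
  rw [add_assoc]; simp

lemma IsSmoothCompact.integrable_heatKernel_mul {ν : ℝ} (hν : 0 < ν) {φ : R3 × ℝ → ℝ}
    (hφ : IsSmoothCompact φ) (z : R3 × ℝ) :
    Integrable (fun p : R3 × ℝ => heatKernel (ν * p.2) p.1 * φ (z + p))
      ((volume : Measure R3).prod halfLine) := by
  refine hφ.integrable_kernel_mul (μ := halfLine) (t := fun s => s)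
    (k := fun p => heatKernel (ν * p.2) p.1) (by fun_prop) measurable_id
    (lintegral_closedBall_const_mul_lt_top lintegral_closedBall_enorm_inv_lt_top
      (ENNReal.ofReal_ne_top (r := 1 / (2 * Real.pi * ν)))) (fun y => ?_) z
  refine le_trans ?_ (lintegral_oseenMaj_le hν y)
  refine le_trans ?_ (setLIntegral_le_lintegral (Ioi 0) _)
  refine setLIntegral_mono' measurableSet_Ioi fun s (hs : 0 < s) => ?_
  rw [Real.enorm_of_nonneg (heatKernel_nonneg (by positivity) _)]
  refine ENNReal.ofReal_le_ofReal ?_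
  have h2 := tailMoment_nonneg hν 1 hs.le y
  have h3 := tailMoment_nonneg hν 2 hs.le y
  simp only [oseenMaj, hs, if_true]
  have : 0 ≤ tailMoment ν 2 s y / 4 * ‖y‖ ^ 2 := by positivity
  linarith

/-- The Hessian in `oseen_apply_eq` is moved onto the test function. What remains are heat flows of
test functions, to which Duhamel's formula applies. -/
lemma IsSmoothCompact.integral_oseen_mul {ν : ℝ} (hν : 0 < ν) {φ : R3 × ℝ → ℝ}
    (hφ : IsSmoothCompact φ) (a : R3) (i : Fin 3) (z : R3 × ℝ) :
    Integrable (fun p : ℝ × ℝ => ν * heatConv (ν * (p.1 + p.2))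
        (dirDeriv (a, 0) (dirDeriv (spatialDir i) φ)) (z + (0, p.1))) (halfLine.prod halfLine) ∧
    ∫ ζ : R3 × ℝ, oseen ν ζ a i * φ (z + ζ)
      = a i * (∫ s in Ioi (0 : ℝ), heatConv (ν * s) φ (z + (0, s)))
        + ∫ p : ℝ × ℝ, ν * heatConv (ν * (p.1 + p.2))
            (dirDeriv (a, 0) (dirDeriv (spatialDir i) φ)) (z + (0, p.1))
          ∂(halfLine.prod halfLine) := by
  -- Integrability over space and both time variables together justifies all exchanges of integrals
  -- below.
  set e : R3 := EuclideanSpace.single i 1 with he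
  have hF : Integrable (fun p : R3 × (ℝ × ℝ) => ν * heatKernelD2 (ν * (p.2.1 + p.2.2)) a e p.1
      * φ (z + (p.1, p.2.1))) ((volume : Measure R3).prod (halfLine.prod halfLine)) :=
    hφ.integrable_kernel_mul (μ := halfLine.prod halfLine) (t := Prod.fst)
      (k := fun p => ν * heatKernelD2 (ν * (p.2.1 + p.2.2)) a e p.1) (by fun_prop) measurable_fst
      (lintegral_closedBall_const_mul_lt_top lintegral_closedBall_enorm_inv_lt_top
        ENNReal.ofReal_ne_top) (lintegral_enorm_heatKernelD2_le hν a e) z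
  have hinner : ∀ᵐ p : ℝ × ℝ ∂(halfLine.prod halfLine),
      ∫ y, ν * heatKernelD2 (ν * (p.1 + p.2)) a e y * φ (z + (y, p.1))
        = ν * heatConv (ν * (p.1 + p.2)) (dirDeriv (a, 0) (dirDeriv (spatialDir i) φ))
          (z + (0, p.1)) := by
    filter_upwards [halfLine_prod_ae] with p hp
    have hσ : 0 < ν * (p.1 + p.2) := mul_pos hν (add_pos hp.1 hp.2)
    have h := integral_heatKernelD2_mul hφ hσ a e (z + (0, p.1))
    have h' := integral_heatKernelD1_mul (hφ.dirDeriv (e, 0)) hσ a (z + (0, p.1))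
    rw [h', neg_neg] at h
    simp only [add_zero_mk_add_mk] at h
    simp_rw [mul_assoc]
    rw [integral_const_mul, h]
    rfl
  have hI2 := hF.integral_prod_right.congr hinner
  refine ⟨hI2, ?_⟩
  have hG := hφ.integrable_heatKernel_mul hν z
  have hO : Integrable (fun ζ : R3 × ℝ => oseen ν ζ a i * φ (z + ζ))
      ((volume : Measure R3).prod halfLine) := by
    rw [prod_halfLine_eq]
    exact (hφ.integrable_oseen_mul hν a i z).integrableOn
  have hsplit : ∀ᵐ ζ : R3 × ℝ ∂((volume : Measure R3).prod halfLine),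
      oseen ν ζ a i * φ (z + ζ) = a i * (heatKernel (ν * ζ.2) ζ.1 * φ (z + ζ))
        + ∫ m in Ioi (0 : ℝ), ν * heatKernelD2 (ν * (ζ.2 + m)) a e ζ.1 * φ (z + ζ) := by
    filter_upwards [prod_halfLine_ae] with ζ hζ
    rw [show oseen ν ζ a i = oseen ν (ζ.1, ζ.2) a i from rfl, oseen_apply_eq hν hζ,
      integral_mul_const]
    ring
  have hD : Integrable (fun ζ : R3 × ℝ => ∫ m in Ioi (0 : ℝ),
      ν * heatKernelD2 (ν * (ζ.2 + m)) a e ζ.1 * φ (z + ζ))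
      ((volume : Measure R3).prod halfLine) := by
    refine (hO.sub (hG.const_mul (a i))).congr ?_
    filter_upwards [hsplit] with ζ hζ
    simp only [Pi.sub_apply, hζ]
    ring
  have h0 : ∫ ζ : R3 × ℝ, oseen ν ζ a i * φ (z + ζ)
      = ∫ ζ : R3 × ℝ, oseen ν ζ a i * φ (z + ζ) ∂((volume : Measure R3).prod halfLine) := by
    rw [prod_halfLine_eq]
    refine (setIntegral_eq_integral_of_forall_compl_eq_zero fun ζ hζ => ?_).symm
    have : ¬ 0 < ζ.2 := fun h => hζ ⟨mem_univ _, h⟩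
    simp [oseen, this]
  rw [h0, integral_congr_ae hsplit, integral_add (hG.const_mul _) hD, integral_const_mul]
  congr 1
  · congr 1
    rw [integral_prod_symm _ hG]
    refine setIntegral_congr_fun measurableSet_Ioi fun s _ => ?_
    simp only [heatConv, add_zero_mk_add_mk]
  · rw [← integral_congr_ae hinner, ← integral_prod_symm _ hF, integral_prod _ hF,
      integral_prod _ hD]
    refine integral_congr_ae ?_
    filter_upwards [hF.prod_right_ae] with y hy
    rw [integral_prod _ hy]

lemma lintegral_enorm_heatKernelD1_le {ν : ℝ} (hν : 0 < ν) (a y : R3) :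
    ∫⁻ m, ‖ν * heatKernelD1 (ν * m) a y‖ₑ ∂halfLine
      ≤ ENNReal.ofReal ((‖a‖ + 1) / (4 * Real.pi)) * (‖y‖ₑ ^ 2)⁻¹ := by
  have hp := Real.pi_pos
  rcases eq_or_ne y 0 with rfl | hy
  · rw [enorm_zero, zero_pow two_ne_zero, ENNReal.inv_zero, ENNReal.mul_top (by simp; positivity)]
    exact le_top
  have hr : 0 < ‖y‖ := norm_pos_iff.2 hy
  calc ∫⁻ m, ‖ν * heatKernelD1 (ν * m) a y‖ₑ ∂halfLine
      ≤ ∫⁻ m in Ioi (0 : ℝ), ENNReal.ofReal (ν * (‖y‖ * ‖a‖ / 2))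
          * ENNReal.ofReal (heatKernel (ν * m) y / (ν * m)) := by
        refine setLIntegral_mono' measurableSet_Ioi fun m (hm : 0 < m) => ?_
        have h0 := heatKernel_nonneg (τ := ν * m) (by positivity) y
        have h1 := abs_real_inner_le_norm y a
        rw [← ENNReal.ofReal_mul (by positivity), ← ofReal_norm]
        refine ENNReal.ofReal_le_ofReal ?_
        simp only [heatKernelD1]
        rw [norm_mul, norm_mul, norm_neg, norm_div, Real.norm_of_nonneg hν.le,
          Real.norm_of_nonneg h0, Real.norm_eq_abs, Real.norm_of_nonneg (by positivity)]
        calc ν * (|inner ℝ y a| / (2 * (ν * m)) * heatKernel (ν * m) y)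
            ≤ ν * (‖y‖ * ‖a‖ / (2 * (ν * m)) * heatKernel (ν * m) y) := by gcongr
          _ = _ := by field_simp
    _ = ENNReal.ofReal (ν * (‖y‖ * ‖a‖ / 2)) * (ENNReal.ofReal (1 / ν)
          * ENNReal.ofReal (1 / (2 * Real.pi * ‖y‖ ^ 3))) := by
        rw [lintegral_const_mul' _ _ ENNReal.ofReal_ne_top, lintegral_Ioi_comp_mul_left hν
          (f := fun x => ENNReal.ofReal (heatKernel x y / x)) (by fun_prop),
          lintegral_heatKernel_div_time hy]
    _ ≤ _ := by
        rw [← ofReal_norm (x := y), ← ENNReal.ofReal_pow hr.le,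
          ← ENNReal.ofReal_inv_of_pos (by positivity), ← ENNReal.ofReal_mul (by positivity),
          ← ENNReal.ofReal_mul (by positivity), ← ENNReal.ofReal_mul (by positivity)]
        refine ENNReal.ofReal_le_ofReal ?_
        have : ν * (‖y‖ * ‖a‖ / 2) * (1 / ν * (1 / (2 * Real.pi * ‖y‖ ^ 3)))
            = ‖a‖ / (4 * Real.pi) * (‖y‖ ^ 2)⁻¹ := by field_simp; norm_num
        rw [this]
        gcongr
        linarith

lemma inner_rieszKernel (ν : ℝ) (a y : R3) :
    inner ℝ (rieszKernel ν y) a = ∫ m in Ioi (0 : ℝ), ν * heatKernelD1 (ν * m) a y := by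
  have e : ∀ m : ℝ, ν * heatKernelD1 (ν * m) a y
      = -(inner ℝ y a / 2) * (ν * (heatKernel (ν * (0 + m)) y / (ν * (0 + m)) ^ 1)) := by
    intro m
    simp only [heatKernelD1, zero_add, pow_one]
    ring
  simp_rw [e]
  rw [integral_const_mul]
  simp only [rieszKernel, real_inner_smul_left, tailMoment]
  ring

/-- The kernel is a time integral of heat kernel derivatives in a unit direction, so the constant is
`(1 + 1)/(4π)`. -/
lemma enorm_rieszKernel_apply_le {ν : ℝ} (hν : 0 < ν) (y : R3) (i : Fin 3) :
    ‖rieszKernel ν y i‖ₑ ≤ ENNReal.ofReal (1 / (2 * Real.pi)) * (‖y‖ₑ ^ 2)⁻¹ := by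
  have h := inner_rieszKernel ν (EuclideanSpace.single i 1) y
  rw [inner_single_one] at h
  rw [h]
  refine (enorm_integral_le_lintegral_enorm _).trans
    ((lintegral_enorm_heatKernelD1_le hν _ y).trans (le_of_eq ?_))
  congr 2
  simp; ring

lemma apply_sum_inner (a r : R3) : ∑ j, a j * r j = inner ℝ r a := by
  simp [PiLp.inner_apply]

lemma IsSmoothCompact.integrable_rieszKernel_mul {ν : ℝ} (hν : 0 < ν) {φ : R3 × ℝ → ℝ}
    (hφ : IsSmoothCompact φ) (j : Fin 3) (z : R3 × ℝ) :
    Integrable fun y => rieszKernel ν y j * φ (z + (y, 0)) := by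
  -- A one-point parameter space expresses that no time variable is integrated.
  have h := hφ.integrable_kernel_mul (μ := Measure.dirac ()) (t := fun _ => 0)
    (k := fun p : R3 × Unit => rieszKernel ν p.1 j) (by fun_prop) measurable_const
    (lintegral_closedBall_const_mul_lt_top lintegral_closedBall_enorm_inv_sq_lt_top
      ENNReal.ofReal_ne_top) (fun y => by simpa using enorm_rieszKernel_apply_le hν y j) z
  have h2 := h.integral_prod_left
  simpa using h2

lemma IsSmoothCompact.sum_mul_rieszConv {ν : ℝ} (hν : 0 < ν) {φ : R3 × ℝ → ℝ}
    (hφ : IsSmoothCompact φ) (a : R3) (z : R3 × ℝ) :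
    ∑ j, a j * rieszConv ν j φ z
      = -∫ m in Ioi (0 : ℝ), ν * heatConv (ν * m) (dirDeriv (a, 0) φ) z := by
  have hF : Integrable (fun p : R3 × ℝ => ν * heatKernelD1 (ν * p.2) a p.1 * φ (z + (p.1, 0)))
      ((volume : Measure R3).prod halfLine) :=
    hφ.integrable_kernel_mul (μ := halfLine) (t := fun _ => 0)
      (k := fun p => ν * heatKernelD1 (ν * p.2) a p.1) (by fun_prop) measurable_const
      (lintegral_closedBall_const_mul_lt_top lintegral_closedBall_enorm_inv_sq_lt_top
        ENNReal.ofReal_ne_top) (lintegral_enorm_heatKernelD1_le hν a) z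
  have h1 : ∑ j, a j * rieszConv ν j φ z
      = ∫ y, (∫ m in Ioi (0 : ℝ), ν * heatKernelD1 (ν * m) a y * φ (z + (y, 0))) := by
    simp_rw [integral_mul_const, ← inner_rieszKernel, rieszConv, ← integral_const_mul]
    rw [← integral_finsetSum _ fun j _ => (hφ.integrable_rieszKernel_mul hν j z).const_mul _]
    congr 1
    funext y
    rw [← apply_sum_inner, Finset.sum_mul]
    simp_rw [mul_assoc]
  rw [h1, ← integral_prod _ hF, integral_prod_symm _ hF, ← integral_neg]
  refine setIntegral_congr_fun measurableSet_Ioi fun m (hm : 0 < m) => ?_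
  simp_rw [mul_assoc]
  rw [integral_const_mul, integral_heatKernelD1_mul hφ (by positivity)]
  ring

/-- The adjoint of the Oseen kernel maps `-(∂ₜ + νΔ) φ` to the Leray projection of `φ`. -/
lemma IsSmoothCompact.integral_oseen_mul_heatAdj {ν : ℝ} (hν : 0 < ν) {φ : R3 × ℝ → ℝ}
    (hφ : IsSmoothCompact φ) (a : R3) (i : Fin 3) (z : R3 × ℝ) :
    ∫ ζ : R3 × ℝ, oseen ν ζ a i * heatAdj ν φ (z + ζ)
      = -(a i * φ z) + ∑ j, a j * rieszConv ν j (dirDeriv (spatialDir i) φ) z := by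
  obtain ⟨h1, h2⟩ := (hφ.heatAdj ν).integral_oseen_mul hν a i z
  rw [h2, integral_heatConv_heatAdj_zero hφ hν, (hφ.dirDeriv _).sum_mul_rieszConv hν,
    integral_prod_symm _ h1, mul_neg, ← integral_neg]
  congr 1
  -- For fixed `m` the integral over `s` collapses by Duhamel's formula to minus a heat flow at time
  -- `νm`. The remaining integral over `m` is the Riesz term.
  refine setIntegral_congr_fun measurableSet_Ioi fun m (hm : 0 < m) => ?_
  simp only
  rw [integral_const_mul, ← hφ.heatAdj_dirDeriv, ← (hφ.dirDeriv _).heatAdj_dirDeriv,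
    integral_heatConv_heatAdj ((hφ.dirDeriv _).dirDeriv _) hν hm]
  ring

/-- The derivative moves to the test function and commutes with the adjoint heat operator, which
reduces this to `integral_oseen_mul_heatAdj`. -/
lemma IsSmoothCompact.integral_oseenGrad_mul_heatAdj {ν : ℝ} (hν : 0 < ν) {φ : R3 × ℝ → ℝ}
    (hφ : IsSmoothCompact φ) (a b : R3) (i : Fin 3) (z : R3 × ℝ) :
    ∫ ζ : R3 × ℝ, oseenGrad ν ζ a b i * heatAdj ν φ (z + ζ)
      = a i * dirDeriv (b, 0) φ z
        - ∑ j, a j * rieszConv ν j (dirDeriv (spatialDir i) (dirDeriv (b, 0) φ)) z := by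
  rw [(hφ.heatAdj ν).integral_oseenGrad_mul hν, ← hφ.heatAdj_dirDeriv,
    (hφ.dirDeriv _).integral_oseen_mul_heatAdj hν]
  ring

lemma dirDeriv_space_eq_sum (φ : R3 × ℝ → ℝ) (a : R3) (z : R3 × ℝ) :
    dirDeriv (a, 0) φ z = ∑ j, a j * dirDeriv (spatialDir j) φ z := by
  have h : ((a, 0) : R3 × ℝ) = ∑ j, a j • spatialDir j := by
    refine Prod.ext ?_ ?_
    · rw [Prod.fst_sum]
      ext k
      simp [spatialDir, Pi.single_apply]
    · rw [Prod.snd_sum]; simp [spatialDir]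
  simp only [dirDeriv]
  rw [h, map_sum]
  simp

lemma heatConv_sum {ι : Type*} (s : Finset ι) {f : ι → R3 × ℝ → ℝ}
    (hf : ∀ i, IsSmoothCompact (f i)) {τ : ℝ} (hτ : 0 < τ) (z : R3 × ℝ) :
    heatConv τ (fun w => ∑ i ∈ s, f i w) z = ∑ i ∈ s, heatConv τ (f i) z := by
  unfold heatConv
  rw [← integral_finsetSum _ fun i _ => (hf i).integrable_slice_mul (continuous_heatKernel hτ) z]
  simp_rw [Finset.mul_sum]

/-- The columns of the Oseen kernel are divergence free. -/
lemma IsSmoothCompact.sum_integral_oseen_mul {ν : ℝ} (hν : 0 < ν) {φ : R3 × ℝ → ℝ}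
    (hφ : IsSmoothCompact φ) (a : R3) (z : R3 × ℝ) :
    ∑ i, ∫ ζ : R3 × ℝ, oseen ν ζ a i * dirDeriv (spatialDir i) φ (z + ζ) = 0 := by
  have hψ := hφ.dirDeriv (a, 0)
  have hterm := fun i : Fin 3 => (hφ.dirDeriv (spatialDir i)).integral_oseen_mul hν a i z
  simp_rw [fun i => (hterm i).2]
  rw [Finset.sum_add_distrib]
  have h1 : ∑ i, a i * (∫ s in Ioi (0 : ℝ), heatConv (ν * s) (dirDeriv (spatialDir i) φ)
      (z + (0, s))) = ∫ s in Ioi (0 : ℝ), heatConv (ν * s) (dirDeriv (a, 0) φ) (z + (0, s)) := by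
    simp_rw [← integral_const_mul]
    have hint : ∀ i : Fin 3, Integrable (fun s => a i * heatConv (ν * s)
        (dirDeriv (spatialDir i) φ) (z + (0, s))) halfLine := by
      intro i
      have := ((hφ.dirDeriv (spatialDir i)).integrable_heatKernel_mul hν z).integral_prod_right
      refine Integrable.const_mul ?_ _
      simpa only [heatConv, add_zero_mk_add_mk] using this
    rw [← integral_finsetSum _ fun i _ => hint i]
    refine setIntegral_congr_fun measurableSet_Ioi fun s (hs : 0 < s) => ?_
    have e : dirDeriv (a, 0) φ = fun w => ∑ j, a j * dirDeriv (spatialDir j) φ w :=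
      funext fun w => dirDeriv_space_eq_sum φ a w
    simp only
    rw [e, heatConv_sum _ (fun j => (hφ.dirDeriv _).const_mul _) (by positivity)]
    simp_rw [heatConv_const_mul]
  have hsum : ∀ᵐ p : ℝ × ℝ ∂(halfLine.prod halfLine), ∑ i, ν * heatConv (ν * (p.1 + p.2))
        (dirDeriv (a, 0) (dirDeriv (spatialDir i) (dirDeriv (spatialDir i) φ))) (z + (0, p.1))
      = ν * heatConv (ν * (p.1 + p.2)) (spaceLap (dirDeriv (a, 0) φ)) (z + (0, p.1)) := by
    filter_upwards [halfLine_prod_ae] with p hp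
    rw [← Finset.mul_sum, hφ.spaceLap_dirDeriv]
    congr 1
    unfold spaceLap
    rw [dirDeriv_sum _ fun j => ((hφ.dirDeriv _).dirDeriv _).differentiable,
      heatConv_sum _ (fun j => ((hφ.dirDeriv _).dirDeriv _).dirDeriv _)
        (mul_pos hν (add_pos hp.1 hp.2))]
  have hI : Integrable (fun p : ℝ × ℝ => ν * heatConv (ν * (p.1 + p.2))
      (spaceLap (dirDeriv (a, 0) φ)) (z + (0, p.1))) (halfLine.prod halfLine) :=
    (integrable_finsetSum Finset.univ fun i _ => (hterm i).1).congr hsum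
  -- Here `ν` times the heat flow of the Laplacian is the derivative in `m` of the heat flow. It
  -- integrates to minus the value at `m = 0` and cancels the contribution of the heat kernel.
  have h2 : ∫ p : ℝ × ℝ, ν * heatConv (ν * (p.1 + p.2)) (spaceLap (dirDeriv (a, 0) φ))
      (z + (0, p.1)) ∂(halfLine.prod halfLine)
      = -∫ s in Ioi (0 : ℝ), heatConv (ν * s) (dirDeriv (a, 0) φ) (z + (0, s)) := by
    rw [integral_prod _ hI, ← integral_neg]
    refine integral_congr_ae ?_
    filter_upwards [hI.prod_right_ae, ae_restrict_mem measurableSet_Ioi] with s hs (hs0 : 0 < s)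
    have hd : ∀ m, 0 ≤ m → HasDerivAt
        (fun m => heatConv (ν * (s + m)) (dirDeriv (a, 0) φ) (z + (0, s)))
        (ν * heatConv (ν * (s + m)) (spaceLap (dirDeriv (a, 0) φ)) (z + (0, s))) m := by
      intro m hm
      have h := hasDerivAt_heatConv hψ (ν * s) ν 0 (s₀ := m) (by positivity) (z + (0, s))
      simp only [zero_mul, add_zero, ← mul_add, ← Prod.zero_eq_mk] at h
      exact h
    rw [integral_Ioi_of_hasDerivAt_of_tendsto (m := 0) (hd 0 le_rfl).continuousAt.continuousWithinAt
      (fun m hm => hd m (le_of_lt hm)) hs]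
    · simp
    · refine (tendsto_heatConv_atTop hψ (z + (0, s))).comp ?_
      exact (tendsto_atTop_add_const_left _ s tendsto_id).const_mul_atTop hν
  rw [h1, ← integral_finsetSum _ fun i _ => (hterm i).1, integral_congr_ae hsum, h2]
  ring

lemma IsSmoothCompact.sum_integral_oseenGrad_mul {ν : ℝ} (hν : 0 < ν) {φ : R3 × ℝ → ℝ}
    (hφ : IsSmoothCompact φ) (a b : R3) (z : R3 × ℝ) :
    ∑ i, ∫ ζ : R3 × ℝ, oseenGrad ν ζ a b i * dirDeriv (spatialDir i) φ (z + ζ) = 0 := by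
  simp_rw [fun i => (hφ.dirDeriv (spatialDir i)).integral_oseenGrad_mul hν a b i z,
    fun i => hφ.dirDeriv_comm (b, 0) (spatialDir i)]
  rw [Finset.sum_neg_distrib, (hφ.dirDeriv (b, 0)).sum_integral_oseen_mul hν, neg_zero]

/-! ### Majorizing pairs of weights -/

/-- The weights `h`, `h'` that control the velocity and the forcing. -/
structure IsMajorizingPair (h h' : R3 → ℝ≥0∞) : Prop where
  pos : ∀ x, 0 < h x
  aemeasurable : AEMeasurable h
  aemeasurable' : AEMeasurable h'
  sq_lt_top : ∀ K : Set R3, IsCompact K → ∫⁻ x in K, h x ^ 2 < ∞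
  ker : ∀ x, ∫⁻ y, h (x - y) ^ 2 * (‖y‖ₑ ^ 2)⁻¹ ≤ h x
  ker' : ∀ x, ∫⁻ y, h' (x - y) * ‖y‖ₑ⁻¹ ≤ h x

/-- The weight `(1 + |x|)⁻ᵏ (1 + t²)⁻¹` on space-time. -/
noncomputable def stDecay (k : ℕ) (z : R3 × ℝ) : ℝ := ((1 + ‖z.1‖) ^ k)⁻¹ * (1 + z.2 ^ 2)⁻¹

lemma stDecay_pos (k : ℕ) (z : R3 × ℝ) : 0 < stDecay k z := by
  unfold stDecay; positivity

lemma stDecay_anti {k l : ℕ} (hkl : k ≤ l) (z : R3 × ℝ) : stDecay l z ≤ stDecay k z := by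
  unfold stDecay
  have : 1 ≤ 1 + ‖z.1‖ := by linarith [norm_nonneg z.1]
  gcongr

lemma lintegral_stDecay_mul_le (k : ℕ) (f : R3 → ℝ≥0∞) :
    ∫⁻ z : R3 × ℝ, ENNReal.ofReal (stDecay k z) * f z.1
      ≤ ENNReal.ofReal Real.pi * ∫⁻ x, f x * ENNReal.ofReal ((1 + ‖x‖) ^ k)⁻¹ := by
  rw [Measure.volume_eq_prod]
  refine (lintegral_prod_le _).trans ?_
  rw [← lintegral_const_mul' _ _ ENNReal.ofReal_ne_top]
  refine lintegral_mono fun x => ?_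
  have e : ∀ t : ℝ, ENNReal.ofReal (stDecay k (x, t)) * f x
      = f x * ENNReal.ofReal ((1 + ‖x‖) ^ k)⁻¹ * ENNReal.ofReal (1 + t ^ 2)⁻¹ := by
    intro t
    rw [stDecay, ENNReal.ofReal_mul (by positivity)]
    ring
  simp_rw [e]
  rw [lintegral_const_mul _ (by fun_prop), ← ofReal_integral_eq_lintegral_ofReal
    integrable_inv_one_add_sq (Eventually.of_forall fun t => by positivity),
    integral_univ_inv_one_add_sq, mul_comm]

lemma IsSmoothCompact.exists_decay {φ : R3 × ℝ → ℝ} (hφ : IsSmoothCompact φ) (k : ℕ) :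
    ∃ C : ℝ, 0 < C ∧ ∀ z, |φ z| ≤ C * stDecay k z := by
  obtain ⟨C, R, hC, hR, hb, hs⟩ := hφ.exists_bound
  refine ⟨C * ((1 + R) ^ k * (1 + R ^ 2)), by positivity, fun z => ?_⟩
  by_cases h0 : φ z = 0
  · rw [h0, abs_zero]
    have := stDecay_pos k z
    positivity
  · obtain ⟨h1, h2⟩ := hs z h0
    have h3 : z.2 ^ 2 ≤ R ^ 2 := sq_le_sq' (abs_le.1 h2).1 (abs_le.1 h2).2
    refine (hb z).trans ?_
    rw [mul_assoc]
    refine le_mul_of_one_le_right hC.le ?_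
    rw [stDecay, ← mul_inv, ← div_eq_mul_inv, one_le_div (by positivity)]
    gcongr

/-- It compares a kernel centred at any single point with the standard weight, so one point where
`h` is finite controls integrals over all of space. -/
lemma ofReal_one_add_norm_inv_le (x y : R3) :
    ENNReal.ofReal (1 + ‖y‖)⁻¹ ≤ ENNReal.ofReal (1 + ‖x‖) * ‖x - y‖ₑ⁻¹ := by
  have h1 : ‖x - y‖ₑ ≤ ENNReal.ofReal (1 + ‖x‖) * ENNReal.ofReal (1 + ‖y‖) := by
    rw [← ENNReal.ofReal_mul (by positivity), ← ofReal_norm]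
    refine ENNReal.ofReal_le_ofReal ?_
    nlinarith [norm_sub_le x y, norm_nonneg x, norm_nonneg y, mul_nonneg (norm_nonneg x) (norm_nonneg y)]
  rw [ENNReal.ofReal_inv_of_pos (by positivity)]
  have h2 : ENNReal.ofReal (1 + ‖y‖) ≠ 0 := by simp; positivity
  have h3 : ENNReal.ofReal (1 + ‖x‖) ≠ 0 := by simp; positivity
  calc (ENNReal.ofReal (1 + ‖y‖))⁻¹
      = ENNReal.ofReal (1 + ‖x‖) * (ENNReal.ofReal (1 + ‖x‖) * ENNReal.ofReal (1 + ‖y‖))⁻¹ := by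
        rw [ENNReal.mul_inv (Or.inl h3) (Or.inl ENNReal.ofReal_ne_top), ← mul_assoc,
          ENNReal.mul_inv_cancel h3 ENNReal.ofReal_ne_top, one_mul]
    _ ≤ _ := by gcongr

namespace IsMajorizingPair

variable {h h' : R3 → ℝ≥0∞}

lemma ae_lt_top (H : IsMajorizingPair h h') : ∀ᵐ x, h x < ∞ := by
  have h1 : ∀ n : ℕ, ∀ᵐ x, x ∈ Metric.closedBall (0 : R3) n → h x < ∞ := by
    intro n
    rw [← ae_restrict_iff' Metric.isClosed_closedBall.measurableSet]
    filter_upwards [ae_lt_top' ((H.aemeasurable.pow_const 2).restrict)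
      (H.sq_lt_top _ (isCompact_closedBall _ _)).ne] with x hx
    exact lt_of_not_ge fun hc => by simp [top_le_iff.1 hc] at hx
  filter_upwards [ae_all_iff.2 h1] with x hx
  obtain ⟨n, hn⟩ := exists_nat_ge ‖x‖
  exact hx n (by simpa using hn)

lemma exists_lt_top (H : IsMajorizingPair h h') : ∃ x, h x < ∞ := H.ae_lt_top.exists

/-- The kernel inequality at one point `x₁` with `h x₁ < ∞`, transferred to the weight centred at
the origin. -/
lemma lintegral_sq_mul_lt_top (H : IsMajorizingPair h h') :
    ∫⁻ x, h x ^ 2 * ENNReal.ofReal ((1 + ‖x‖) ^ 2)⁻¹ < ∞ := by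
  obtain ⟨x₁, hx₁⟩ := H.exists_lt_top
  have h1 := H.ker x₁
  rw [← lintegral_sub_left_eq_self _ x₁] at h1
  simp only [sub_sub_cancel] at h1
  calc ∫⁻ x, h x ^ 2 * ENNReal.ofReal ((1 + ‖x‖) ^ 2)⁻¹
      ≤ ∫⁻ x, ENNReal.ofReal (1 + ‖x₁‖) ^ 2 * (h x ^ 2 * (‖x₁ - x‖ₑ ^ 2)⁻¹) := by
        refine lintegral_mono fun x => ?_
        calc h x ^ 2 * ENNReal.ofReal ((1 + ‖x‖) ^ 2)⁻¹
            = h x ^ 2 * (ENNReal.ofReal (1 + ‖x‖)⁻¹) ^ 2 := by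
              rw [← ENNReal.ofReal_pow (by positivity), inv_pow]
          _ ≤ h x ^ 2 * (ENNReal.ofReal (1 + ‖x₁‖) * ‖x₁ - x‖ₑ⁻¹) ^ 2 := by
              gcongr; exact ofReal_one_add_norm_inv_le x₁ x
          _ = _ := by rw [mul_pow, ENNReal.inv_pow]; ring
    _ = ENNReal.ofReal (1 + ‖x₁‖) ^ 2 * ∫⁻ x, h x ^ 2 * (‖x₁ - x‖ₑ ^ 2)⁻¹ :=
        lintegral_const_mul' _ _ (by finiteness)
    _ < ∞ := ENNReal.mul_lt_top (by finiteness) (h1.trans_lt hx₁)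

lemma lintegral_mul_lt_top' (H : IsMajorizingPair h h') :
    ∫⁻ x, h' x * ENNReal.ofReal ((1 + ‖x‖) ^ 1)⁻¹ < ∞ := by
  obtain ⟨x₁, hx₁⟩ := H.exists_lt_top
  have h1 := H.ker' x₁
  rw [← lintegral_sub_left_eq_self _ x₁] at h1
  simp only [sub_sub_cancel] at h1
  calc ∫⁻ x, h' x * ENNReal.ofReal ((1 + ‖x‖) ^ 1)⁻¹
      ≤ ∫⁻ x, ENNReal.ofReal (1 + ‖x₁‖) * (h' x * ‖x₁ - x‖ₑ⁻¹) := by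
        refine lintegral_mono fun x => ?_
        rw [pow_one]
        calc h' x * ENNReal.ofReal (1 + ‖x‖)⁻¹
            ≤ h' x * (ENNReal.ofReal (1 + ‖x₁‖) * ‖x₁ - x‖ₑ⁻¹) := by
              gcongr; exact ofReal_one_add_norm_inv_le x₁ x
          _ = _ := by ring
    _ = ENNReal.ofReal (1 + ‖x₁‖) * ∫⁻ x, h' x * ‖x₁ - x‖ₑ⁻¹ :=
        lintegral_const_mul' _ _ (by finiteness)
    _ < ∞ := ENNReal.mul_lt_top (by finiteness) (h1.trans_lt hx₁)

lemma ae_lt_top' (H : IsMajorizingPair h h') : ∀ᵐ x, h' x < ∞ := by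
  filter_upwards [MeasureTheory.ae_lt_top' (H.aemeasurable'.mul (by fun_prop))
    H.lintegral_mul_lt_top'.ne] with x hx
  refine lt_of_not_ge fun hc => ?_
  rw [Pi.mul_apply, top_le_iff.1 hc, ENNReal.top_mul (by simp; positivity)] at hx
  exact lt_irrefl _ hx

/-- With `w = (1+|x|)⁻¹` one has `h w³ ≤ (h w)² + w⁴`, and `w⁴` is integrable in three dimensions.
The weight `3` matches the decay of heat flows of test functions. -/
lemma lintegral_mul_lt_top (H : IsMajorizingPair h h') :
    ∫⁻ x, h x * ENNReal.ofReal ((1 + ‖x‖) ^ 3)⁻¹ < ∞ := by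
  have h4 : ∫⁻ x : R3, ENNReal.ofReal ((1 + ‖x‖) ^ 4)⁻¹ < ∞ := by
    have := (integrable_one_add_norm (E := R3) (μ := volume) (r := 4)
      (by simp; norm_num)).lintegral_lt_top
    refine lt_of_le_of_lt (lintegral_mono fun x => ?_) this
    refine ENNReal.ofReal_le_ofReal (le_of_eq ?_)
    rw [Real.rpow_neg (by positivity)]
    norm_cast
  refine lt_of_le_of_lt (b := ∫⁻ x, (h x ^ 2 * ENNReal.ofReal ((1 + ‖x‖) ^ 2)⁻¹
      + ENNReal.ofReal ((1 + ‖x‖) ^ 4)⁻¹)) (lintegral_mono fun x => ?_) ?_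
  · set w := ENNReal.ofReal (1 + ‖x‖)⁻¹
    have e : ∀ k : ℕ, ENNReal.ofReal ((1 + ‖x‖) ^ k)⁻¹ = w ^ k := fun k => by
      rw [← ENNReal.ofReal_pow (by positivity), inv_pow]
    simp only [e]
    calc h x * w ^ 3 = (h x * w) * w ^ 2 := by ring
      _ ≤ (h x * w) ^ 2 + (w ^ 2) ^ 2 := by
          rcases le_total (h x * w) (w ^ 2) with hle | hle
          · exact (mul_le_mul_left hle _).trans (by rw [sq (w ^ 2)]; exact le_add_self)
          · exact (mul_le_mul_right hle _).trans (by rw [sq (h x * w)]; exact le_self_add)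
      _ = _ := by ring
  · rw [lintegral_add_right _ (by fun_prop)]
    exact ENNReal.add_lt_top.2 ⟨H.lintegral_sq_mul_lt_top, h4⟩

lemma lintegral_stDecay_mul_lt_top (H : IsMajorizingPair h h') :
    ∫⁻ z : R3 × ℝ, ENNReal.ofReal (stDecay 3 z) * h z.1 < ∞ :=
  (lintegral_stDecay_mul_le 3 h).trans_lt
    (ENNReal.mul_lt_top (by finiteness) H.lintegral_mul_lt_top)

lemma lintegral_oseenGradMaj_mul_le (H : IsMajorizingPair h h') {ν : ℝ} (hν : 0 < ν) (x : R3) :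
    ∫⁻ ζ : R3 × ℝ, ENNReal.ofReal (oseenGradMaj ν ζ) * h (x - ζ.1) ^ 2
      ≤ ENNReal.ofReal (1 / (Real.pi * ν)) * h x := by
  rw [Measure.volume_eq_prod]
  refine (lintegral_prod_le _).trans ?_
  calc ∫⁻ y, ∫⁻ s, ENNReal.ofReal (oseenGradMaj ν (y, s)) * h (x - y) ^ 2
      ≤ ∫⁻ y, ENNReal.ofReal (1 / (Real.pi * ν)) * (h (x - y) ^ 2 * (‖y‖ₑ ^ 2)⁻¹) := by
        refine lintegral_mono fun y => ?_
        rw [lintegral_mul_const _ (by fun_prop)]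
        calc _ ≤ ENNReal.ofReal (1 / (Real.pi * ν)) * (‖y‖ₑ ^ 2)⁻¹ * h (x - y) ^ 2 := by
              gcongr; exact lintegral_oseenGradMaj_le hν y
          _ = _ := by ring
    _ = ENNReal.ofReal (1 / (Real.pi * ν)) * ∫⁻ y, h (x - y) ^ 2 * (‖y‖ₑ ^ 2)⁻¹ :=
        lintegral_const_mul' _ _ ENNReal.ofReal_ne_top
    _ ≤ _ := by gcongr; exact H.ker x

lemma lintegral_oseenMaj_mul_le (H : IsMajorizingPair h h') {ν : ℝ} (hν : 0 < ν) (x : R3) :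
    ∫⁻ ζ : R3 × ℝ, ENNReal.ofReal (oseenMaj ν ζ) * h' (x - ζ.1)
      ≤ ENNReal.ofReal (1 / (2 * Real.pi * ν)) * h x := by
  rw [Measure.volume_eq_prod]
  refine (lintegral_prod_le _).trans ?_
  calc ∫⁻ y, ∫⁻ s, ENNReal.ofReal (oseenMaj ν (y, s)) * h' (x - y)
      ≤ ∫⁻ y, ENNReal.ofReal (1 / (2 * Real.pi * ν)) * (h' (x - y) * ‖y‖ₑ⁻¹) := by
        refine lintegral_mono fun y => ?_
        rw [lintegral_mul_const _ (by fun_prop)]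
        calc _ ≤ ENNReal.ofReal (1 / (2 * Real.pi * ν)) * ‖y‖ₑ⁻¹ * h' (x - y) := by
              gcongr; exact lintegral_oseenMaj_le hν y
          _ = _ := by ring
    _ = ENNReal.ofReal (1 / (2 * Real.pi * ν)) * ∫⁻ y, h' (x - y) * ‖y‖ₑ⁻¹ :=
        lintegral_const_mul' _ _ ENNReal.ofReal_ne_top
    _ ≤ _ := by gcongr; exact H.ker' x

end IsMajorizingPair

/-! ### Controlled fields and the Duhamel term -/

/-- The field `V` on space-time vanishes in the past and is bounded by `c h`, up to null sets. -/
structure IsControlled (c : ℝ≥0∞) (h : R3 → ℝ≥0∞) (V : R3 × ℝ → R3) : Prop where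
  aestronglyMeasurable : AEStronglyMeasurable V
  enorm_le : ∀ᵐ z, ‖V z‖ₑ ≤ c * h z.1
  eq_zero : ∀ᵐ z : R3 × ℝ, z.2 ≤ 0 → V z = 0

instance isAddHaarMeasure_spaceTime : (volume : Measure (R3 × ℝ)).IsAddHaarMeasure :=
  inferInstanceAs ((volume : Measure R3).prod (volume : Measure ℝ)).IsAddHaarMeasure

lemma ae_sub_left {p : R3 × ℝ → Prop} (hp : ∀ᵐ z, p z) (z : R3 × ℝ) : ∀ᵐ ζ, p (z - ζ) :=
  (Measure.measurePreserving_sub_left volume z).quasiMeasurePreserving.ae hp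

/-- The integrand of the Duhamel term. -/
noncomputable def duhamelKernel (ν : ℝ) (V g : R3 × ℝ → R3) (ζ z : R3 × ℝ) : R3 :=
  oseen ν ζ (g z) - oseenGrad ν ζ (V z) (V z)

/-- The contribution of the forcing `g` and of the transport of `V` to the velocity. -/
noncomputable def duhamel (ν : ℝ) (V g : R3 × ℝ → R3) (z : R3 × ℝ) : R3 :=
  ∫ ζ, duhamelKernel ν V g ζ (z - ζ)

section Duhamel

variable {h h' : R3 → ℝ≥0∞} {ν : ℝ} {c c' : ℝ≥0∞} {V W g : R3 × ℝ → R3}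

lemma enorm_duhamelKernel_le (hν : 0 < ν) (V g : R3 × ℝ → R3) (ζ z : R3 × ℝ) :
    ‖duhamelKernel ν V g ζ z‖ₑ
      ≤ ENNReal.ofReal (oseenMaj ν ζ) * ‖g z‖ₑ + ENNReal.ofReal (oseenGradMaj ν ζ) * ‖V z‖ₑ ^ 2 := by
  have h1 := oseenMaj_nonneg hν ζ
  have h2 := oseenGradMaj_nonneg hν ζ
  refine (enorm_sub_le).trans (add_le_add ?_ ?_)
  · rw [← ofReal_norm, ← ofReal_norm, ← ENNReal.ofReal_mul h1]
    exact ENNReal.ofReal_le_ofReal (norm_oseen_le hν ζ _)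
  · rw [← ofReal_norm, ← ofReal_norm, ← ENNReal.ofReal_pow (norm_nonneg _), ← ENNReal.ofReal_mul h2]
    exact ENNReal.ofReal_le_ofReal ((norm_oseenGrad_le hν ζ _ _).trans (le_of_eq (by ring)))

/-- The central estimate: integrating the majorants over time first leaves the two kernels of the
weights, so every contribution is again a multiple of `h`. The constant is linear in the bound for
the forcing and quadratic in the one for the velocity. -/
lemma lintegral_duhamelKernel_le (H : IsMajorizingPair h h') (hν : 0 < ν) (hc : c ≠ ∞)
    (hc' : c' ≠ ∞)
    (hV : ∀ᵐ z, ‖V z‖ₑ ≤ c * h z.1) (hg : ∀ᵐ z, ‖g z‖ₑ ≤ c' * h' z.1) (z : R3 × ℝ) :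
    ∫⁻ ζ, (ENNReal.ofReal (oseenMaj ν ζ) * ‖g (z - ζ)‖ₑ
        + ENNReal.ofReal (oseenGradMaj ν ζ) * ‖V (z - ζ)‖ₑ ^ 2)
      ≤ (c' * ENNReal.ofReal (1 / (2 * Real.pi * ν)) + c ^ 2 * ENNReal.ofReal (1 / (Real.pi * ν)))
        * h z.1 := by
  calc _ ≤ ∫⁻ ζ : R3 × ℝ, (c' * (ENNReal.ofReal (oseenMaj ν ζ) * h' (z.1 - ζ.1))
        + c ^ 2 * (ENNReal.ofReal (oseenGradMaj ν ζ) * h (z.1 - ζ.1) ^ 2)) := by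
        refine lintegral_mono_ae ?_
        filter_upwards [ae_sub_left hV z, ae_sub_left hg z] with ζ h1 h2
        refine add_le_add ?_ ?_
        · calc _ ≤ ENNReal.ofReal (oseenMaj ν ζ) * (c' * h' (z - ζ).1) := by gcongr
            _ = _ := by rw [Prod.fst_sub]; ring
        · calc _ ≤ ENNReal.ofReal (oseenGradMaj ν ζ) * (c * h (z - ζ).1) ^ 2 := by gcongr
            _ = _ := by rw [Prod.fst_sub]; ring
    _ = c' * (∫⁻ ζ : R3 × ℝ, ENNReal.ofReal (oseenMaj ν ζ) * h' (z.1 - ζ.1))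
        + c ^ 2 * ∫⁻ ζ : R3 × ℝ, ENNReal.ofReal (oseenGradMaj ν ζ) * h (z.1 - ζ.1) ^ 2 := by
        have hm : AEMeasurable fun ζ : R3 × ℝ => h' (z.1 - ζ.1) := by
          have q1 : Measure.QuasiMeasurePreserving (fun ζ : R3 × ℝ => z.1 - ζ.1) :=
            (Measure.measurePreserving_sub_left volume z.1).quasiMeasurePreserving.comp
              Measure.quasiMeasurePreserving_fst
          exact H.aemeasurable'.comp_quasiMeasurePreserving q1
        have hm' : AEMeasurable fun ζ : R3 × ℝ =>
            c' * (ENNReal.ofReal (oseenMaj ν ζ) * h' (z.1 - ζ.1)) :=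
          ((by fun_prop : AEMeasurable fun ζ : R3 × ℝ => ENNReal.ofReal (oseenMaj ν ζ)).mul
            hm).const_mul _
        rw [lintegral_add_left' hm', lintegral_const_mul' _ _ hc',
          lintegral_const_mul' _ _ (by finiteness)]
    _ ≤ c' * (ENNReal.ofReal (1 / (2 * Real.pi * ν)) * h z.1)
        + c ^ 2 * (ENNReal.ofReal (1 / (Real.pi * ν)) * h z.1) := by
        gcongr
        · exact H.lintegral_oseenMaj_mul_le hν z.1
        · exact H.lintegral_oseenGradMaj_mul_le hν z.1
    _ = _ := by ring

lemma aestronglyMeasurable_sub_left {β : Type*} [TopologicalSpace β]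
    {f : R3 × ℝ → β} (hf : AEStronglyMeasurable f) (z : R3 × ℝ) :
    AEStronglyMeasurable fun ζ => f (z - ζ) :=
  hf.comp_quasiMeasurePreserving (Measure.measurePreserving_sub_left volume z).quasiMeasurePreserving

lemma aestronglyMeasurable_duhamelKernel {α : Type*} [MeasurableSpace α] {μ : Measure α}
    {f k : α → R3 × ℝ} (hf : AEMeasurable f μ)
    (hV : AEMeasurable (fun a => V (k a)) μ) (hg : AEMeasurable (fun a => g (k a)) μ) :
    AEStronglyMeasurable (fun a => duhamelKernel ν V g (f a) (k a)) μ := by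
  have h1 : Measurable fun q : (R3 × ℝ) × R3 × R3 => oseen ν q.1 q.2.2 - oseenGrad ν q.1 q.2.1 q.2.1 :=
    by fun_prop
  exact (h1.comp_aemeasurable (hf.prodMk (hV.prodMk hg))).aestronglyMeasurable

lemma integrable_duhamelKernel (H : IsMajorizingPair h h') (hν : 0 < ν) (hc : c ≠ ∞) (hc' : c' ≠ ∞)
    (hV : IsControlled c h V) (hg : IsControlled c' h' g) {z : R3 × ℝ} (hz : h z.1 ≠ ∞) :
    Integrable fun ζ => duhamelKernel ν V g ζ (z - ζ) := by
  refine ⟨aestronglyMeasurable_duhamelKernel aemeasurable_id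
    (aestronglyMeasurable_sub_left hV.1 z).aemeasurable
    (aestronglyMeasurable_sub_left hg.1 z).aemeasurable, ?_⟩
  refine lt_of_le_of_lt (lintegral_mono fun ζ => enorm_duhamelKernel_le hν V g ζ (z - ζ)) ?_
  refine (lintegral_duhamelKernel_le H hν hc hc' hV.2 hg.2 z).trans_lt ?_
  finiteness

lemma enorm_duhamel_le (H : IsMajorizingPair h h') (hν : 0 < ν) (hc : c ≠ ∞) (hc' : c' ≠ ∞)
    (hV : ∀ᵐ z, ‖V z‖ₑ ≤ c * h z.1) (hg : ∀ᵐ z, ‖g z‖ₑ ≤ c' * h' z.1) (z : R3 × ℝ) :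
    ‖duhamel ν V g z‖ₑ ≤ (c' * ENNReal.ofReal (1 / (2 * Real.pi * ν))
      + c ^ 2 * ENNReal.ofReal (1 / (Real.pi * ν))) * h z.1 :=
  (enorm_integral_le_lintegral_enorm _).trans
    ((lintegral_mono fun ζ => enorm_duhamelKernel_le hν V g ζ (z - ζ)).trans
      (lintegral_duhamelKernel_le H hν hc hc' hV hg z))

/-- Polarization: `B(a, a) - B(b, b) = B(a, a - b) + B(a - b, b)` for the bilinear map `B`. -/
lemma norm_oseenGrad_sub_le (hν : 0 < ν) (ζ : R3 × ℝ) (a b : R3) :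
    ‖oseenGrad ν ζ a a - oseenGrad ν ζ b b‖ ≤ oseenGradMaj ν ζ * (‖a‖ + ‖b‖) * ‖a - b‖ := by
  have e : oseenGrad ν ζ a a - oseenGrad ν ζ b b
      = oseenGrad ν ζ a (a - b) + oseenGrad ν ζ (a - b) b := by
    simp only [← oseenGradCLM_apply hν, map_sub, sub_apply]
    abel
  rw [e]
  calc _ ≤ oseenGradMaj ν ζ * ‖a‖ * ‖a - b‖ + oseenGradMaj ν ζ * ‖a - b‖ * ‖b‖ :=
        (norm_add_le _ _).trans (add_le_add (norm_oseenGrad_le hν ζ _ _) (norm_oseenGrad_le hν ζ _ _))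
    _ = _ := by ring

lemma enorm_duhamel_sub_le (H : IsMajorizingPair h h') (hν : 0 < ν) (hc : c ≠ ∞) (hc' : c' ≠ ∞)
    (hV : IsControlled c h V) (hW : IsControlled c h W) (hg : IsControlled c' h' g) {δ : ℝ≥0∞}
    (hδ : δ ≠ ∞) (hd : ∀ᵐ z, ‖V z - W z‖ₑ ≤ δ * h z.1) {z : R3 × ℝ} (hz : h z.1 ≠ ∞) :
    ‖duhamel ν V g z - duhamel ν W g z‖ₑ
      ≤ 2 * c * ENNReal.ofReal (1 / (Real.pi * ν)) * δ * h z.1 := by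
  unfold duhamel
  rw [← integral_sub (integrable_duhamelKernel H hν hc hc' hV hg hz)
    (integrable_duhamelKernel H hν hc hc' hW hg hz)]
  refine (enorm_integral_le_lintegral_enorm _).trans ?_
  calc _ ≤ ∫⁻ ζ : R3 × ℝ, (2 * c * δ) * (ENNReal.ofReal (oseenGradMaj ν ζ) * h (z.1 - ζ.1) ^ 2) := by
        refine lintegral_mono_ae ?_
        filter_upwards [ae_sub_left hV.2 z, ae_sub_left hW.2 z, ae_sub_left hd z] with ζ h1 h2 h3
        have h0 := oseenGradMaj_nonneg hν ζ
        have e : duhamelKernel ν V g ζ (z - ζ) - duhamelKernel ν W g ζ (z - ζ)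
            = -(oseenGrad ν ζ (V (z - ζ)) (V (z - ζ)) - oseenGrad ν ζ (W (z - ζ)) (W (z - ζ))) := by
          simp only [duhamelKernel]; abel
        rw [e, enorm_neg]
        calc _ ≤ ENNReal.ofReal (oseenGradMaj ν ζ)
              * (‖V (z - ζ)‖ₑ + ‖W (z - ζ)‖ₑ) * ‖V (z - ζ) - W (z - ζ)‖ₑ := by
              rw [← ofReal_norm, ← ofReal_norm, ← ofReal_norm, ← ofReal_norm,
                ← ENNReal.ofReal_add (by positivity) (by positivity), ← ENNReal.ofReal_mul h0,
                ← ENNReal.ofReal_mul (by positivity)]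
              exact ENNReal.ofReal_le_ofReal (norm_oseenGrad_sub_le hν ζ _ _)
          _ ≤ ENNReal.ofReal (oseenGradMaj ν ζ)
              * (c * h (z - ζ).1 + c * h (z - ζ).1) * (δ * h (z - ζ).1) := by gcongr
          _ = _ := by rw [Prod.fst_sub]; ring
    _ = (2 * c * δ) * ∫⁻ ζ : R3 × ℝ, (ENNReal.ofReal (oseenGradMaj ν ζ) * h (z.1 - ζ.1) ^ 2) :=
        lintegral_const_mul' _ _ (by finiteness)
    _ ≤ (2 * c * δ) * (ENNReal.ofReal (1 / (Real.pi * ν)) * h z.1) := by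
        gcongr; exact H.lintegral_oseenGradMaj_mul_le hν z.1
    _ = _ := by ring

end Duhamel

/-! ### Pairing the Duhamel term with test functions -/

lemma integral_euclidean_apply {α : Type*} [MeasurableSpace α] {μ : Measure α} {f : α → R3}
    (hf : Integrable f μ) (i : Fin 3) : (∫ a, f a ∂μ) i = ∫ a, f a i ∂μ :=
  ((EuclideanSpace.proj (𝕜 := ℝ) i).integral_comp_comm hf).symm

lemma enorm_apply_le_enorm (a : R3) (i : Fin 3) : ‖a i‖ₑ ≤ ‖a‖ₑ := by
  rw [← ofReal_norm, ← ofReal_norm]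
  exact ENNReal.ofReal_le_ofReal (abs_apply_le_norm a i)

lemma MeasureTheory.AEStronglyMeasurable.euclidean_apply {α : Type*} [MeasurableSpace α]
    {μ : Measure α} {f : α → R3} (hf : AEStronglyMeasurable f μ) (i : Fin 3) :
    AEStronglyMeasurable (fun a => f a i) μ :=
  (EuclideanSpace.proj (𝕜 := ℝ) i).continuous.comp_aestronglyMeasurable hf

lemma enorm_le_ofReal_mul_stDecay {θ C : ℝ} {k : ℕ} {z : R3 × ℝ} (hC : 0 ≤ C)
    (h : |θ| ≤ C * stDecay k z) :
    ‖θ‖ₑ ≤ ENNReal.ofReal C * ENNReal.ofReal (stDecay k z) := by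
  rw [← ENNReal.ofReal_mul hC, ← ofReal_norm]
  exact ENNReal.ofReal_le_ofReal h

lemma integrable_smul_of_decay {F : Type*} [NormedAddCommGroup F] [NormedSpace ℝ F]
    {f : R3 × ℝ → F} {θ : R3 × ℝ → ℝ} {k : ℕ} {C : ℝ} (hC : 0 ≤ C)
    (hf : AEStronglyMeasurable f) (hfw : ∫⁻ z, ENNReal.ofReal (stDecay k z) * ‖f z‖ₑ < ∞)
    (hθ : AEStronglyMeasurable θ) (hθd : ∀ z, |θ z| ≤ C * stDecay k z) :
    Integrable fun z => θ z • f z := by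
  refine ⟨hθ.smul hf, ?_⟩
  refine lt_of_le_of_lt (b := ∫⁻ z, ENNReal.ofReal C * (ENNReal.ofReal (stDecay k z) * ‖f z‖ₑ))
    (lintegral_mono fun z => ?_) ?_
  · rw [enorm_smul, ← mul_assoc]
    gcongr
    exact enorm_le_ofReal_mul_stDecay hC (hθd z)
  · rw [lintegral_const_mul' _ _ ENNReal.ofReal_ne_top]
    exact ENNReal.mul_lt_top (by finiteness) hfw

section Pairing

variable {h h' : R3 → ℝ≥0∞} {ν : ℝ} {c c' : ℝ≥0∞} {V g : R3 × ℝ → R3}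

lemma lintegral_stDecay_mul_lt_top_of_le {F : Type*} [NormedAddCommGroup F] {k : ℕ}
    {w : R3 → ℝ≥0∞} (hw : ∫⁻ x, w x * ENNReal.ofReal ((1 + ‖x‖) ^ k)⁻¹ < ∞) (hc : c ≠ ∞)
    {f : R3 × ℝ → F} (hf : ∀ᵐ z, ‖f z‖ₑ ≤ c * w z.1) :
    ∫⁻ z, ENNReal.ofReal (stDecay k z) * ‖f z‖ₑ < ∞ := by
  refine lt_of_le_of_lt (b := ∫⁻ z : R3 × ℝ, c * (ENNReal.ofReal (stDecay k z) * w z.1))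
    (lintegral_mono_ae ?_) ?_
  · filter_upwards [hf] with z hz
    calc _ ≤ ENNReal.ofReal (stDecay k z) * (c * w z.1) := by gcongr
      _ = _ := by ring
  · rw [lintegral_const_mul' _ _ hc]
    exact ENNReal.mul_lt_top (by finiteness) ((lintegral_stDecay_mul_le k w).trans_lt
      (ENNReal.mul_lt_top (by finiteness) hw))

lemma IsControlled.lintegral_lt_top (H : IsMajorizingPair h h') (hc : c ≠ ∞)
    (hV : IsControlled c h V) : ∫⁻ z, ENNReal.ofReal (stDecay 3 z) * ‖V z‖ₑ < ∞ :=
  lintegral_stDecay_mul_lt_top_of_le H.lintegral_mul_lt_top hc hV.enorm_le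

lemma IsControlled.lintegral_lt_top' (H : IsMajorizingPair h h') (hc' : c' ≠ ∞)
    (hg : IsControlled c' h' g) : ∫⁻ z, ENNReal.ofReal (stDecay 1 z) * ‖g z‖ₑ < ∞ :=
  lintegral_stDecay_mul_lt_top_of_le H.lintegral_mul_lt_top' hc' hg.enorm_le

lemma IsControlled.lintegral_mul_lt_top (H : IsMajorizingPair h h') (hc : c ≠ ∞)
    (hV : IsControlled c h V) (i j : Fin 3) :
    ∫⁻ z, ENNReal.ofReal (stDecay 2 z) * ‖V z i * V z j‖ₑ < ∞ := by
  refine lintegral_stDecay_mul_lt_top_of_le (c := c ^ 2) (w := fun x => h x ^ 2)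
    H.lintegral_sq_mul_lt_top (by finiteness) ?_
  filter_upwards [hV.enorm_le] with z hz
  rw [enorm_mul, ← mul_pow, sq]
  exact mul_le_mul' ((enorm_apply_le_enorm _ _).trans hz) ((enorm_apply_le_enorm _ _).trans hz)

lemma lintegral_stDecay_apply_lt_top {k : ℕ} {f : R3 × ℝ → R3}
    (hf : ∫⁻ z, ENNReal.ofReal (stDecay k z) * ‖f z‖ₑ < ∞) (i : Fin 3) :
    ∫⁻ z, ENNReal.ofReal (stDecay k z) * ‖f z i‖ₑ < ∞ :=
  lt_of_le_of_lt (lintegral_mono fun z => by gcongr; exact enorm_apply_le_enorm _ _) hf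

lemma lintegral_stDecay_lt_top_of_le {F : Type*} [NormedAddCommGroup F] {k l : ℕ} (hkl : k ≤ l)
    {f : R3 × ℝ → F} (hf : ∫⁻ z, ENNReal.ofReal (stDecay k z) * ‖f z‖ₑ < ∞) :
    ∫⁻ z, ENNReal.ofReal (stDecay l z) * ‖f z‖ₑ < ∞ :=
  lt_of_le_of_lt (lintegral_mono fun z => by gcongr; exact stDecay_anti hkl z) hf

/-- The measure preserving shear `(z, ζ) ↦ (z - ζ, ζ)` moves the convolution onto `θ`. Absolute
integrability holds because the Duhamel term is at most a multiple of `h`, which is integrable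
against the decay of `θ`. -/
lemma integral_duhamel_mul (H : IsMajorizingPair h h') (hν : 0 < ν) (hc : c ≠ ∞) (hc' : c' ≠ ∞)
    (hV : IsControlled c h V) (hg : IsControlled c' h' g) {θ : R3 × ℝ → ℝ}
    (hθ : Continuous θ) {C : ℝ} (hC : 0 ≤ C) (hθd : ∀ z, |θ z| ≤ C * stDecay 3 z) (i : Fin 3) :
    Integrable (fun z => ∫ ζ, duhamelKernel ν V g ζ z i * θ (z + ζ)) ∧
      ∫ z, duhamel ν V g z i * θ z = ∫ z, ∫ ζ, duhamelKernel ν V g ζ z i * θ (z + ζ) := by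
  have hmp := measurePreserving_sub_prod (volume : Measure (R3 × ℝ)) (volume : Measure (R3 × ℝ))
  set G : (R3 × ℝ) × (R3 × ℝ) → ℝ := fun q => duhamelKernel ν V g q.2 q.1 i * θ (q.1 + q.2)
  have hGm : AEStronglyMeasurable G (volume.prod volume) := by
    refine AEStronglyMeasurable.mul ?_ (by fun_prop)
    exact (aestronglyMeasurable_duhamelKernel (f := Prod.snd) (k := Prod.fst) (by fun_prop)
      (hV.1.aemeasurable.comp_quasiMeasurePreserving Measure.quasiMeasurePreserving_fst)
      (hg.1.aemeasurable.comp_quasiMeasurePreserving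
        Measure.quasiMeasurePreserving_fst)).euclidean_apply i
  have hFm : AEStronglyMeasurable (fun q : (R3 × ℝ) × (R3 × ℝ) =>
      duhamelKernel ν V g q.2 (q.1 - q.2) i * θ q.1) (volume.prod volume) := by
    have := hGm.comp_quasiMeasurePreserving hmp.quasiMeasurePreserving
    simpa only [G, Function.comp_def, sub_add_cancel] using this
  have hF : Integrable (fun q : (R3 × ℝ) × (R3 × ℝ) =>
      duhamelKernel ν V g q.2 (q.1 - q.2) i * θ q.1) (volume.prod volume) := by
    refine ⟨hFm, ?_⟩
    set D := c' * ENNReal.ofReal (1 / (2 * Real.pi * ν)) + c ^ 2 * ENNReal.ofReal (1 / (Real.pi * ν))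
    refine lt_of_le_of_lt (lintegral_prod_le _) ?_
    refine lt_of_le_of_lt (b := ∫⁻ z : R3 × ℝ, ENNReal.ofReal C * D
      * (ENNReal.ofReal (stDecay 3 z) * h z.1)) (lintegral_mono fun z => ?_) ?_
    · simp only [enorm_mul]
      rw [lintegral_mul_const' _ _ (by finiteness)]
      calc _ ≤ (D * h z.1) * (ENNReal.ofReal C * ENNReal.ofReal (stDecay 3 z)) := by
            gcongr
            · refine le_trans (lintegral_mono fun ζ => ?_)
                (lintegral_duhamelKernel_le H hν hc hc' hV.2 hg.2 z)
              exact (enorm_apply_le_enorm _ _).trans (enorm_duhamelKernel_le hν V g ζ (z - ζ))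
            · exact enorm_le_ofReal_mul_stDecay hC (hθd z)
        _ = _ := by ring
    · rw [lintegral_const_mul' _ _ (by finiteness)]
      exact ENNReal.mul_lt_top (by finiteness) H.lintegral_stDecay_mul_lt_top
  have hGi : Integrable G (volume.prod volume) := by
    rw [← hmp.integrable_comp hGm]
    simpa only [G, Function.comp_def, sub_add_cancel] using hF
  refine ⟨hGi.integral_prod_left, ?_⟩
  calc ∫ z, duhamel ν V g z i * θ z
      = ∫ z, ∫ ζ, duhamelKernel ν V g ζ (z - ζ) i * θ z := by
        refine integral_congr_ae ?_
        have hfin : ∀ᵐ z : R3 × ℝ, h z.1 < ∞ :=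
          Measure.quasiMeasurePreserving_fst.ae H.ae_lt_top
        filter_upwards [hfin] with z hz
        rw [integral_mul_const, duhamel,
          integral_euclidean_apply (integrable_duhamelKernel H hν hc hc' hV hg hz.ne)]
    _ = ∫ q, (fun q : (R3 × ℝ) × (R3 × ℝ) =>
      duhamelKernel ν V g q.2 (q.1 - q.2) i * θ q.1) q ∂(volume.prod volume) :=
        (integral_prod _ hF).symm
    _ = ∫ q, G q ∂(volume.prod volume) := by
        conv_rhs => rw [← hmp.map_eq]
        rw [integral_map hmp.aemeasurable (by rw [hmp.map_eq]; exact hGm)]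
        simp only [G, sub_add_cancel]
    _ = _ := integral_prod _ hGi

lemma IsSmoothCompact.integral_duhamelKernel_mul (hν : 0 < ν) {θ : R3 × ℝ → ℝ}
    (hθ : IsSmoothCompact θ) (V g : R3 × ℝ → R3) (i : Fin 3) (z : R3 × ℝ) :
    ∫ ζ, duhamelKernel ν V g ζ z i * θ (z + ζ)
      = (∫ ζ, oseen ν ζ (g z) i * θ (z + ζ)) - ∫ ζ, oseenGrad ν ζ (V z) (V z) i * θ (z + ζ) := by
  rw [← integral_sub (hθ.integrable_oseen_mul hν _ i z) (hθ.integrable_oseenGrad_mul hν _ _ i z)]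
  simp only [duhamelKernel, PiLp.sub_apply, sub_mul]

/-- The pairing of the pressure gradient with a test function is the integral of this density. -/
noncomputable def pressureDensity (ν : ℝ) (V g : R3 × ℝ → R3) (ψ : R3 × ℝ → ℝ) (z : R3 × ℝ) : ℝ :=
  (∑ j, g z j * rieszConv ν j ψ z)
    + ∑ j, ∑ k, V z j * V z k * rieszConv ν j (dirDeriv (spatialDir k) ψ) z

lemma IsSmoothCompact.rieszConv_dirDeriv (hν : 0 < ν) {ψ : R3 × ℝ → ℝ}
    (hψ : IsSmoothCompact ψ) (a : R3) (j : Fin 3) (z : R3 × ℝ) :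
    rieszConv ν j (dirDeriv (a, 0) ψ) z
      = ∑ k, a k * rieszConv ν j (dirDeriv (spatialDir k) ψ) z := by
  unfold rieszConv
  simp_rw [dirDeriv_space_eq_sum ψ a, Finset.mul_sum, ← integral_const_mul]
  rw [integral_finsetSum]
  · refine Finset.sum_congr rfl fun k _ => ?_
    congr 1; funext y; ring
  · intro k _
    refine (((hψ.dirDeriv (spatialDir k)).integrable_rieszKernel_mul hν j z).const_mul (a k)).congr
      (Eventually.of_forall fun y => ?_)
    simp only; ring

/-- The local terms are those of the weak momentum equation. The Riesz terms depend on `φ` only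
through `∂ᵢφ`, and therefore form a pressure gradient. -/
lemma IsSmoothCompact.integral_duhamelKernel_mul_heatAdj (hν : 0 < ν) {φ : R3 × ℝ → ℝ}
    (hφ : IsSmoothCompact φ) (V g : R3 × ℝ → R3) (i : Fin 3) (z : R3 × ℝ) :
    ∫ ζ, duhamelKernel ν V g ζ z i * heatAdj ν φ (z + ζ)
      = -(g z i * φ z) - (∑ k, V z i * V z k * dirDeriv (spatialDir k) φ z)
        + pressureDensity ν V g (dirDeriv (spatialDir i) φ) z := by
  rw [(hφ.heatAdj ν).integral_duhamelKernel_mul hν, hφ.integral_oseen_mul_heatAdj hν,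
    hφ.integral_oseenGrad_mul_heatAdj hν, dirDeriv_space_eq_sum φ (V z), Finset.mul_sum]
  simp_rw [hφ.dirDeriv_comm (spatialDir i) (V z, 0),
    fun j => (hφ.dirDeriv (spatialDir i)).rieszConv_dirDeriv hν (V z) j z, pressureDensity,
    Finset.mul_sum, mul_assoc]
  ring

lemma integral_duhamel_mul_heatAdj (H : IsMajorizingPair h h') (hν : 0 < ν) (hc : c ≠ ∞)
    (hc' : c' ≠ ∞) (hV : IsControlled c h V) (hg : IsControlled c' h' g) {φ : R3 × ℝ → ℝ}
    (hφ : IsSmoothCompact φ) (i : Fin 3) :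
    Integrable (fun z => -(g z i * φ z) - (∑ k, V z i * V z k * dirDeriv (spatialDir k) φ z)
        + pressureDensity ν V g (dirDeriv (spatialDir i) φ) z) ∧
    ∫ z, duhamel ν V g z i * heatAdj ν φ z
      = ∫ z, (-(g z i * φ z) - (∑ k, V z i * V z k * dirDeriv (spatialDir k) φ z)
        + pressureDensity ν V g (dirDeriv (spatialDir i) φ) z) := by
  obtain ⟨C, hC, hd⟩ := (hφ.heatAdj ν).exists_decay 3
  have := integral_duhamel_mul H hν hc hc' hV hg (hφ.heatAdj ν).continuous hC.le hd i
  simpa only [hφ.integral_duhamelKernel_mul_heatAdj hν] using this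

lemma sum_integral_duhamel_mul (H : IsMajorizingPair h h') (hν : 0 < ν) (hc : c ≠ ∞)
    (hc' : c' ≠ ∞) (hV : IsControlled c h V) (hg : IsControlled c' h' g) {φ : R3 × ℝ → ℝ}
    (hφ : IsSmoothCompact φ) :
    ∑ i, ∫ z, duhamel ν V g z i * dirDeriv (spatialDir i) φ z = 0 := by
  have h1 : ∀ i : Fin 3,
      Integrable (fun z => ∫ ζ, duhamelKernel ν V g ζ z i * dirDeriv (spatialDir i) φ (z + ζ)) ∧
      ∫ z, duhamel ν V g z i * dirDeriv (spatialDir i) φ z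
        = ∫ z, ∫ ζ, duhamelKernel ν V g ζ z i * dirDeriv (spatialDir i) φ (z + ζ) := fun i => by
    obtain ⟨C, hC, hd⟩ := (hφ.dirDeriv (spatialDir i)).exists_decay 3
    exact integral_duhamel_mul H hν hc hc' hV hg (hφ.dirDeriv (spatialDir i)).continuous hC.le hd i
  simp_rw [fun i => (h1 i).2]
  rw [← integral_finsetSum _ fun i _ => (h1 i).1]
  refine integral_eq_zero_of_ae (Eventually.of_forall fun z => ?_)
  simp_rw [fun i => (hφ.dirDeriv (spatialDir i)).integral_duhamelKernel_mul hν V g i z]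
  rw [Finset.sum_sub_distrib, hφ.sum_integral_oseen_mul hν, hφ.sum_integral_oseenGrad_mul hν]
  simp

end Pairing

/-! ### Tempered distributions given by integrals -/

/-- A seminorm on Schwartz functions that controls their decay. -/
noncomputable def decaySeminorm (ψ : 𝓢(R3 × ℝ, ℝ)) : ℝ :=
  (Finset.Iic ((8, 0) : ℕ × ℕ)).sup (schwartzSeminormFamily ℝ (R3 × ℝ) ℝ) ψ

lemma decaySeminorm_nonneg (ψ : 𝓢(R3 × ℝ, ℝ)) : 0 ≤ decaySeminorm ψ := apply_nonneg _ _

/-- Of the eight powers of decay, six are spent on space and two on time. -/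
lemma abs_schwartz_le (ψ : 𝓢(R3 × ℝ, ℝ)) (z : R3 × ℝ) :
    |ψ z| ≤ 2 ^ 8 * decaySeminorm ψ * stDecay 6 z := by
  have h1 := SchwartzMap.one_add_le_sup_seminorm_apply (𝕜 := ℝ) (m := (8, 0)) (k := 8) (n := 0)
    le_rfl le_rfl ψ z
  rw [norm_iteratedFDeriv_zero, Real.norm_eq_abs] at h1
  have h2 : (1 + ‖z.1‖) ^ 6 * (1 + z.2 ^ 2) ≤ (1 + ‖z‖) ^ 8 := by
    have e1 : ‖z.1‖ ≤ ‖z‖ := norm_fst_le z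
    have e2 : |z.2| ≤ ‖z‖ := norm_snd_le z
    have e3 : 1 + z.2 ^ 2 ≤ (1 + ‖z‖) ^ 2 := by
      rw [← sq_abs z.2]
      nlinarith [abs_nonneg z.2]
    calc _ ≤ (1 + ‖z‖) ^ 6 * (1 + ‖z‖) ^ 2 := by gcongr
      _ = _ := by ring
  rw [stDecay, ← mul_inv, ← div_eq_mul_inv, le_div_iff₀ (by positivity), mul_comm]
  exact (mul_le_mul_of_nonneg_right h2 (abs_nonneg _)).trans h1

/-- The map `A` is the identity for the velocity, and a convolution with a Riesz kernel for the
pressure. Weighted integrability of `f` together with a seminorm bound on `A ψ` yields continuity on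
the Schwartz space. -/
lemma exists_clm_eq_integral {F : Type*} [NormedAddCommGroup F] [NormedSpace ℝ F]
    {f : R3 × ℝ → F} {k : ℕ} (hf : AEStronglyMeasurable f)
    (hfw : ∫⁻ z, ENNReal.ofReal (stDecay k z) * ‖f z‖ₑ < ∞)
    (A : 𝓢(R3 × ℝ, ℝ) → R3 × ℝ → ℝ) (hadd : ∀ φ ψ z, A (φ + ψ) z = A φ z + A ψ z)
    (hsmul : ∀ (r : ℝ) ψ z, A (r • ψ) z = r * A ψ z) (hA : ∀ ψ, AEStronglyMeasurable (A ψ))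
    {C : ℝ} (hC : 0 ≤ C) (hb : ∀ ψ z, |A ψ z| ≤ C * decaySeminorm ψ * stDecay k z) :
    ∃ T : 𝓢(R3 × ℝ, ℝ) →L[ℝ] F, ∀ ψ, T ψ = ∫ z, A ψ z • f z := by
  have hi : ∀ ψ, Integrable fun z => A ψ z • f z := fun ψ =>
    integrable_smul_of_decay (mul_nonneg hC (decaySeminorm_nonneg ψ)) hf hfw (hA ψ) (hb ψ)
  refine ⟨SchwartzMap.mkCLMtoNormedSpace (fun ψ => ∫ z, A ψ z • f z) (fun φ ψ => ?_)
    (fun r ψ => ?_) ⟨Finset.Iic (8, 0),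
      C * (∫⁻ z, ENNReal.ofReal (stDecay k z) * ‖f z‖ₑ).toReal, by positivity, fun ψ => ?_⟩,
    fun ψ => rfl⟩
  · simp_rw [hadd, add_smul]
    exact integral_add (hi φ) (hi ψ)
  · simp_rw [hsmul, mul_smul, integral_smul]
    rfl
  · change _ ≤ _ * decaySeminorm ψ
    have h0 := decaySeminorm_nonneg ψ
    rw [← ENNReal.ofReal_le_ofReal_iff (by positivity), ofReal_norm]
    refine (enorm_integral_le_lintegral_enorm _).trans ?_
    calc _ ≤ ∫⁻ z, ENNReal.ofReal (C * decaySeminorm ψ)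
          * (ENNReal.ofReal (stDecay k z) * ‖f z‖ₑ) := by
          refine lintegral_mono fun z => ?_
          rw [enorm_smul, ← mul_assoc]
          gcongr
          exact enorm_le_ofReal_mul_stDecay (by positivity) (hb ψ z)
      _ = ENNReal.ofReal (C * decaySeminorm ψ) * ∫⁻ z, ENNReal.ofReal (stDecay k z) * ‖f z‖ₑ :=
          lintegral_const_mul' _ _ ENNReal.ofReal_ne_top
      _ = _ := by
          rw [mul_right_comm, ENNReal.ofReal_mul (by positivity : 0 ≤ C * decaySeminorm ψ),
            ENNReal.ofReal_toReal hfw.ne]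

lemma lintegral_riesz_decay_le : ∃ C : ℝ≥0∞, C ≠ ∞ ∧ ∀ x : R3,
    ∫⁻ y, (‖y‖ₑ ^ 2)⁻¹ * ENNReal.ofReal ((1 + ‖x + y‖) ^ 6)⁻¹
      ≤ C * ENNReal.ofReal ((1 + ‖x‖) ^ 2)⁻¹ := by
  have h4 : ∫⁻ x : R3, ENNReal.ofReal ((1 + ‖x‖) ^ 4)⁻¹ < ∞ := by
    have := (integrable_one_add_norm (E := R3) (μ := volume) (r := 4)
      (by simp; norm_num)).lintegral_lt_top
    refine lt_of_le_of_lt (lintegral_mono fun x => ?_) this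
    refine ENNReal.ofReal_le_ofReal (le_of_eq ?_)
    rw [Real.rpow_neg (by positivity)]
    norm_cast
  have hball := lintegral_closedBall_enorm_inv_sq_lt_top 1
  set A := ∫⁻ y in Metric.closedBall (0 : R3) 1, (‖y‖ₑ ^ 2)⁻¹
  set B := ∫⁻ x : R3, ENNReal.ofReal ((1 + ‖x‖) ^ 4)⁻¹
  refine ⟨ENNReal.ofReal 2 * (A + ENNReal.ofReal 2 * B), by finiteness, fun x => ?_⟩
  have hB : ∫⁻ y : R3, ENNReal.ofReal ((1 + ‖x + y‖) ^ 4)⁻¹ = B :=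
    lintegral_add_left_eq_self (fun y : R3 => ENNReal.ofReal ((1 + ‖y‖) ^ 4)⁻¹) x
  have hpt : ∀ᵐ y : R3, (‖y‖ₑ ^ 2)⁻¹ * ENNReal.ofReal ((1 + ‖x + y‖) ^ 6)⁻¹
      ≤ ENNReal.ofReal 2 * ENNReal.ofReal ((1 + ‖x‖) ^ 2)⁻¹
        * ((Metric.closedBall (0 : R3) 1).indicator (fun y => (‖y‖ₑ ^ 2)⁻¹) y
          + ENNReal.ofReal 2 * ENNReal.ofReal ((1 + ‖x + y‖) ^ 4)⁻¹) := by
    filter_upwards [Measure.ae_ne volume (0 : R3)] with y hy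
    have hr : 0 < ‖y‖ := norm_pos_iff.2 hy
    set a := 1 + ‖x + y‖ with ha
    have ha1 : 1 ≤ a := by simp [ha]
    have hB0 : 0 < 1 + ‖x‖ := by positivity
    have hle : 1 + ‖x‖ ≤ a + ‖y‖ := by
      have := norm_sub_le (x + y) y
      rw [add_sub_cancel_right] at this
      linarith
    have hind : ENNReal.ofReal (if ‖y‖ ≤ 1 then (‖y‖ ^ 2)⁻¹ else 0)
        = (Metric.closedBall (0 : R3) 1).indicator (fun y => (‖y‖ₑ ^ 2)⁻¹) y := by
      by_cases h1 : ‖y‖ ≤ 1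
      · rw [if_pos h1, indicator_of_mem (by simpa using h1), ENNReal.ofReal_inv_of_pos (by positivity),
          ENNReal.ofReal_pow hr.le, ofReal_norm]
      · rw [if_neg h1, indicator_of_notMem (by simpa using h1), ENNReal.ofReal_zero]
    rw [← hind, ← ofReal_norm, ← ENNReal.ofReal_pow hr.le, ← ENNReal.ofReal_inv_of_pos (by positivity),
      ← ENNReal.ofReal_mul (by positivity), ← ENNReal.ofReal_mul (by positivity),
      ← ENNReal.ofReal_mul (by positivity), ← ENNReal.ofReal_add (by positivity) (by positivity),
      ← ENNReal.ofReal_mul (by positivity)]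
    refine ENNReal.ofReal_le_ofReal ?_
    -- Since `1 + |x| ≤ a + |y|`, the decay in `x` is paid for either by two of the six powers of
    -- `a` or by the factor `|y|⁻²`. The rest is integrable: `|y|⁻²` near the origin, `a⁻⁴`
    -- elsewhere.
    have e1 : (1 + ‖x‖) ^ 2 ≤ 2 * (a ^ 2 + ‖y‖ ^ 2) := by nlinarith [sq_nonneg (a - ‖y‖)]
    have e2 : (‖y‖ ^ 2)⁻¹ * (a ^ 6)⁻¹
        ≤ 2 * ((1 + ‖x‖) ^ 2)⁻¹ * ((‖y‖ ^ 2)⁻¹ * (a ^ 4)⁻¹ + (a ^ 6)⁻¹) := by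
      rw [← sub_nonneg]
      have : 2 * ((1 + ‖x‖) ^ 2)⁻¹ * ((‖y‖ ^ 2)⁻¹ * (a ^ 4)⁻¹ + (a ^ 6)⁻¹)
          - (‖y‖ ^ 2)⁻¹ * (a ^ 6)⁻¹ = (2 * (a ^ 2 + ‖y‖ ^ 2) - (1 + ‖x‖) ^ 2)
            * (((1 + ‖x‖) ^ 2)⁻¹ * (‖y‖ ^ 2)⁻¹ * (a ^ 6)⁻¹) := by field_simp
      rw [this]
      exact mul_nonneg (by linarith) (by positivity)
    refine e2.trans (mul_le_mul_of_nonneg_left ?_ (by positivity))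
    have e3 : (a ^ 6)⁻¹ ≤ (a ^ 4)⁻¹ := by gcongr; norm_num
    have e4 : (a ^ 4)⁻¹ ≤ 1 := inv_le_one_of_one_le₀ (one_le_pow₀ ha1)
    have e5 : 0 ≤ (a ^ 4)⁻¹ := by positivity
    split_ifs with h1
    · have : (‖y‖ ^ 2)⁻¹ * (a ^ 4)⁻¹ ≤ (‖y‖ ^ 2)⁻¹ := mul_le_of_le_one_right (by positivity) e4
      linarith
    · have : (‖y‖ ^ 2)⁻¹ * (a ^ 4)⁻¹ ≤ (a ^ 4)⁻¹ :=
        mul_le_of_le_one_left (by positivity) (inv_le_one_of_one_le₀ (one_le_pow₀ (by linarith)))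
      linarith
  refine (lintegral_mono_ae hpt).trans (le_of_eq ?_)
  rw [lintegral_const_mul' _ _ (by finiteness), lintegral_add_right _ (by fun_prop),
    lintegral_indicator Metric.isClosed_closedBall.measurableSet,
    lintegral_const_mul' _ _ (by finiteness), hB]
  ring

lemma aestronglyMeasurable_rieszConv {ν : ℝ} (j : Fin 3) {ψ : R3 × ℝ → ℝ} (hψ : Continuous ψ) :
    AEStronglyMeasurable (rieszConv ν j ψ) := by
  unfold rieszConv
  have h1 : StronglyMeasurable fun p : (R3 × ℝ) × R3 => rieszKernel ν p.2 j * ψ (p.1 + (p.2, 0)) := by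
    have := hψ.measurable
    exact Measurable.stronglyMeasurable (by fun_prop)
  exact h1.integral_prod_right'.aestronglyMeasurable

lemma exists_rieszConv_schwartz_le {ν : ℝ} (hν : 0 < ν) : ∃ C : ℝ, 0 ≤ C ∧
    ∀ (j : Fin 3) (ψ : 𝓢(R3 × ℝ, ℝ)) z,
      Integrable (fun y => rieszKernel ν y j * ψ (z + (y, 0))) ∧
      |rieszConv ν j ψ z| ≤ C * decaySeminorm ψ * stDecay 2 z := by
  obtain ⟨C, hC, hb⟩ := lintegral_riesz_decay_le
  refine ⟨2 ^ 8 * (ENNReal.ofReal (1 / (2 * Real.pi)) * C).toReal, by positivity, fun j ψ z => ?_⟩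
  have h0 := decaySeminorm_nonneg ψ
  have hl : ∫⁻ y, ‖rieszKernel ν y j * ψ (z + (y, 0))‖ₑ
      ≤ ENNReal.ofReal (2 ^ 8 * (ENNReal.ofReal (1 / (2 * Real.pi)) * C).toReal
        * decaySeminorm ψ * stDecay 2 z) := by
    calc _ ≤ ∫⁻ y, ENNReal.ofReal (1 / (2 * Real.pi))
          * (ENNReal.ofReal (2 ^ 8 * decaySeminorm ψ) * ENNReal.ofReal (1 + z.2 ^ 2)⁻¹)
          * ((‖y‖ₑ ^ 2)⁻¹ * ENNReal.ofReal ((1 + ‖z.1 + y‖) ^ 6)⁻¹) := by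
          refine lintegral_mono fun y => ?_
          rw [enorm_mul]
          calc _ ≤ (ENNReal.ofReal (1 / (2 * Real.pi)) * (‖y‖ₑ ^ 2)⁻¹)
                * (ENNReal.ofReal (2 ^ 8 * decaySeminorm ψ)
                  * ENNReal.ofReal (stDecay 6 (z + (y, 0)))) :=
                mul_le_mul' (enorm_rieszKernel_apply_le hν y j)
                  (enorm_le_ofReal_mul_stDecay (by positivity) (abs_schwartz_le ψ _))
            _ = _ := by
                simp only [stDecay, Prod.fst_add, Prod.snd_add, add_zero]
                rw [ENNReal.ofReal_mul (by positivity : 0 ≤ ((1 + ‖z.1 + y‖) ^ 6)⁻¹)]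
                ring
      _ ≤ ENNReal.ofReal (1 / (2 * Real.pi))
          * (ENNReal.ofReal (2 ^ 8 * decaySeminorm ψ) * ENNReal.ofReal (1 + z.2 ^ 2)⁻¹)
          * (C * ENNReal.ofReal ((1 + ‖z.1‖) ^ 2)⁻¹) := by
          rw [lintegral_const_mul' _ _ (by finiteness)]
          gcongr
          exact hb z.1
      _ = _ := by
          rw [stDecay, mul_right_comm _ _ (decaySeminorm ψ),
            ENNReal.ofReal_mul (by positivity : 0 ≤ 2 ^ 8 * decaySeminorm ψ
              * (ENNReal.ofReal (1 / (2 * Real.pi)) * C).toReal),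
            ENNReal.ofReal_mul (by positivity : 0 ≤ ((1 + ‖z.1‖) ^ 2)⁻¹),
            ENNReal.ofReal_mul (by positivity : 0 ≤ 2 ^ 8 * decaySeminorm ψ),
            ENNReal.ofReal_toReal (by finiteness)]
          ring
  refine ⟨⟨?_, hl.trans_lt (by finiteness)⟩, ?_⟩
  · have h1 : Continuous fun y : R3 => ψ (z + (y, 0)) := ψ.continuous.comp (by fun_prop)
    exact (by fun_prop : Measurable fun y => rieszKernel ν y j).aestronglyMeasurable.mul
      h1.aestronglyMeasurable
  · have := stDecay_pos 2 z
    rw [← ENNReal.ofReal_le_ofReal_iff (by positivity), ← Real.norm_eq_abs, ofReal_norm]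
    exact (enorm_integral_le_lintegral_enorm _).trans hl

lemma exists_clm_rieszConv {ν : ℝ} (hν : 0 < ν) (j : Fin 3) {f : R3 × ℝ → ℝ}
    (hf : AEStronglyMeasurable f) (hfw : ∫⁻ z, ENNReal.ofReal (stDecay 2 z) * ‖f z‖ₑ < ∞) :
    ∃ T : 𝓢(R3 × ℝ, ℝ) →L[ℝ] ℝ, ∀ ψ : 𝓢(R3 × ℝ, ℝ),
      Integrable (fun z => f z * rieszConv ν j ψ z) ∧ T ψ = ∫ z, f z * rieszConv ν j ψ z := by
  obtain ⟨C, hC, hb⟩ := exists_rieszConv_schwartz_le hν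
  obtain ⟨T, hT⟩ := exists_clm_eq_integral hf hfw (fun ψ => rieszConv ν j ψ)
    (fun φ ψ z => by
      unfold rieszConv
      rw [← integral_add (hb j φ z).1 (hb j ψ z).1]
      simp only [add_apply, mul_add])
    (fun r ψ z => by
      unfold rieszConv
      rw [← integral_const_mul]
      congr 1; funext y
      simp only [smul_apply, smul_eq_mul]; ring)
    (fun ψ => aestronglyMeasurable_rieszConv j ψ.continuous) hC (fun ψ z => (hb j ψ z).2)
  refine ⟨T, fun ψ => ⟨?_, ?_⟩⟩
  · have := integrable_smul_of_decay (mul_nonneg hC (decaySeminorm_nonneg ψ)) hf hfw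
      (aestronglyMeasurable_rieszConv (ν := ν) j ψ.continuous) (fun z => (hb j ψ z).2)
    simpa only [smul_eq_mul, mul_comm] using this
  · rw [hT]
    simp only [smul_eq_mul, mul_comm]

lemma dirDeriv_schwartz (v : R3 × ℝ) (ψ : 𝓢(R3 × ℝ, ℝ)) : dirDeriv v ψ = (∂_{v} ψ : 𝓢(R3 × ℝ, ℝ)) := by
  funext z
  rw [SchwartzMap.lineDerivOp_apply_eq_fderiv]
  rfl

/-- The Riesz convolution of a Schwartz function decays like `|x|⁻²`, which is enough for `VᵢVⱼ` and
for `g` under their weights. The pressure is therefore a tempered distribution on all of space-time.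
-/
lemma exists_clm_pressure {ν : ℝ} (hν : 0 < ν) {V g : R3 × ℝ → R3}
    (hV : AEStronglyMeasurable V) (hg : AEStronglyMeasurable g)
    (hVw : ∀ i j, ∫⁻ z, ENNReal.ofReal (stDecay 2 z) * ‖V z i * V z j‖ₑ < ∞)
    (hgw : ∫⁻ z, ENNReal.ofReal (stDecay 1 z) * ‖g z‖ₑ < ∞) :
    ∃ p : 𝓢(R3 × ℝ, ℝ) →L[ℝ] ℝ, ∀ ψ : 𝓢(R3 × ℝ, ℝ),
      Integrable (pressureDensity ν V g ψ) ∧ p ψ = ∫ z, pressureDensity ν V g ψ z := by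
  choose T hT using fun j : Fin 3 => exists_clm_rieszConv hν j (hg.euclidean_apply j)
    (lintegral_stDecay_apply_lt_top (lintegral_stDecay_lt_top_of_le one_le_two hgw) j)
  choose S hS using fun j k : Fin 3 => exists_clm_rieszConv hν j
    ((hV.euclidean_apply j).mul (hV.euclidean_apply k)) (hVw j k)
  have hi : ∀ ψ : 𝓢(R3 × ℝ, ℝ), ∀ j k : Fin 3, Integrable fun z =>
      V z j * V z k * rieszConv ν j (dirDeriv (spatialDir k) ψ) z := fun ψ j k => by
    rw [dirDeriv_schwartz]; exact (hS j k _).1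
  have h1 : ∀ ψ : 𝓢(R3 × ℝ, ℝ), Integrable fun z => ∑ j, g z j * rieszConv ν j ψ z := fun ψ =>
    integrable_finsetSum _ fun j _ => (hT j ψ).1
  have h2 : ∀ ψ : 𝓢(R3 × ℝ, ℝ), Integrable fun z => ∑ j, ∑ k,
      V z j * V z k * rieszConv ν j (dirDeriv (spatialDir k) ψ) z := fun ψ =>
    integrable_finsetSum _ fun j _ => integrable_finsetSum _ fun k _ => hi ψ j k
  refine ⟨∑ j, T j + ∑ j, ∑ k,
    (S j k).comp (LineDeriv.lineDerivOpCLM ℝ (𝓢(R3 × ℝ, ℝ)) (spatialDir k)), fun ψ => ⟨?_, ?_⟩⟩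
  · exact (h1 ψ).add (h2 ψ)
  · unfold pressureDensity
    rw [integral_add (h1 ψ) (h2 ψ), integral_finsetSum _ fun j _ => (hT j ψ).1,
      integral_finsetSum _ fun j _ => integrable_finsetSum _ fun k _ => hi ψ j k]
    simp_rw [fun j : Fin 3 => integral_finsetSum Finset.univ fun k (_ : k ∈ Finset.univ) => hi ψ j k]
    simp only [add_apply, sum_apply,
      ContinuousLinearMap.comp_apply, LineDeriv.lineDerivOpCLM_apply, dirDeriv_schwartz,
      (hT _ ψ).2, (hS _ _ _).2, Pi.mul_apply]

/-! ### The heat flow of the initial velocity -/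

lemma MeasureTheory.Integrable.euclidean_apply {α : Type*} [MeasurableSpace α]
    {μ : Measure α} {f : α → R3} (hf : Integrable f μ) (i : Fin 3) :
    Integrable (fun a => f a i) μ :=
  (EuclideanSpace.proj (𝕜 := ℝ) i).integrable_comp hf

/-- Half of the Gaussian exponent pays for decay in `r`; the other half is the heat kernel at twice
the time, up to the factor `2^{3/2}` of the normalizations. -/
lemma heatKernel_le_two_mul {τ T r : ℝ} (hτ : 0 < τ) (hτT : τ ≤ T) {y : R3} (hr : 0 ≤ r)
    (hy : r ≤ 2 * ‖y‖) :
    heatKernel τ y ≤ 2 ^ (3 / 2 : ℝ) * Real.exp (-r ^ 2 / (32 * T)) * heatKernel (2 * τ) y := by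
  have hp := Real.pi_pos
  have e1 : Real.exp (-‖y‖ ^ 2 / (4 * τ))
      ≤ Real.exp (-r ^ 2 / (32 * T)) * Real.exp (-‖y‖ ^ 2 / (4 * (2 * τ))) := by
    rw [← Real.exp_add]
    refine Real.exp_le_exp.2 ?_
    have h1 : r ^ 2 ≤ 4 * ‖y‖ ^ 2 := by nlinarith
    have h2 : r ^ 2 / (32 * T) ≤ 4 * ‖y‖ ^ 2 / (32 * τ) := by gcongr
    have h3 : -‖y‖ ^ 2 / (4 * τ) = -(4 * ‖y‖ ^ 2 / (32 * τ)) + -‖y‖ ^ 2 / (4 * (2 * τ)) := by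
      field_simp; ring
    rw [h3, neg_div, neg_div]
    linarith
  have e2 : (4 * Real.pi * τ) ^ (-(3 / 2) : ℝ)
      = 2 ^ (3 / 2 : ℝ) * (4 * Real.pi * (2 * τ)) ^ (-(3 / 2) : ℝ) := by
    rw [show 4 * Real.pi * (2 * τ) = 2 * (4 * Real.pi * τ) by ring,
      Real.mul_rpow (x := 2) (by norm_num) (by positivity), ← mul_assoc,
      ← Real.rpow_add (by norm_num)]
    norm_num
  unfold heatKernel
  rw [e2]
  calc _ ≤ 2 ^ (3 / 2 : ℝ) * (4 * Real.pi * (2 * τ)) ^ (-(3 / 2) : ℝ)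
        * (Real.exp (-r ^ 2 / (32 * T)) * Real.exp (-‖y‖ ^ 2 / (4 * (2 * τ)))) := by gcongr
    _ = _ := by ring

/-- Gaussian decay of the heat flow of a compactly supported function, uniform up to time zero. -/
lemma IsSmoothCompact.exists_lintegral_heatKernel_mul_le {φ : R3 × ℝ → ℝ} (hφ : IsSmoothCompact φ)
    {T : ℝ} (hT : 0 < T) : ∃ C : ℝ, 0 < C ∧ ∀ τ, 0 < τ → τ ≤ T → ∀ z : R3 × ℝ,
      ∫⁻ y, ‖heatKernel τ y * φ (z + (y, 0))‖ₑ
        ≤ ENNReal.ofReal (C * Real.exp (-‖z.1‖ ^ 2 / (32 * T))) := by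
  obtain ⟨C, R, hC, hR, hb, hs⟩ := hφ.exists_bound
  refine ⟨C * (2 ^ (3 / 2 : ℝ) + Real.exp ((2 * R) ^ 2 / (32 * T))), by positivity,
    fun τ hτ hτT z => ?_⟩
  set q := Real.exp (-‖z.1‖ ^ 2 / (32 * T)) with hq
  -- A pointwise bound by a multiple of a heat kernel suffices, because heat kernels have mass one.
  -- Far from the support the kernel at time `2τ` is used, near it the kernel at time `τ`.
  have key : ∀ (σ B : ℝ), 0 < σ → 0 ≤ B →
      (∀ y, ‖heatKernel τ y * φ (z + (y, 0))‖ ≤ B * heatKernel σ y) →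
      ∫⁻ y, ‖heatKernel τ y * φ (z + (y, 0))‖ₑ ≤ ENNReal.ofReal B := by
    intro σ B hσ hB hle
    calc _ ≤ ∫⁻ y : R3, ENNReal.ofReal B * ENNReal.ofReal (heatKernel σ y) := by
          refine lintegral_mono fun y => ?_
          rw [← ENNReal.ofReal_mul hB, ← ofReal_norm]
          exact ENNReal.ofReal_le_ofReal (hle y)
      _ = ENNReal.ofReal B := by
          rw [lintegral_const_mul' _ _ ENNReal.ofReal_ne_top, lintegral_heatKernel hσ, mul_one]
  rcases le_total (2 * R) ‖z.1‖ with hz | hz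
  · refine (key (2 * τ) (C * 2 ^ (3 / 2 : ℝ) * q) (by positivity) (by positivity) fun y => ?_).trans
      (ENNReal.ofReal_le_ofReal ?_)
    · by_cases h0 : φ (z + (y, 0)) = 0
      · rw [h0, mul_zero, norm_zero]
        have := heatKernel_nonneg (τ := 2 * τ) (by positivity) y
        positivity
      · have h1 := (hs _ h0).1
        rw [Prod.fst_add] at h1
        simp only at h1
        have h2 : ‖z.1‖ ≤ 2 * ‖y‖ := by
          have := norm_sub_le (z.1 + y) y
          rw [add_sub_cancel_right] at this
          linarith
        rw [norm_mul, Real.norm_of_nonneg (heatKernel_nonneg hτ.le y)]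
        calc _ ≤ (2 ^ (3 / 2 : ℝ) * q * heatKernel (2 * τ) y) * C :=
              mul_le_mul (heatKernel_le_two_mul hτ hτT (norm_nonneg _) h2) (hb _) (abs_nonneg _)
                (by have := heatKernel_nonneg (τ := 2 * τ) (by positivity) y; positivity)
          _ = _ := by ring
    · have : 0 ≤ C * Real.exp ((2 * R) ^ 2 / (32 * T)) * q := by positivity
      nlinarith
  · refine (key τ C hτ hC.le fun y => ?_).trans (ENNReal.ofReal_le_ofReal ?_)
    · rw [norm_mul, Real.norm_of_nonneg (heatKernel_nonneg hτ.le y), mul_comm]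
      exact mul_le_mul_of_nonneg_right (hb _) (heatKernel_nonneg hτ.le y)
    · have h1 : 1 ≤ Real.exp ((2 * R) ^ 2 / (32 * T)) * q := by
        rw [hq, ← Real.exp_add]
        refine Real.one_le_exp ?_
        rw [neg_div, ← sub_eq_add_neg, sub_nonneg]
        gcongr
      have h2 : 0 ≤ C * 2 ^ (3 / 2 : ℝ) * q := by positivity
      nlinarith

/-- The heat flow of the vector field `u₀`. -/
noncomputable def heatFlow (ν : ℝ) (u₀ : R3 → R3) (z : R3 × ℝ) : R3 :=
  if 0 < z.2 then ∫ y, heatKernel (ν * z.2) y • u₀ (z.1 - y) else 0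

/-- `u₀` is integrable against all Gaussians. -/
def GaussianIntegrable (u₀ : R3 → R3) : Prop :=
  ∀ τ : ℝ, 0 < τ → Integrable fun y => Real.exp (-‖y‖ ^ 2 / (4 * τ)) • u₀ y

section HeatFlow

variable {u₀ : R3 → R3} {ν : ℝ}

/-- Multiplication by the inverse Gaussian, which is continuous, recovers `u₀`. -/
lemma GaussianIntegrable.aestronglyMeasurable (hu : GaussianIntegrable u₀) :
    AEStronglyMeasurable u₀ := by
  have h1 := (by fun_prop : Continuous fun y : R3 => Real.exp (‖y‖ ^ 2 / (4 * 1))).aestronglyMeasurable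
    (μ := volume) |>.smul (hu 1 one_pos).1
  refine h1.congr (Eventually.of_forall fun y => ?_)
  simp only [Pi.smul_apply', smul_smul, ← Real.exp_add, neg_div, add_neg_cancel, Real.exp_zero,
    one_smul]

/-- Passing to a Borel representative of `u₀` changes no value of the flow, so the flow is
measurable everywhere and not just up to a null set. -/
lemma measurable_heatFlow (hu : AEStronglyMeasurable u₀) : StronglyMeasurable (heatFlow ν u₀) := by
  have e : heatFlow ν u₀ = heatFlow ν (hu.mk u₀) := by
    funext z
    unfold heatFlow
    split_ifs
    · refine integral_congr_ae ?_
      filter_upwards [(Measure.measurePreserving_sub_left volume z.1).quasiMeasurePreserving.ae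
        hu.ae_eq_mk] with y hy
      rw [hy]
    · rfl
  rw [e]
  have hm := hu.stronglyMeasurable_mk.measurable
  refine StronglyMeasurable.ite (measurableSet_lt measurable_const measurable_snd) ?_
    stronglyMeasurable_const
  exact StronglyMeasurable.integral_prod_right' (f := fun p : (R3 × ℝ) × R3 =>
    heatKernel (ν * p.1.2) p.2 • hu.mk u₀ (p.1.1 - p.2))
    (Measurable.stronglyMeasurable (by fun_prop))

lemma GaussianIntegrable.integrable_mul_norm (hu : GaussianIntegrable u₀) (C : ℝ) {T : ℝ}
    (hT : 0 < T) : Integrable fun x => C * Real.exp (-‖x‖ ^ 2 / (32 * T)) * ‖u₀ x‖ := by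
  have h1 := ((hu (8 * T) (by positivity)).norm).const_mul C
  refine h1.congr (Eventually.of_forall fun x => ?_)
  simp only [norm_smul, Real.norm_eq_abs, Real.abs_exp]
  rw [show 4 * (8 * T) = 32 * T by ring]
  ring

lemma integrable_heatKernel_smul (hu : GaussianIntegrable u₀) {φ : R3 × ℝ → ℝ}
    (hφ : IsSmoothCompact φ) {τ : ℝ} (hτ : 0 < τ) (r : ℝ) :
    Integrable (fun q : R3 × R3 => (heatKernel τ q.2 * φ (q.1 + q.2, r)) • u₀ q.1)
      (volume.prod volume) := by
  have hum := hu.aestronglyMeasurable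
  have hc := hφ.continuous.measurable
  obtain ⟨C, hC, hb⟩ := hφ.exists_lintegral_heatKernel_mul_le hτ
  refine ⟨?_, ?_⟩
  · exact (by fun_prop : Measurable fun q : R3 × R3 =>
      heatKernel τ q.2 * φ (q.1 + q.2, r)).aestronglyMeasurable.smul
        (hum.comp_quasiMeasurePreserving Measure.quasiMeasurePreserving_fst)
  refine lt_of_le_of_lt (lintegral_prod_le _) ?_
  refine lt_of_le_of_lt (lintegral_mono fun x => ?_)
    (hu.integrable_mul_norm C hτ).lintegral_lt_top
  simp only [enorm_smul]
  rw [lintegral_mul_const' _ _ (by finiteness), ENNReal.ofReal_mul (by positivity), ofReal_norm]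
  gcongr
  simpa using hb τ hτ le_rfl (x, r)

/-- The heat semigroup is moved from `u₀` to the test function. Its Gaussian decay there makes the
exchange of integrals legitimate although `u₀` is only integrable against Gaussians. -/
lemma integral_smul_heatFlow (hν : 0 < ν) (hu : GaussianIntegrable u₀) {φ : R3 × ℝ → ℝ}
    (hφ : IsSmoothCompact φ) {t : ℝ} (ht : 0 < t) (r : ℝ) :
    ∫ x, φ (x, r) • heatFlow ν u₀ (x, t) = ∫ x, heatConv (ν * t) φ (x, r) • u₀ x := by
  have hmp := measurePreserving_sub_prod (volume : Measure R3) (volume : Measure R3)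
  have hG := integrable_heatKernel_smul hu hφ (mul_pos hν ht) r
  have hF := (hmp.integrable_comp hG.1).2 hG
  simp only [Function.comp_def, sub_add_cancel] at hF
  calc ∫ x, φ (x, r) • heatFlow ν u₀ (x, t)
      = ∫ x, ∫ y, (heatKernel (ν * t) y * φ (x, r)) • u₀ (x - y) := by
        congr 1; funext x
        simp only [heatFlow, ht, if_true]
        rw [← integral_smul]
        congr 1; funext y
        rw [smul_smul, mul_comm]
    _ = ∫ q : R3 × R3, (heatKernel (ν * t) q.2 * φ (q.1, r)) • u₀ (q.1 - q.2)
          ∂(volume.prod volume) := (integral_prod _ hF).symm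
    _ = ∫ q : R3 × R3, (heatKernel (ν * t) q.2 * φ (q.1 + q.2, r)) • u₀ q.1
          ∂(volume.prod volume) := by
        conv_rhs => rw [← hmp.map_eq]
        rw [integral_map hmp.aemeasurable (by rw [hmp.map_eq]; exact hG.1)]
        simp only [sub_add_cancel]
    _ = ∫ x, ∫ y, (heatKernel (ν * t) y * φ (x + y, r)) • u₀ x := integral_prod _ hG
    _ = _ := by
        congr 1; funext x
        rw [integral_smul_const, heatConv]
        simp

lemma enorm_heatConv_le {φ : R3 × ℝ → ℝ} {τ : ℝ} {z : R3 × ℝ} :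
    ‖heatConv τ φ z‖ₑ ≤ ∫⁻ y, ‖heatKernel τ y * φ (z + (y, 0))‖ₑ :=
  enorm_integral_le_lintegral_enorm _

lemma measurable_heatConv {α : Type*} [MeasurableSpace α] {f : α → ℝ} {k : α → R3 × ℝ}
    {φ : R3 × ℝ → ℝ} (hφ : Continuous φ) (hf : Measurable f) (hk : Measurable k) :
    Measurable fun a => heatConv (f a) φ (k a) := by
  have hc := hφ.measurable
  exact (StronglyMeasurable.integral_prod_right' (f := fun p : α × R3 =>
    heatKernel (f p.1) p.2 * φ (k p.1 + (p.2, 0)))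
    (Measurable.stronglyMeasurable (by fun_prop))).measurable

lemma tendsto_integral_smul_heatFlow (hν : 0 < ν) (hu : GaussianIntegrable u₀) {φ : R3 × ℝ → ℝ}
    (hφ : IsSmoothCompact φ) (r : ℝ) :
    Tendsto (fun t => ∫ x, φ (x, r) • heatFlow ν u₀ (x, t)) (𝓝[>] 0)
      (𝓝 (∫ x, φ (x, r) • u₀ x)) := by
  obtain ⟨C, hC, hb⟩ := hφ.exists_lintegral_heatKernel_mul_le hν
  have hum := hu.aestronglyMeasurable
  have h1 : Tendsto (fun t => ∫ x, heatConv (ν * t) φ (x, r) • u₀ x) (𝓝[>] 0)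
      (𝓝 (∫ x, φ (x, r) • u₀ x)) := by
    refine tendsto_integral_filter_of_dominated_convergence
      (fun x => C * Real.exp (-‖x‖ ^ 2 / (32 * ν)) * ‖u₀ x‖) ?_ ?_
      (hu.integrable_mul_norm C hν) ?_
    · refine Eventually.of_forall fun t => ?_
      exact (measurable_heatConv hφ.continuous measurable_const
        (by fun_prop)).aestronglyMeasurable.smul hum
    · have : ∀ᶠ t : ℝ in 𝓝[>] 0, t ∈ Ioc 0 1 := Ioc_mem_nhdsGT one_pos
      filter_upwards [this] with t ht
      refine Eventually.of_forall fun x => ?_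
      rw [norm_smul]
      gcongr
      rw [← ENNReal.ofReal_le_ofReal_iff (by positivity), ofReal_norm]
      exact enorm_heatConv_le.trans (hb (ν * t) (mul_pos hν ht.1)
        (mul_le_of_le_one_right hν.le ht.2) (x, r))
    · refine Eventually.of_forall fun x => Tendsto.smul_const ?_ _
      refine (tendsto_heatConv_zero hφ (x, r)).comp ?_
      refine tendsto_nhdsWithin_iff.2 ⟨?_, ?_⟩
      · have : Tendsto (fun t : ℝ => ν * t) (𝓝 0) (𝓝 (ν * 0)) := tendsto_id.const_mul ν
        rw [mul_zero] at this
        exact this.mono_left nhdsWithin_le_nhds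
      · filter_upwards [self_mem_nhdsWithin] with t ht
        exact mul_pos hν ht
  refine h1.congr' ?_
  filter_upwards [self_mem_nhdsWithin] with t ht
  exact (integral_smul_heatFlow hν hu hφ ht r).symm

lemma integral_heatFlow_eq {φ : R3 × ℝ → ℝ} (hi : Integrable fun z => φ z • heatFlow ν u₀ z) :
    ∫ z, φ z • heatFlow ν u₀ z
      = ∫ t in Ioi (0 : ℝ), ∫ x, φ (x, t) • heatFlow ν u₀ (x, t) := by
  rw [Measure.volume_eq_prod, integral_prod_symm _ hi]
  refine (setIntegral_eq_integral_of_forall_compl_eq_zero fun t ht => ?_).symm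
  have : ¬ 0 < t := ht
  simp [heatFlow, this]

/-- After transfer to the test function, Duhamel's formula at time zero applies at each `x`. The
test function may be nonzero at time zero, which is where the initial velocity appears. -/
lemma integral_smul_heatFlow_heatAdj (hν : 0 < ν) (hu : GaussianIntegrable u₀) {φ : R3 × ℝ → ℝ}
    (hφ : IsSmoothCompact φ) (hi : Integrable fun z => heatAdj ν φ z • heatFlow ν u₀ z) :
    ∫ z, heatAdj ν φ z • heatFlow ν u₀ z = -∫ x, φ (x, 0) • u₀ x := by
  have hum := hu.aestronglyMeasurable
  have hψ := hφ.heatAdj ν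
  obtain ⟨-, R, -, hR, -, hs⟩ := hψ.exists_bound
  obtain ⟨C, hC, hb⟩ := hψ.exists_lintegral_heatKernel_mul_le (mul_pos hν hR)
  have hI : Integrable (fun q : R3 × ℝ => heatConv (ν * q.2) (heatAdj ν φ) q • u₀ q.1)
      ((volume : Measure R3).prod halfLine) := by
    refine ⟨(measurable_heatConv hψ.continuous (by fun_prop)
      measurable_id).aestronglyMeasurable.smul
        (hum.comp_quasiMeasurePreserving Measure.quasiMeasurePreserving_fst), ?_⟩
    refine lt_of_le_of_lt (lintegral_prod_le _) ?_
    refine lt_of_le_of_lt (b := ∫⁻ x, ENNReal.ofReal R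
      * ENNReal.ofReal (C * Real.exp (-‖x‖ ^ 2 / (32 * (ν * R))) * ‖u₀ x‖))
      (lintegral_mono fun x => ?_) ?_
    · calc ∫⁻ t in Ioi (0 : ℝ), ‖heatConv (ν * t) (heatAdj ν φ) (x, t) • u₀ x‖ₑ
          ≤ ∫⁻ t in Ioi (0 : ℝ), (Ioc (0 : ℝ) R).indicator (fun _ =>
            ENNReal.ofReal (C * Real.exp (-‖x‖ ^ 2 / (32 * (ν * R))) * ‖u₀ x‖)) t := by
            refine setLIntegral_mono' measurableSet_Ioi fun t (ht : 0 < t) => ?_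
            by_cases htR : t ≤ R
            · rw [indicator_of_mem (show t ∈ Ioc 0 R from ⟨ht, htR⟩), enorm_smul, ENNReal.ofReal_mul (by positivity),
                ofReal_norm]
              gcongr
              exact enorm_heatConv_le.trans (hb (ν * t) (by positivity) (by gcongr) (x, t))
            · rw [heatConv_eq_zero hs _ (lt_of_lt_of_le (not_le.1 htR) (le_abs_self _))]
              simp
        _ ≤ ∫⁻ t, (Ioc (0 : ℝ) R).indicator (fun _ =>
            ENNReal.ofReal (C * Real.exp (-‖x‖ ^ 2 / (32 * (ν * R))) * ‖u₀ x‖)) t :=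
            setLIntegral_le_lintegral _ _
        _ = _ := by
            rw [lintegral_indicator measurableSet_Ioc, setLIntegral_const, Real.volume_Ioc,
              sub_zero, mul_comm]
    · rw [lintegral_const_mul' _ _ ENNReal.ofReal_ne_top]
      exact ENNReal.mul_lt_top (by finiteness)
        (hu.integrable_mul_norm C (mul_pos hν hR)).lintegral_lt_top
  calc ∫ z, heatAdj ν φ z • heatFlow ν u₀ z
      = ∫ t in Ioi (0 : ℝ), ∫ x, heatConv (ν * t) (heatAdj ν φ) (x, t) • u₀ x := by
        rw [integral_heatFlow_eq hi]
        exact setIntegral_congr_fun measurableSet_Ioi fun t ht =>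
          integral_smul_heatFlow hν hu hψ ht t
    _ = ∫ x, ∫ t in Ioi (0 : ℝ), heatConv (ν * t) (heatAdj ν φ) (x, t) • u₀ x := by
        rw [← integral_prod_symm _ hI, integral_prod _ hI]
    _ = ∫ x, -(φ (x, 0) • u₀ x) := by
        congr 1; funext x
        rw [integral_smul_const]
        have := integral_heatConv_heatAdj_zero hφ hν (x, 0)
        simp only [Prod.mk_add_mk, add_zero, zero_add] at this
        rw [this, neg_smul]
    _ = _ := integral_neg _

lemma IsSmoothCompact.fderiv_slice {φ : R3 × ℝ → ℝ} (hφ : IsSmoothCompact φ) (z : R3 × ℝ)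
    (x v : R3) : fderiv ℝ (fun x : R3 => φ (z + (x, 0))) x v = dirDeriv (v, 0) φ (z + (x, 0)) := by
  have h1 : HasFDerivAt (fun x : R3 => z + (x, (0 : ℝ))) (ContinuousLinearMap.inl ℝ R3 ℝ) x :=
    (ContinuousLinearMap.inl ℝ R3 ℝ).hasFDerivAt.const_add z
  have h2 := (hφ.differentiable (z + (x, 0))).hasFDerivAt.comp x h1
  have h3 : fderiv ℝ (fun x : R3 => φ (z + (x, 0))) x = _ := h2.fderiv
  rw [h3]
  simp [dirDeriv]

/-- The restriction of a test function to a time slice. -/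
noncomputable def IsSmoothCompact.slice {φ : R3 × ℝ → ℝ} (hφ : IsSmoothCompact φ) (z : R3 × ℝ) :
    𝓢(R3, ℝ) :=
  (hφ.slice_hasCompactSupport z).toSchwartzMap (hφ.contDiff.comp (by fun_prop))

lemma IsSmoothCompact.slice_apply {φ : R3 × ℝ → ℝ} (hφ : IsSmoothCompact φ) (z : R3 × ℝ) (x : R3) :
    hφ.slice z x = φ (z + (x, 0)) := rfl

lemma DivFree.integral_slice (hdiv : DivFree u₀) {φ : R3 × ℝ → ℝ} (hφ : IsSmoothCompact φ)
    (z : R3 × ℝ) : ∫ x, ∑ j, u₀ x j * dirDeriv (spatialDir j) φ (z + (x, 0)) = 0 := by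
  have h := hdiv (hφ.slice z) (hφ.slice_hasCompactSupport z)
  simp only [SchwartzMap.lineDerivOp_apply_eq_fderiv] at h
  refine Eq.trans ?_ h
  congr 1; funext x
  refine Finset.sum_congr rfl fun j _ => ?_
  congr 1
  exact (hφ.fderiv_slice z x _).symm

/-- For each displacement `y` the translated slice of `φ` is an admissible test function for the
divergence of `u₀`, so already the inner integral over `x` vanishes. -/
lemma sum_integral_heatFlow_slice (hν : 0 < ν) (hu : GaussianIntegrable u₀) (hdiv : DivFree u₀)
    {φ : R3 × ℝ → ℝ} (hφ : IsSmoothCompact φ) {t : ℝ} (ht : 0 < t) :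
    ∑ i, (∫ x, dirDeriv (spatialDir i) φ (x, t) • heatFlow ν u₀ (x, t)) i = 0 := by
  have hG := fun i : Fin 3 =>
    integrable_heatKernel_smul hu (hφ.dirDeriv (spatialDir i)) (mul_pos hν ht) t
  have e : ∀ i : Fin 3, ∀ x, heatConv (ν * t) (dirDeriv (spatialDir i) φ) (x, t) • u₀ x
      = ∫ y, (heatKernel (ν * t) y * dirDeriv (spatialDir i) φ (x + y, t)) • u₀ x := by
    intro i x
    rw [integral_smul_const, heatConv]
    simp
  have hterm : ∀ i : Fin 3, (∫ x, dirDeriv (spatialDir i) φ (x, t) • heatFlow ν u₀ (x, t)) i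
      = ∫ y, (∫ x, (heatKernel (ν * t) y * dirDeriv (spatialDir i) φ (x + y, t)) • u₀ x) i := by
    intro i
    rw [integral_smul_heatFlow hν hu (hφ.dirDeriv _) ht t]
    simp_rw [e]
    rw [← integral_prod _ (hG i), integral_prod_symm _ (hG i),
      integral_euclidean_apply (hG i).integral_prod_right]
  simp_rw [hterm]
  rw [← integral_finsetSum _ fun i _ =>
    (hG i).integral_prod_right.euclidean_apply i]
  refine integral_eq_zero_of_ae ?_
  filter_upwards [ae_all_iff.2 fun i => (hG i).prod_left_ae] with y hy
  simp_rw [fun i => integral_euclidean_apply (hy i)]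
  rw [← integral_finsetSum _ fun i _ => (hy i).euclidean_apply i]
  have h0 := hdiv.integral_slice hφ (y, t)
  rw [Pi.zero_apply, ← mul_zero (heatKernel (ν * t) y), ← h0, ← integral_const_mul]
  congr 1; funext x
  rw [Finset.mul_sum]
  refine Finset.sum_congr rfl fun j _ => ?_
  simp only [PiLp.smul_apply, smul_eq_mul, Prod.mk_add_mk, add_zero, add_comm y x]
  ring

lemma sum_integral_heatFlow_mul (hν : 0 < ν) (hu : GaussianIntegrable u₀) (hdiv : DivFree u₀)
    {φ : R3 × ℝ → ℝ} (hφ : IsSmoothCompact φ)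
    (hi : ∀ i, Integrable fun z => dirDeriv (spatialDir i) φ z • heatFlow ν u₀ z) :
    ∑ i, ∫ z, heatFlow ν u₀ z i * dirDeriv (spatialDir i) φ z = 0 := by
  have hint : ∀ i : Fin 3, IntegrableOn
      (fun t => ∫ x, dirDeriv (spatialDir i) φ (x, t) • heatFlow ν u₀ (x, t)) (Ioi 0) := by
    intro i
    have h2 := hi i
    rw [Measure.volume_eq_prod] at h2
    exact h2.integral_prod_right.integrableOn
  have hterm : ∀ i : Fin 3, ∫ z, heatFlow ν u₀ z i * dirDeriv (spatialDir i) φ z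
      = ∫ t in Ioi (0 : ℝ), (∫ x, dirDeriv (spatialDir i) φ (x, t) • heatFlow ν u₀ (x, t)) i := by
    intro i
    rw [← integral_euclidean_apply (hint i), ← integral_heatFlow_eq (hi i),
      integral_euclidean_apply (hi i)]
    simp only [PiLp.smul_apply, smul_eq_mul, mul_comm]
  simp_rw [hterm]
  rw [← integral_finsetSum _ fun i _ => (hint i).euclidean_apply i]
  exact setIntegral_eq_zero_of_forall_eq_zero fun t ht =>
    sum_integral_heatFlow_slice hν hu hdiv hφ ht

end HeatFlow

/-! ### The mild formulation -/

/-- The bound for the velocity, relative to the weight. -/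
noncomputable def velBound (ν : ℝ) : ℝ≥0∞ := ENNReal.ofReal (2 * Real.pi * ν / 11)

/-- The bound for the forcing, relative to the weight. -/
noncomputable def forceBound (ν : ℝ) : ℝ≥0∞ := ENNReal.ofReal ((Real.pi * ν) ^ 2 / 11)

lemma velBound_ne_top (ν : ℝ) : velBound ν ≠ ∞ := ENNReal.ofReal_ne_top

lemma forceBound_ne_top (ν : ℝ) : forceBound ν ≠ ∞ := ENNReal.ofReal_ne_top

/-- Small data for the Navier–Stokes equations; the forcing is extended by zero to the past. -/
structure SmallData (ν : ℝ) (h h' : R3 → ℝ≥0∞) (u₀ : R3 → R3) (g : R3 × ℝ → R3) : Prop where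
  pos : 0 < ν
  pair : IsMajorizingPair h h'
  gaussian : GaussianIntegrable u₀
  divFree : DivFree u₀
  flow_lt : ∀ z : R3 × ℝ, 0 < z.2 →
    ‖heatFlow ν u₀ z‖ₑ < ENNReal.ofReal (Real.pi * ν / 11) * h z.1
  force : IsControlled (forceBound ν) h' g

/-- The velocity generated by the heat flow of `u₀`, the forcing `g` and the transport of `V`. -/
noncomputable def mildMap (ν : ℝ) (u₀ : R3 → R3) (g V : R3 × ℝ → R3) (z : R3 × ℝ) : R3 :=
  heatFlow ν u₀ z + duhamel ν V g z

lemma oseen_zero_right {ν : ℝ} (ζ : R3 × ℝ) : oseen ν ζ 0 = 0 := by simp [oseen]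

lemma oseenGrad_zero_left {ν : ℝ} (ζ : R3 × ℝ) (b : R3) : oseenGrad ν ζ 0 b = 0 := by
  simp [oseenGrad]

section Duhamel

variable {h h' : R3 → ℝ≥0∞} {ν : ℝ} {c c' : ℝ≥0∞} {V W g k : R3 × ℝ → R3}

lemma duhamel_congr (hVW : V =ᵐ[volume] W) (hgk : g =ᵐ[volume] k) :
    duhamel ν V g = duhamel ν W k := by
  funext z
  refine integral_congr_ae ?_
  filter_upwards [ae_sub_left hVW z, ae_sub_left hgk z] with ζ h1 h2
  simp only [duhamelKernel, h1, h2]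

lemma stronglyMeasurable_duhamel (hV : AEStronglyMeasurable V) (hg : AEStronglyMeasurable g) :
    StronglyMeasurable (duhamel ν V g) := by
  rw [duhamel_congr hV.ae_eq_mk hg.ae_eq_mk]
  have h1 := hV.stronglyMeasurable_mk.measurable
  have h2 := hg.stronglyMeasurable_mk.measurable
  refine StronglyMeasurable.integral_prod_right' (f := fun p : (R3 × ℝ) × (R3 × ℝ) =>
    duhamelKernel ν (hV.mk V) (hg.mk g) p.2 (p.1 - p.2)) (Measurable.stronglyMeasurable ?_)
  unfold duhamelKernel
  fun_prop

lemma duhamelKernel_eq_zero {ζ z : R3 × ℝ} (hz : z.2 ≤ ζ.2)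
    (hV : (z - ζ).2 ≤ 0 → V (z - ζ) = 0) (hg : (z - ζ).2 ≤ 0 → g (z - ζ) = 0) :
    duhamelKernel ν V g ζ (z - ζ) = 0 := by
  have h1 : (z - ζ).2 ≤ 0 := by rw [Prod.snd_sub]; linarith
  rw [duhamelKernel, hV h1, hg h1, oseen_zero_right, oseenGrad_zero_left, sub_zero]

/-- Causality: a positive displacement leads to the past, where `V` and `g` vanish, and for the
other displacements the kernel is zero. -/
lemma duhamel_eq_zero (hV : ∀ᵐ z : R3 × ℝ, z.2 ≤ 0 → V z = 0)
    (hg : ∀ᵐ z : R3 × ℝ, z.2 ≤ 0 → g z = 0) {z : R3 × ℝ} (hz : z.2 ≤ 0) :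
    duhamel ν V g z = 0 := by
  refine integral_eq_zero_of_ae ?_
  filter_upwards [ae_sub_left hV z, ae_sub_left hg z] with ζ h1 h2
  by_cases hs : 0 < ζ.2
  · exact duhamelKernel_eq_zero (hz.trans hs.le) h1 h2
  · simp [duhamelKernel, oseen, oseenGrad, hs]

lemma enorm_duhamel_le_indicator (hν : 0 < ν) (hV : IsControlled c h V) (hg : IsControlled c' h' g)
    (x : R3) (t : ℝ) : ‖duhamel ν V g (x, t)‖ₑ ≤ ∫⁻ ζ : R3 × ℝ, {ζ : R3 × ℝ | ζ.2 < t}.indicator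
      (fun ζ => c' * (ENNReal.ofReal (oseenMaj ν ζ) * h' (x - ζ.1))
        + c ^ 2 * (ENNReal.ofReal (oseenGradMaj ν ζ) * h (x - ζ.1) ^ 2)) ζ := by
  refine (enorm_integral_le_lintegral_enorm _).trans (lintegral_mono_ae ?_)
  filter_upwards [ae_sub_left hV.2 (x, t), ae_sub_left hg.2 (x, t), ae_sub_left hV.3 (x, t),
    ae_sub_left hg.3 (x, t)] with ζ h1 h2 h3 h4
  by_cases hs : ζ.2 < t
  · rw [indicator_of_mem (show ζ ∈ {ζ : R3 × ℝ | ζ.2 < t} from hs)]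
    refine (enorm_duhamelKernel_le hν V g ζ _).trans (add_le_add ?_ ?_)
    · calc _ ≤ ENNReal.ofReal (oseenMaj ν ζ) * (c' * h' ((x, t) - ζ).1) := by gcongr
        _ = _ := by rw [Prod.fst_sub]; ring
    · calc _ ≤ ENNReal.ofReal (oseenGradMaj ν ζ) * (c * h ((x, t) - ζ).1) ^ 2 := by gcongr
        _ = _ := by rw [Prod.fst_sub]; ring
  · rw [duhamelKernel_eq_zero (not_lt.1 hs) h3 h4]
    simp

lemma aemeasurable_comp_sub_fst {f : R3 → ℝ≥0∞} (hf : AEMeasurable f) (x : R3) :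
    AEMeasurable fun ζ : R3 × ℝ => f (x - ζ.1) :=
  hf.comp_quasiMeasurePreserving
    ((Measure.measurePreserving_sub_left volume x).quasiMeasurePreserving.comp
      Measure.quasiMeasurePreserving_fst)

/-- Causality restricts the displacement to `0 < s < t`, a set shrinking to nothing, while the full
majorant is integrable wherever `h x` is finite. -/
lemma tendsto_duhamel_zero (H : IsMajorizingPair h h') (hν : 0 < ν) (hc : c ≠ ∞) (hc' : c' ≠ ∞)
    (hV : IsControlled c h V) (hg : IsControlled c' h' g) {x : R3} (hx : h x ≠ ∞) :
    Tendsto (fun t => duhamel ν V g (x, t)) (𝓝[>] 0) (𝓝 0) := by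
  set B : R3 × ℝ → ℝ≥0∞ := fun ζ => c' * (ENNReal.ofReal (oseenMaj ν ζ) * h' (x - ζ.1))
        + c ^ 2 * (ENNReal.ofReal (oseenGradMaj ν ζ) * h (x - ζ.1) ^ 2) with hB
  have hB0 : ∀ ζ : R3 × ℝ, ζ.2 ≤ 0 → B ζ = 0 := by
    intro ζ hζ
    simp [hB, oseenMaj, oseenGradMaj, not_lt.2 hζ]
  have hm1 : AEMeasurable fun ζ : R3 × ℝ => c' * (ENNReal.ofReal (oseenMaj ν ζ) * h' (x - ζ.1)) :=
    ((by fun_prop : AEMeasurable fun ζ : R3 × ℝ => ENNReal.ofReal (oseenMaj ν ζ)).mul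
      (aemeasurable_comp_sub_fst H.aemeasurable' x)).const_mul _
  have hm2 : AEMeasurable fun ζ : R3 × ℝ =>
      c ^ 2 * (ENNReal.ofReal (oseenGradMaj ν ζ) * h (x - ζ.1) ^ 2) :=
    ((by fun_prop : AEMeasurable fun ζ : R3 × ℝ => ENNReal.ofReal (oseenGradMaj ν ζ)).mul
      ((aemeasurable_comp_sub_fst H.aemeasurable x).pow_const 2)).const_mul _
  have hBi : ∫⁻ ζ, B ζ ≠ ∞ := by
    rw [hB, lintegral_add_left' hm1, lintegral_const_mul' _ _ hc',
      lintegral_const_mul' _ _ (by finiteness)]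
    have h1 := (H.lintegral_oseenMaj_mul_le hν x).trans_lt
      (ENNReal.mul_lt_top (by finiteness) hx.lt_top)
    have h2 := (H.lintegral_oseenGradMaj_mul_le hν x).trans_lt
      (ENNReal.mul_lt_top (by finiteness) hx.lt_top)
    finiteness
  have h0 : Tendsto (fun t : ℝ => ∫⁻ ζ : R3 × ℝ, {ζ : R3 × ℝ | ζ.2 < t}.indicator B ζ) (𝓝[>] 0)
      (𝓝 (∫⁻ _ : R3 × ℝ, 0)) := by
    refine tendsto_lintegral_filter_of_dominated_convergence' B ?_ ?_ hBi ?_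
    · exact Eventually.of_forall fun t =>
        (hm1.add hm2).indicator (measurableSet_lt measurable_snd measurable_const)
    · exact Eventually.of_forall fun t => Eventually.of_forall fun ζ => indicator_le_self _ _ _
    · refine Eventually.of_forall fun ζ => tendsto_const_nhds.congr' ?_
      by_cases hζ : 0 < ζ.2
      · filter_upwards [Ioc_mem_nhdsGT hζ] with t ht
        rw [indicator_of_notMem]
        exact not_lt.2 ht.2
      · refine Eventually.of_forall fun t => ?_
        beta_reduce
        by_cases hm : ζ ∈ {ζ : R3 × ℝ | ζ.2 < t}
        · rw [indicator_of_mem hm, hB0 ζ (not_lt.1 hζ)]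
        · rw [indicator_of_notMem hm]
  rw [lintegral_zero] at h0
  rw [tendsto_zero_iff_enorm_tendsto_zero]
  exact tendsto_of_tendsto_of_tendsto_of_le_of_le tendsto_const_nhds h0 (fun _ => zero_le)
    fun t => enorm_duhamel_le_indicator hν hV hg x t

lemma tendsto_integral_smul_duhamel (H : IsMajorizingPair h h') (hν : 0 < ν) (hc : c ≠ ∞)
    (hc' : c' ≠ ∞) (hV : IsControlled c h V) (hg : IsControlled c' h' g) {φ : R3 × ℝ → ℝ}
    (hφ : IsSmoothCompact φ) (r : ℝ) :
    (∀ t, Integrable fun x => φ (x, r) • duhamel ν V g (x, t)) ∧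
    Tendsto (fun t => ∫ x, φ (x, r) • duhamel ν V g (x, t)) (𝓝[>] 0) (𝓝 0) := by
  obtain ⟨C, hC, hd⟩ := hφ.exists_decay 3
  have hsm := stronglyMeasurable_duhamel (ν := ν) hV.1 hg.1
  set D := c' * ENNReal.ofReal (1 / (2 * Real.pi * ν)) + c ^ 2 * ENNReal.ofReal (1 / (Real.pi * ν))
  have hD : D ≠ ∞ := by finiteness
  have hmeas : ∀ t, AEStronglyMeasurable (fun x => φ (x, r) • duhamel ν V g (x, t)) volume := by
    intro t
    have h1 : Continuous fun x => φ (x, r) := hφ.continuous.comp (by fun_prop)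
    exact h1.aestronglyMeasurable.smul
      (hsm.comp_measurable (by fun_prop)).aestronglyMeasurable
  have hbd : ∀ t, ∀ᵐ x, ‖φ (x, r) • duhamel ν V g (x, t)‖
      ≤ (ENNReal.ofReal C * D * (h x * ENNReal.ofReal ((1 + ‖x‖) ^ 3)⁻¹)).toReal := by
    intro t
    filter_upwards [H.ae_lt_top] with x hx
    rw [← ENNReal.ofReal_le_ofReal_iff ENNReal.toReal_nonneg, ofReal_norm,
      ENNReal.ofReal_toReal (by finiteness), enorm_smul]
    have h1 : stDecay 3 (x, r) ≤ ((1 + ‖x‖) ^ 3)⁻¹ := by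
      unfold stDecay
      exact mul_le_of_le_one_right (by positivity)
        (inv_le_one_of_one_le₀ (by nlinarith [sq_nonneg r]))
    calc _ ≤ (ENNReal.ofReal C * ENNReal.ofReal ((1 + ‖x‖) ^ 3)⁻¹) * (D * h x) :=
          mul_le_mul' ((enorm_le_ofReal_mul_stDecay hC.le (hd _)).trans (by gcongr))
            (enorm_duhamel_le H hν hc hc' hV.2 hg.2 (x, t))
      _ = _ := by ring
  have hbi : Integrable fun x : R3 =>
      (ENNReal.ofReal C * D * (h x * ENNReal.ofReal ((1 + ‖x‖) ^ 3)⁻¹)).toReal := by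
    refine integrable_toReal_of_lintegral_ne_top
      ((H.aemeasurable.mul (by fun_prop)).const_mul _) ?_
    have := H.lintegral_mul_lt_top
    change ∫⁻ x, ENNReal.ofReal C * D * (h x * ENNReal.ofReal ((1 + ‖x‖) ^ 3)⁻¹) ≠ ∞
    rw [lintegral_const_mul' _ _ (by finiteness)]
    finiteness
  refine ⟨fun t => hbi.mono' (hmeas t) (hbd t), ?_⟩
  rw [← integral_zero R3 R3 (μ := volume)]
  refine tendsto_integral_filter_of_dominated_convergence _ (Eventually.of_forall hmeas)
    (Eventually.of_forall hbd) hbi ?_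
  filter_upwards [H.ae_lt_top] with x hx
  have := (tendsto_duhamel_zero H hν hc hc' hV hg hx.ne).const_smul (φ (x, r))
  rwa [smul_zero] at this

end Duhamel

namespace SmallData

variable {h h' : R3 → ℝ≥0∞} {ν : ℝ} {u₀ : R3 → R3} {V W g : R3 × ℝ → R3}

lemma flow_controlled (D : SmallData ν h h' u₀ g) :
    IsControlled (ENNReal.ofReal (Real.pi * ν / 11)) h (heatFlow ν u₀) where
  aestronglyMeasurable := (measurable_heatFlow D.gaussian.aestronglyMeasurable).aestronglyMeasurable
  enorm_le := Eventually.of_forall fun z => by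
    by_cases hz : 0 < z.2
    · exact (D.flow_lt z hz).le
    · simp [heatFlow, hz]
  eq_zero := Eventually.of_forall fun z hz => by simp [heatFlow, not_lt.2 hz]

/-- Strictness comes from the heat flow, which is strictly below half of the bound; the Duhamel term
is at most the other half. Where `h` is infinite, finiteness of the velocity is enough. -/
lemma enorm_mildMap_lt (D : SmallData ν h h' u₀ g) (hV : ∀ᵐ z, ‖V z‖ₑ ≤ velBound ν * h z.1)
    {z : R3 × ℝ} (hz : 0 < z.2) : ‖mildMap ν u₀ g V z‖ₑ < velBound ν * h z.1 := by
  have hν := D.pos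
  have hp := Real.pi_pos
  rcases eq_or_ne (h z.1) ∞ with hx | hx
  · rw [hx, velBound, ENNReal.mul_top (by simp; positivity)]
    exact enorm_lt_top
  have h1 := enorm_duhamel_le D.pair hν (velBound_ne_top ν) (forceBound_ne_top ν) hV
    D.force.enorm_le z
  have h2 : (forceBound ν * ENNReal.ofReal (1 / (2 * Real.pi * ν))
      + velBound ν ^ 2 * ENNReal.ofReal (1 / (Real.pi * ν)))
      ≤ ENNReal.ofReal (Real.pi * ν / 11) := by
    rw [forceBound, velBound, ← ENNReal.ofReal_mul (by positivity),
      ← ENNReal.ofReal_pow (by positivity), ← ENNReal.ofReal_mul (by positivity),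
      ← ENNReal.ofReal_add (by positivity) (by positivity)]
    refine ENNReal.ofReal_le_ofReal ?_
    -- The two parts are `1/2` and `4/11` of `πν/11`, together `19/22`.
    have : (Real.pi * ν) ^ 2 / 11 * (1 / (2 * Real.pi * ν))
        + (2 * Real.pi * ν / 11) ^ 2 * (1 / (Real.pi * ν)) = Real.pi * ν / 11 * (19 / 22) := by
      field_simp; norm_num
    rw [this]
    exact mul_le_of_le_one_right (by positivity) (by norm_num)
  have h3 : ‖duhamel ν V g z‖ₑ ≤ ENNReal.ofReal (Real.pi * ν / 11) * h z.1 :=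
    h1.trans (by gcongr)
  calc _ ≤ ‖heatFlow ν u₀ z‖ₑ + ‖duhamel ν V g z‖ₑ := enorm_add_le _ _
    _ < ENNReal.ofReal (Real.pi * ν / 11) * h z.1 + ENNReal.ofReal (Real.pi * ν / 11) * h z.1 :=
        ENNReal.add_lt_add_of_lt_of_le enorm_ne_top (D.flow_lt z hz) h3
    _ = velBound ν * h z.1 := by
        rw [← add_mul, ← ENNReal.ofReal_add (by positivity) (by positivity), velBound]
        congr 2; ring

lemma mildMap_eq_zero (D : SmallData ν h h' u₀ g) (hV : IsControlled (velBound ν) h V)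
    {z : R3 × ℝ} (hz : z.2 ≤ 0) : mildMap ν u₀ g V z = 0 := by
  rw [mildMap, duhamel_eq_zero hV.eq_zero D.force.eq_zero hz, heatFlow, if_neg (not_lt.2 hz), add_zero]

lemma stronglyMeasurable_mildMap (D : SmallData ν h h' u₀ g) (hV : AEStronglyMeasurable V) :
    StronglyMeasurable (mildMap ν u₀ g V) :=
  (measurable_heatFlow D.gaussian.aestronglyMeasurable).add
    (stronglyMeasurable_duhamel hV D.force.aestronglyMeasurable)

lemma mildMap_controlled (D : SmallData ν h h' u₀ g) (hV : IsControlled (velBound ν) h V) :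
    IsControlled (velBound ν) h (mildMap ν u₀ g V) where
  aestronglyMeasurable := (D.stronglyMeasurable_mildMap hV.1).aestronglyMeasurable
  enorm_le := Eventually.of_forall fun z => by
    rcases lt_or_ge 0 z.2 with hz | hz
    · exact (D.enorm_mildMap_lt hV.enorm_le hz).le
    · simp [D.mildMap_eq_zero hV hz]
  eq_zero := Eventually.of_forall fun _ hz => D.mildMap_eq_zero hV hz

/-- The heat flow and the forcing drop out. The quadratic term has Lipschitz constant `2 ·
(2πν/11)/(πν) = 4/11`. -/
lemma enorm_mildMap_sub_le (D : SmallData ν h h' u₀ g) (hV : IsControlled (velBound ν) h V)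
    (hW : IsControlled (velBound ν) h W) {δ : ℝ≥0∞} (hδ : δ ≠ ∞)
    (hd : ∀ᵐ z, ‖V z - W z‖ₑ ≤ δ * h z.1) {z : R3 × ℝ} (hz : h z.1 ≠ ∞) :
    ‖mildMap ν u₀ g V z - mildMap ν u₀ g W z‖ₑ ≤ ENNReal.ofReal (4 / 11) * δ * h z.1 := by
  have hν := D.pos
  have hp := Real.pi_pos
  have h1 := enorm_duhamel_sub_le D.pair hν (velBound_ne_top ν) (forceBound_ne_top ν) hV hW D.force
    hδ hd hz
  have h2 : 2 * velBound ν * ENNReal.ofReal (1 / (Real.pi * ν)) = ENNReal.ofReal (4 / 11) := by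
    rw [velBound, ← ENNReal.ofReal_ofNat 2, ← ENNReal.ofReal_mul (by positivity),
      ← ENNReal.ofReal_mul (by positivity)]
    congr 1
    field_simp; norm_num
  rw [h2] at h1
  simpa [mildMap] using h1

/-- The Lipschitz estimate is iterated from the trivial bound by twice the velocity bound, and
`(4/11)ⁿ` tends to zero. Finiteness of `h` almost everywhere lets the pointwise limit be taken. -/
lemma ae_eq_of_mild (D : SmallData ν h h' u₀ g) (hV : IsControlled (velBound ν) h V)
    (hW : IsControlled (velBound ν) h W) (hVm : V =ᵐ[volume] mildMap ν u₀ g V)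
    (hWm : W =ᵐ[volume] mildMap ν u₀ g W) : V =ᵐ[volume] W := by
  have hfin : ∀ᵐ z : R3 × ℝ, h z.1 < ∞ := Measure.quasiMeasurePreserving_fst.ae D.pair.ae_lt_top
  have hn : ∀ n : ℕ, ∀ᵐ z, ‖V z - W z‖ₑ
      ≤ ENNReal.ofReal (4 / 11) ^ n * (2 * velBound ν) * h z.1 := by
    intro n
    induction n with
    | zero =>
      filter_upwards [hV.enorm_le, hW.enorm_le] with z h1 h2
      calc _ ≤ ‖V z‖ₑ + ‖W z‖ₑ := enorm_sub_le
        _ ≤ velBound ν * h z.1 + velBound ν * h z.1 := add_le_add h1 h2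
        _ = _ := by ring
    | succ n ih =>
      filter_upwards [hVm, hWm, hfin] with z h1 h2 hz
      rw [h1, h2]
      refine (D.enorm_mildMap_sub_le hV hW ?_ ih hz.ne).trans (le_of_eq (by ring))
      have := velBound_ne_top ν
      finiteness
  filter_upwards [ae_all_iff.2 hn, hfin] with z h1 hz
  have h2 : Tendsto (fun n : ℕ => ENNReal.ofReal (4 / 11) ^ n * (2 * velBound ν) * h z.1) atTop
      (𝓝 (0 * (2 * velBound ν) * h z.1)) := by
    refine ENNReal.Tendsto.mul_const (ENNReal.Tendsto.mul_const
      (ENNReal.tendsto_pow_atTop_nhds_zero_of_lt_one ?_) (Or.inr ?_)) (Or.inr hz.ne)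
    · rw [← ENNReal.ofReal_one, ENNReal.ofReal_lt_ofReal_iff one_pos]; norm_num
    · have := velBound_ne_top ν
      finiteness
  rw [zero_mul, zero_mul] at h2
  have h3 : ‖V z - W z‖ₑ = 0 := le_antisymm (ge_of_tendsto' h2 h1) zero_le
  exact sub_eq_zero.1 (enorm_eq_zero.1 h3)

end SmallData

/-! ### Mild solutions are weak solutions -/

/-- The field `u` on space-time, restricted to positive times and extended by zero. -/
noncomputable def extendZero (u : R3 → ℝ → R3) (z : R3 × ℝ) : R3 := if 0 < z.2 then u z.1 z.2 else 0

lemma extendZero_of_pos {u : R3 → ℝ → R3} {z : R3 × ℝ} (hz : 0 < z.2) :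
    extendZero u z = u z.1 z.2 := if_pos hz

lemma extendZero_of_nonpos {u : R3 → ℝ → R3} {z : R3 × ℝ} (hz : z.2 ≤ 0) :
    extendZero u z = 0 := if_neg (not_lt.2 hz)

lemma measurableSet_spaceTime : MeasurableSet spaceTime := MeasurableSet.univ.prod measurableSet_Ioi

lemma extendZero_eq_indicator (u : R3 → ℝ → R3) :
    extendZero u = spaceTime.indicator fun z => u z.1 z.2 := by
  funext z
  by_cases hz : 0 < z.2
  · rw [extendZero_of_pos hz, indicator_of_mem (show z ∈ spaceTime from ⟨mem_univ _, hz⟩)]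
  · rw [extendZero_of_nonpos (not_lt.1 hz), indicator_of_notMem fun h => hz h.2]

lemma aestronglyMeasurable_extendZero {u : R3 → ℝ → R3}
    (hu : AEStronglyMeasurable (fun z : R3 × ℝ => u z.1 z.2) (volume.restrict spaceTime)) :
    AEStronglyMeasurable (extendZero u) := by
  rw [extendZero_eq_indicator]
  exact (aestronglyMeasurable_indicator_iff measurableSet_spaceTime).2 hu

lemma integral_neg_sub_add {α : Type*} [MeasurableSpace α] {μ : Measure α} {f g k : α → ℝ}
    (hf : Integrable f μ) (hg : Integrable g μ) (hk : Integrable k μ) :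
    ∫ a, (-f a - g a + k a) ∂μ = -∫ a, f a ∂μ - ∫ a, g a ∂μ + ∫ a, k a ∂μ := by
  have h1 : Integrable (fun a => -f a) μ := hf.neg
  have h2 : Integrable (fun a => -f a - g a) μ := h1.sub hg
  rw [integral_add h2 hk, integral_sub h1 hg, integral_neg]

namespace IsTestFunction

variable {φ : 𝓢(R3 × ℝ, ℝ)}

lemma isSmoothCompact (hφ : IsTestFunction φ) : IsSmoothCompact φ := ⟨φ.smooth _, hφ.1⟩

lemma eq_zero (hφ : IsTestFunction φ) {z : R3 × ℝ} (hz : z.2 ≤ 0) : φ z = 0 :=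
  image_eq_zero_of_notMem_tsupport fun h => not_lt.2 hz (hφ.2 h).2

lemma lineDeriv (hφ : IsTestFunction φ) (v : R3 × ℝ) :
    IsTestFunction (∂_{v} φ : 𝓢(R3 × ℝ, ℝ)) := by
  have h1 : tsupport (∂_{v} φ : 𝓢(R3 × ℝ, ℝ)) ⊆ tsupport φ := by
    rw [← dirDeriv_schwartz]
    refine closure_minimal (fun z hz => ?_) (isClosed_tsupport _)
    refine by_contra fun hn => hz ?_
    simp [dirDeriv, fderiv_of_notMem_tsupport (𝕜 := ℝ) hn]
  exact ⟨hφ.1.mono' (subset_closure.trans h1), h1.trans hφ.2⟩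

lemma dirDeriv_eq_zero (hφ : IsTestFunction φ) (v : R3 × ℝ) {z : R3 × ℝ} (hz : z.2 ≤ 0) :
    dirDeriv v φ z = 0 := by
  rw [dirDeriv_schwartz]
  exact (hφ.lineDeriv v).eq_zero hz

end IsTestFunction

lemma heatAdj_schwartz (ν : ℝ) (φ : 𝓢(R3 × ℝ, ℝ)) (z : R3 × ℝ) :
    heatAdj ν φ z = (∂_{timeDir} φ) z + ν * ∑ j, (∂_{spatialDir j} (∂_{spatialDir j} φ)) z := by
  simp only [heatAdj, spaceLap, dirDeriv_schwartz]

lemma IsTestFunction.heatAdj_eq_zero {φ : 𝓢(R3 × ℝ, ℝ)} (hφ : IsTestFunction φ) (ν : ℝ)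
    {z : R3 × ℝ} (hz : z.2 ≤ 0) : heatAdj ν φ z = 0 := by
  rw [heatAdj_schwartz, (hφ.lineDeriv _).eq_zero hz,
    Finset.sum_eq_zero fun j _ => ((hφ.lineDeriv _).lineDeriv _).eq_zero hz, mul_zero, add_zero]

lemma IsTestFunction.integral_momentum {φ : 𝓢(R3 × ℝ, ℝ)} (hφ : IsTestFunction φ) (ν : ℝ)
    (g u : R3 → ℝ → R3) (i : Fin 3) :
    ∫ z : R3 × ℝ,
        (-(u z.1 z.2 i * (∂_{timeDir} φ) z)
          - ∑ j, u z.1 z.2 i * u z.1 z.2 j * (∂_{spatialDir j} φ) z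
          - ν * (u z.1 z.2 i * ∑ j, (∂_{spatialDir j} (∂_{spatialDir j} φ)) z)
          - g z.1 z.2 i * φ z)
      = ∫ z : R3 × ℝ, (-(extendZero u z i * heatAdj ν φ z)
          - (∑ j, extendZero u z i * extendZero u z j * dirDeriv (spatialDir j) φ z)
          - extendZero g z i * φ z) := by
  congr 1; funext z
  rcases lt_or_ge 0 z.2 with hz | hz
  · simp only [extendZero_of_pos hz, heatAdj_schwartz, dirDeriv_schwartz]
    ring
  · simp only [hφ.eq_zero hz, hφ.dirDeriv_eq_zero _ hz, hφ.heatAdj_eq_zero ν hz,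
      (hφ.lineDeriv _).eq_zero hz, ((hφ.lineDeriv _).lineDeriv _).eq_zero hz]
    simp

/-- Every test function on space is a time slice of a test function on space-time. -/
lemma exists_isSmoothCompact_extension (φ : 𝓢(R3, ℝ)) (hφ : HasCompactSupport φ) :
    ∃ ψ : R3 × ℝ → ℝ, IsSmoothCompact ψ ∧ ∀ x, ψ (x, 0) = φ x := by
  let χ : ContDiffBump (0 : ℝ) := ⟨1, 2, one_pos, one_lt_two⟩
  refine ⟨fun z => φ z.1 * χ z.2, ⟨?_, ?_⟩, fun x => ?_⟩
  · exact ((φ.smooth _).comp contDiff_fst).mul (χ.contDiff.comp contDiff_snd)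
  · refine HasCompactSupport.intro (hφ.isCompact.prod χ.hasCompactSupport.isCompact) fun z hz => ?_
    by_contra hne
    exact hz ⟨subset_tsupport _ (left_ne_zero_of_mul hne), subset_tsupport _ (right_ne_zero_of_mul hne)⟩
  · simp only
    rw [χ.one_of_mem_closedBall (by simp [χ]), mul_one]

lemma integrable_slice_smul {h h' : R3 → ℝ≥0∞} (H : IsMajorizingPair h h') {c : ℝ≥0∞} (hc : c ≠ ∞)
    {f : R3 → R3} (hf : AEStronglyMeasurable f) (hfc : ∀ᵐ x, ‖f x‖ₑ ≤ c * h x) {φ : R3 × ℝ → ℝ}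
    (hφ : IsSmoothCompact φ) (r : ℝ) : Integrable fun x => φ (x, r) • f x := by
  obtain ⟨C, hC, hd⟩ := hφ.exists_decay 3
  have h1 : Continuous fun x => φ (x, r) := hφ.continuous.comp (by fun_prop)
  refine ⟨h1.aestronglyMeasurable.smul hf, ?_⟩
  refine lt_of_le_of_lt (b := ∫⁻ x : R3, ENNReal.ofReal C * c
    * (h x * ENNReal.ofReal ((1 + ‖x‖) ^ 3)⁻¹)) (lintegral_mono_ae ?_) ?_
  · filter_upwards [hfc] with x hx
    rw [enorm_smul]
    have h1 : stDecay 3 (x, r) ≤ ((1 + ‖x‖) ^ 3)⁻¹ := by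
      unfold stDecay
      exact mul_le_of_le_one_right (by positivity)
        (inv_le_one_of_one_le₀ (by nlinarith [sq_nonneg r]))
    calc _ ≤ (ENNReal.ofReal C * ENNReal.ofReal ((1 + ‖x‖) ^ 3)⁻¹) * (c * h x) :=
          mul_le_mul' ((enorm_le_ofReal_mul_stDecay hC.le (hd _)).trans (by gcongr)) hx
      _ = _ := by ring
  · rw [lintegral_const_mul' _ _ (by finiteness)]
    have := H.lintegral_mul_lt_top
    finiteness

lemma IsControlled.integrable_smul {h h' : R3 → ℝ≥0∞} (H : IsMajorizingPair h h') {c : ℝ≥0∞}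
    (hc : c ≠ ∞) {V : R3 × ℝ → R3} (hV : IsControlled c h V) {θ : R3 × ℝ → ℝ}
    (hθ : IsSmoothCompact θ) : Integrable fun z => θ z • V z := by
  obtain ⟨C, hC, hd⟩ := hθ.exists_decay 3
  exact integrable_smul_of_decay hC.le hV.1 (hV.lintegral_lt_top H hc)
    hθ.continuous.aestronglyMeasurable hd

lemma IsControlled.integrable_mul {h h' : R3 → ℝ≥0∞} (H : IsMajorizingPair h h') {c : ℝ≥0∞}
    (hc : c ≠ ∞) {V : R3 × ℝ → R3} (hV : IsControlled c h V) {θ : R3 × ℝ → ℝ}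
    (hθ : IsSmoothCompact θ) (i : Fin 3) : Integrable fun z => V z i * θ z := by
  simpa [mul_comm] using (hV.integrable_smul H hc hθ).euclidean_apply i

lemma IsControlled.integrable_mul_mul {h h' : R3 → ℝ≥0∞} (H : IsMajorizingPair h h') {c : ℝ≥0∞}
    (hc : c ≠ ∞) {V : R3 × ℝ → R3} (hV : IsControlled c h V) {θ : R3 × ℝ → ℝ}
    (hθ : IsSmoothCompact θ) (i j : Fin 3) : Integrable fun z => V z i * V z j * θ z := by
  obtain ⟨C, hC, hd⟩ := hθ.exists_decay 2
  have := integrable_smul_of_decay hC.le ((hV.1.euclidean_apply i).mul (hV.1.euclidean_apply j))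
    (hV.lintegral_mul_lt_top H hc i j) hθ.continuous.aestronglyMeasurable hd
  simpa [mul_comm] using this

lemma IsControlled.integrable_mul' {h h' : R3 → ℝ≥0∞} (H : IsMajorizingPair h h') {c : ℝ≥0∞}
    (hc : c ≠ ∞) {g : R3 × ℝ → R3} (hg : IsControlled c h' g) {θ : R3 × ℝ → ℝ}
    (hθ : IsSmoothCompact θ) (i : Fin 3) : Integrable fun z => g z i * θ z := by
  obtain ⟨C, hC, hd⟩ := hθ.exists_decay 1
  simpa [mul_comm] using (integrable_smul_of_decay hC.le hg.1 (hg.lintegral_lt_top' H hc)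
    hθ.continuous.aestronglyMeasurable hd).euclidean_apply i

namespace SmallData

variable {h h' : R3 → ℝ≥0∞} {ν : ℝ} {u₀ : R3 → R3} {V W g : R3 × ℝ → R3}

/-- As `φ` vanishes at time zero, the heat flow contributes nothing and only the Duhamel term is
left. -/
lemma integral_mildMap_mul_heatAdj (D : SmallData ν h h' u₀ g) (hV : IsControlled (velBound ν) h V)
    {φ : R3 × ℝ → ℝ} (hφ : IsSmoothCompact φ) (hφ0 : ∀ x, φ (x, 0) = 0) (i : Fin 3) :
    ∫ z, mildMap ν u₀ g V z i * heatAdj ν φ z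
      = ∫ z, (-(g z i * φ z) - (∑ k, V z i * V z k * dirDeriv (spatialDir k) φ z)
        + pressureDensity ν V g (dirDeriv (spatialDir i) φ) z) := by
  have hfl := D.flow_controlled.integrable_smul D.pair ENNReal.ofReal_ne_top (hφ.heatAdj ν)
  have h1 : ∫ z, heatFlow ν u₀ z i * heatAdj ν φ z = 0 := by
    have := integral_smul_heatFlow_heatAdj D.pos D.gaussian hφ hfl
    simp only [hφ0, zero_smul, integral_zero, neg_zero] at this
    have h2 := integral_euclidean_apply hfl i
    rw [this] at h2
    simpa [mul_comm] using h2.symm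
  have hw := (D.mildMap_controlled hV).integrable_mul D.pair (velBound_ne_top ν) (hφ.heatAdj ν) i
  have hf := D.flow_controlled.integrable_mul D.pair ENNReal.ofReal_ne_top (hφ.heatAdj ν) i
  rw [← (integral_duhamel_mul_heatAdj D.pair D.pos (velBound_ne_top ν) (forceBound_ne_top ν) hV
    D.force hφ i).2, ← add_zero (∫ z, mildMap ν u₀ g V z i * heatAdj ν φ z), ← neg_zero, ← h1,
    ← sub_eq_add_neg, ← integral_sub hw hf]
  congr 1; funext z
  simp only [mildMap, PiLp.add_apply]
  ring

lemma sum_integral_mildMap_mul (D : SmallData ν h h' u₀ g) (hV : IsControlled (velBound ν) h V)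
    {φ : R3 × ℝ → ℝ} (hφ : IsSmoothCompact φ) :
    ∑ i, ∫ z, mildMap ν u₀ g V z i * dirDeriv (spatialDir i) φ z = 0 := by
  have h1 := sum_integral_heatFlow_mul D.pos D.gaussian D.divFree hφ
    fun i => D.flow_controlled.integrable_smul D.pair ENNReal.ofReal_ne_top (hφ.dirDeriv _)
  have h2 := sum_integral_duhamel_mul D.pair D.pos (velBound_ne_top ν) (forceBound_ne_top ν) hV
    D.force hφ
  have hw := fun i : Fin 3 => (D.mildMap_controlled hV).integrable_mul D.pair (velBound_ne_top ν)
    (hφ.dirDeriv (spatialDir i)) i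
  have hf := fun i : Fin 3 => D.flow_controlled.integrable_mul D.pair ENNReal.ofReal_ne_top
    (hφ.dirDeriv (spatialDir i)) i
  refine Eq.trans ?_ h2
  rw [← sub_zero (∑ i, ∫ z, mildMap ν u₀ g V z i * dirDeriv (spatialDir i) φ z), ← h1,
    ← Finset.sum_sub_distrib]
  refine Finset.sum_congr rfl fun i _ => ?_
  rw [← integral_sub (hw i) (hf i)]
  congr 1; funext z
  simp only [mildMap, PiLp.add_apply]
  ring

lemma tendsto_integral_smul_mildMap (D : SmallData ν h h' u₀ g)
    (hV : IsControlled (velBound ν) h V) {φ : R3 × ℝ → ℝ} (hφ : IsSmoothCompact φ) (r : ℝ) :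
    Tendsto (fun t => ∫ x, φ (x, r) • mildMap ν u₀ g V (x, t)) (𝓝[>] 0)
      (𝓝 (∫ x, φ (x, r) • u₀ x)) := by
  obtain ⟨hi, ht⟩ := tendsto_integral_smul_duhamel D.pair D.pos (velBound_ne_top ν)
    (forceBound_ne_top ν) hV D.force hφ r
  have h1 := (tendsto_integral_smul_heatFlow D.pos D.gaussian hφ r).add ht
  rw [add_zero] at h1
  refine h1.congr' ?_
  filter_upwards [self_mem_nhdsWithin] with t (ht : 0 < t)
  rw [← integral_add _ (hi t)]
  · simp only [mildMap, smul_add]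
  · exact integrable_slice_smul D.pair (ENNReal.ofReal_ne_top (r := Real.pi * ν / 11))
      ((measurable_heatFlow D.gaussian.aestronglyMeasurable).comp_measurable
        (by fun_prop)).aestronglyMeasurable
      (Eventually.of_forall fun x => (D.flow_lt (x, t) ht).le) hφ r

end SmallData

lemma IsControlled.isTempered {h h' : R3 → ℝ≥0∞} (H : IsMajorizingPair h h') {c : ℝ≥0∞}
    (hc : c ≠ ∞) {u : R3 → ℝ → R3} (hu : IsControlled c h (extendZero u)) : IsTempered u := by
  obtain ⟨T, hT⟩ := exists_clm_eq_integral hu.1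
    (lintegral_stDecay_lt_top_of_le (by norm_num : 3 ≤ 6) (hu.lintegral_lt_top H hc))
    (fun ψ z => ψ z) (fun φ ψ z => rfl) (fun r ψ z => rfl)
    (fun ψ => ψ.continuous.aestronglyMeasurable) (by positivity) abs_schwartz_le
  refine ⟨T, fun φ hφ => ?_⟩
  rw [hT]
  congr 1; funext z
  rcases lt_or_ge 0 z.2 with hz | hz
  · rw [extendZero_of_pos hz]
  · rw [hφ.eq_zero hz, zero_smul, zero_smul]

lemma IsControlled.locallySquareIntegrable {h h' : R3 → ℝ≥0∞} (H : IsMajorizingPair h h')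
    {c : ℝ≥0∞} (hc : c ≠ ∞) {u : R3 → ℝ → R3} (hu : IsControlled c h (extendZero u)) :
    LocallySquareIntegrable u := by
  intro K hK hKs
  have hae : (fun z : R3 × ℝ => u z.1 z.2) =ᵐ[volume.restrict K] extendZero u := by
    filter_upwards [ae_restrict_mem hK.measurableSet] with z hz
    rw [extendZero_of_pos (hKs hz).2]
  rw [memLp_congr_ae hae]
  refine ⟨hu.1.restrict, ?_⟩
  rw [eLpNorm_lt_top_iff_lintegral_rpow_enorm_lt_top (by norm_num) (by norm_num)]
  obtain ⟨R, hR⟩ := hK.isBounded.exists_norm_le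
  have hR' : 0 ≤ max R 0 := le_max_right _ _
  set ε : ℝ := ((1 + max R 0) ^ 2)⁻¹ * (1 + max R 0 ^ 2)⁻¹ with hε
  have hε0 : 0 < ε := by positivity
  have hsq : ∫⁻ z, ENNReal.ofReal (stDecay 2 z) * ‖(‖extendZero u z‖ ^ 2 : ℝ)‖ₑ < ∞ := by
    refine lintegral_stDecay_mul_lt_top_of_le (c := c ^ 2) (w := fun x => h x ^ 2)
      H.lintegral_sq_mul_lt_top (by finiteness) ?_
    filter_upwards [hu.enorm_le] with z hz
    rw [enorm_pow, enorm_norm, ← mul_pow]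
    gcongr
  refine lt_of_le_of_lt (b := (ENNReal.ofReal ε)⁻¹
    * ∫⁻ z, ENNReal.ofReal (stDecay 2 z) * ‖(‖extendZero u z‖ ^ 2 : ℝ)‖ₑ) ?_
    (ENNReal.mul_lt_top (by simp [hε0]) hsq)
  rw [← lintegral_const_mul' _ _ (by simp [hε0])]
  refine le_trans ?_ (setLIntegral_le_lintegral K _)
  refine setLIntegral_mono' hK.measurableSet fun z hz => ?_
  have h1 : ε ≤ stDecay 2 z := by
    have e1 : ‖z.1‖ ≤ max R 0 := (norm_fst_le z).trans ((hR z hz).trans (le_max_left _ _))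
    have e2 : |z.2| ≤ max R 0 := (norm_snd_le z).trans ((hR z hz).trans (le_max_left _ _))
    have e3 : z.2 ^ 2 ≤ max R 0 ^ 2 := sq_le_sq' (abs_le.1 e2).1 (abs_le.1 e2).2
    rw [hε, stDecay]
    gcongr
  rw [enorm_pow, enorm_norm, ENNReal.toReal_ofNat, ENNReal.rpow_ofNat, ← mul_assoc]
  refine le_mul_of_one_le_left zero_le ?_
  calc (1 : ℝ≥0∞) = (ENNReal.ofReal ε)⁻¹ * ENNReal.ofReal ε :=
        (ENNReal.inv_mul_cancel (by simp [hε0]) ENNReal.ofReal_ne_top).symm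
    _ ≤ _ := by gcongr

/-- Each clause is known for the mild image. The mild equation, needed only almost everywhere,
transfers it to `u` itself. -/
lemma SmallData.isWeakSolution_of_mild {h h' : R3 → ℝ≥0∞} {ν : ℝ} {u₀ : R3 → R3}
    {g u : R3 → ℝ → R3} (D : SmallData ν h h' u₀ (extendZero g))
    (hu : IsControlled (velBound ν) h (extendZero u))
    (hm : extendZero u =ᵐ[volume] mildMap ν u₀ (extendZero g) (extendZero u)) :
    IsWeakSolution ν u₀ g u where
  tempered := hu.isTempered D.pair (velBound_ne_top ν)
  locallySquareIntegrable := hu.locallySquareIntegrable D.pair (velBound_ne_top ν)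
  divFree := by
    intro φ hφ
    have hc := velBound_ne_top ν
    rw [← D.sum_integral_mildMap_mul hu hφ.isSmoothCompact, ← integral_finsetSum _ fun i _ =>
      (D.mildMap_controlled hu).integrable_mul D.pair hc (hφ.isSmoothCompact.dirDeriv _) i]
    refine integral_congr_ae ?_
    filter_upwards [hm] with z hz
    rw [← hz]
    rcases lt_or_ge 0 z.2 with hz | hz
    · simp only [extendZero_of_pos hz, dirDeriv_schwartz]
    · simp only [(hφ.lineDeriv _).eq_zero hz, hφ.dirDeriv_eq_zero _ hz, mul_zero]
  momentum := by
    have hc := velBound_ne_top ν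
    obtain ⟨p, hp⟩ := exists_clm_pressure D.pos hu.1 D.force.1 (hu.lintegral_mul_lt_top D.pair hc)
      (D.force.lintegral_lt_top' D.pair (forceBound_ne_top ν))
    -- The functional `p` represents the Riesz terms, which enter the momentum equation with the
    -- opposite sign.
    refine ⟨-p, fun φ hφ i => ?_⟩
    have hs := hφ.isSmoothCompact
    rw [hφ.integral_momentum, neg_apply, (hp _).2]
    have h1 := D.integral_mildMap_mul_heatAdj hu hs (fun x => hφ.eq_zero le_rfl) i
    have h2 : ∫ z, extendZero u z i * heatAdj ν φ z
        = ∫ z, mildMap ν u₀ (extendZero g) (extendZero u) z i * heatAdj ν φ z :=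
      integral_congr_ae (by filter_upwards [hm] with z hz; rw [← hz])
    have i1 := hu.integrable_mul D.pair hc (hs.heatAdj ν) i
    have i2 := integrable_finsetSum Finset.univ fun j (_ : j ∈ Finset.univ) =>
      hu.integrable_mul_mul D.pair hc (hs.dirDeriv (spatialDir j)) i j
    have i3 := D.force.integrable_mul' D.pair (forceBound_ne_top ν) hs i
    have i4 := (hp (∂_{spatialDir i} φ)).1
    rw [dirDeriv_schwartz] at h1
    rw [integral_neg_sub_add i3 i2 i4] at h1
    have h3 := integral_neg_sub_add i1 i2 i3.neg
    simp only [Pi.neg_apply, ← sub_eq_add_neg, integral_neg] at h3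
    rw [h3, h2, h1]
    ring
  initial := by
    intro φ hφ
    obtain ⟨ψ, hψ, hψφ⟩ := exists_isSmoothCompact_extension φ hφ
    have h1 := D.tendsto_integral_smul_mildMap hu hψ 0
    simp only [hψφ] at h1
    refine (h1.mono_left inf_le_left).congr' ?_
    -- Equality almost everywhere on space-time gives equality of slices only for almost every time,
    -- which is why the initial limit is taken along such times.
    have h2 : ∀ᵐ t : ℝ, ∀ᵐ x : R3, extendZero u (x, t)
        = mildMap ν u₀ (extendZero g) (extendZero u) (x, t) := by
      have hm' : ∀ᵐ z ∂((volume : Measure R3).prod (volume : Measure ℝ)),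
        extendZero u z = mildMap ν u₀ (extendZero g) (extendZero u) z := hm
      exact Measure.ae_ae_of_ae_prod (Measure.measurePreserving_swap.quasiMeasurePreserving.ae hm')
    filter_upwards [Filter.mem_inf_of_right h2, Filter.mem_inf_of_left self_mem_nhdsWithin]
      with t ht (ht0 : 0 < t)
    refine integral_congr_ae ?_
    filter_upwards [ht] with x hx
    rw [← hx, extendZero_of_pos ht0]

/-! ### Uniqueness for the Stokes equations -/

lemma isTestFunction_of_forall {φ : 𝓢(R3 × ℝ, ℝ)} {K : Set (R3 × ℝ)} (hK : IsCompact K)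
    (hKs : K ⊆ spaceTime) (h0 : ∀ z, z ∉ K → φ z = 0) : IsTestFunction φ := by
  have h1 : tsupport φ ⊆ K :=
    closure_minimal (fun z hz => by_contra fun hn => hz (h0 z hn)) hK.isClosed
  exact ⟨HasCompactSupport.intro hK h0, h1.trans hKs⟩

namespace IsTestFunction

variable {φ ψ : 𝓢(R3 × ℝ, ℝ)}

lemma add (hφ : IsTestFunction φ) (hψ : IsTestFunction ψ) : IsTestFunction (φ + ψ) := by
  refine isTestFunction_of_forall (hφ.1.isCompact.union hψ.1.isCompact)
    (union_subset hφ.2 hψ.2) fun z hz => ?_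
  rw [add_apply, image_eq_zero_of_notMem_tsupport fun h => hz (Or.inl h),
    image_eq_zero_of_notMem_tsupport fun h => hz (Or.inr h), add_zero]

lemma smul (hφ : IsTestFunction φ) (r : ℝ) : IsTestFunction (r • φ) := by
  refine isTestFunction_of_forall hφ.1.isCompact hφ.2 fun z hz => ?_
  rw [smul_apply, image_eq_zero_of_notMem_tsupport hz, smul_zero]

lemma zero : IsTestFunction (0 : 𝓢(R3 × ℝ, ℝ)) :=
  isTestFunction_of_forall isCompact_empty (empty_subset _) fun _ _ => rfl

lemma sum {ι : Type*} (s : Finset ι) {f : ι → 𝓢(R3 × ℝ, ℝ)} (hf : ∀ i, IsTestFunction (f i)) :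
    IsTestFunction (∑ i ∈ s, f i) := by
  classical
  induction s using Finset.induction_on with
  | empty => rw [Finset.sum_empty]; exact zero
  | insert a s ha ih => rw [Finset.sum_insert ha]; exact (hf a).add ih

end IsTestFunction

/-- The Laplacian in the space variable, on Schwartz functions. -/
noncomputable def schwartzLap (φ : 𝓢(R3 × ℝ, ℝ)) : 𝓢(R3 × ℝ, ℝ) :=
  ∑ j, ∂_{spatialDir j} (∂_{spatialDir j} φ)

/-- The adjoint heat operator on Schwartz functions. -/
noncomputable def schwartzHeatAdj (ν : ℝ) (φ : 𝓢(R3 × ℝ, ℝ)) : 𝓢(R3 × ℝ, ℝ) :=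
  ∂_{timeDir} φ + ν • schwartzLap φ

lemma coe_schwartzLap (φ : 𝓢(R3 × ℝ, ℝ)) : ⇑(schwartzLap φ) = spaceLap φ := by
  funext z
  simp only [schwartzLap, spaceLap, dirDeriv_schwartz, sum_apply]

lemma coe_schwartzHeatAdj (ν : ℝ) (φ : 𝓢(R3 × ℝ, ℝ)) :
    ⇑(schwartzHeatAdj ν φ) = heatAdj ν φ := by
  funext z
  simp only [schwartzHeatAdj, heatAdj, add_apply, smul_apply, smul_eq_mul, coe_schwartzLap,
    dirDeriv_schwartz]

/-- The field `d` solves the Stokes equations with zero data. -/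
structure IsNullStokes (ν : ℝ) (c : ℝ≥0∞) (h : R3 → ℝ≥0∞) (d : R3 × ℝ → R3) : Prop where
  controlled : IsControlled c h d
  momentum : ∃ Q : 𝓢(R3 × ℝ, ℝ) →L[ℝ] ℝ, ∀ φ, IsTestFunction φ → ∀ i : Fin 3,
    ∫ z, d z i * heatAdj ν φ z = Q (∂_{spatialDir i} φ)
  divFree : ∀ φ : 𝓢(R3 × ℝ, ℝ), IsTestFunction φ →
    ∑ i, ∫ z, d z i * dirDeriv (spatialDir i) φ z = 0
  initial : ∀ ψ : R3 × ℝ → ℝ, IsSmoothCompact ψ →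
    Tendsto (fun t : ℝ => ∫ x, ψ (x, 0) • d (x, t)) (𝓝[>] 0 ⊓ ae volume) (𝓝 0)

lemma dirDeriv_time_mul {f : ℝ → ℝ} (hf : Differentiable ℝ f) {φ : R3 × ℝ → ℝ}
    (hφ : Differentiable ℝ φ) (v : R3 × ℝ) :
    dirDeriv v (fun z => f z.2 * φ z)
      = fun z => f z.2 * dirDeriv v φ z + deriv f z.2 * v.2 * φ z := by
  funext z
  have h1 : HasFDerivAt (fun z : R3 × ℝ => f z.2)
      ((deriv f z.2) • ContinuousLinearMap.snd ℝ R3 ℝ) z := by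
    have := (hf z.2).hasDerivAt.hasFDerivAt.comp z (hasFDerivAt_snd (𝕜 := ℝ) (p := z))
    refine this.congr_fderiv ?_
    ext <;> simp
  have h2 := h1.mul (hφ z).hasFDerivAt
  have h3 : fderiv ℝ (fun z => f z.2 * φ z) z = _ := h2.fderiv
  simp only [dirDeriv]
  rw [h3]
  simp
  ring

/-- A smooth function that vanishes on `(-∞, 1]` and equals one on `[2, ∞)`. -/
noncomputable def timeCutoff (s : ℝ) : ℝ := Real.smoothTransition (s - 1)

lemma contDiff_timeCutoff : ContDiff ℝ (⊤ : ℕ∞) timeCutoff :=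
  Real.smoothTransition.contDiff.comp (contDiff_id.sub contDiff_const)

lemma timeCutoff_eq_zero {s : ℝ} (hs : s ≤ 1) : timeCutoff s = 0 :=
  Real.smoothTransition.zero_of_nonpos (by linarith)

lemma timeCutoff_eq_one {s : ℝ} (hs : 2 ≤ s) : timeCutoff s = 1 :=
  Real.smoothTransition.one_of_one_le (by linarith)

lemma abs_timeCutoff_le (s : ℝ) : |timeCutoff s| ≤ 1 := by
  rw [timeCutoff, abs_of_nonneg (Real.smoothTransition.nonneg _)]
  exact Real.smoothTransition.le_one _

lemma continuous_deriv_timeCutoff : Continuous (deriv timeCutoff) :=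
  contDiff_timeCutoff.continuous_deriv (by simp)

lemma exists_deriv_timeCutoff_le : ∃ C : ℝ, 0 < C ∧
    ∀ s, |deriv timeCutoff s| ≤ (Icc (1 : ℝ) 2).indicator (fun _ => C) s := by
  obtain ⟨C, hC⟩ := (isCompact_Icc (a := (1 : ℝ)) (b := 2)).exists_bound_of_continuousOn
    continuous_deriv_timeCutoff.continuousOn
  refine ⟨max C 1, by positivity, fun s => ?_⟩
  by_cases hs : s ∈ Icc (1 : ℝ) 2
  · rw [indicator_of_mem hs]
    exact (hC s hs).trans (le_max_left _ _)
  · rw [indicator_of_notMem hs]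
    have : deriv timeCutoff s = 0 := by
      rcases lt_or_ge s 1 with h1 | h1
      · have : timeCutoff =ᶠ[𝓝 s] fun _ => 0 := by
          filter_upwards [Iio_mem_nhds h1] with r hr
          exact timeCutoff_eq_zero (le_of_lt hr)
        rw [this.deriv_eq, deriv_const]
      · have h2 : 2 < s := by
          by_contra hn
          exact hs ⟨h1, not_lt.1 hn⟩
        have : timeCutoff =ᶠ[𝓝 s] fun _ => 1 := by
          filter_upwards [Ioi_mem_nhds h2] with r hr
          exact timeCutoff_eq_one (le_of_lt hr)
        rw [this.deriv_eq, deriv_const]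
    rw [this, abs_zero]

/-- A test function that is cut off near time zero. -/
noncomputable def cutoffMul (ε : ℝ) (φ : R3 × ℝ → ℝ) (z : R3 × ℝ) : ℝ := timeCutoff (ε⁻¹ * z.2) * φ z

lemma contDiff_timeCutoff_scaled (ε : ℝ) :
    ContDiff ℝ (⊤ : ℕ∞) fun s : ℝ => timeCutoff (ε⁻¹ * s) :=
  contDiff_timeCutoff.comp (contDiff_const.mul contDiff_id)

lemma deriv_timeCutoff_scaled (ε s : ℝ) :
    deriv (fun s : ℝ => timeCutoff (ε⁻¹ * s)) s = ε⁻¹ * deriv timeCutoff (ε⁻¹ * s) :=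
  deriv_comp_mul_left ε⁻¹ timeCutoff s

lemma IsSmoothCompact.cutoffMul {φ : R3 × ℝ → ℝ} (hφ : IsSmoothCompact φ) (ε : ℝ) :
    IsSmoothCompact (cutoffMul ε φ) :=
  hφ.mul_left ((contDiff_timeCutoff_scaled ε).comp contDiff_snd)

lemma IsSmoothCompact.dirDeriv_cutoffMul {φ : R3 × ℝ → ℝ} (hφ : IsSmoothCompact φ) (ε : ℝ)
    (v : R3 × ℝ) (z : R3 × ℝ) : dirDeriv v (_root_.cutoffMul ε φ) z
      = _root_.cutoffMul ε (dirDeriv v φ) z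
        + ε⁻¹ * deriv timeCutoff (ε⁻¹ * z.2) * v.2 * φ z := by
  have h1 := dirDeriv_time_mul ((contDiff_timeCutoff_scaled ε).differentiable (by simp))
    hφ.differentiable v
  have h2 := congrFun h1 z
  simp only [deriv_timeCutoff_scaled] at h2
  exact h2

lemma IsSmoothCompact.dirDeriv_space_cutoffMul {φ : R3 × ℝ → ℝ} (hφ : IsSmoothCompact φ) (ε : ℝ)
    (j : Fin 3) : dirDeriv (spatialDir j) (_root_.cutoffMul ε φ)
      = _root_.cutoffMul ε (dirDeriv (spatialDir j) φ) := by
  funext z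
  rw [hφ.dirDeriv_cutoffMul]
  simp [spatialDir]

lemma IsSmoothCompact.spaceLap_cutoffMul {φ : R3 × ℝ → ℝ} (hφ : IsSmoothCompact φ) (ε : ℝ) :
    spaceLap (_root_.cutoffMul ε φ) = _root_.cutoffMul ε (spaceLap φ) := by
  funext z
  simp only [spaceLap, hφ.dirDeriv_space_cutoffMul, (hφ.dirDeriv _).dirDeriv_space_cutoffMul]
  simp only [_root_.cutoffMul, spaceLap, Finset.mul_sum]

lemma IsSmoothCompact.heatAdj_cutoffMul {φ : R3 × ℝ → ℝ} (hφ : IsSmoothCompact φ) (ν ε : ℝ)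
    (z : R3 × ℝ) : heatAdj ν (_root_.cutoffMul ε φ) z
      = _root_.cutoffMul ε (heatAdj ν φ) z + ε⁻¹ * deriv timeCutoff (ε⁻¹ * z.2) * φ z := by
  simp only [heatAdj, hφ.spaceLap_cutoffMul, hφ.dirDeriv_cutoffMul, timeDir]
  simp only [_root_.cutoffMul, heatAdj, timeDir]
  ring

lemma IsSmoothCompact.exists_test_cutoffMul {φ : R3 × ℝ → ℝ} (hφ : IsSmoothCompact φ) {ε : ℝ}
    (hε : 0 < ε) : ∃ ψ : 𝓢(R3 × ℝ, ℝ), IsTestFunction ψ ∧ ⇑ψ = _root_.cutoffMul ε φ := by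
  refine ⟨(hφ.cutoffMul ε).hasCompactSupport.toSchwartzMap (hφ.cutoffMul ε).contDiff, ?_, rfl⟩
  refine isTestFunction_of_forall (K := tsupport φ ∩ {z | ε ≤ z.2})
    (hφ.hasCompactSupport.isCompact.inter_right (isClosed_le continuous_const continuous_snd))
    (fun z hz => ⟨mem_univ _, lt_of_lt_of_le hε hz.2⟩) fun z hz => ?_
  change timeCutoff (ε⁻¹ * z.2) * φ z = 0
  by_cases h1 : z ∈ tsupport φ
  · have h2 : z.2 < ε := by
      by_contra hn
      exact hz ⟨h1, not_lt.1 hn⟩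
    rw [timeCutoff_eq_zero, zero_mul]
    rw [inv_mul_le_iff₀ hε, mul_one]
    exact h2.le
  · rw [image_eq_zero_of_notMem_tsupport h1, mul_zero]

namespace IsNullStokes

variable {h h' : R3 → ℝ≥0∞} {ν : ℝ} {c : ℝ≥0∞} {d : R3 × ℝ → R3}

/-- The momentum equation tested with `Δφ` gives `Q(∂ₗΔφ)`. Testing the divergence with the adjoint
heat operator of `∂ₗφ`, and using the momentum equation with `∂ᵢ∂ₗφ`, shows that the same value is
zero. The pressure is thus eliminated without being known. -/
lemma integral_mul_heatAdj_spaceLap_of_test (N : IsNullStokes ν c h d) {φ : 𝓢(R3 × ℝ, ℝ)}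
    (hφ : IsTestFunction φ) (l : Fin 3) : ∫ z, d z l * heatAdj ν (spaceLap φ) z = 0 := by
  obtain ⟨Q, hQ⟩ := N.momentum
  have hs := hφ.isSmoothCompact
  have htest : IsTestFunction (schwartzLap φ) :=
    IsTestFunction.sum _ fun j => (hφ.lineDeriv _).lineDeriv _
  have h1 := hQ _ htest l
  rw [coe_schwartzLap] at h1
  rw [h1]
  have hl := hφ.lineDeriv (spatialDir l)
  have htest' : IsTestFunction (schwartzHeatAdj ν (∂_{spatialDir l} φ)) :=
    (hl.lineDeriv _).add ((IsTestFunction.sum _ fun j => (hl.lineDeriv _).lineDeriv _).smul ν)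
  have h2 := N.divFree _ htest'
  rw [coe_schwartzHeatAdj] at h2
  have h3 : ∀ i : Fin 3, ∫ z, d z i * dirDeriv (spatialDir i)
      (heatAdj ν (∂_{spatialDir l} φ : 𝓢(R3 × ℝ, ℝ))) z
      = Q (∂_{spatialDir i} (∂_{spatialDir i} (∂_{spatialDir l} φ : 𝓢(R3 × ℝ, ℝ)))) := by
    intro i
    rw [← hQ _ (hl.lineDeriv _) i, ← hl.isSmoothCompact.heatAdj_dirDeriv, dirDeriv_schwartz]
  simp_rw [h3] at h2
  rw [← h2, ← map_sum]
  congr 1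
  ext z
  rw [← dirDeriv_schwartz, coe_schwartzLap, ← hs.spaceLap_dirDeriv, dirDeriv_schwartz,
    ← coe_schwartzLap]
  rfl

/-- The initial condition concerns the fixed slice `ψ(·, 0)`. Replacing it by the moving slice `ψ(·,
t)` costs an error that tends to zero by dominated convergence against `h`. -/
lemma tendsto_integral_slice (N : IsNullStokes ν c h d) (H : IsMajorizingPair h h') (hc : c ≠ ∞)
    {ψ : R3 × ℝ → ℝ} (hψ : IsSmoothCompact ψ) :
    Tendsto (fun t : ℝ => ∫ x, ψ (x, t) • d (x, t)) (𝓝[>] 0 ⊓ ae volume) (𝓝 0) := by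
  obtain ⟨C, hC, hd⟩ := hψ.exists_decay 3
  have hctrl : ∀ᵐ t : ℝ, (AEStronglyMeasurable (fun x : R3 => d (x, t))) ∧
      ∀ᵐ x : R3, ‖d (x, t)‖ₑ ≤ c * h x := by
    have h1 : ∀ᵐ z ∂((volume : Measure R3).prod (volume : Measure ℝ)), ‖d z‖ₑ ≤ c * h z.1 :=
      N.controlled.enorm_le
    have h2 := Measure.ae_ae_of_ae_prod
      (Measure.measurePreserving_swap.quasiMeasurePreserving.ae h1)
    have h3 : AEStronglyMeasurable d ((volume : Measure R3).prod (volume : Measure ℝ)) :=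
      N.controlled.1
    have h4 := (h3.comp_quasiMeasurePreserving
      Measure.measurePreserving_swap.quasiMeasurePreserving).prodMk_left
    filter_upwards [h2, h4] with t h2 h4
    exact ⟨h4, h2⟩
  have hpt : ∀ t x, |ψ (x, t)| ≤ C * ((1 + ‖x‖) ^ 3)⁻¹ := fun t x => by
    refine (hd (x, t)).trans ?_
    unfold stDecay
    exact mul_le_mul_of_nonneg_left (mul_le_of_le_one_right (by positivity)
        (inv_le_one_of_one_le₀ (by nlinarith [sq_nonneg t]))) hC.le
  have hdiff : Tendsto (fun t : ℝ => ∫⁻ x, c * h x * ‖ψ (x, t) - ψ (x, 0)‖ₑ) (𝓝[>] 0)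
      (𝓝 (∫⁻ _ : R3, 0)) := by
    refine tendsto_lintegral_filter_of_dominated_convergence'
      (fun x => c * ENNReal.ofReal (2 * C) * (h x * ENNReal.ofReal ((1 + ‖x‖) ^ 3)⁻¹)) ?_ ?_ ?_ ?_
    · refine Eventually.of_forall fun t => (H.aemeasurable.const_mul c).mul ?_
      have := hψ.continuous
      exact (by fun_prop : Continuous fun x => ψ (x, t) - ψ (x, 0)).enorm.aemeasurable
    · refine Eventually.of_forall fun t => Eventually.of_forall fun x => ?_
      have : ‖ψ (x, t) - ψ (x, 0)‖ₑ
          ≤ ENNReal.ofReal (2 * C) * ENNReal.ofReal ((1 + ‖x‖) ^ 3)⁻¹ := by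
        rw [← ENNReal.ofReal_mul (by positivity), ← ofReal_norm]
        refine ENNReal.ofReal_le_ofReal ((norm_sub_le _ _).trans ?_)
        have e1 := hpt t x
        have e2 := hpt 0 x
        simp only [Real.norm_eq_abs]
        linarith
      calc _ ≤ c * h x * (ENNReal.ofReal (2 * C) * ENNReal.ofReal ((1 + ‖x‖) ^ 3)⁻¹) := by gcongr
        _ = _ := by ring
    · rw [lintegral_const_mul' _ _ (by finiteness)]
      have := H.lintegral_mul_lt_top
      finiteness
    · filter_upwards [H.ae_lt_top] with x hx
      have h1 : Tendsto (fun t : ℝ => ψ (x, t) - ψ (x, 0)) (𝓝[>] 0) (𝓝 0) := by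
        have hcont : Continuous fun t : ℝ => ψ (x, t) - ψ (x, 0) :=
          (hψ.continuous.comp (by fun_prop)).sub continuous_const
        have := hcont.tendsto 0
        rw [sub_self] at this
        exact this.mono_left nhdsWithin_le_nhds
      have h2 := ENNReal.Tendsto.const_mul (a := c * h x)
        ((tendsto_zero_iff_enorm_tendsto_zero).1 h1) (Or.inr (by finiteness))
      rwa [mul_zero] at h2
  rw [lintegral_zero] at hdiff
  have hd0 : Tendsto (fun t : ℝ => ∫ x, (ψ (x, t) - ψ (x, 0)) • d (x, t)) (𝓝[>] 0 ⊓ ae volume)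
      (𝓝 0) := by
    rw [tendsto_zero_iff_enorm_tendsto_zero]
    refine tendsto_of_tendsto_of_tendsto_of_le_of_le' tendsto_const_nhds
      (hdiff.mono_left inf_le_left) (Eventually.of_forall fun _ => zero_le) ?_
    filter_upwards [Filter.mem_inf_of_right hctrl] with t ht
    refine (enorm_integral_le_lintegral_enorm _).trans (lintegral_mono_ae ?_)
    filter_upwards [ht.2] with x hx
    rw [enorm_smul, mul_comm]
    gcongr
  have h0 := (N.initial ψ hψ).add hd0
  rw [add_zero] at h0
  refine h0.congr' ?_
  filter_upwards [Filter.mem_inf_of_right hctrl] with t ht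
  have i1 := integrable_slice_smul H hc ht.1 ht.2 hψ 0
  have i2 := integrable_slice_smul H hc ht.1 ht.2 hψ t
  rw [← integral_add i1]
  · congr 1; funext x
    rw [← add_smul]; congr 1; ring
  · exact (i2.sub i1).congr (Eventually.of_forall fun x => by simp [sub_smul])

end IsNullStokes

lemma IsSmoothCompact.exists_lintegral_heatKernel_mul_indicator_le {φ : R3 × ℝ → ℝ}
    (hφ : IsSmoothCompact φ) : ∃ C R : ℝ, 0 < C ∧ ∀ τ, 0 < τ → ∀ z : R3 × ℝ,
      ∫⁻ y, ‖heatKernel τ y * φ (z + (y, 0))‖ₑ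
        ≤ (Icc (-R) R).indicator (fun _ => ENNReal.ofReal (C * ((1 + ‖z.1‖) ^ 3)⁻¹)) z.2 := by
  obtain ⟨C, R, hC, hb⟩ := exists_integral_heatKernel_mul_abs_le hφ
  refine ⟨C, R, hC, fun τ hτ z => ?_⟩
  have hi := hφ.integrable_slice_mul (continuous_heatKernel hτ) z
  have e : ∀ y, ‖heatKernel τ y * φ (z + (y, 0))‖ = heatKernel τ y * |φ (z + (y, 0))| := fun y => by
    rw [norm_mul, Real.norm_of_nonneg (heatKernel_nonneg hτ.le y), Real.norm_eq_abs]
  rw [← ofReal_integral_norm_eq_lintegral_enorm hi]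
  simp_rw [e]
  refine (ENNReal.ofReal_le_ofReal (hb τ hτ z)).trans (le_of_eq ?_)
  by_cases hz : z.2 ∈ Icc (-R) R
  · simp [indicator_of_mem hz]
  · simp [indicator_of_notMem hz]

lemma indicator_decay_le {C R : ℝ} (hC : 0 ≤ C) (z : R3 × ℝ) :
    (Icc (-R) R).indicator (fun _ => ENNReal.ofReal (C * ((1 + ‖z.1‖) ^ 3)⁻¹)) z.2
      ≤ ENNReal.ofReal (C * (1 + R ^ 2) * stDecay 3 z) := by
  by_cases hz : z.2 ∈ Icc (-R) R
  · rw [indicator_of_mem hz]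
    refine ENNReal.ofReal_le_ofReal ?_
    have h1 : z.2 ^ 2 ≤ R ^ 2 := sq_le_sq' hz.1 hz.2
    have h2 : 1 ≤ (1 + R ^ 2) * (1 + z.2 ^ 2)⁻¹ := by
      rw [← div_eq_mul_inv, one_le_div (by positivity)]; linarith
    calc C * ((1 + ‖z.1‖) ^ 3)⁻¹ ≤ C * ((1 + ‖z.1‖) ^ 3)⁻¹ * ((1 + R ^ 2) * (1 + z.2 ^ 2)⁻¹) :=
          le_mul_of_one_le_right (by positivity) h2
      _ = _ := by rw [stDecay]; ring
  · rw [indicator_of_notMem hz]; exact zero_le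

/-- The bound is uniform in the heat time and its rate is the one for which `h` is integrable. It
justifies the limits at heat time zero and infinity. -/
lemma IsSmoothCompact.exists_heatConv_decay {φ : R3 × ℝ → ℝ} (hφ : IsSmoothCompact φ) :
    ∃ C : ℝ, 0 < C ∧ ∀ τ, 0 < τ → ∀ z, |heatConv τ φ z| ≤ C * stDecay 3 z := by
  obtain ⟨C, R, hC, hb⟩ := hφ.exists_lintegral_heatKernel_mul_indicator_le
  refine ⟨C * (1 + R ^ 2), by positivity, fun τ hτ z => ?_⟩
  have := stDecay_pos 3 z
  rw [← ENNReal.ofReal_le_ofReal_iff (by positivity), ← Real.norm_eq_abs, ofReal_norm]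
  exact enorm_heatConv_le.trans ((hb τ hτ z).trans (indicator_decay_le hC.le z))

lemma heatAdj_spaceLap_comp_add (ν : ℝ) (φ : R3 × ℝ → ℝ) (w z : R3 × ℝ) :
    heatAdj ν (spaceLap fun z => φ (z + w)) z = heatAdj ν (spaceLap φ) (z + w) := by
  have h1 : (spaceLap fun z => φ (z + w)) = fun z => spaceLap φ (z + w) := by
    funext z
    simp only [spaceLap, dirDeriv_comp_add]
  rw [h1]
  generalize spaceLap φ = ψ
  simp only [heatAdj, spaceLap, dirDeriv_comp_add]

namespace IsNullStokes

variable {h h' : R3 → ℝ≥0∞} {ν : ℝ} {c : ℝ≥0∞} {d : R3 × ℝ → R3}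

/-- The test function may now be nonzero at time zero. It is cut off on the time scale `ε`, and the
derivative of the cutoff produces an average of slice integrals over `[ε, 2ε]`, which vanishes in
the limit by the initial condition. -/
lemma integral_mul_heatAdj_spaceLap (N : IsNullStokes ν c h d) (H : IsMajorizingPair h h')
    (hc : c ≠ ∞) {φ : R3 × ℝ → ℝ} (hφ : IsSmoothCompact φ) (l : Fin 3) :
    ∫ z, d z l * heatAdj ν (spaceLap φ) z = 0 := by
  set ψ := spaceLap φ with hψdef
  have hψ : IsSmoothCompact ψ := hφ.spaceLap
  have hθ := hψ.heatAdj ν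
  have iA : ∀ ε, Integrable fun z => d z l * cutoffMul ε (heatAdj ν ψ) z := fun ε =>
    N.controlled.integrable_mul H hc (hθ.cutoffMul ε) l
  have iT : ∀ ε, Integrable fun z => d z l * heatAdj ν (cutoffMul ε ψ) z := fun ε =>
    N.controlled.integrable_mul H hc ((hψ.cutoffMul ε).heatAdj ν) l
  have iB : ∀ ε, Integrable fun z : R3 × ℝ =>
      d z l * (ε⁻¹ * deriv timeCutoff (ε⁻¹ * z.2) * ψ z) := fun ε => by
    refine ((iT ε).sub (iA ε)).congr (Eventually.of_forall fun z => ?_)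
    simp only [Pi.sub_apply, hψ.heatAdj_cutoffMul]
    ring
  have hsum : ∀ ε, 0 < ε → ∫ z, d z l * cutoffMul ε (heatAdj ν ψ) z
      = -∫ z : R3 × ℝ, d z l * (ε⁻¹ * deriv timeCutoff (ε⁻¹ * z.2) * ψ z) := by
    intro ε hε
    obtain ⟨χ, hχ, hχe⟩ := hφ.exists_test_cutoffMul hε
    have h1 := N.integral_mul_heatAdj_spaceLap_of_test hχ l
    rw [hχe, hφ.spaceLap_cutoffMul, ← hψdef] at h1
    rw [eq_neg_iff_add_eq_zero, ← integral_add (iA ε) (iB ε), ← h1]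
    congr 1; funext z
    rw [hψ.heatAdj_cutoffMul]
    ring
  have hA : Tendsto (fun ε => ∫ z, d z l * cutoffMul ε (heatAdj ν ψ) z) (𝓝[>] 0)
      (𝓝 (∫ z, d z l * heatAdj ν ψ z)) := by
    refine tendsto_integral_filter_of_dominated_convergence (fun z => ‖d z l * heatAdj ν ψ z‖)
      (Eventually.of_forall fun ε => (iA ε).1) ?_
      (N.controlled.integrable_mul H hc hθ l).norm ?_
    · refine Eventually.of_forall fun ε => Eventually.of_forall fun z => ?_
      rw [norm_mul, norm_mul, cutoffMul, norm_mul]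
      gcongr
      exact mul_le_of_le_one_left (norm_nonneg _) (abs_timeCutoff_le _)
    · filter_upwards [N.controlled.eq_zero] with z hz
      rcases lt_or_ge 0 z.2 with hp | hp
      · refine tendsto_const_nhds.congr' ?_
        filter_upwards [Ioc_mem_nhdsGT (half_pos hp)] with ε hε
        rw [cutoffMul, timeCutoff_eq_one, one_mul]
        rw [← div_eq_inv_mul, le_div_iff₀ hε.1]
        linarith [hε.2]
      · simp [hz hp]
  have hB : Tendsto (fun ε => ∫ z : R3 × ℝ, d z l * (ε⁻¹ * deriv timeCutoff (ε⁻¹ * z.2) * ψ z))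
      (𝓝[>] 0) (𝓝 0) := by
    obtain ⟨C, hC, hCb⟩ := exists_deriv_timeCutoff_le
    rw [Metric.tendsto_nhds]
    intro δ hδ
    have hm := N.tendsto_integral_slice H hc hψ
    rw [Metric.tendsto_nhds] at hm
    have hm' := hm (δ / (2 * C)) (by positivity)
    rw [Filter.eventually_inf] at hm'
    obtain ⟨S, hS, T, hT, hST⟩ := hm'
    obtain ⟨η, hη, hηS⟩ := mem_nhdsGT_iff_exists_Ioc_subset.1 hS
    have hη0 : 0 < η := hη
    have hsl : ∀ᵐ t : ℝ, Integrable fun x => ψ (x, t) • d (x, t) := by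
      have := N.controlled.integrable_smul H hc hψ
      rw [Measure.volume_eq_prod] at this
      exact this.prod_left_ae
    filter_upwards [Ioc_mem_nhdsGT (half_pos hη0)] with ε hε
    have hε0 : 0 < ε := hε.1
    have hBi := iB ε
    rw [Measure.volume_eq_prod] at hBi
    rw [dist_zero_right, Measure.volume_eq_prod, integral_prod_symm _ hBi]
    have hbound : ∀ᵐ t : ℝ, ‖∫ x, d (x, t) l * (ε⁻¹ * deriv timeCutoff (ε⁻¹ * t) * ψ (x, t))‖
        ≤ (Icc ε (2 * ε)).indicator (fun _ => ε⁻¹ * C * (δ / (2 * C))) t := by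
      filter_upwards [hsl, hT] with t ht htT
      have e : ∫ x, d (x, t) l * (ε⁻¹ * deriv timeCutoff (ε⁻¹ * t) * ψ (x, t))
          = ε⁻¹ * deriv timeCutoff (ε⁻¹ * t) * (∫ x, ψ (x, t) • d (x, t)) l := by
        rw [integral_euclidean_apply ht, ← integral_const_mul]
        congr 1; funext x
        simp only [PiLp.smul_apply, smul_eq_mul]
        ring
      rw [e, norm_mul, norm_mul, Real.norm_of_nonneg (inv_nonneg.2 hε0.le)]
      have h1 := hCb (ε⁻¹ * t)
      by_cases hmem : t ∈ Icc ε (2 * ε)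
      · have hmem' : ε⁻¹ * t ∈ Icc (1 : ℝ) 2 := by
          rw [← div_eq_inv_mul]
          exact ⟨(one_le_div hε0).2 hmem.1, (div_le_iff₀ hε0).2 hmem.2⟩
        rw [indicator_of_mem hmem] 
        rw [indicator_of_mem hmem'] at h1
        have htS : t ∈ S := hηS ⟨lt_of_lt_of_le hε0 hmem.1, hmem.2.trans (by linarith [hε.2])⟩
        have h2 := hST t ⟨htS, htT⟩
        rw [dist_zero_right] at h2
        have h3 : ‖(∫ x, ψ (x, t) • d (x, t)) l‖ ≤ δ / (2 * C) :=
          (abs_apply_le_norm _ l).trans h2.le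
        rw [← Real.norm_eq_abs] at h1
        gcongr
      · have hmem' : ε⁻¹ * t ∉ Icc (1 : ℝ) 2 := by
          rw [← div_eq_inv_mul]
          exact fun hh => hmem ⟨(one_le_div hε0).1 hh.1, (div_le_iff₀ hε0).1 hh.2⟩
        rw [indicator_of_notMem hmem] 
        rw [indicator_of_notMem hmem'] at h1
        rw [abs_nonpos_iff.1 h1]
        simp
    have hfin := norm_integral_le_of_norm_le
      ((integrable_indicator_iff measurableSet_Icc).2 (integrableOn_const (by simp))) hbound
    refine lt_of_le_of_lt hfin ?_
    rw [integral_indicator measurableSet_Icc, setIntegral_const, Measure.real, Real.volume_Icc,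
      ENNReal.toReal_ofReal (by linarith), smul_eq_mul]
    -- The length `ε` of the interval cancels the factor `1/ε` from the derivative of the cutoff.
    have : (2 * ε - ε) * (ε⁻¹ * C * (δ / (2 * C))) = δ / 2 := by field_simp; ring
    rw [this]
    linarith
  refine tendsto_nhds_unique hA ?_
  have := hB.neg
  rw [neg_zero] at this
  refine this.congr' ?_
  filter_upwards [self_mem_nhdsWithin] with ε hε
  exact (hsum ε hε).symm

/-- The preceding identity is applied to all space-time translates of `φ` and averaged against the
heat kernel. Translates can reach time zero, hence the need for test functions that do not vanish
there. Duhamel's formula evaluates the average as minus a heat flow of `Δφ`. -/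
lemma integral_mul_heatConv_spaceLap (N : IsNullStokes ν c h d) (H : IsMajorizingPair h h')
    (hν : 0 < ν) (hc : c ≠ ∞) {φ : R3 × ℝ → ℝ} (hφ : IsSmoothCompact φ) (l : Fin 3) {m : ℝ}
    (hm : 0 < m) : ∫ z, d z l * heatConv (ν * m) (spaceLap φ) z = 0 := by
  have hψ := hφ.spaceLap
  have hθ := hψ.heatAdj ν
  obtain ⟨C, R, hC, hb⟩ := hθ.exists_lintegral_heatKernel_mul_indicator_le
  have hθm := hθ.continuous.measurable
  have hF : Integrable (fun q : (R3 × ℝ) × (R3 × ℝ) => d q.1 l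
      * (heatKernel (ν * (q.2.2 + m)) q.2.1 * heatAdj ν (spaceLap φ) (q.1 + q.2)))
      (volume.prod ((volume : Measure R3).prod halfLine)) := by
    refine ⟨?_, ?_⟩
    · exact ((N.controlled.1.euclidean_apply l).comp_quasiMeasurePreserving
        Measure.quasiMeasurePreserving_fst).mul
        (Measurable.aestronglyMeasurable (by fun_prop))
    refine lt_of_le_of_lt (lintegral_prod_le _) ?_
    refine lt_of_le_of_lt (b := ∫⁻ z, ENNReal.ofReal (2 * R * C * (1 + R ^ 2))
      * (ENNReal.ofReal (stDecay 3 z) * ‖d z‖ₑ)) (lintegral_mono_ae ?_) ?_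
    · filter_upwards [N.controlled.eq_zero] with z hz
      rcases le_or_gt z.2 0 with hz0 | hz0
      · simp [hz hz0]
      simp only [enorm_mul (d z l)]
      rw [lintegral_const_mul' _ _ (by finiteness)]
      have hin : ∫⁻ p : R3 × ℝ, ‖heatKernel (ν * (p.2 + m)) p.1 * heatAdj ν (spaceLap φ) (z + p)‖ₑ
          ∂((volume : Measure R3).prod halfLine)
          ≤ ENNReal.ofReal (2 * R * C * (1 + R ^ 2)) * ENNReal.ofReal (stDecay 3 z) := by
        rw [lintegral_prod_symm _ (Measurable.aemeasurable (by fun_prop))]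
        have hslice : ∀ s, 0 < s →
            ∫⁻ y, ‖heatKernel (ν * (s + m)) y * heatAdj ν (spaceLap φ) (z + (y, s))‖ₑ
            ≤ (Icc (-R) R).indicator (fun _ => ENNReal.ofReal (C * ((1 + ‖z.1‖) ^ 3)⁻¹))
              (z.2 + s) := by
          intro s hs
          have := hb (ν * (s + m)) (by positivity) (z + (0, s))
          simp only [add_zero_mk_add_mk, Prod.fst_add, Prod.snd_add, add_zero] at this
          exact this
        rcases le_or_gt z.2 R with hzR | hzR
        · calc ∫⁻ s in Ioi (0 : ℝ),
                ∫⁻ y, ‖heatKernel (ν * (s + m)) y * heatAdj ν (spaceLap φ) (z + (y, s))‖ₑ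
              ≤ ∫⁻ s in Ioi (0 : ℝ), (Icc (-R) R).indicator
                (fun _ => ENNReal.ofReal (C * ((1 + ‖z.1‖) ^ 3)⁻¹)) (z.2 + s) :=
                setLIntegral_mono' measurableSet_Ioi fun s hs => hslice s hs
            _ ≤ ∫⁻ s, (Icc (-R) R).indicator
                (fun _ => ENNReal.ofReal (C * ((1 + ‖z.1‖) ^ 3)⁻¹)) (z.2 + s) :=
                setLIntegral_le_lintegral _ _
            _ = ENNReal.ofReal (C * ((1 + ‖z.1‖) ^ 3)⁻¹) * ENNReal.ofReal (2 * R) := by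
                rw [lintegral_add_left_eq_self (fun s => (Icc (-R) R).indicator
                  (fun _ => ENNReal.ofReal (C * ((1 + ‖z.1‖) ^ 3)⁻¹)) s) z.2,
                  lintegral_indicator measurableSet_Icc, setLIntegral_const, Real.volume_Icc]
                congr 2; ring
            _ ≤ ENNReal.ofReal (C * (1 + R ^ 2) * stDecay 3 z) * ENNReal.ofReal (2 * R) := by
                refine mul_le_mul' ?_ le_rfl
                have := indicator_decay_le hC.le (R := R) z
                rwa [indicator_of_mem (show z.2 ∈ Icc (-R) R from ⟨by linarith, hzR⟩)] at this
            _ = _ := by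
                have hR : 0 < R := hz0.trans_le hzR
                have := stDecay_pos 3 z
                rw [← ENNReal.ofReal_mul (by positivity), ← ENNReal.ofReal_mul (by positivity)]
                congr 1; ring
        · refine le_trans (setLIntegral_mono' measurableSet_Ioi fun s (hs : 0 < s) =>
            (hslice s hs).trans (le_of_eq (indicator_of_notMem (fun hh => ?_) _))) ?_
          · linarith [hh.2]
          · simp
      calc _ ≤ ‖d z‖ₑ * (ENNReal.ofReal (2 * R * C * (1 + R ^ 2)) * ENNReal.ofReal (stDecay 3 z)) :=
            mul_le_mul' (enorm_apply_le_enorm _ _) hin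
        _ = _ := by ring
    · rw [lintegral_const_mul' _ _ ENNReal.ofReal_ne_top]
      exact ENNReal.mul_lt_top (by finiteness) (N.controlled.lintegral_lt_top H hc)
  have h1 : ∫ q : (R3 × ℝ) × (R3 × ℝ), d q.1 l
      * (heatKernel (ν * (q.2.2 + m)) q.2.1 * heatAdj ν (spaceLap φ) (q.1 + q.2))
      ∂(volume.prod ((volume : Measure R3).prod halfLine)) = 0 := by
    rw [integral_prod_symm _ hF]
    refine integral_eq_zero_of_ae (Eventually.of_forall fun p => ?_)
    have h2 := N.integral_mul_heatAdj_spaceLap H hc (hφ.comp_add p) l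
    simp only [heatAdj_spaceLap_comp_add] at h2
    have : ∀ z, d z l * (heatKernel (ν * (p.2 + m)) p.1 * heatAdj ν (spaceLap φ) (z + p))
        = heatKernel (ν * (p.2 + m)) p.1 * (d z l * heatAdj ν (spaceLap φ) (z + p)) := fun z => by
      ring
    simp only [this]
    rw [integral_const_mul, h2, mul_zero]
    rfl
  rw [integral_prod _ hF] at h1
  rw [← neg_eq_zero, ← integral_neg, ← h1]
  refine integral_congr_ae ?_
  filter_upwards [hF.prod_right_ae, N.controlled.eq_zero] with z hz _
  rw [integral_const_mul, ← mul_neg, ← integral_heatConv_heatAdj hψ hν hm]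
  -- Integrability of the inner integrand is available only after multiplication by `d z l`; where
  -- this factor vanishes, both sides are zero.
  by_cases hd0 : d z l = 0
  · rw [hd0, zero_mul, zero_mul]
  congr 1
  have hz' : Integrable (fun p : R3 × ℝ => heatKernel (ν * (p.2 + m)) p.1
      * heatAdj ν (spaceLap φ) (z + p)) ((volume : Measure R3).prod halfLine) := by
    have := hz.const_mul (d z l)⁻¹
    simpa only [← mul_assoc, inv_mul_cancel₀ hd0, one_mul] using this
  rw [integral_prod_symm _ hz']
  simp only [heatConv, add_zero_mk_add_mk]

/-- A Liouville argument: by the preceding lemma the pairing of `d` with the heat flow of `φ` does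
not change with the heat time. Its limit is the pairing with `φ` as the heat time tends to zero, and
zero as it tends to infinity. -/
lemma integral_mul_eq_zero (N : IsNullStokes ν c h d) (H : IsMajorizingPair h h')
    (hν : 0 < ν) (hc : c ≠ ∞) {φ : R3 × ℝ → ℝ} (hφ : IsSmoothCompact φ) (l : Fin 3) :
    ∫ z, d z l * φ z = 0 := by
  obtain ⟨C, hC, hb⟩ := hφ.exists_heatConv_decay
  obtain ⟨C', hC', hb'⟩ := hφ.spaceLap.exists_heatConv_decay
  have hdm := N.controlled.1.euclidean_apply l
  have hdl := lintegral_stDecay_apply_lt_top (N.controlled.lintegral_lt_top H hc) l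
  have hmeas : ∀ (ψ : R3 × ℝ → ℝ), IsSmoothCompact ψ → ∀ τ,
      AEStronglyMeasurable fun z => heatConv τ ψ z := fun ψ hψ τ =>
    (measurable_heatConv hψ.continuous measurable_const measurable_id).aestronglyMeasurable
  have hdec : ∀ A : ℝ, Integrable fun z => ‖d z l‖ * (A * stDecay 3 z) := by
    intro A
    have hsm : AEStronglyMeasurable fun z : R3 × ℝ => |A| * stDecay 3 z := by
      unfold stDecay
      exact Measurable.aestronglyMeasurable (by fun_prop)
    have h1 := (integrable_smul_of_decay (abs_nonneg A) hdm hdl hsm fun z => by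
      rw [abs_of_nonneg (mul_nonneg (abs_nonneg A) (stDecay_pos 3 z).le)]).norm
    -- The constant `A` may have any sign: integrability is proved with `|A|`, and the sign is
    -- restored as a constant factor.
    refine (h1.const_mul (SignType.sign A : ℝ)).congr (Eventually.of_forall fun z => ?_)
    simp only [smul_eq_mul, norm_mul, Real.norm_eq_abs, abs_abs, abs_of_pos (stDecay_pos 3 z)]
    rw [← mul_assoc, ← mul_assoc, sign_mul_abs]
    ring
  have hle : ∀ {A : ℝ} {ψ : R3 × ℝ → ℝ} {τ : ℝ},
      (∀ z, |heatConv τ ψ z| ≤ A * stDecay 3 z) →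
      ∀ z, ‖d z l * heatConv τ ψ z‖ ≤ ‖d z l‖ * (A * stDecay 3 z) := by
    intro A ψ τ hA z
    rw [norm_mul]
    exact mul_le_mul_of_nonneg_left (hA z) (norm_nonneg _)
  set F : ℝ → ℝ := fun m => ∫ z, d z l * heatConv (ν * m) φ z with hF
  have hderiv : ∀ m, 0 < m → HasDerivAt F 0 m := by
    intro m hm
    have h1 := hasDerivAt_integral_of_dominated_loc_of_deriv_le (μ := volume)
      (F := fun m z => d z l * heatConv (ν * m) φ z)
      (F' := fun m z => d z l * (ν * heatConv (ν * m) (spaceLap φ) z)) (x₀ := m)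
      (s := Ioi 0) (bound := fun z => ‖d z l‖ * (ν * C' * stDecay 3 z)) (Ioi_mem_nhds hm)
      (Eventually.of_forall fun m => hdm.mul (hmeas φ hφ _))
      ((hdec C).mono' (hdm.mul (hmeas φ hφ _))
        (Eventually.of_forall (hle (hb _ (mul_pos hν hm)))))
      (hdm.mul ((hmeas _ hφ.spaceLap _).const_mul ν))
      (Eventually.of_forall fun z m' (hm' : 0 < m') => by
        have := hb' (ν * m') (mul_pos hν hm') z
        rw [norm_mul, norm_mul, Real.norm_of_nonneg hν.le, mul_assoc ν]
        gcongr
        exact this)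
      (hdec (ν * C'))
      (Eventually.of_forall fun z m' (hm' : 0 < m') => by
        have h2 := hasDerivAt_heatConv hφ 0 ν 0 (s₀ := m')
          (by rw [zero_add]; exact mul_pos hν hm') z
        simp only [zero_add, zero_mul, add_zero, ← Prod.zero_eq_mk] at h2
        exact h2.const_mul _)
    have h3 := h1.2
    have h4 : ∫ z, d z l * (ν * heatConv (ν * m) (spaceLap φ) z) = 0 := by
      have : ∀ z, d z l * (ν * heatConv (ν * m) (spaceLap φ) z)
        = ν * (d z l * heatConv (ν * m) (spaceLap φ) z) := fun z => by ring
      simp only [this]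
      rw [integral_const_mul, N.integral_mul_heatConv_spaceLap H hν hc hφ l hm, mul_zero]
    rwa [h4] at h3
  have hconst : ∀ m, 0 < m → F m = F 1 := fun m hm =>
    isOpen_Ioi.is_const_of_deriv_eq_zero isPreconnected_Ioi
      (fun x hx => (hderiv x hx).differentiableAt.differentiableWithinAt)
      (fun x hx => (hderiv x hx).deriv) hm (show (1 : ℝ) ∈ Ioi (0 : ℝ) from mem_Ioi.2 zero_lt_one)
  have hlim0 : Tendsto F (𝓝[>] 0) (𝓝 (∫ z, d z l * φ z)) := by
    refine tendsto_integral_filter_of_dominated_convergence _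
      (Eventually.of_forall fun m => hdm.mul (hmeas φ hφ _)) ?_ (hdec C) ?_
    · filter_upwards [self_mem_nhdsWithin] with m hm
      exact Eventually.of_forall (hle (hb _ (mul_pos hν hm)))
    · refine Eventually.of_forall fun z => Tendsto.const_mul _ ?_
      refine (tendsto_heatConv_zero hφ z).comp ?_
      refine tendsto_nhdsWithin_iff.2 ⟨?_, ?_⟩
      · have : Tendsto (fun t : ℝ => ν * t) (𝓝 0) (𝓝 (ν * 0)) := tendsto_id.const_mul ν
        rw [mul_zero] at this
        exact this.mono_left nhdsWithin_le_nhds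
      · filter_upwards [self_mem_nhdsWithin] with t ht
        exact mul_pos hν ht
  have hlimT : Tendsto F atTop (𝓝 0) := by
    rw [← integral_zero (R3 × ℝ) ℝ (μ := volume)]
    refine tendsto_integral_filter_of_dominated_convergence _
      (Eventually.of_forall fun m => hdm.mul (hmeas φ hφ _)) ?_ (hdec C) ?_
    · filter_upwards [eventually_gt_atTop 0] with m hm
      exact Eventually.of_forall (hle (hb _ (mul_pos hν hm)))
    · refine Eventually.of_forall fun z => ?_
      have := ((tendsto_heatConv_atTop hφ z).comp (tendsto_id.const_mul_atTop hν)).const_mul (d z l)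
      rw [mul_zero] at this
      exact this
  have e0 : ∫ z, d z l * φ z = F 1 := by
    refine tendsto_nhds_unique hlim0 (tendsto_const_nhds.congr' ?_)
    filter_upwards [self_mem_nhdsWithin] with m hm
    exact (hconst m hm).symm
  have e1 : (0 : ℝ) = F 1 := by
    refine tendsto_nhds_unique hlimT (tendsto_const_nhds.congr' ?_)
    filter_upwards [eventually_gt_atTop 0] with m hm
    exact (hconst m hm).symm
  rw [e0, ← e1]

lemma ae_eq_zero (N : IsNullStokes ν c h d) (H : IsMajorizingPair h h') (hν : 0 < ν)
    (hc : c ≠ ∞) : ∀ᵐ z, d z = 0 := by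
  have hl : ∀ l : Fin 3, ∀ᵐ z, d z l = 0 := by
    intro l
    have hdl := lintegral_stDecay_apply_lt_top (N.controlled.lintegral_lt_top H hc) l
    refine ae_eq_zero_of_integral_contDiff_smul_eq_zero (E := R3 × ℝ) (μ := volume)
      (f := fun z => d z l) ?_ fun φ hφ hs => ?_
    · rw [locallyIntegrable_iff]
      intro K hK
      obtain ⟨f, hf, hcs, hf1⟩ : ∃ f : R3 × ℝ → ℝ, ContDiff ℝ (⊤ : ℕ∞) f ∧ HasCompactSupport f ∧
          ∀ z ∈ K, f z = 1 := by
        obtain ⟨R, hR⟩ := hK.isBounded.subset_closedBall (0 : R3 × ℝ)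
        let f : ContDiffBump (0 : R3 × ℝ) :=
          ⟨|R| + 1, |R| + 2, by positivity, by linarith⟩
        refine ⟨f, f.contDiff, f.hasCompactSupport, fun z hz => f.one_of_mem_closedBall ?_⟩
        exact Metric.closedBall_subset_closedBall (by linarith [le_abs_self R]) (hR hz)
      have h1 := N.controlled.integrable_mul H hc ⟨hf, hcs⟩ l
      refine (h1.integrableOn (s := K)).congr_fun (fun z hz => ?_) hK.measurableSet
      simp [hf1 z hz]
    · have := N.integral_mul_eq_zero H hν hc ⟨hφ, hs⟩ l
      simpa [mul_comm] using this
  filter_upwards [ae_all_iff.2 hl] with z hz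
  ext l
  exact hz l

end IsNullStokes

/-! ### Uniqueness -/

/-- The half space is a countable union of compact sets, on each of which square integrability
includes measurability. -/
lemma LocallySquareIntegrable.aestronglyMeasurable {v : R3 → ℝ → R3}
    (hv : LocallySquareIntegrable v) :
    AEStronglyMeasurable (fun z : R3 × ℝ => v z.1 z.2) (volume.restrict spaceTime) := by
  have hU : spaceTime = ⋃ n : ℕ, Metric.closedBall (0 : R3) n ×ˢ Icc (1 / ((n : ℝ) + 1)) n := by
    ext z
    simp only [spaceTime, mem_prod, mem_univ, true_and, mem_Ioi, mem_iUnion, mem_closedBall_zero_iff,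
      mem_Icc]
    constructor
    · intro hz
      obtain ⟨n, hn⟩ := exists_nat_one_div_lt hz
      obtain ⟨m, hm⟩ := exists_nat_ge (max ‖z.1‖ z.2)
      have e1 : (n : ℝ) ≤ (max n m : ℕ) := by exact_mod_cast le_max_left _ _
      have e2 : (m : ℝ) ≤ (max n m : ℕ) := by exact_mod_cast le_max_right _ _
      refine ⟨max n m, ((le_max_left _ _).trans hm).trans e2, le_trans ?_ hn.le,
        ((le_max_right _ _).trans hm).trans e2⟩
      exact one_div_le_one_div_of_le (by positivity) (by linarith)
    · rintro ⟨n, -, h1, -⟩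
      exact lt_of_lt_of_le (by positivity) h1
  have hK : ∀ n : ℕ, AEStronglyMeasurable (fun z : R3 × ℝ => v z.1 z.2)
      (volume.restrict (Metric.closedBall (0 : R3) n ×ˢ Icc (1 / ((n : ℝ) + 1)) n)) := fun n =>
    (hv _ ((isCompact_closedBall _ _).prod isCompact_Icc)
      (hU ▸ subset_iUnion (fun n : ℕ => Metric.closedBall (0 : R3) n ×ˢ Icc (1 / ((n : ℝ) + 1)) n)
        n)).1
  rw [hU]
  exact aestronglyMeasurable_iUnion_iff.2 hK

lemma isControlled_extendZero {c : ℝ≥0∞} {h : R3 → ℝ≥0∞} {v : R3 → ℝ → R3}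
    (hv : AEStronglyMeasurable (fun z : R3 × ℝ => v z.1 z.2) (volume.restrict spaceTime))
    (hb : ∀ x, ∀ t : ℝ, 0 < t → ‖v x t‖ₑ ≤ c * h x) : IsControlled c h (extendZero v) where
  aestronglyMeasurable := aestronglyMeasurable_extendZero hv
  enorm_le := Eventually.of_forall fun z => by
    rcases lt_or_ge 0 z.2 with hz | hz
    · rw [extendZero_of_pos hz]
      exact hb _ _ hz
    · simp [extendZero_of_nonpos hz]
  eq_zero := Eventually.of_forall fun _ hz => extendZero_of_nonpos hz

lemma IsControlled.sub {c c' : ℝ≥0∞} {h : R3 → ℝ≥0∞} {V W : R3 × ℝ → R3} (hV : IsControlled c h V)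
    (hW : IsControlled c' h W) : IsControlled (c + c') h (fun z => V z - W z) where
  aestronglyMeasurable := hV.1.sub hW.1
  enorm_le := by
    filter_upwards [hV.2, hW.2] with z h1 h2
    exact enorm_sub_le.trans ((add_le_add h1 h2).trans (le_of_eq (add_mul _ _ _).symm))
  eq_zero := by
    filter_upwards [hV.3, hW.3] with z h1 h2 hz
    rw [h1 hz, h2 hz, sub_zero]

lemma IsControlled.ae_integrable_slice {h h' : R3 → ℝ≥0∞} (H : IsMajorizingPair h h') {c : ℝ≥0∞}
    (hc : c ≠ ∞) {V : R3 × ℝ → R3} (hV : IsControlled c h V) {ψ : R3 × ℝ → ℝ}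
    (hψ : IsSmoothCompact ψ) (r : ℝ) : ∀ᵐ t : ℝ, Integrable fun x => ψ (x, r) • V (x, t) := by
  have hm : AEStronglyMeasurable (fun q : ℝ × R3 => V (q.2, q.1))
      ((volume : Measure ℝ).prod (volume : Measure R3)) :=
    AEStronglyMeasurable.comp_measurePreserving (g := V) hV.1 Measure.measurePreserving_swap
  have hb : ∀ᵐ q ∂((volume : Measure ℝ).prod (volume : Measure R3)), ‖V (q.2, q.1)‖ₑ ≤ c * h q.2 :=
    Measure.measurePreserving_swap.quasiMeasurePreserving.ae
      (p := fun z : R3 × ℝ => ‖V z‖ₑ ≤ c * h z.1) hV.enorm_le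
  filter_upwards [hm.prodMk_left, Measure.ae_ae_of_ae_prod hb] with t h1 h2
  exact integrable_slice_smul H hc h1 h2 hψ r

namespace SmallData

variable {h h' : R3 → ℝ≥0∞} {ν : ℝ} {u₀ : R3 → R3} {g v : R3 → ℝ → R3}

/-- The mild image is formed with the quadratic term of `v` itself. In the difference the
nonlinearity, the forcing and the initial velocity all cancel, and only the two pressures remain. -/
lemma isNullStokes_sub (D : SmallData ν h h' u₀ (extendZero g)) (hw : IsWeakSolution ν u₀ g v)
    (hV : IsControlled (velBound ν) h (extendZero v)) :
    IsNullStokes ν (velBound ν + velBound ν) h fun z =>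
      extendZero v z - mildMap ν u₀ (extendZero g) (extendZero v) z where
  controlled := hV.sub (D.mildMap_controlled hV)
  momentum := by
    have hc := velBound_ne_top ν
    obtain ⟨q, hq⟩ := exists_clm_pressure D.pos hV.1 D.force.1 (hV.lintegral_mul_lt_top D.pair hc)
      (D.force.lintegral_lt_top' D.pair (forceBound_ne_top ν))
    obtain ⟨p, hp⟩ := hw.momentum
    refine ⟨-p - q, fun φ hφ i => ?_⟩
    have hs := hφ.isSmoothCompact
    have h0 := hp φ hφ i
    rw [hφ.integral_momentum] at h0
    have h1 := D.integral_mildMap_mul_heatAdj hV hs (fun x => hφ.eq_zero le_rfl) i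
    have i1 := hV.integrable_mul D.pair hc (hs.heatAdj ν) i
    have i1' := (D.mildMap_controlled hV).integrable_mul D.pair hc (hs.heatAdj ν) i
    have i2 := integrable_finsetSum Finset.univ fun j (_ : j ∈ Finset.univ) =>
      hV.integrable_mul_mul D.pair hc (hs.dirDeriv (spatialDir j)) i j
    have i3 := D.force.integrable_mul' D.pair (forceBound_ne_top ν) hs i
    have i4 := (hq (∂_{spatialDir i} φ)).1
    rw [dirDeriv_schwartz] at h1
    rw [integral_neg_sub_add i3 i2 i4, ← (hq _).2] at h1
    have h3 := integral_neg_sub_add i1 i2 i3.neg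
    simp only [Pi.neg_apply, ← sub_eq_add_neg, integral_neg] at h3
    rw [h3] at h0
    simp only [PiLp.sub_apply, sub_mul]
    rw [integral_sub i1 i1', h1]
    simp only [sub_apply, neg_apply, ← h0]
    ring
  divFree := by
    intro φ hφ
    have hc := velBound_ne_top ν
    have hs := hφ.isSmoothCompact
    have i1 := fun i => hV.integrable_mul D.pair hc (hs.dirDeriv (spatialDir i)) i
    have i2 := fun i =>
      (D.mildMap_controlled hV).integrable_mul D.pair hc (hs.dirDeriv (spatialDir i)) i
    have h1 := D.sum_integral_mildMap_mul hV hs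
    have h2 := hw.divFree φ hφ
    have h3 : ∑ i, ∫ z, extendZero v z i * dirDeriv (spatialDir i) φ z = 0 := by
      rw [← h2, ← integral_finsetSum _ fun i _ => i1 i]
      congr 1; funext z
      rcases lt_or_ge 0 z.2 with hz | hz
      · simp only [extendZero_of_pos hz, dirDeriv_schwartz]
      · simp only [(hφ.lineDeriv _).eq_zero hz, hφ.dirDeriv_eq_zero _ hz, mul_zero]
    simp only [PiLp.sub_apply, sub_mul]
    rw [Finset.sum_congr rfl fun i _ => integral_sub (i1 i) (i2 i), Finset.sum_sub_distrib, h1, h3,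
      sub_zero]
  initial := by
    intro ψ hψ
    have hc := velBound_ne_top ν
    have hM := D.mildMap_controlled hV
    have h1 := (D.tendsto_integral_smul_mildMap hV hψ 0).mono_left
      (inf_le_left : 𝓝[>] (0 : ℝ) ⊓ ae volume ≤ 𝓝[>] 0)
    have h2 := hw.initial (hψ.slice (0, 0)) (hψ.slice_hasCompactSupport (0, 0))
    simp only [IsSmoothCompact.slice_apply, Prod.mk_add_mk, zero_add] at h2
    have h3 := h2.sub h1
    rw [sub_self] at h3
    refine h3.congr' ?_
    filter_upwards [Filter.mem_inf_of_right (hV.ae_integrable_slice D.pair hc hψ 0),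
      Filter.mem_inf_of_right (hM.ae_integrable_slice D.pair hc hψ 0),
      Filter.mem_inf_of_left self_mem_nhdsWithin] with t i1 i2 (ht : 0 < t)
    simp only [smul_sub]
    rw [integral_sub i1 i2]
    simp only [extendZero_of_pos (z := (_, t)) ht]

theorem ae_eq_mildMap (D : SmallData ν h h' u₀ (extendZero g)) (hw : IsWeakSolution ν u₀ g v)
    (hV : IsControlled (velBound ν) h (extendZero v)) :
    extendZero v =ᵐ[volume] mildMap ν u₀ (extendZero g) (extendZero v) := by
  have hc := velBound_ne_top ν
  filter_upwards [(D.isNullStokes_sub hw hV).ae_eq_zero D.pair D.pos (by finiteness)] with z hz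
  exact sub_eq_zero.1 hz

theorem ae_eq_of_isWeakSolution {u : R3 → ℝ → R3} (D : SmallData ν h h' u₀ (extendZero g))
    (hu : IsWeakSolution ν u₀ g u) (hub : IsControlled (velBound ν) h (extendZero u))
    (hv : IsWeakSolution ν u₀ g v) (hvb : IsControlled (velBound ν) h (extendZero v)) :
    (fun z : R3 × ℝ => v z.1 z.2) =ᵐ[volume.restrict spaceTime] fun z => u z.1 z.2 := by
  have h1 := D.ae_eq_of_mild hvb hub (D.ae_eq_mildMap hv hvb) (D.ae_eq_mildMap hu hub)
  filter_upwards [ae_restrict_of_ae h1, ae_restrict_mem measurableSet_spaceTime] with z h2 hz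
  rwa [extendZero_of_pos hz.2, extendZero_of_pos hz.2] at h2

end SmallData

/-! ### Independent labels on the binary tree -/

/-- Labels in the unit interval for the vertices of the infinite binary tree. -/
abbrev TreeLabels : Type := List Bool → unitInterval

/-- The law of independent uniform labels. -/
noncomputable def treeLaw : Measure TreeLabels := Measure.infinitePi fun _ => volume

instance isProbabilityMeasure_treeLaw : IsProbabilityMeasure treeLaw := by
  unfold treeLaw; infer_instance

/-- The labels of the subtree below a child of the root. -/
def subtree (b : Bool) (ω : TreeLabels) : TreeLabels := fun l => ω (b :: l)

/-- The tree with given label at the root and given subtrees. -/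
def graft (p : unitInterval × TreeLabels × TreeLabels) : TreeLabels
  | [] => p.1
  | false :: l => p.2.1 l
  | true :: l => p.2.2 l

@[fun_prop] lemma measurable_subtree (b : Bool) : Measurable (subtree b) :=
  measurable_pi_lambda _ fun l => measurable_pi_apply (b :: l)

lemma measurable_graft : Measurable graft := by
  refine measurable_pi_lambda _ fun l => ?_
  match l with
  | [] => exact measurable_fst
  | false :: l => exact (measurable_pi_apply l).comp (measurable_fst.comp measurable_snd)
  | true :: l => exact (measurable_pi_apply l).comp (measurable_snd.comp measurable_snd)

/-- A vertex is the root or lies below exactly one of the two children. -/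
lemma prod_eq_prod_preimage_cons {M : Type*} [CommMonoid M] (s : Finset (List Bool))
    (f : List Bool → M) :
    ∏ i ∈ s, f i = (if [] ∈ s then f [] else 1)
      * ((∏ i ∈ s.preimage (List.cons false) (List.cons_injective.injOn), f (false :: i))
        * ∏ i ∈ s.preimage (List.cons true) (List.cons_injective.injOn), f (true :: i)) := by
  classical
  rw [← Finset.prod_ite_eq' s [] f, Finset.prod_preimage' (List.cons false) s _ f,
    Finset.prod_preimage' (List.cons true) s _ f, Finset.prod_filter, Finset.prod_filter,
    ← Finset.prod_mul_distrib, ← Finset.prod_mul_distrib]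
  refine Finset.prod_congr rfl fun i _ => ?_
  match i with
  | [] => simp
  | false :: l => simp
  | true :: l => simp

/-- A cylinder set pulls back to a product of a constraint on the root and one cylinder set for each
subtree, and the product formula splits accordingly. Finite-dimensional cylinders determine the law.
-/
lemma map_graft_treeLaw :
    ((volume : Measure unitInterval).prod (treeLaw.prod treeLaw)).map graft = treeLaw := by
  refine Measure.eq_infinitePi _ fun s t ht => ?_
  rw [Measure.map_apply measurable_graft (MeasurableSet.pi s.countable_toSet fun i _ => ht i)]
  have h1 : graft ⁻¹' (s : Set (List Bool)).pi t = (if [] ∈ s then t [] else univ)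
      ×ˢ ((s.preimage (List.cons false) (List.cons_injective.injOn) : Set (List Bool)).pi
          (fun i => t (false :: i))
        ×ˢ (s.preimage (List.cons true) (List.cons_injective.injOn) : Set (List Bool)).pi
          (fun i => t (true :: i))) := by
    ext p
    simp only [mem_preimage, Set.mem_pi, Finset.mem_coe, mem_prod, Finset.mem_preimage]
    constructor
    · intro h
      refine ⟨?_, fun i hi => h _ hi, fun i hi => h _ hi⟩
      split_ifs with h0
      · exact h _ h0
      · trivial
    · rintro ⟨h0, h1, h2⟩ i hi
      match i with
      | [] => rwa [if_pos hi] at h0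
      | false :: l => exact h1 l hi
      | true :: l => exact h2 l hi
  rw [h1, Measure.prod_prod, Measure.prod_prod, treeLaw, Measure.infinitePi_pi _ fun i _ => ht _,
    Measure.infinitePi_pi _ fun i _ => ht _, prod_eq_prod_preimage_cons s]
  congr 1
  split_ifs
  · rfl
  · exact measure_univ

/-- The label of the root and the two subtrees below it are independent. -/
lemma measurePreserving_split : MeasurePreserving
    (fun ω : TreeLabels => (ω [], subtree false ω, subtree true ω)) treeLaw
    ((volume : Measure unitInterval).prod (treeLaw.prod treeLaw)) where
  measurable := by fun_prop
  map_eq := by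
    conv_lhs => rw [← map_graft_treeLaw, Measure.map_map (by fun_prop) measurable_graft]
    exact Measure.map_id

/-! ### The law of the mark of a vertex -/

/-- The mark of a vertex: its kind and the space-time displacement to its children. The kinds are
`0` for the initial velocity, `1` for branching, `2` for the forcing and `3` for a dead vertex. -/
abbrev Mark : Type := Fin 4 × (R3 × ℝ)

/-- The law of a mark for given densities of the displacement at branching and forcing. -/
noncomputable def markLaw (ρ σ : R3 × ℝ → ℝ≥0∞) : Measure Mark :=
  ENNReal.ofReal (1 / 2) • Measure.dirac (0, 0)
    + ENNReal.ofReal (1 / 5) • (volume.withDensity ρ).map (Prod.mk 1)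
    + ENNReal.ofReal (3 / 10) • (volume.withDensity σ).map (Prod.mk 2)
    + (ENNReal.ofReal (1 / 2) - (ENNReal.ofReal (1 / 5) * (∫⁻ ζ, ρ ζ)
      + ENNReal.ofReal (3 / 10) * ∫⁻ ζ, σ ζ)) • Measure.dirac (3, 0)

section MarkLaw

variable {ρ σ : R3 × ℝ → ℝ≥0∞}

lemma lintegral_markLaw (hρ : Measurable ρ) (hσ : Measurable σ) {f : Mark → ℝ≥0∞}
    (hf : Measurable f) : ∫⁻ m, f m ∂markLaw ρ σ
      = ENNReal.ofReal (1 / 2) * f (0, 0) + ENNReal.ofReal (1 / 5) * (∫⁻ ζ, ρ ζ * f (1, ζ))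
        + ENNReal.ofReal (3 / 10) * (∫⁻ ζ, σ ζ * f (2, ζ))
        + (ENNReal.ofReal (1 / 2) - (ENNReal.ofReal (1 / 5) * (∫⁻ ζ, ρ ζ)
          + ENNReal.ofReal (3 / 10) * ∫⁻ ζ, σ ζ)) * f (3, 0) := by
  have h1 : ∀ k : Fin 4, Measurable fun ζ : R3 × ℝ => f (k, ζ) := fun k => by fun_prop
  simp only [markLaw, lintegral_add_measure, lintegral_smul_measure, smul_eq_mul,
    lintegral_dirac' _ hf]
  rw [lintegral_map hf (by fun_prop), lintegral_map hf (by fun_prop),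
    lintegral_withDensity_eq_lintegral_mul _ hρ (h1 1),
    lintegral_withDensity_eq_lintegral_mul _ hσ (h1 2)]
  rfl

lemma isProbabilityMeasure_markLaw (hρ : Measurable ρ) (hσ : Measurable σ) (hρ1 : ∫⁻ ζ, ρ ζ ≤ 1)
    (hσ1 : ∫⁻ ζ, σ ζ ≤ 1) : IsProbabilityMeasure (markLaw ρ σ) where
  measure_univ := by
    rw [← lintegral_one, lintegral_markLaw hρ hσ measurable_const]
    simp only [mul_one]
    -- The dead mark receives exactly what branching and forcing leave of `1/5 + 3/10 = 1/2`, so the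
    -- truncated subtraction is a true one.
    rw [add_assoc (ENNReal.ofReal (1 / 2)), add_assoc (ENNReal.ofReal (1 / 2)),
      add_tsub_cancel_of_le, ← ENNReal.ofReal_add (by norm_num) (by norm_num), ← ENNReal.ofReal_one]
    · norm_num
    · calc _ ≤ ENNReal.ofReal (1 / 5) * 1 + ENNReal.ofReal (3 / 10) * 1 := by gcongr
        _ = ENNReal.ofReal (1 / 2) := by
          rw [mul_one, mul_one, ← ENNReal.ofReal_add (by norm_num) (by norm_num)]; norm_num

/-- The dead mark has value zero, so densities of mass below one contribute as they are and need no
normalization. -/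
lemma integral_markLaw (hρ : Measurable ρ) (hσ : Measurable σ) (hρ1 : ∫⁻ ζ, ρ ζ ≤ 1)
    (hσ1 : ∫⁻ ζ, σ ζ ≤ 1) {f : Mark → R3} (hf : Measurable f) {C : ℝ} (hC : ∀ m, ‖f m‖ ≤ C)
    (h3 : f (3, 0) = 0) :
    (Integrable (fun ζ => (ρ ζ).toReal • f (1, ζ)) ∧
      Integrable (fun ζ => (σ ζ).toReal • f (2, ζ))) ∧
    ∫ m, f m ∂markLaw ρ σ = (1 / 2 : ℝ) • f (0, 0)
      + (1 / 5 : ℝ) • (∫ ζ, (ρ ζ).toReal • f (1, ζ))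
      + (3 / 10 : ℝ) • (∫ ζ, (σ ζ).toReal • f (2, ζ)) := by
  have := isProbabilityMeasure_markLaw hρ hσ hρ1 hσ1
  have hi : Integrable f (markLaw ρ σ) :=
    Integrable.of_bound hf.aestronglyMeasurable C (Eventually.of_forall hC)
  have f1 := ae_lt_top hρ (hρ1.trans_lt ENNReal.one_lt_top).ne
  have f2 := ae_lt_top hσ (hσ1.trans_lt ENNReal.one_lt_top).ne
  have hi' := hi
  rw [markLaw, integrable_add_measure, integrable_add_measure, integrable_add_measure] at hi'
  obtain ⟨⟨⟨i0, i1⟩, i2⟩, i3⟩ := hi'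
  have hh1 : Integrable (fun ζ => (ρ ζ).toReal • f (1, ζ)) := by
    rw [integrable_smul_measure (by simp) (by simp),
      integrable_map_measure hf.aestronglyMeasurable (by fun_prop)] at i1
    exact (integrable_withDensity_iff_integrable_smul' hρ f1).1 i1
  have hh2 : Integrable (fun ζ => (σ ζ).toReal • f (2, ζ)) := by
    rw [integrable_smul_measure (by simp) (by simp),
      integrable_map_measure hf.aestronglyMeasurable (by fun_prop)] at i2
    exact (integrable_withDensity_iff_integrable_smul' hσ f2).1 i2
  refine ⟨⟨hh1, hh2⟩, ?_⟩
  rw [markLaw, integral_add_measure (i0.add_measure i1 |>.add_measure i2) i3,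
    integral_add_measure (i0.add_measure i1) i2, integral_add_measure i0 i1]
  simp only [integral_smul_measure]
  rw [integral_dirac' _ _ hf.stronglyMeasurable, integral_dirac' _ _ hf.stronglyMeasurable, h3,
    integral_map (by fun_prop) hf.aestronglyMeasurable,
    integral_map (by fun_prop) hf.aestronglyMeasurable,
    integral_withDensity_eq_integral_toReal_smul hρ f1,
    integral_withDensity_eq_integral_toReal_smul hσ f2, smul_zero, add_zero,
    ENNReal.toReal_ofReal (by norm_num), ENNReal.toReal_ofReal (by norm_num),
    ENNReal.toReal_ofReal (by norm_num)]

/-- This makes the family of mark laws a probability kernel in the state, as the sampler requires.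
-/
lemma measurable_markLaw {S : Type*} [MeasurableSpace S] {ρ σ : S → R3 × ℝ → ℝ≥0∞}
    (hρ : Measurable (Function.uncurry ρ)) (hσ : Measurable (Function.uncurry σ)) :
    Measurable fun s => markLaw (ρ s) (σ s) := by
  refine Measure.measurable_of_measurable_coe _ fun A hA => ?_
  have hf : Measurable (A.indicator (1 : Mark → ℝ≥0∞)) := measurable_one.indicator hA
  have h1 : ∀ k : Fin 4, Measurable fun ζ : R3 × ℝ => A.indicator (1 : Mark → ℝ≥0∞) (k, ζ) :=
    fun k => by fun_prop
  simp only [← lintegral_indicator_one hA, fun s => lintegral_markLaw (ρ := ρ s) (σ := σ s)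
    (hρ.comp measurable_prodMk_left) (hσ.comp measurable_prodMk_left) hf]
  have m1 : Measurable fun s => ∫⁻ ζ, ρ s ζ := hρ.lintegral_prod_right
  have m2 : Measurable fun s => ∫⁻ ζ, σ s ζ := hσ.lintegral_prod_right
  have m3 : Measurable fun s => ∫⁻ ζ, ρ s ζ * A.indicator (1 : Mark → ℝ≥0∞) (1, ζ) :=
    Measurable.lintegral_prod_right (f := fun s ζ => ρ s ζ * A.indicator (1 : Mark → ℝ≥0∞) (1, ζ))
      (hρ.mul ((h1 1).comp measurable_snd))
  have m4 : Measurable fun s => ∫⁻ ζ, σ s ζ * A.indicator (1 : Mark → ℝ≥0∞) (2, ζ) :=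
    Measurable.lintegral_prod_right (f := fun s ζ => σ s ζ * A.indicator (1 : Mark → ℝ≥0∞) (2, ζ))
      (hσ.mul ((h1 2).comp measurable_snd))
  fun_prop

end MarkLaw

/-! ### Subcritical branching processes -/

/-- A branching mechanism with states in `S`: a vertex in state `s` with label `r` has the mark
`mark s r` and, if this mark is of the branching kind, two children in state `child s (mark s r)`.
The value at time `t` of a vertex is computed from the values of its children. -/
structure Branching (S : Type*) [MeasurableSpace S] where
  mark : S → unitInterval → Mark
  child : S → Mark → S
  value : S → Mark → ℝ → R3 → R3 → R3
  bound : ℝ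
  measurable_mark : Measurable fun q : S × unitInterval => mark q.1 q.2
  measurable_child : Measurable fun q : S × Mark => child q.1 q.2
  measurable_value : Measurable fun q : S × Mark × ℝ × R3 × R3 =>
    value q.1 q.2.1 q.2.2.1 q.2.2.2.1 q.2.2.2.2
  norm_value_lt : ∀ s m t a b, ‖value s m t a b‖ < bound
  value_congr : ∀ s m t a b a' b', m.1 ≠ 1 → value s m t a b = value s m t a' b'
  subcritical : ∀ s, volume {r | (mark s r).1 = 1} ≤ ENNReal.ofReal (1 / 5)

namespace Branching

variable {S : Type*} [MeasurableSpace S] (B : Branching S)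

attribute [fun_prop] measurable_mark measurable_child measurable_value

/-- The state of the children of a vertex in state `s` with label `r`. -/
def next (s : S) (r : unitInterval) : S := B.child s (B.mark s r)

lemma measurable_next : Measurable fun q : S × unitInterval => B.next q.1 q.2 :=
  B.measurable_child.comp (measurable_fst.prodMk B.measurable_mark)

/-- The tree of descendants of a vertex in state `s` has fewer than `n` generations. -/
def ExtinctBy : ℕ → S → TreeLabels → Prop
  | 0, _, _ => False
  | n + 1, s, ω => (B.mark s (ω [])).1 ≠ 1 ∨
      (ExtinctBy n (B.next s (ω [])) (subtree false ω) ∧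
        ExtinctBy n (B.next s (ω [])) (subtree true ω))

/-- The value of a vertex when its descendants from generation `n` on have value zero. -/
noncomputable def truncValue : ℕ → ℝ → S → TreeLabels → R3
  | 0, _, _, _ => 0
  | n + 1, t, s, ω => B.value s (B.mark s (ω [])) t
      (truncValue n (t - (B.mark s (ω [])).2.2) (B.next s (ω [])) (subtree false ω))
      (truncValue n (t - (B.mark s (ω [])).2.2) (B.next s (ω [])) (subtree true ω))

variable {B}

lemma ExtinctBy.succ {n : ℕ} {s : S} {ω : TreeLabels} (h : B.ExtinctBy n s ω) :
    B.ExtinctBy (n + 1) s ω := by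
  induction n generalizing s ω with
  | zero => exact h.elim
  | succ n ih => exact h.imp_right fun h => ⟨ih h.1, ih h.2⟩

/-- Below the last generation nothing is evaluated: a vertex that does not branch ignores the values
assigned to its children. -/
lemma ExtinctBy.truncValue_succ {n : ℕ} {s : S} {ω : TreeLabels} (h : B.ExtinctBy n s ω) (t : ℝ) :
    B.truncValue (n + 1) t s ω = B.truncValue n t s ω := by
  induction n generalizing s ω t with
  | zero => exact h.elim
  | succ n ih =>
    rcases h with h | h
    · exact B.value_congr _ _ _ _ _ _ _ h
    · rw [truncValue, ih h.1, ih h.2]; rfl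

lemma ExtinctBy.mono {n k : ℕ} {s : S} {ω : TreeLabels} (h : B.ExtinctBy n s ω) (hk : n ≤ k) :
    B.ExtinctBy k s ω := by
  induction k, hk using Nat.le_induction with
  | base => exact h
  | succ k _ ih => exact ih.succ

lemma ExtinctBy.truncValue_eq {n k : ℕ} {s : S} {ω : TreeLabels} (h : B.ExtinctBy n s ω)
    (hk : n ≤ k) (t : ℝ) : B.truncValue k t s ω = B.truncValue n t s ω := by
  induction k, hk using Nat.le_induction with
  | base => rfl
  | succ k hk ih => rw [(h.mono hk).truncValue_succ, ih]

variable (B)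

lemma measurableSet_branches : MeasurableSet {q : S × unitInterval | (B.mark q.1 q.2).1 = 1} :=
  (measurable_fst.comp B.measurable_mark) (measurableSet_singleton 1)

lemma measurableSet_extinctBy (n : ℕ) :
    MeasurableSet {q : S × TreeLabels | B.ExtinctBy n q.1 q.2} := by
  induction n with
  | zero => exact MeasurableSet.empty
  | succ n ih =>
    have h0 : Measurable fun q : S × TreeLabels => (q.1, q.2 []) := by fun_prop
    have h1 := B.measurable_next.comp h0
    have h2 : ∀ b, Measurable fun q : S × TreeLabels => (B.next q.1 (q.2 []), subtree b q.2) :=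
      fun b => h1.prodMk (by fun_prop)
    exact (h0 B.measurableSet_branches).compl.union
      ((h2 false ih).inter (h2 true ih))

lemma measurable_truncValue (n : ℕ) :
    Measurable fun q : ℝ × S × TreeLabels => B.truncValue n q.1 q.2.1 q.2.2 := by
  induction n with
  | zero => exact measurable_const
  | succ n ih =>
    have h0 : Measurable fun q : ℝ × S × TreeLabels => (q.2.1, q.2.2 []) := by fun_prop
    have h1 := B.measurable_next.comp h0
    have h2 := B.measurable_mark.comp h0
    have h3 : Measurable fun q : ℝ × S × TreeLabels => q.1 - (B.mark q.2.1 (q.2.2 [])).2.2 :=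
      measurable_fst.sub (measurable_snd.comp (measurable_snd.comp h2))
    have h4 : ∀ b, Measurable fun q : ℝ × S × TreeLabels =>
        (q.1 - (B.mark q.2.1 (q.2.2 [])).2.2, B.next q.2.1 (q.2.2 []), subtree b q.2.2) :=
      fun b => h3.prodMk (h1.prodMk (by fun_prop))
    exact B.measurable_value.comp ((measurable_fst.comp measurable_snd).prodMk
      (h2.prodMk (measurable_fst.prodMk ((ih.comp (h4 false)).prodMk (ih.comp (h4 true))))))

/-- To survive `n + 1` generations the root must branch, with probability at most `1/5`, and one of
two independent subtrees must survive `n`. The union bound gives the factor `2/5` for each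
generation. -/
lemma treeLaw_not_extinctBy_le (n : ℕ) (s : S) :
    treeLaw {ω | ¬B.ExtinctBy n s ω} ≤ ENNReal.ofReal (2 / 5) ^ n := by
  induction n generalizing s with
  | zero => rw [pow_zero]; exact prob_le_one
  | succ n ih =>
    have hm := B.measurableSet_extinctBy n
    set A : Bool → Set (unitInterval × TreeLabels × TreeLabels) := fun b =>
      {p | (B.mark s p.1).1 = 1 ∧ ¬B.ExtinctBy n (B.next s p.1) (bif b then p.2.2 else p.2.1)}
      with hA
    have hbr : MeasurableSet {r | (B.mark s r).1 = 1} :=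
      measurable_prodMk_left B.measurableSet_branches
    have hnx : Measurable fun p : unitInterval × TreeLabels × TreeLabels => B.next s p.1 :=
      B.measurable_next.comp (measurable_const.prodMk measurable_fst)
    have hAm : ∀ b, MeasurableSet (A b) := fun b => by
      refine (measurable_fst hbr).inter (MeasurableSet.compl ?_)
      cases b
      · exact (hnx.prodMk (by fun_prop : Measurable fun p : unitInterval × TreeLabels × TreeLabels =>
          p.2.1)) hm
      · exact (hnx.prodMk (by fun_prop : Measurable fun p : unitInterval × TreeLabels × TreeLabels =>
          p.2.2)) hm
    have hAle : ∀ b, ((volume : Measure unitInterval).prod (treeLaw.prod treeLaw)) (A b)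
        ≤ ENNReal.ofReal (1 / 5) * ENNReal.ofReal (2 / 5) ^ n := by
      intro b
      rw [Measure.prod_apply (hAm b)]
      calc _ ≤ ∫⁻ r, {r | (B.mark s r).1 = 1}.indicator (fun _ => ENNReal.ofReal (2 / 5) ^ n) r := by
            refine lintegral_mono fun r => ?_
            by_cases hr : (B.mark s r).1 = 1
            · rw [indicator_of_mem (show r ∈ {r | (B.mark s r).1 = 1} from hr)]
              have hne : MeasurableSet {ω | ¬B.ExtinctBy n (B.next s r) ω} :=
                (measurable_prodMk_left hm).compl
              refine le_trans (le_of_eq ?_) (ih (B.next s r))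
              cases b
              · have : Prod.mk r ⁻¹' A false = {ω | ¬B.ExtinctBy n (B.next s r) ω} ×ˢ univ := by
                  ext p; simp [hA, hr]
                rw [this, Measure.prod_prod, measure_univ, mul_one]
              · have : Prod.mk r ⁻¹' A true = univ ×ˢ {ω | ¬B.ExtinctBy n (B.next s r) ω} := by
                  ext p; simp [hA, hr]
                rw [this, Measure.prod_prod, measure_univ, one_mul]
            · have : Prod.mk r ⁻¹' A b = ∅ := by ext p; simp [hA, hr]
              rw [this, measure_empty]
              exact zero_le
        _ = ENNReal.ofReal (2 / 5) ^ n * volume {r | (B.mark s r).1 = 1} := by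
            rw [lintegral_indicator hbr, setLIntegral_const]
        _ ≤ _ := by rw [mul_comm]; gcongr; exact B.subcritical s
    have hsub : {ω | ¬B.ExtinctBy (n + 1) s ω} ⊆
        (fun ω : TreeLabels => (ω [], subtree false ω, subtree true ω)) ⁻¹' (A false ∪ A true) := by
      intro ω hω
      simp only [ExtinctBy, mem_ofPred_eq, not_or, not_not, not_and_or] at hω
      exact hω.2.imp (fun h => ⟨hω.1, h⟩) (fun h => ⟨hω.1, h⟩)
    calc _ ≤ _ := measure_mono hsub
      _ = _ := measurePreserving_split.measure_preimage
          ((hAm false).union (hAm true)).nullMeasurableSet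
      _ ≤ _ := measure_union_le _ _
      _ ≤ _ := add_le_add (hAle false) (hAle true)
      _ = ENNReal.ofReal (2 / 5) ^ (n + 1) := by
        rw [← add_mul, ← ENNReal.ofReal_add (by norm_num) (by norm_num), pow_succ']
        norm_num

lemma ae_extinct (s : S) : ∀ᵐ ω ∂treeLaw, ∃ n, B.ExtinctBy n s ω := by
  rw [ae_iff]
  have h1 : Tendsto (fun n : ℕ => ENNReal.ofReal (2 / 5) ^ n) atTop (𝓝 0) :=
    ENNReal.tendsto_pow_atTop_nhds_zero_of_lt_one (by
      rw [← ENNReal.ofReal_one, ENNReal.ofReal_lt_ofReal_iff one_pos]; norm_num)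
  refine le_antisymm (ge_of_tendsto' h1 fun n => ?_) zero_le
  refine (measure_mono ?_).trans (B.treeLaw_not_extinctBy_le n s)
  intro ω (hω : ¬∃ n, B.ExtinctBy n s ω) hn
  exact hω ⟨n, hn⟩

open Classical in
/-- The value of a vertex in state `s`; it is zero if the tree of descendants is infinite. -/
noncomputable def rootValue (t : ℝ) (s : S) (ω : TreeLabels) : R3 :=
  if h : ∃ n, B.ExtinctBy n s ω then B.truncValue (Nat.find h) t s ω else 0

variable {B}

lemma ExtinctBy.rootValue_eq {n : ℕ} {s : S} {ω : TreeLabels} (h : B.ExtinctBy n s ω) (t : ℝ) :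
    B.rootValue t s ω = B.truncValue n t s ω := by
  classical
  have hex : ∃ n, B.ExtinctBy n s ω := ⟨n, h⟩
  rw [rootValue, dif_pos hex]
  exact ((Nat.find_spec hex).truncValue_eq (Nat.find_min' hex h) t).symm

variable (B)

lemma norm_rootValue_lt (t : ℝ) (s : S) (ω : TreeLabels) : ‖B.rootValue t s ω‖ < B.bound := by
  by_cases h : ∃ n, B.ExtinctBy n s ω
  · obtain ⟨n, hn⟩ := h
    rw [hn.rootValue_eq]
    cases n with
    | zero => exact hn.elim
    | succ n => exact B.norm_value_lt _ _ _ _ _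
  · rw [rootValue, dif_neg h, norm_zero]
    exact (norm_nonneg _).trans_lt (B.norm_value_lt s (0, 0) 0 0 0)

/-- The root value is a pointwise limit of truncated values restricted to extinction by generation
`n`; these are eventually constant, or identically zero when the tree is infinite. -/
lemma measurable_rootValue : Measurable fun q : ℝ × S × TreeLabels =>
    B.rootValue q.1 q.2.1 q.2.2 := by
  have hm : ∀ n, MeasurableSet {q : ℝ × S × TreeLabels | B.ExtinctBy n q.2.1 q.2.2} := fun n =>
    measurable_snd (B.measurableSet_extinctBy n)
  refine measurable_of_tendsto_metrizable
    (fun n => (B.measurable_truncValue n).indicator (hm n)) (tendsto_pi_nhds.2 fun q => ?_)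
  by_cases h : ∃ n, B.ExtinctBy n q.2.1 q.2.2
  · obtain ⟨n, hn⟩ := h
    refine tendsto_const_nhds.congr' ?_
    filter_upwards [eventually_ge_atTop n] with k hk
    rw [indicator_of_mem (show q ∈ {q : ℝ × S × TreeLabels | B.ExtinctBy k q.2.1 q.2.2} from
      hn.mono hk), (hn.mono hk).rootValue_eq]
  · have h0 : B.rootValue q.1 q.2.1 q.2.2 = 0 := dif_neg h
    rw [h0]
    refine tendsto_const_nhds.congr fun k => ?_
    exact (indicator_of_notMem (s := {q : ℝ × S × TreeLabels | B.ExtinctBy k q.2.1 q.2.2})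
      (fun hk => h ⟨k, hk⟩) _).symm

/-- If the root branches, extinction passes to both subtrees and the truncated recursion has
stabilized. If it does not, the subtrees may be infinite, but their values are irrelevant. -/
lemma rootValue_eq_value {s : S} {ω : TreeLabels} (h : ∃ n, B.ExtinctBy n s ω) (t : ℝ) :
    B.rootValue t s ω = B.value s (B.mark s (ω [])) t
      (B.rootValue (t - (B.mark s (ω [])).2.2) (B.next s (ω [])) (subtree false ω))
      (B.rootValue (t - (B.mark s (ω [])).2.2) (B.next s (ω [])) (subtree true ω)) := by
  obtain ⟨n, hn⟩ := h
  rw [hn.rootValue_eq]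
  cases n with
  | zero => exact hn.elim
  | succ n =>
    rcases hn with hk | ⟨h1, h2⟩
    · exact B.value_congr _ _ _ _ _ _ _ hk
    · rw [h1.rootValue_eq, h2.rootValue_eq]
      rfl

/-- The expected value of a vertex in state `s`. -/
noncomputable def mean (t : ℝ) (s : S) : R3 := ∫ ω, B.rootValue t s ω ∂treeLaw

lemma stronglyMeasurable_mean : StronglyMeasurable fun q : ℝ × S => B.mean q.1 q.2 :=
  StronglyMeasurable.integral_prod_right' (f := fun p : (ℝ × S) × TreeLabels =>
    B.rootValue p.1.1 p.1.2 p.2)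
    (B.measurable_rootValue.comp (by fun_prop : Measurable fun p : (ℝ × S) × TreeLabels =>
      (p.1.1, p.1.2, p.2))).stronglyMeasurable

lemma norm_mean_le (t : ℝ) (s : S) : ‖B.mean t s‖ ≤ B.bound := by
  have := norm_integral_le_of_norm_le_const (μ := treeLaw)
    (Eventually.of_forall fun ω => (B.norm_rootValue_lt t s ω).le)
  simpa [mean] using this

lemma integrable_rootValue (t : ℝ) (s : S) : Integrable (B.rootValue t s) treeLaw :=
  Integrable.of_bound (B.measurable_rootValue.comp (by fun_prop : Measurable fun ω : TreeLabels =>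
    (t, s, ω))).aestronglyMeasurable B.bound
    (Eventually.of_forall fun ω => (B.norm_rootValue_lt t s ω).le)

/-- The expected value of a vertex with a given mark. -/
noncomputable def markMean (t : ℝ) (s : S) (m : Mark) : R3 :=
  ∫ p : TreeLabels × TreeLabels, B.value s m t (B.rootValue (t - m.2.2) (B.child s m) p.1)
    (B.rootValue (t - m.2.2) (B.child s m) p.2) ∂(treeLaw.prod treeLaw)

lemma measurable_value_rootValue (t : ℝ) (s : S) :
    Measurable fun q : Mark × TreeLabels × TreeLabels =>
      B.value s q.1 t (B.rootValue (t - q.1.2.2) (B.child s q.1) q.2.1)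
        (B.rootValue (t - q.1.2.2) (B.child s q.1) q.2.2) := by
  have h1 : Measurable fun q : Mark × TreeLabels × TreeLabels => B.child s q.1 :=
    B.measurable_child.comp (by fun_prop : Measurable fun q : Mark × TreeLabels × TreeLabels =>
      (s, q.1))
  have h2 : Measurable fun q : Mark × TreeLabels × TreeLabels => t - q.1.2.2 := by fun_prop
  have h3 := B.measurable_rootValue.comp (h2.prodMk (h1.prodMk
    (by fun_prop : Measurable fun q : Mark × TreeLabels × TreeLabels => q.2.1)))
  have h4 := B.measurable_rootValue.comp (h2.prodMk (h1.prodMk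
    (by fun_prop : Measurable fun q : Mark × TreeLabels × TreeLabels => q.2.2)))
  exact B.measurable_value.comp (measurable_const.prodMk (measurable_fst.prodMk
    (measurable_const.prodMk (h3.prodMk h4))))

lemma measurable_markMean (t : ℝ) (s : S) : Measurable (B.markMean t s) :=
  (StronglyMeasurable.integral_prod_right' (f := fun q : Mark × TreeLabels × TreeLabels =>
    B.value s q.1 t (B.rootValue (t - q.1.2.2) (B.child s q.1) q.2.1)
      (B.rootValue (t - q.1.2.2) (B.child s q.1) q.2.2))
    (B.measurable_value_rootValue t s).stronglyMeasurable).measurable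

lemma norm_markMean_le (t : ℝ) (s : S) (m : Mark) : ‖B.markMean t s m‖ ≤ B.bound := by
  have := norm_integral_le_of_norm_le_const (μ := treeLaw.prod treeLaw)
    (f := fun p => B.value s m t (B.rootValue (t - m.2.2) (B.child s m) p.1)
      (B.rootValue (t - m.2.2) (B.child s m) p.2))
    (Eventually.of_forall fun ω => (B.norm_value_lt _ _ _ _ _).le)
  simpa [markMean] using this

/-- The mean is obtained by conditioning on the mark of the root. -/
lemma mean_eq_integral_markMean (t : ℝ) (s : S) :
    B.mean t s = ∫ m, B.markMean t s m ∂((volume : Measure unitInterval).map (B.mark s)) := by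
  have hmk : Measurable (B.mark s) := B.measurable_mark.comp measurable_prodMk_left
  have hG : Measurable fun p : unitInterval × TreeLabels × TreeLabels =>
      B.value s (B.mark s p.1) t (B.rootValue (t - (B.mark s p.1).2.2) (B.next s p.1) p.2.1)
        (B.rootValue (t - (B.mark s p.1).2.2) (B.next s p.1) p.2.2) :=
    (B.measurable_value_rootValue t s).comp ((hmk.comp measurable_fst).prodMk measurable_snd)
  rw [integral_map hmk.aemeasurable (B.measurable_markMean t s).aestronglyMeasurable, mean,
    -- The recursion for the root value holds almost surely, by extinction. The independence of the
    -- root label and the two subtrees then factorizes the expectation.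
    integral_congr_ae ((B.ae_extinct s).mono fun ω hω => B.rootValue_eq_value hω t)]
  have h1 := integral_map (μ := treeLaw) measurePreserving_split.measurable.aemeasurable
    (f := fun p : unitInterval × TreeLabels × TreeLabels =>
      B.value s (B.mark s p.1) t (B.rootValue (t - (B.mark s p.1).2.2) (B.next s p.1) p.2.1)
        (B.rootValue (t - (B.mark s p.1).2.2) (B.next s p.1) p.2.2)) hG.aestronglyMeasurable
  rw [measurePreserving_split.map_eq] at h1
  rw [← h1, integral_prod]
  · rfl
  · exact Integrable.of_bound hG.aestronglyMeasurable B.bound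
      (Eventually.of_forall fun p => (B.norm_value_lt _ _ _ _ _).le)

end Branching

/-! ### The branching process of the Navier–Stokes equations -/

/-- The state of a vertex: a position and the weight at this position. -/
abbrev WeightedPoint : Type := R3 × ℝ≥0∞

/-- The density of the displacement at a branching vertex in state `s`. -/
noncomputable def branchDensity (ν : ℝ) (w : R3 → ℝ≥0∞) (s : WeightedPoint) (ζ : R3 × ℝ) : ℝ≥0∞ :=
  ENNReal.ofReal (Real.pi * ν) * (ENNReal.ofReal (oseenGradMaj ν ζ) * w (s.1 - ζ.1) ^ 2) / s.2

/-- The density of the displacement at a forcing vertex in state `s`. -/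
noncomputable def forceDensity (ν : ℝ) (w : R3 → ℝ≥0∞) (s : WeightedPoint) (ζ : R3 × ℝ) : ℝ≥0∞ :=
  ENNReal.ofReal (2 * Real.pi * ν) * (ENNReal.ofReal (oseenMaj ν ζ) * w (s.1 - ζ.1)) / s.2

open Classical in
/-- The density `ρ` if its total mass is at most one, and zero otherwise. -/
noncomputable def subProb (ρ : R3 × ℝ → ℝ≥0∞) (ζ : R3 × ℝ) : ℝ≥0∞ :=
  if ∫⁻ ζ, ρ ζ ≤ 1 then ρ ζ else 0

lemma subProb_eq {ρ : R3 × ℝ → ℝ≥0∞} (h : ∫⁻ ζ, ρ ζ ≤ 1) : subProb ρ = ρ := by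
  funext ζ; rw [subProb, if_pos h]

lemma lintegral_subProb_le (ρ : R3 × ℝ → ℝ≥0∞) : ∫⁻ ζ, subProb ρ ζ ≤ 1 := by
  by_cases h : ∫⁻ ζ, ρ ζ ≤ 1
  · rwa [subProb_eq h]
  · simp [subProb, h]

lemma Measurable.subProb {ρ : R3 × ℝ → ℝ≥0∞} (hρ : Measurable ρ) : Measurable (subProb ρ) := by
  by_cases h : ∫⁻ ζ, ρ ζ ≤ 1
  · rwa [subProb_eq h]
  · have : _root_.subProb ρ = fun _ => 0 := funext fun ζ => if_neg h
    rw [this]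
    exact measurable_const

lemma measurable_subProb {S : Type*} [MeasurableSpace S] {ρ : S → R3 × ℝ → ℝ≥0∞}
    (hρ : Measurable (Function.uncurry ρ)) :
    Measurable (Function.uncurry fun s => subProb (ρ s)) := by
  have h1 : Measurable fun s => ∫⁻ ζ, ρ s ζ := hρ.lintegral_prod_right
  exact Measurable.ite (measurableSet_le (h1.comp measurable_fst) measurable_const) hρ
    measurable_const

lemma measurable_branchDensity {ν : ℝ} {w : R3 → ℝ≥0∞} (hw : Measurable w) :
    Measurable (Function.uncurry (branchDensity ν w)) := by
  unfold branchDensity Function.uncurry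
  fun_prop

lemma measurable_forceDensity {ν : ℝ} {w : R3 → ℝ≥0∞} (hw : Measurable w) :
    Measurable (Function.uncurry (forceDensity ν w)) := by
  unfold forceDensity Function.uncurry
  fun_prop

lemma measurable_branchDensity_apply {ν : ℝ} {w : R3 → ℝ≥0∞} (hw : Measurable w)
    (s : WeightedPoint) : Measurable (branchDensity ν w s) := by
  unfold branchDensity
  fun_prop

lemma measurable_forceDensity_apply {ν : ℝ} {w : R3 → ℝ≥0∞} (hw : Measurable w)
    (s : WeightedPoint) : Measurable (forceDensity ν w s) := by
  unfold forceDensity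
  fun_prop

/-- The value of a vertex with mark `m` whose children have values `a` and `b`, for a heat flow
`U`, a forcing `k` and a weight `w` of the forcing. -/
noncomputable def vertexValue (ν : ℝ) (w : R3 → ℝ≥0∞) (U k : R3 × ℝ → R3) (s : WeightedPoint)
    (m : Mark) (t : ℝ) (a b : R3) : R3 :=
  -- Each factor inverts the probability of the kind and the numerical constant of its density: `2`
  -- for probability `1/2`, `5` for `1/5`, and `(10/3)/(2πν) = 5/(3πν)` for `3/10`. The minus sign
  -- is that of the transport term.
  if m.1 = 0 then (2 / s.2.toReal) • U (s.1, t)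
  else if m.1 = 1 then (-(5 / (Real.pi * ν * oseenGradMaj ν m.2))) • oseenGrad ν m.2 a b
  else if m.1 = 2 then
    (5 / (3 * Real.pi * ν * (oseenMaj ν m.2 * (w (s.1 - m.2.1)).toReal)))
      • oseen ν m.2 (k ((s.1, t) - m.2))
  else 0

open Classical in
/-- The vector `a`, replaced by zero unless `0 < t` and `a` is shorter than `c`. -/
noncomputable def clip (c t : ℝ) (a : R3) : R3 := if 0 < t ∧ ‖a‖ < c then a else 0

lemma norm_clip_lt {c : ℝ} (hc : 0 < c) (t : ℝ) (a : R3) : ‖clip c t a‖ < c := by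
  unfold clip
  split_ifs with h
  · exact h.2
  · rwa [norm_zero]

lemma clip_of_lt {c t : ℝ} {a : R3} (ht : 0 < t) (ha : ‖a‖ < c) : clip c t a = a := if_pos ⟨ht, ha⟩

lemma clip_of_nonpos {c t : ℝ} (a : R3) (ht : t ≤ 0) : clip c t a = 0 :=
  if_neg fun h => not_lt.2 ht h.1

lemma measurable_clip (c : ℝ) : Measurable fun q : ℝ × R3 => clip c q.1 q.2 :=
  Measurable.ite ((measurableSet_lt measurable_const measurable_fst).inter
    (measurableSet_lt measurable_snd.norm measurable_const)) measurable_snd measurable_const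

section VertexValue

variable {ν : ℝ} {w : R3 → ℝ≥0∞} {U k : R3 × ℝ → R3}

lemma measurable_vertexValue (hw : Measurable w) (hU : Measurable U) (hk : Measurable k) :
    Measurable fun q : WeightedPoint × Mark × ℝ × R3 × R3 =>
      vertexValue ν w U k q.1 q.2.1 q.2.2.1 q.2.2.2.1 q.2.2.2.2 := by
  have hset : ∀ i : Fin 4, MeasurableSet {q : WeightedPoint × Mark × ℝ × R3 × R3 | q.2.1.1 = i} :=
    fun i => (by fun_prop : Measurable fun q : WeightedPoint × Mark × ℝ × R3 × R3 => q.2.1.1)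
      (measurableSet_singleton i)
  unfold vertexValue
  refine Measurable.ite (hset 0) (by fun_prop) (Measurable.ite (hset 1) (by fun_prop)
    (Measurable.ite (hset 2) (by fun_prop) measurable_const))

lemma markLaw_branching_le {ρ σ : R3 × ℝ → ℝ≥0∞} (hρ : Measurable ρ) (hσ : Measurable σ)
    (hρ1 : ∫⁻ ζ, ρ ζ ≤ 1) : markLaw ρ σ {m | m.1 = 1} ≤ ENNReal.ofReal (1 / 5) := by
  have hm : MeasurableSet {m : Mark | m.1 = 1} := measurable_fst (measurableSet_singleton 1)
  rw [← lintegral_indicator_one hm, lintegral_markLaw hρ hσ (measurable_one.indicator hm),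
    indicator_of_notMem (show ((0, 0) : Mark) ∉ {m : Mark | m.1 = 1} by simp),
    indicator_of_notMem (show ((3, 0) : Mark) ∉ {m : Mark | m.1 = 1} by simp),
    lintegral_congr fun ζ => by
      rw [indicator_of_mem (show ((1, ζ) : Mark) ∈ {m : Mark | m.1 = 1} from rfl), Pi.one_apply,
        mul_one],
    (lintegral_congr fun ζ => by
      rw [indicator_of_notMem (show ((2, ζ) : Mark) ∉ {m : Mark | m.1 = 1} by simp), mul_zero] :
      ∫⁻ ζ, σ ζ * _ = ∫⁻ _ : R3 × ℝ, 0)]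
  simp only [mul_zero, zero_add, add_zero, lintegral_zero]
  exact mul_le_of_le_one_right zero_le hρ1

/-- The branching mechanism of the Navier–Stokes equations, for a sampler `F` of the marks. -/
noncomputable def nsBranching (hν : 0 < ν) {w' : R3 → ℝ≥0∞} (hw : Measurable w)
    (hw' : Measurable w') (hU : Measurable U) (hk : Measurable k)
    {F : WeightedPoint → unitInterval → Mark}
    (hF : Measurable fun q : WeightedPoint × unitInterval => F q.1 q.2)
    (hsub : ∀ s, volume {r | (F s r).1 = 1} ≤ ENNReal.ofReal (1 / 5)) :
    Branching WeightedPoint where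
  mark := F
  -- Children carry the value of a Borel representative of the weight, while the root can be started
  -- with the given value at every point.
  child s m := (s.1 - m.2.1, w (s.1 - m.2.1))
  -- Clipping enforces the bound for arbitrary arguments, which measurability alone could not
  -- provide. It is inactive for the marks and values that matter, and it makes the process vanish
  -- at nonpositive times.
  value s m t a b := clip (2 * Real.pi * ν / 11) t (vertexValue ν w' U k s m t a b)
  bound := 2 * Real.pi * ν / 11
  measurable_mark := hF
  measurable_child := by fun_prop
  measurable_value := (measurable_clip _).comp
    ((by fun_prop : Measurable fun q : WeightedPoint × Mark × ℝ × R3 × R3 => q.2.2.1).prodMk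
      (measurable_vertexValue hw' hU hk))
  norm_value_lt _ _ _ _ _ := norm_clip_lt (by have := Real.pi_pos; positivity) _ _
  value_congr s m t a b a' b' hm := by
    simp only [vertexValue, if_neg hm]
  subcritical := hsub

/-- Densities are replaced by zero in states where their mass exceeds one, so that the mark law is a
probability in every state. A Markov kernel can then be sampled by a jointly measurable function of
the state and one uniform variable. -/
lemma exists_mark_sampler {w' : R3 → ℝ≥0∞} (hw : Measurable w) (hw' : Measurable w') :
    ∃ F : WeightedPoint → unitInterval → Mark,
      (Measurable fun q : WeightedPoint × unitInterval => F q.1 q.2) ∧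
      (∀ s, volume {r | (F s r).1 = 1} ≤ ENNReal.ofReal (1 / 5)) ∧
      ∀ s, (volume : Measure unitInterval).map (F s)
        = markLaw (subProb (branchDensity ν w s)) (subProb (forceDensity ν w' s)) := by
  have hρ := measurable_subProb (measurable_branchDensity (ν := ν) hw)
  have hσ := measurable_subProb (measurable_forceDensity (ν := ν) hw')
  have hs1 := fun s => (measurable_branchDensity_apply (ν := ν) hw s).subProb
  have hs2 := fun s => (measurable_forceDensity_apply (ν := ν) hw' s).subProb
  obtain ⟨κ, hκ⟩ : ∃ κ : ProbabilityTheory.Kernel WeightedPoint Mark, ∀ s, κ s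
      = markLaw (subProb (branchDensity ν w s)) (subProb (forceDensity ν w' s)) :=
    ⟨⟨_, measurable_markLaw hρ hσ⟩, fun _ => rfl⟩
  have : ProbabilityTheory.IsMarkovKernel κ := ⟨fun s => by
    rw [hκ]
    exact isProbabilityMeasure_markLaw (hs1 s) (hs2 s) (lintegral_subProb_le _)
      (lintegral_subProb_le _)⟩
  obtain ⟨F, hF, hFκ⟩ := κ.exists_measurable_map_eq_unitInterval
  have hFs : ∀ s, Measurable (F s) := fun s => hF.comp measurable_prodMk_left
  refine ⟨F, hF, fun s => ?_, fun s => (hFκ s).trans (hκ s)⟩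
  have h1 : volume {r | (F s r).1 = 1} = κ s {m | m.1 = 1} := by
    rw [← hFκ s]
    exact (Measure.map_apply (hFs s) (measurable_fst (measurableSet_singleton 1))).symm
  rw [h1, hκ]
  exact markLaw_branching_le (hs1 s) (hs2 s) (lintegral_subProb_le _)

end VertexValue

/-- Independence and bilinearity: the expectation of `B(X, X')` for independent copies is `B(E X, E
X)`. This turns the two subtrees into the quadratic term. -/
lemma integral_oseenGrad_prod {ν : ℝ} (hν : 0 < ν) (ζ : R3 × ℝ) {α : Type*} [MeasurableSpace α]
    {μ : Measure α} [SFinite μ] {X : α → R3} (hX : Integrable X μ) :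
    ∫ p : α × α, oseenGrad ν ζ (X p.1) (X p.2) ∂(μ.prod μ)
      = oseenGrad ν ζ (∫ a, X a ∂μ) (∫ a, X a ∂μ) := by
  have e : ∀ a b, oseenGrad ν ζ a b = oseenGradCLM hν ζ a b := fun a b => rfl
  have hi : Integrable (fun p : α × α => oseenGradCLM hν ζ (X p.1) (X p.2)) (μ.prod μ) := by
    refine Integrable.mono' ((hX.norm.mul_prod hX.norm).const_mul ‖oseenGradCLM hν ζ‖) ?_ ?_
    · have h1 := hX.1.comp_fst (ν := μ)
      have h2 := hX.1.comp_snd (μ := μ)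
      exact (oseenGradCLM hν ζ).aestronglyMeasurable_comp₂ h1 h2
    · exact Eventually.of_forall fun p => by
        rw [← mul_assoc]; exact (oseenGradCLM hν ζ).le_opNorm₂ _ _
  simp only [e]
  rw [integral_prod _ hi]
  simp only [fun a => (oseenGradCLM hν ζ a).integral_comp_comm hX]
  exact ((oseenGradCLM hν ζ).flip (∫ a, X a ∂μ)).integral_comp_comm hX

section Representation

variable {h h' w w' : R3 → ℝ≥0∞} {ν : ℝ} {u₀ : R3 → R3} {g k : R3 × ℝ → R3}

/-- The kernel inequality for `h`, divided by `h x`, says that branching has mass at most one; at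
such states the truncation by `subProb` does nothing. -/
lemma IsMajorizingPair.lintegral_branchDensity_le (H : IsMajorizingPair h h') (hν : 0 < ν)
    (hw : w =ᵐ[volume] h) {x : R3} (hx : h x ≠ ∞) : ∫⁻ ζ, branchDensity ν w (x, h x) ζ ≤ 1 := by
  have hp := Real.pi_pos
  have hw' : ∀ᵐ ζ : R3 × ℝ, w (x - ζ.1) = h (x - ζ.1) :=
    Measure.quasiMeasurePreserving_fst.ae (p := fun y => w (x - y) = h (x - y))
      ((Measure.measurePreserving_sub_left volume x).quasiMeasurePreserving.ae hw)
  simp only [branchDensity, div_eq_mul_inv]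
  rw [lintegral_mul_const' _ _ (by simp [(H.pos x).ne']),
    lintegral_const_mul' _ _ ENNReal.ofReal_ne_top,
    lintegral_congr_ae (hw'.mono fun ζ hζ => by simp only [hζ]; rfl)]
  calc _ ≤ ENNReal.ofReal (Real.pi * ν) * (ENNReal.ofReal (1 / (Real.pi * ν)) * h x)
        * (h x)⁻¹ := by gcongr; exact H.lintegral_oseenGradMaj_mul_le hν x
    _ = 1 := by
      rw [← mul_assoc, ← ENNReal.ofReal_mul (by positivity), mul_one_div_cancel (by positivity),
        ENNReal.ofReal_one, one_mul, ENNReal.mul_inv_cancel (H.pos x).ne' hx]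

lemma IsMajorizingPair.lintegral_forceDensity_le (H : IsMajorizingPair h h') (hν : 0 < ν)
    (hw : w' =ᵐ[volume] h') {x : R3} (hx : h x ≠ ∞) :
    ∫⁻ ζ, forceDensity ν w' (x, h x) ζ ≤ 1 := by
  have hp := Real.pi_pos
  have hw' : ∀ᵐ ζ : R3 × ℝ, w' (x - ζ.1) = h' (x - ζ.1) :=
    Measure.quasiMeasurePreserving_fst.ae (p := fun y => w' (x - y) = h' (x - y))
      ((Measure.measurePreserving_sub_left volume x).quasiMeasurePreserving.ae hw)
  simp only [forceDensity, div_eq_mul_inv]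
  rw [lintegral_mul_const' _ _ (by simp [(H.pos x).ne']),
    lintegral_const_mul' _ _ ENNReal.ofReal_ne_top,
    lintegral_congr_ae (hw'.mono fun ζ hζ => by simp only [hζ]; rfl)]
  calc _ ≤ ENNReal.ofReal (2 * Real.pi * ν) * (ENNReal.ofReal (1 / (2 * Real.pi * ν)) * h x)
        * (h x)⁻¹ := by gcongr; exact H.lintegral_oseenMaj_mul_le hν x
    _ = 1 := by
      rw [← mul_assoc, ← ENNReal.ofReal_mul (by positivity), mul_one_div_cancel (by positivity),
        ENNReal.ofReal_one, one_mul, ENNReal.mul_inv_cancel (H.pos x).ne' hx]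

/-- The velocity of which the process `B` is a stochastic representation. -/
noncomputable def meanField (h : R3 → ℝ≥0∞) (B : Branching WeightedPoint) (z : R3 × ℝ) : R3 :=
  (h z.1).toReal • B.mean z.2 (z.1, h z.1)

/-- The weight `h x`, the branching probability and the density cancel the factor in the vertex
value. The two factors `w` left over restore the velocities of the children from their normalized
values. -/
lemma smul_vertexValue_branching (hν : 0 < ν) {x : R3} (hx0 : h x ≠ 0)
    (hx : h x ≠ ∞) (ζ : R3 × ℝ) (a : R3) :
    (h x).toReal • ((1 / 5 : ℝ) • ((branchDensity ν w (x, h x) ζ).toReal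
      • ((-(5 / (Real.pi * ν * oseenGradMaj ν ζ))) • oseenGrad ν ζ a a)))
      = -oseenGrad ν ζ ((w (x - ζ.1)).toReal • a) ((w (x - ζ.1)).toReal • a) := by
  have hp := Real.pi_pos
  have hM := oseenGradMaj_nonneg hν ζ
  have hr : (h x).toReal ≠ 0 := ENNReal.toReal_ne_zero.2 ⟨hx0, hx⟩
  have hb : oseenGrad ν ζ ((w (x - ζ.1)).toReal • a) ((w (x - ζ.1)).toReal • a)
      = (w (x - ζ.1)).toReal ^ 2 • oseenGrad ν ζ a a := by
    simp only [← oseenGradCLM_apply hν, map_smul, smul_apply, smul_smul, sq]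
  have hd : (branchDensity ν w (x, h x) ζ).toReal
      = Real.pi * ν * (oseenGradMaj ν ζ * (w (x - ζ.1)).toReal ^ 2) / (h x).toReal := by
    rw [branchDensity, ENNReal.toReal_div, ENNReal.toReal_mul, ENNReal.toReal_mul,
      ENNReal.toReal_ofReal (by positivity), ENNReal.toReal_ofReal hM, ENNReal.toReal_pow]
  rw [hb, hd, smul_smul, smul_smul, smul_smul, ← neg_smul]
  -- Where the majorant vanishes, division by zero makes the factor zero; the kernel vanishes there
  -- as well, so nothing is lost.
  rcases hM.eq_or_lt with h0 | h0
  · have : oseenGrad ν ζ a a = 0 := by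
      have := norm_oseenGrad_le hν ζ a a
      rw [← h0, zero_mul, zero_mul] at this
      exact norm_le_zero_iff.1 this
    rw [this, smul_zero, smul_zero]
  · congr 1
    field_simp

/-- All normalizations cancel when the majorant and `w'` are positive. If one of them vanishes, so
does the forcing term, through the kernel bound or the bound on `a`. -/
lemma smul_vertexValue_force (hν : 0 < ν) {x : R3} (hx0 : h x ≠ 0)
    (hx : h x ≠ ∞) {ζ : R3 × ℝ} (hw : w' (x - ζ.1) ≠ ∞) {a : R3}
    (ha : ‖a‖ₑ ≤ forceBound ν * w' (x - ζ.1)) :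
    (h x).toReal • ((3 / 10 : ℝ) • ((forceDensity ν w' (x, h x) ζ).toReal
      • ((5 / (3 * Real.pi * ν * (oseenMaj ν ζ * (w' (x - ζ.1)).toReal))) • oseen ν ζ a)))
      = oseen ν ζ a := by
  have hp := Real.pi_pos
  have hM := oseenMaj_nonneg hν ζ
  have hr : (h x).toReal ≠ 0 := ENNReal.toReal_ne_zero.2 ⟨hx0, hx⟩
  have hd : (forceDensity ν w' (x, h x) ζ).toReal
      = 2 * Real.pi * ν * (oseenMaj ν ζ * (w' (x - ζ.1)).toReal) / (h x).toReal := by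
    rw [forceDensity, ENNReal.toReal_div, ENNReal.toReal_mul, ENNReal.toReal_mul,
      ENNReal.toReal_ofReal (by positivity), ENNReal.toReal_ofReal hM]
  rw [hd, smul_smul, smul_smul, smul_smul]
  rcases hM.eq_or_lt with h0 | h0
  · have : oseen ν ζ a = 0 := by
      have := norm_oseen_le hν ζ a
      rw [← h0, zero_mul] at this
      exact norm_le_zero_iff.1 this
    rw [this, smul_zero]
  rcases eq_or_ne (w' (x - ζ.1)) 0 with h1 | h1
  · rw [h1, mul_zero, nonpos_iff_eq_zero, enorm_eq_zero] at ha
    rw [ha, oseen_zero_right, smul_zero]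
  · have hwr : (w' (x - ζ.1)).toReal ≠ 0 := ENNReal.toReal_ne_zero.2 ⟨h1, hw⟩
    nth_rewrite 2 [← one_smul ℝ (oseen ν ζ a)]
    congr 1
    field_simp
    norm_num

/-- The bound reproduces itself: `(5/(πν)) (2πν/11)²` is `10/11` of `2πν/11`. This is where
branching with probability `1/5` meets the smallness `1/11`. -/
lemma norm_branching_lt (hν : 0 < ν) (ζ : R3 × ℝ) {a b : R3}
    (ha : ‖a‖ < 2 * Real.pi * ν / 11) (hb : ‖b‖ < 2 * Real.pi * ν / 11) :
    ‖(-(5 / (Real.pi * ν * oseenGradMaj ν ζ))) • oseenGrad ν ζ a b‖ < 2 * Real.pi * ν / 11 := by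
  have hp := Real.pi_pos
  have hM := oseenGradMaj_nonneg hν ζ
  rw [norm_smul, norm_neg, Real.norm_of_nonneg (by positivity)]
  rcases hM.eq_or_lt with h0 | h0
  · rw [← h0, mul_zero, div_zero, zero_mul]; positivity
  calc _ ≤ 5 / (Real.pi * ν * oseenGradMaj ν ζ)
        * (oseenGradMaj ν ζ * (2 * Real.pi * ν / 11) * (2 * Real.pi * ν / 11)) := by
        refine mul_le_mul_of_nonneg_left ((norm_oseenGrad_le hν ζ a b).trans ?_) (by positivity)
        gcongr
    _ = 10 / 11 * (2 * Real.pi * ν / 11) := by field_simp; norm_num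
    _ < _ := by
        have : 0 < 2 * Real.pi * ν / 11 := by positivity
        linarith

/-- The size is at most `(5/(3πν)) (πν)²/11`, which is `5/6` of the bound. -/
lemma norm_force_lt (hν : 0 < ν) (ζ : R3 × ℝ) {c : ℝ≥0∞} (hc : c ≠ ∞) {a : R3}
    (ha : ‖a‖ₑ ≤ forceBound ν * c) :
    ‖(5 / (3 * Real.pi * ν * (oseenMaj ν ζ * c.toReal))) • oseen ν ζ a‖
      < 2 * Real.pi * ν / 11 := by
  have hp := Real.pi_pos
  have hM := oseenMaj_nonneg hν ζ
  have hc0 : 0 ≤ c.toReal := ENNReal.toReal_nonneg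
  have ha' : ‖a‖ ≤ (Real.pi * ν) ^ 2 / 11 * c.toReal := by
    have := ENNReal.toReal_mono (by have := forceBound_ne_top ν; finiteness) ha
    rwa [toReal_enorm, ENNReal.toReal_mul, forceBound, ENNReal.toReal_ofReal (by positivity)] at this
  rw [norm_smul, Real.norm_of_nonneg (by positivity)]
  rcases (mul_nonneg hM hc0).eq_or_lt with h0 | h0
  · rw [← h0, mul_zero, div_zero, zero_mul]; positivity
  calc _ ≤ 5 / (3 * Real.pi * ν * (oseenMaj ν ζ * c.toReal))
        * (oseenMaj ν ζ * ((Real.pi * ν) ^ 2 / 11 * c.toReal)) := by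
        refine mul_le_mul_of_nonneg_left ((norm_oseen_le hν ζ a).trans ?_) (by positivity)
        gcongr
    _ = 5 / 6 * (2 * Real.pi * ν / 11) := by
        have h1 : oseenMaj ν ζ ≠ 0 := left_ne_zero_of_mul h0.ne'
        have h2 : c.toReal ≠ 0 := right_ne_zero_of_mul h0.ne'
        field_simp; norm_num
    _ < _ := by
        have : 0 < 2 * Real.pi * ν / 11 := by positivity
        linarith

/-- The branching mechanism `B` is the one of the Navier–Stokes equations with viscosity `ν`,
heat flow `U` of the initial velocity and forcing `k`, for the weights `w` and `w'`. -/
structure Branching.IsNavierStokes (B : Branching WeightedPoint) (ν : ℝ) (w w' : R3 → ℝ≥0∞)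
    (U k : R3 × ℝ → R3) : Prop where
  bound_eq : B.bound = 2 * Real.pi * ν / 11
  child_eq : ∀ s m, B.child s m = (s.1 - m.2.1, w (s.1 - m.2.1))
  value_eq : ∀ s m t a b,
    B.value s m t a b = clip (2 * Real.pi * ν / 11) t (vertexValue ν w' U k s m t a b)
  law_eq : ∀ s, (volume : Measure unitInterval).map (B.mark s)
    = markLaw (subProb (branchDensity ν w s)) (subProb (forceDensity ν w' s))

lemma exists_isNavierStokes {U : R3 × ℝ → R3} (hν : 0 < ν) (hw : Measurable w)
    (hw' : Measurable w') (hU : Measurable U) (hk : Measurable k) :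
    ∃ B : Branching WeightedPoint, B.IsNavierStokes ν w w' U k := by
  obtain ⟨F, hF, hsub, hlaw⟩ := exists_mark_sampler (ν := ν) hw hw'
  exact ⟨nsBranching hν hw hw' hU hk hF hsub, rfl, fun _ _ => rfl, fun _ _ _ _ _ => rfl, hlaw⟩

namespace Branching.IsNavierStokes

variable {B : Branching WeightedPoint} {U : R3 × ℝ → R3}

lemma markMean_of_ne (hB : B.IsNavierStokes ν w w' U k) (t : ℝ) (s : WeightedPoint) {m : Mark}
    (hm : m.1 ≠ 1) : B.markMean t s m
      = clip (2 * Real.pi * ν / 11) t (vertexValue ν w' U k s m t 0 0) := by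
  rw [Branching.markMean]
  simp only [fun a b => B.value_congr s m t a b 0 0 hm, hB.value_eq]
  simp

/-- The root values of the children lie below the bound, so clipping is inactive and the vertex
value is bilinear in independent variables. -/
lemma markMean_branching (hB : B.IsNavierStokes ν w w' U k) (hν : 0 < ν) {t : ℝ} (ht : 0 < t)
    (s : WeightedPoint) (ζ : R3 × ℝ) : B.markMean t s (1, ζ)
      = (-(5 / (Real.pi * ν * oseenGradMaj ν ζ))) • oseenGrad ν ζ
        (B.mean (t - ζ.2) (s.1 - ζ.1, w (s.1 - ζ.1)))
        (B.mean (t - ζ.2) (s.1 - ζ.1, w (s.1 - ζ.1))) := by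
  rw [Branching.markMean, Branching.mean,
    ← integral_oseenGrad_prod hν ζ (B.integrable_rootValue _ _), ← integral_smul]
  congr 1; funext p
  have h1 := fun a => B.norm_rootValue_lt (t - ζ.2) (s.1 - ζ.1, w (s.1 - ζ.1)) a
  rw [hB.bound_eq] at h1
  have e : ∀ a b, vertexValue ν w' U k s (1, ζ) t a b
      = (-(5 / (Real.pi * ν * oseenGradMaj ν ζ))) • oseenGrad ν ζ a b := fun a b => by
    simp [vertexValue]
  rw [hB.value_eq, hB.child_eq, e, clip_of_lt ht (norm_branching_lt hν ζ (h1 _) (h1 _))]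

lemma mean_of_nonpos (hB : B.IsNavierStokes ν w w' U k) {t : ℝ} (ht : t ≤ 0) (s : WeightedPoint) :
    B.mean t s = 0 := by
  rw [B.mean_eq_integral_markMean]
  refine integral_eq_zero_of_ae (Eventually.of_forall fun m => ?_)
  rw [Branching.markMean]
  simp only [hB.value_eq, clip_of_nonpos _ ht, integral_zero]
  rfl

lemma meanField_of_nonpos (hB : B.IsNavierStokes ν w w' U k) {z : R3 × ℝ} (hz : z.2 ≤ 0) :
    meanField h B z = 0 := by
  rw [meanField, hB.mean_of_nonpos hz, smul_zero]

lemma enorm_meanField_le (hB : B.IsNavierStokes ν w w' U k) (z : R3 × ℝ) :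
    ‖meanField h B z‖ₑ ≤ velBound ν * h z.1 := by
  rw [meanField, enorm_smul, mul_comm]
  refine mul_le_mul' ?_ ?_
  · rw [← ofReal_norm, velBound, ← hB.bound_eq]
    exact ENNReal.ofReal_le_ofReal (B.norm_mean_le _ _)
  · rw [Real.enorm_of_nonneg ENNReal.toReal_nonneg]
    exact ENNReal.ofReal_toReal_le

lemma meanField_controlled (hB : B.IsNavierStokes ν w w' U k) (hh : AEMeasurable h) :
    IsControlled (velBound ν) h (meanField h B) where
  aestronglyMeasurable := by
    have h1 : AEMeasurable fun z : R3 × ℝ => h z.1 :=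
      hh.comp_quasiMeasurePreserving Measure.quasiMeasurePreserving_fst
    have h2 : AEMeasurable fun z : R3 × ℝ => (z.2, z.1, h z.1) :=
      measurable_snd.aemeasurable.prodMk (measurable_fst.aemeasurable.prodMk h1)
    exact (h1.ennreal_toReal.smul
      (B.stronglyMeasurable_mean.measurable.comp_aemeasurable h2)).aestronglyMeasurable
  enorm_le := Eventually.of_forall hB.enorm_meanField_le
  eq_zero := Eventually.of_forall fun _ hz => hB.meanField_of_nonpos hz

/-- The mean field is a fixed point of the mild formulation. -/
theorem meanField_eq_mildMap (D : SmallData ν h h' u₀ g)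
    (hB : B.IsNavierStokes ν w w' (heatFlow ν u₀) k) (hw : Measurable w) (hw' : Measurable w')
    (hwh : w =ᵐ[volume] h) (hwh' : w' =ᵐ[volume] h') (hkg : k =ᵐ[volume] g) {z : R3 × ℝ}
    (hz : 0 < z.2) (hx : h z.1 ≠ ∞) :
    meanField h B z = mildMap ν u₀ g (meanField h B) z := by
  obtain ⟨x, t⟩ := z
  simp only at hz hx
  have hν := D.pos
  have hp := Real.pi_pos
  have hx0 : h x ≠ 0 := (D.pair.pos x).ne'
  have hr : (h x).toReal ≠ 0 := ENNReal.toReal_ne_zero.2 ⟨hx0, hx⟩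
  have hr0 : 0 < (h x).toReal := ENNReal.toReal_pos hx0 hx
  have m1 := D.pair.lintegral_branchDensity_le hν hwh hx
  have m2 := D.pair.lintegral_forceDensity_le hν hwh' hx
  -- The Borel representatives agree with the weights for almost every displacement, which suffices
  -- because displacements have densities.
  have hfin : ∀ᵐ ζ : R3 × ℝ, h (x - ζ.1) < ∞ ∧ w (x - ζ.1) = h (x - ζ.1) ∧ h' (x - ζ.1) < ∞ ∧
      w' (x - ζ.1) = h' (x - ζ.1) :=
    Measure.quasiMeasurePreserving_fst.ae (p := fun y => h (x - y) < ∞ ∧ w (x - y) = h (x - y) ∧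
      h' (x - y) < ∞ ∧ w' (x - y) = h' (x - y))
      ((Measure.measurePreserving_sub_left volume x).quasiMeasurePreserving.ae
        (D.pair.ae_lt_top.and (hwh.and (D.pair.ae_lt_top'.and hwh'))))
  have hk : ∀ᵐ ζ : R3 × ℝ, k ((x, t) - ζ) = g ((x, t) - ζ) := ae_sub_left hkg (x, t)
  have hg : ∀ᵐ ζ : R3 × ℝ, ‖g ((x, t) - ζ)‖ₑ ≤ forceBound ν * h' (x - ζ.1) :=
    ae_sub_left D.force.enorm_le (x, t)
  obtain ⟨⟨i1, i2⟩, hmean⟩ := integral_markLaw (measurable_branchDensity_apply (ν := ν) hw (x, h x))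
    (measurable_forceDensity_apply (ν := ν) hw' (x, h x)) m1 m2 (B.measurable_markMean t (x, h x))
    (fun m => B.norm_markMean_le t (x, h x) m)
    (by rw [hB.markMean_of_ne _ _ (by simp)]; simp [vertexValue, clip])
  -- The three kinds of marks contribute the heat flow, the quadratic term and the forcing term of
  -- the mild equation, in this order.
  have e0 : (h x).toReal • ((1 / 2 : ℝ) • B.markMean t (x, h x) (0, 0)) = heatFlow ν u₀ (x, t) := by
    have e : vertexValue ν w' (heatFlow ν u₀) k (x, h x) (0, 0) t 0 0
        = (2 / (h x).toReal) • heatFlow ν u₀ (x, t) := by simp [vertexValue]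
    rw [hB.markMean_of_ne _ _ (by simp), e, clip_of_lt hz, smul_smul, smul_smul]
    · nth_rewrite 2 [← one_smul ℝ (heatFlow ν u₀ (x, t))]
      congr 1
      field_simp
    · have h1 : ‖heatFlow ν u₀ (x, t)‖ < Real.pi * ν / 11 * (h x).toReal := by
        have := (ENNReal.toReal_lt_toReal enorm_ne_top (by finiteness)).2 (D.flow_lt (x, t) hz)
        rwa [toReal_enorm, ENNReal.toReal_mul, ENNReal.toReal_ofReal (by positivity)] at this
      rw [norm_smul, Real.norm_of_nonneg (by positivity), div_mul_eq_mul_div, div_lt_iff₀ hr0]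
      linarith
  have e1 : ∀ᵐ ζ : R3 × ℝ, (h x).toReal • ((1 / 5 : ℝ) • ((branchDensity ν w (x, h x) ζ).toReal
      • B.markMean t (x, h x) (1, ζ)))
      = -oseenGrad ν ζ (meanField h B ((x, t) - ζ)) (meanField h B ((x, t) - ζ)) := by
    filter_upwards [hfin] with ζ hζ
    rw [hB.markMean_branching hν hz, smul_vertexValue_branching hν hx0 hx, hζ.2.1]
    rfl
  have e2 : ∀ᵐ ζ : R3 × ℝ, (h x).toReal • ((3 / 10 : ℝ) • ((forceDensity ν w' (x, h x) ζ).toReal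
      • B.markMean t (x, h x) (2, ζ))) = oseen ν ζ (g ((x, t) - ζ)) := by
    filter_upwards [hfin, hk, hg] with ζ hζ h1 h2
    have hne : w' (x - ζ.1) ≠ ∞ := by rw [hζ.2.2.2]; exact hζ.2.2.1.ne
    rw [← h1, ← hζ.2.2.2] at h2
    have e : vertexValue ν w' (heatFlow ν u₀) k (x, h x) (2, ζ) t 0 0
        = (5 / (3 * Real.pi * ν * (oseenMaj ν ζ * (w' (x - ζ.1)).toReal)))
          • oseen ν ζ (k ((x, t) - ζ)) := by simp [vertexValue]
    rw [hB.markMean_of_ne _ _ (by simp), e, clip_of_lt hz (norm_force_lt hν ζ hne h2),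
      smul_vertexValue_force hν hx0 hx hne h2, h1]
  have j1 := ((i1.smul (1 / 5 : ℝ)).smul (h x).toReal).congr e1
  have j2 := ((i2.smul (3 / 10 : ℝ)).smul (h x).toReal).congr e2
  have hd : duhamel ν (meanField h B) g (x, t)
      = (∫ ζ, oseen ν ζ (g ((x, t) - ζ)))
        + ∫ ζ, -oseenGrad ν ζ (meanField h B ((x, t) - ζ)) (meanField h B ((x, t) - ζ)) := by
    rw [← integral_add j2 j1]
    simp only [duhamel, duhamelKernel, sub_eq_add_neg]
  rw [← subProb_eq m1, ← subProb_eq m2, ← hB.law_eq, ← B.mean_eq_integral_markMean, subProb_eq m1,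
    subProb_eq m2] at hmean
  rw [mildMap, hd, ← integral_congr_ae e1, ← integral_congr_ae e2, ← e0]
  simp only [integral_smul]
  rw [meanField, hmean, smul_add, smul_add]
  abel

end Branching.IsNavierStokes

end Representation

/-! ### Proof of the main theorem -/

lemma gaussianIntegrable_of_integrable_sub {ν : ℝ} (hν : 0 < ν) {u₀ : R3 → R3}
    (hu : ∀ x, ∀ t : ℝ, 0 < t →
      Integrable (fun y => Real.exp (-‖y‖ ^ 2 / (4 * ν * t)) • u₀ (x - y))) :
    GaussianIntegrable u₀ := by
  intro τ hτ
  have h1 := (hu 0 (τ / ν) (by positivity)).comp_neg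
  have e : 4 * ν * (τ / ν) = 4 * τ := by field_simp
  simpa [e] using h1

lemma heatFlow_eq_smul {ν t : ℝ} (ht : 0 < t) (u₀ : R3 → R3) (x : R3) :
    heatFlow ν u₀ (x, t) = ((4 * Real.pi * ν * t) ^ (-(3 / 2) : ℝ)) •
      ∫ y, Real.exp (-‖y‖ ^ 2 / (4 * ν * t)) • u₀ (x - y) := by
  rw [heatFlow, if_pos ht, ← integral_smul]
  congr 1; funext y
  simp only [smul_smul, heatKernel, mul_assoc]

theorem theorem1 (ν : ℝ) (hν : 0 < ν)
    (h h' : R3 → ℝ≥0∞) (hpos : ∀ x, 0 < h x)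
    (hmeas : AEMeasurable h) (hmeas' : AEMeasurable h')
    (hL2 : ∀ K : Set R3, IsCompact K → ∫⁻ x in K, h x ^ 2 < ∞)
    (hker : ∀ x, ∫⁻ y, h (x - y) ^ 2 * (‖y‖ₑ ^ 2)⁻¹ ≤ h x)
    (hker' : ∀ x, ∫⁻ y, h' (x - y) * ‖y‖ₑ⁻¹ ≤ h x)
    (u₀ : R3 → R3) (g : R3 → ℝ → R3)
    (hu₀int : ∀ x, ∀ t : ℝ, 0 < t →
      Integrable (fun y => Real.exp (-‖y‖ ^ 2 / (4 * ν * t)) • u₀ (x - y)))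
    (hu₀div : DivFree u₀)
    (hgmeas : AEStronglyMeasurable (fun z : R3 × ℝ => g z.1 z.2) (volume.restrict spaceTime))
    (hu₀ : ∀ x, ∀ t : ℝ, 0 < t →
      ENNReal.ofReal ((4 * Real.pi * ν * t) ^ (-(3 / 2) : ℝ) *
        ‖∫ y, Real.exp (-‖y‖ ^ 2 / (4 * ν * t)) • u₀ (x - y)‖)
        < ENNReal.ofReal (Real.pi * ν / 11) * h x)
    (hg : ∀ x, ∀ t : ℝ, 0 < t →
      ‖g x t‖ₑ < ENNReal.ofReal ((Real.pi * ν) ^ 2 / 11) * h' x) :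
    ∃ (Ω : Type) (_ : MeasurableSpace Ω) (P : R3 → Measure Ω)
      (Ξ : Ioi (0 : ℝ) → Ω → R3) (u : R3 → ℝ → R3),
      (∀ x, IsProbabilityMeasure (P x)) ∧
      Measurable (fun q : Ioi (0 : ℝ) × Ω => Ξ q.1 q.2) ∧
      IsWeakSolution ν u₀ g u ∧
      (∀ x, ∀ᵐ ω ∂(P x), ∀ t : Ioi (0 : ℝ), ‖Ξ t ω‖ < 2 * Real.pi * ν / 11) ∧
      (∀ x, h x ≠ ∞ → ∀ t : Ioi (0 : ℝ), u x t = (h x).toReal • ∫ ω, Ξ t ω ∂(P x)) ∧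
      (∀ x, ∀ t : ℝ, 0 < t → ‖u x t‖ₑ < ENNReal.ofReal (2 * Real.pi * ν / 11) * h x) ∧
      ∀ v : R3 → ℝ → R3, IsWeakSolution ν u₀ g v →
        (∀ x, ∀ t : ℝ, 0 < t → ‖v x t‖ₑ < ENNReal.ofReal (2 * Real.pi * ν / 11) * h x) →
        (fun z : R3 × ℝ => v z.1 z.2) =ᵐ[volume.restrict spaceTime]
          fun z : R3 × ℝ => u z.1 z.2 := by
  have hp := Real.pi_pos
  have H : IsMajorizingPair h h' := ⟨hpos, hmeas, hmeas', hL2, hker, hker'⟩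
  have hG : IsControlled (forceBound ν) h' (extendZero g) :=
    isControlled_extendZero hgmeas fun x t ht => (hg x t ht).le
  have D : SmallData ν h h' u₀ (extendZero g) :=
    { pos := hν
      pair := H
      gaussian := gaussianIntegrable_of_integrable_sub hν hu₀int
      divFree := hu₀div
      flow_lt := fun z hz => by
        have h1 := hu₀ z.1 z.2 hz
        rwa [← Real.norm_of_nonneg (show 0 ≤ (4 * Real.pi * ν * z.2) ^ (-(3 / 2) : ℝ) by positivity),
          ← norm_smul, ← heatFlow_eq_smul hz, ofReal_norm] at h1
      force := hG }
  obtain ⟨w, hw, hwh⟩ := hmeas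
  obtain ⟨w', hw', hwh'⟩ := hmeas'
  obtain ⟨k, hk, hkg⟩ := hG.aestronglyMeasurable
  obtain ⟨B, hB⟩ := exists_isNavierStokes hν hw hw'
    (measurable_heatFlow (ν := ν) D.gaussian.aestronglyMeasurable).measurable hk.measurable
  have hmild : ∀ z : R3 × ℝ, 0 < z.2 → h z.1 ≠ ∞ →
      meanField h B z = mildMap ν u₀ (extendZero g) (meanField h B) z := fun z hz hx =>
    hB.meanField_eq_mildMap D hw hw' hwh.symm hwh'.symm hkg.symm hz hx
  set u : R3 → ℝ → R3 := fun x t => meanField h B (x, t) with hu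
  have hcont : IsControlled (velBound ν) h (meanField h B) := hB.meanField_controlled H.aemeasurable
  have hext : extendZero u = meanField h B := by
    funext z
    rcases lt_or_ge 0 z.2 with hz | hz
    · rw [extendZero_of_pos hz]
    · rw [extendZero_of_nonpos hz, hB.meanField_of_nonpos hz]
  have hucont : IsControlled (velBound ν) h (extendZero u) := by rwa [hext]
  have hweak : IsWeakSolution ν u₀ g u := by
    refine D.isWeakSolution_of_mild hucont ?_
    rw [hext]
    filter_upwards [(Measure.quasiMeasurePreserving_fst (μ := (volume : Measure R3))
      (ν := (volume : Measure ℝ))).ae H.ae_lt_top] with z hx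
    rcases lt_or_ge 0 z.2 with hz | hz
    · exact hmild z hz hx.ne
    · rw [hB.meanField_of_nonpos hz, D.mildMap_eq_zero hcont hz]
  -- The Dirac factor starts the root at `x` with the exact weight `h x`. The process itself refers
  -- only to the sampled weight, so it is measurable even though `h` is measurable only up to a null
  -- set.
  refine ⟨WeightedPoint × TreeLabels, inferInstance, fun x => (Measure.dirac (x, h x)).prod treeLaw,
    fun t ω => B.rootValue t ω.1 ω.2, u, fun x => inferInstance, ?_, hweak, ?_, ?_, ?_, ?_⟩
  · exact B.measurable_rootValue.comp ((measurable_subtype_coe.comp measurable_fst).prodMk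
      measurable_snd)
  · exact fun x => Eventually.of_forall fun ω t => hB.bound_eq ▸ B.norm_rootValue_lt t ω.1 ω.2
  · intro x hx t
    beta_reduce
    have hm : Measurable fun ω : WeightedPoint × TreeLabels => B.rootValue t ω.1 ω.2 :=
      B.measurable_rootValue.comp (by fun_prop : Measurable fun ω : WeightedPoint × TreeLabels =>
        ((t : ℝ), ω.1, ω.2))
    rw [Measure.dirac_prod, integral_map (by fun_prop) hm.aestronglyMeasurable]
    rfl
  · intro x t ht
    -- At points of infinite weight the bound only asks for a finite velocity; elsewhere the mild
    -- equation holds exactly and gives the strict inequality at every point.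
    rcases eq_or_ne (h x) ∞ with hx | hx
    · rw [hx, ENNReal.mul_top (by simp; positivity)]
      exact enorm_lt_top
    · rw [hu]
      beta_reduce
      rw [hmild (x, t) ht hx]
      exact D.enorm_mildMap_lt hcont.enorm_le (z := (x, t)) ht
  · intro v hv hvb
    exact D.ae_eq_of_isWeakSolution hweak hucont hv (isControlled_extendZero
      hv.locallySquareIntegrable.aestronglyMeasurable fun x t ht => (hvb x t ht).le)
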